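/- **Odd form algebras.** All rings are associative and possibly non-unital, $K$ is a commutative ring with $1$. An *odd form ring* $(R,\Delta)$ consists of a ring $R$ with an involution $a\mapsto\bar a$, a group $(\Delta,\dotplus)$, a right action $(u,a)\mapsto u\cdot a$ of the multiplicative semigroup of $R$ on $\Delta$ by group endomorphisms and maps $\phi\colon R\to\Delta$, $\pi,\rho\colon\Delta\to R$ such that $\pi,\phi$ are additive, $\pi(u\cdot a)=\pi(u)a$, $\phi(b)\cdot a=\phi(\bar aba)$, $\rho(u\dotplus v)=\rho(u)-\overline{\pi(u)}\pi(v)+\rho(v)$, $\rho(u\cdot a)=\bar a\rho(u)a$, $\rho(u)+\overline{\rho(u)}+\overline{\pi(u)}\pi(u)=0$, $\pi(\phi(a))=0$, $\rho(\phi(a))=a-\bar a$, $[u,v]=\phi(-\overline{\pi(u)}\pi(v))$, $\phi(a)=\dot 0$ if $a=\bar a$, and $u\cdot(a+b)=u\cdot a\dotplus\phi(\bar b\rho(u)a)\dotplus u\cdot b$. It is an *odd form $K$-algebra* if $R$ is a $K$-algebra with $K$-linear involution and the multiplicative monoid of $K$ acts on $\Delta$ from the right by group endomorphisms, with $u\cdot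 1=u$, $u\cdot(k+k')=u\cdot k\dotplus\phi(kk'\rho(u))\dotplus u\cdot k'$, $(u\cdot k)\cdot a=(u\cdot a)\cdot k=u\cdot ka$, $\phi(a)\cdot k=\phi(k^2a)$, $\pi(u\cdot k)=k\pi(u)$, $\rho(u\cdot k)=k^2\rho(u)$. An *augmentation* is an $R$-invariant subgroup $\mathcal D\le\Delta$ with a left $K$-module structure such that $\phi(R)\subseteq\mathcal D$, $\phi(ka)=k\phi(a)$, and, for $v\in\mathcal D$, $\pi(v)=0$, $v\cdot k=k^2v$, $\rho(kv)=k\rho(v)$, $(kv)\cdot a=k(v\cdot a)$. Fix an augmented odd form $K$-algebra $(R,\Delta,\mathcal D)$ and a multiplicative subset (submonoid) $S\subseteq K$. **Homotopes.** For $s\in S$ let $R^{(s)}=\{a^{(s)}\mid a\in R\}$ be a copy of the $K$-module $R$ with the multiplication $a^{(s)}b^{(s)}=(sab)^{(s)}$ and the involution $\overline{a^{(s)}}=\bar a^{(s)}$. Let $\Delta^{(s)}$ be the group generated by a copy $\{u^{(s)}\}$ of the group $\Delta$ and a central copy $\{\iota(v^{(s)})\}$ of the group $\mathcal D$ subject to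 $v^{(s)}=\iota((sv)^{(s)})$ for $v\in\mathcal D$. Then $(R^{(s)},\Delta^{(s)})$ is an odd form ring with $u^{(s)}\cdot a^{(s)}=(u\cdot sa)^{(s)}$, $\iota(v^{(s)})\cdot a^{(s)}=\iota((v\cdot sa)^{(s)})$, $\phi(a^{(s)})=\iota(\phi(a)^{(s)})$, $\pi(u^{(s)})=\pi(u)^{(s)}$, $\pi(\iota(v^{(s)}))=0$, $\rho(u^{(s)})=(s\rho(u))^{(s)}$, $\rho(\iota(v^{(s)}))=\rho(v)^{(s)}$. The ring $R$ acts by $b\,a^{(s)}c=(bac)^{(s)}$, $u^{(s)}\cdot b=(u\cdot b)^{(s)}$, $\iota(v^{(s)})\cdot b=\iota((v\cdot b)^{(s)})$. There are structure maps $(R^{(ss')},\Delta^{(ss')})\to(R^{(s)},\Delta^{(s)})$, $a^{(ss')}\mapsto(s'a)^{(s)}$, $u^{(ss')}\mapsto(u\cdot s')^{(s)}$, $\iota(v^{(ss')})\mapsto\iota((s'v)^{(s)})$. **Hyperbolic families.** A *hyperbolic pair* is $\eta=(e_{-\eta},e_\eta,q_{-\eta},q_\eta)$ with orthogonal idempotents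 $e_{\pm\eta}\in R$, $\overline{e_\eta}=e_{-\eta}$, and $q_{\pm\eta}\in\Delta$ such that $\pi(q_{\pm\eta})=e_{\pm\eta}$, $\rho(q_{\pm\eta})=0$, $q_{\pm\eta}\cdot e_{\pm\eta}=q_{\pm\eta}$. Put $e_{|\eta|}=e_\eta+e_{-\eta}$ and $-\eta=(e_\eta,e_{-\eta},q_\eta,q_{-\eta})$; $\eta,\theta$ are orthogonal if $e_{|\eta|}e_{|\theta|}=e_{|\theta|}e_{|\eta|}=0$, and then $\eta\oplus\theta$ is their componentwise sum. Idempotents $e,f$ are Morita equivalent if $e\in RfR$ and $f\in ReR$ (additive spans). An *orthogonal hyperbolic family of rank $n$* consists of pairwise orthogonal hyperbolic pairs $\eta_1,\dots,\eta_n$ with pairwise Morita equivalent $e_{|\eta_i|}$. Put $\eta_{-i}=-\eta_i$, $e_i=e_{\eta_i}$ for $i\in\{\pm1,\dots,\pm n\}$. The family is *strong* if all $e_i$, $0<|i|\le n$, are pairwise Morita equivalent. **Steinberg pro-groups.** Put $R_{ij}^{(s)}=e_iR^{(s)}e_j$ and $\Delta^{0,(s)}_i=\{u\in\Delta^{(s)}\cdot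 e_i\mid e_k\pi(u)=0\text{ for all }k\ne0\}$. The group $\mathrm{StU}^{(s)}(R,\Delta;\Phi)$ is generated by $X_{ij}(a)$ ($i\ne\pm j$, $a\in R^{(s)}_{ij}$) and $X_i(u)$ ($u\in\Delta^{0,(s)}_i$) subject to the following relations, the operations being those of $(R^{(s)},\Delta^{(s)})$: $X_{ij}(a)=X_{-j,-i}(-\bar a)$; $X_{ij}(a)X_{ij}(b)=X_{ij}(a+b)$; $X_i(u)X_i(v)=X_i(u\dotplus v)$; $[X_{ij}(a),X_{kl}(b)]=1$ if $i\ne l\ne-j\ne-k\ne i$; $[X_{ij}(a),X_{jk}(b)]=X_{ik}(ab)$ if $i\ne\pm k$; $[X_{ij}(a),X_{j,-i}(b)]=X_{-i}(\phi(ab))$; $[X_i(u),X_j(v)]=X_{-i,j}(-\overline{\pi(u)}\pi(v))$ if $i\ne\pm j$; $[X_i(u),X_{jk}(a)]=1$ if $j\ne i\ne-k$; $[X_i(u),X_{ij}(a)]=X_{-i,j}(\rho(u)a)\,X_j(\dotminus(u\cdot(-a)))$. Here $[x,y]=xyx^{-1}y^{-1}$. The *Steinberg pro-group* $\mathrm{StU}^{(\infty,S)}(R,\Delta;\Phi)$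 is the formal projective limit (in the category of pro-groups) of the groups $\mathrm{StU}^{(s)}(R,\Delta;\Phi)$ over the category with objects $s\in S$ and arrows $s\to t$ the $r\in S$ with $t=sr$, with respect to the homomorphisms induced by the structure maps above. **Root elimination.** Let $\Phi=\{\pm\mathrm e_i\pm\mathrm e_j,\pm\mathrm e_k,\pm2\mathrm e_k\}\subset\mathbb R^n$ ($i\ne j$) be the root system of type $\mathsf{BC}_n$ and put $\mathrm e_{-i}=-\mathrm e_i$. A short root is a root of length $\sqrt2$, i.e. $\alpha=\mathrm e_q-\mathrm e_p$ with indices $p\ne\pm q$. Let $\mathrm{StU}^{(s)}(R,\Delta;\Phi/\alpha)$ and $\mathrm{StU}^{(\infty,S)}(R,\Delta;\Phi/\alpha)$ be the Steinberg group and pro-group of the orthogonal hyperbolic family of rank $n-1$ obtained by replacing $\eta_{|p|},\eta_{|q|}$ by the single pair $\eta_\infty=\eta_p\oplus\eta_q$. **Proposition.** Suppose that $n\ge4$, or that $n\ge3$ and the orthogonal hyperbolic family is strong. Then for every short root $\alpha\in\Phi$ and every presentation $\alpha=\mathrm e_q-\mathrm e_p$ there is a unique morphism of projective systems $F_\alpha=(F_\alpha^{(s)})_{s\in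 S}$, $F_\alpha^{(s)}\colon\mathrm{StU}^{(s)}(R,\Delta;\Phi/\alpha)\to\mathrm{StU}^{(s)}(R,\Delta;\Phi)$, such that for all $i,j\notin\{\pm p,\pm q,\pm\infty\}$ $$X_{ij}(a)\mapsto X_{ij}(a),\quad X_{i\infty}(a)\mapsto X_{ip}(ae_p)X_{iq}(ae_q),\quad X_{\infty j}(a)\mapsto X_{pj}(e_pa)X_{qj}(e_qa),\quad X_j(u)\mapsto X_j(u),$$ $$X_\infty(u)\mapsto X_p(u\cdot e_p)\,X_q(u\cdot e_q)\,X_{-q,p}(e_{-q}\rho(u)e_p),$$ $$X_{-\infty}(u)\mapsto X_{-p}(u\cdot e_{-p})\,X_{-q}(u\cdot e_{-q})\,X_{q,-p}(e_q\rho(u)e_{-p}),$$ and the induced morphism of pro-groups $F_\alpha\colon\mathrm{StU}^{(\infty,S)}(R,\Delta;\Phi/\alpha)\to\mathrm{StU}^{(\infty,S)}(R,\Delta;\Phi)$ is an isomorphism. -/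

import Mathlib

open CategoryTheory
open scoped commutatorElement

set_option linter.unusedSectionVars false

universe u v

/-! ### Odd form rings and (augmented) odd form algebras -/

/-- An odd form ring `(R, Δ)`. The ring `R` is non-unital and carries an involution `star`.
The (not necessarily commutative) group `Δ` is written additively; `act u a` is `u · a`. -/
structure OddFormRing (R : Type u) (Δ : Type v) [NonUnitalRing R] [StarRing R] [AddGroup Δ] where
  act : Δ → R → Δ
  phi : R → Δ
  pi : Δ → R
  rho : Δ → R
  add_act : ∀ u v a, act (u + v) a = act u a + act v a
  act_act : ∀ u a b, act (act u a) b = act u (a * b)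
  pi_add : ∀ u v, pi (u + v) = pi u + pi v
  pi_act : ∀ u a, pi (act u a) = pi u * a
  phi_add : ∀ a b, phi (a + b) = phi a + phi b
  phi_act : ∀ b a, act (phi b) a = phi (star a * b * a)
  rho_add : ∀ u v, rho (u + v) = rho u - star (pi u) * pi v + rho v
  rho_act : ∀ u a, rho (act u a) = star a * rho u * a
  rho_add_star : ∀ u, rho u + star (rho u) + star (pi u) * pi u = 0
  pi_phi : ∀ a, pi (phi a) = 0
  rho_phi : ∀ a, rho (phi a) = a - star a
  commutator : ∀ u v, u + v - u - v = phi (-(star (pi u) * pi v))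
  phi_eq_zero : ∀ a, a = star a → phi a = 0
  act_add : ∀ u a b, act u (a + b) = act u a + phi (star b * rho u * a) + act u b

/-- An odd form `K`-algebra: `R` is a (non-unital) `K`-algebra with `K`-linear involution, and the
multiplicative monoid of `K` acts on `Δ` from the right (`kact u k` is `u · k`). -/
structure OddFormAlgebra (K : Type u) (R : Type u) (Δ : Type u) [CommRing K] [NonUnitalRing R]
    [StarRing R] [Module K R] [IsScalarTower K R R] [SMulCommClass K R R] [AddGroup Δ]
    extends OddFormRing R Δ where
  star_smul : ∀ (k : K) (a : R), star (k • a) = k • star a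
  kact : Δ → K → Δ
  add_kact : ∀ u v k, kact (u + v) k = kact u k + kact v k
  kact_add : ∀ u k l, kact u (k + l) = kact u k + phi ((l * k) • rho u) + kact u l
  kact_act : ∀ u k a, act (kact u k) a = act u (k • a)
  act_kact : ∀ u a k, kact (act u a) k = act u (k • a)
  kact_kact : ∀ u k l, kact (kact u k) l = kact u (k * l)
  kact_one : ∀ u, kact u 1 = u
  phi_kact : ∀ a k, kact (phi a) k = phi ((k * k) • a)
  pi_kact : ∀ u k, pi (kact u k) = k • pi u
  rho_kact : ∀ u k, rho (kact u k) = (k * k) • rho u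

/-- An augmented odd form `K`-algebra `(R, Δ, D)`: the augmentation `D` is an `R`-invariant subgroup
of `Δ` which carries the structure of a left `K`-module (`ksmul k v` is `k v`). -/
structure AugOddFormAlgebra (K : Type u) (R : Type u) (Δ : Type u) [CommRing K] [NonUnitalRing R]
    [StarRing R] [Module K R] [IsScalarTower K R R] [SMulCommClass K R R] [AddGroup Δ]
    extends OddFormAlgebra K R Δ where
  D : AddSubgroup Δ
  act_mem : ∀ v ∈ D, ∀ a, act v a ∈ D
  ksmul : K → D → D
  ksmul_add : ∀ k v w, ksmul k (v + w) = ksmul k v + ksmul k w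
  add_ksmul : ∀ k l v, ksmul (k + l) v = ksmul k v + ksmul l v
  mul_ksmul : ∀ k l v, ksmul (k * l) v = ksmul k (ksmul l v)
  one_ksmul : ∀ v, ksmul 1 v = v
  phi_mem : ∀ a, phi a ∈ D
  phi_smul : ∀ (k : K) (a : R), phi (k • a) = ksmul k ⟨phi a, phi_mem a⟩
  pi_D : ∀ v : D, pi v = 0
  kact_D : ∀ (v : D) (k : K), kact v k = ksmul (k * k) v
  rho_ksmul : ∀ (k : K) (v : D), rho (ksmul k v) = k • rho v
  ksmul_act : ∀ (k : K) (v : D) (a : R), act (ksmul k v) a = ksmul k ⟨act v a, act_mem v v.2 a⟩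

namespace OddFormRing

variable {R : Type u} {Δ : Type v} [NonUnitalRing R] [StarRing R] [AddGroup Δ]
  (P : OddFormRing R Δ)

theorem phi_zero : P.phi 0 = 0 := P.phi_eq_zero 0 (by simp)

theorem act_zero (u : Δ) : P.act u 0 = 0 := by
  have h := P.act_add u 0 0
  simpa [P.phi_zero] using h

theorem zero_act (a : R) : P.act 0 a = 0 := by
  have h := P.add_act 0 0 a
  simpa using h

theorem pi_zero : P.pi 0 = 0 := by
  have h := P.pi_add 0 0
  simpa using h

theorem pi_neg (u : Δ) : P.pi (-u) = -P.pi u := by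
  have h := P.pi_add (-u) u
  rw [neg_add_cancel, P.pi_zero] at h
  exact eq_neg_of_add_eq_zero_left h.symm

theorem rho_zero : P.rho 0 = 0 := by
  have h := P.rho_add 0 0
  simpa [P.pi_zero] using h

theorem neg_act (u : Δ) (a : R) : P.act (-u) a = -P.act u a := by
  have h := P.add_act (-u) u a
  rw [neg_add_cancel, P.zero_act] at h
  exact eq_neg_of_add_eq_zero_left h.symm

theorem phi_neg (a : R) : P.phi (-a) = -P.phi a := by
  have h := P.phi_add (-a) a
  rw [neg_add_cancel, P.phi_zero] at h
  exact eq_neg_of_add_eq_zero_left h.symm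

/-- Elements of `Δ` with trivial `π` are central. -/
theorem add_comm_of_pi (u v : Δ) (h : P.pi v = 0) : u + v = v + u := by
  have h1 := P.commutator u v
  rw [h, mul_zero, neg_zero, P.phi_zero, sub_eq_zero, sub_eq_iff_eq_add] at h1
  exact h1

end OddFormRing

/-! ### Homotopes -/

section Homotope

variable {K : Type u} {R : Type u} {Δ : Type u} [CommRing K] [NonUnitalRing R]
  [StarRing R] [Module K R] [IsScalarTower K R R] [SMulCommClass K R R] [AddGroup Δ]

namespace AugOddFormAlgebra

/-- The homotope `R^{(s)}`: a copy of the `K`-module `R` with the multiplication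
`a^{(s)} b^{(s)} = (s a b)^{(s)}`. The element `a^{(s)}` is `⟨a⟩`. -/
@[ext] structure RHom (A : AugOddFormAlgebra K R Δ) (s : K) where
  val : R

variable {A : AugOddFormAlgebra K R Δ} {s : K}

namespace RHom

instance : Zero (A.RHom s) := ⟨⟨0⟩⟩
instance : Add (A.RHom s) := ⟨fun a b => ⟨a.val + b.val⟩⟩
instance : Neg (A.RHom s) := ⟨fun a => ⟨-a.val⟩⟩
instance : Sub (A.RHom s) := ⟨fun a b => ⟨a.val - b.val⟩⟩
instance : Mul (A.RHom s) := ⟨fun a b => ⟨s • (a.val * b.val)⟩⟩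
instance : Star (A.RHom s) := ⟨fun a => ⟨star a.val⟩⟩

@[simp] theorem val_zero : (0 : A.RHom s).val = 0 := rfl
@[simp] theorem val_add (a b : A.RHom s) : (a + b).val = a.val + b.val := rfl
@[simp] theorem val_neg (a : A.RHom s) : (-a).val = -a.val := rfl
@[simp] theorem val_sub (a b : A.RHom s) : (a - b).val = a.val - b.val := rfl
@[simp] theorem val_mul (a b : A.RHom s) : (a * b).val = s • (a.val * b.val) := rfl
@[simp] theorem val_star (a : A.RHom s) : (star a).val = star a.val := rfl

instance : NonUnitalRing (A.RHom s) where
  add_assoc a b c := by ext; simp [add_assoc]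
  zero_add a := by ext; simp
  add_zero a := by ext; simp
  nsmul := nsmulRec
  zsmul := zsmulRec
  neg_add_cancel a := by ext; simp
  sub_eq_add_neg a b := by ext; simp [sub_eq_add_neg]
  add_comm a b := by ext; simp [add_comm]
  left_distrib a b c := by ext; simp [mul_add]
  right_distrib a b c := by ext; simp [add_mul]
  zero_mul a := by ext; simp
  mul_zero a := by ext; simp
  mul_assoc a b c := by ext; simp [mul_assoc, smul_mul_assoc, mul_smul_comm]

instance : StarRing (A.RHom s) where
  star_involutive a := by ext; simp
  star_mul a b := by ext; simp [A.star_smul]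
  star_add a b := by ext; simp

end RHom

variable (A)

theorem ksmul_zero (k : K) : A.ksmul k 0 = 0 := by
  have h := A.ksmul_add k 0 0
  simpa using h

theorem ksmul_neg (k : K) (v : A.D) : A.ksmul k (-v) = -A.ksmul k v := by
  have h := A.ksmul_add k (-v) v
  rw [neg_add_cancel, ksmul_zero] at h
  exact eq_neg_of_add_eq_zero_left h.symm

theorem add_D_comm (u : Δ) (v : A.D) : u + v = v + u :=
  A.add_comm_of_pi u v (A.pi_D v)

theorem D_comm (v w : A.D) : v + w = w + v :=
  Subtype.ext (A.add_D_comm v w)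

/-- `φ` as a map to the augmentation. -/
def phiD (a : R) : A.D := ⟨A.phi a, A.phi_mem a⟩

/-- The action of `R` on the augmentation. -/
def actD (v : A.D) (a : R) : A.D := ⟨A.act v a, A.act_mem v v.2 a⟩

theorem phiD_smul (k : K) (a : R) : A.phiD (k • a) = A.ksmul k (A.phiD a) :=
  Subtype.ext (A.phi_smul k a)

theorem phiD_add (a b : R) : A.phiD (a + b) = A.phiD a + A.phiD b :=
  Subtype.ext (A.phi_add a b)

theorem phiD_act (b a : R) : A.actD (A.phiD b) a = A.phiD (star a * b * a) :=
  Subtype.ext (A.phi_act b a)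

theorem add_actD (v w : A.D) (a : R) : A.actD (v + w) a = A.actD v a + A.actD w a :=
  Subtype.ext (A.add_act v w a)

theorem actD_actD (v : A.D) (a b : R) : A.actD (A.actD v a) b = A.actD v (a * b) :=
  Subtype.ext (A.act_act v a b)

theorem actD_add (v : A.D) (a b : R) :
    A.actD v (a + b) = A.actD v a + A.phiD (star b * A.rho v * a) + A.actD v b :=
  Subtype.ext (A.act_add v a b)

theorem ksmul_actD (k : K) (v : A.D) (a : R) : A.actD (A.ksmul k v) a = A.ksmul k (A.actD v a) :=
  Subtype.ext (A.ksmul_act k v a)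

theorem rho_add_D (u : Δ) (v : A.D) : A.rho (u + v) = A.rho u + A.rho v := by
  rw [A.rho_add, A.pi_D]; simp

theorem D_actD_smul (v : A.D) (k : K) (a : R) :
    A.actD v (k • a) = A.ksmul (k * k) (A.actD v a) := by
  rw [← ksmul_actD]
  refine Subtype.ext ?_
  change A.act v (k • a) = A.act (A.ksmul (k * k) v) a
  rw [← A.kact_act, A.kact_D]

/-- The relations defining `Δ^{(s)}`: `v^{(s)} = ι((s v)^{(s)})` for `v` in the augmentation. -/
def homRel (s : K) : AddSubgroup (Δ × A.D) where
  carrier := {x | ∃ v : A.D, x = ((v : Δ), -A.ksmul s v)}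
  zero_mem' := ⟨0, Prod.ext rfl (by simp [ksmul_zero])⟩
  add_mem' := by
    rintro _ _ ⟨v, rfl⟩ ⟨w, rfl⟩
    refine ⟨v + w, ?_⟩
    ext
    · simp
    · simp [A.ksmul_add, ← A.D_comm (-A.ksmul s v)]
  neg_mem' := by
    rintro _ ⟨v, rfl⟩
    exact ⟨-v, by simp [ksmul_neg]⟩

instance (s : K) : (A.homRel s).Normal where
  conj_mem := by
    rintro _ ⟨v, rfl⟩ ⟨u, w⟩
    refine ⟨v, ?_⟩
    have h1 : u + v + -u = v := by rw [A.add_D_comm]; simp [add_assoc]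
    have h2 : w + -A.ksmul s v + -w = -A.ksmul s v := by rw [A.D_comm]; simp
    exact Prod.ext h1 h2

/-- The homotope `Δ^{(s)}`: the group generated by the group `Δ` (elements `u^{(s)}`) and a central
copy of the group `D` (elements `ι(v^{(s)})`) subject to `v^{(s)} = ι((s v)^{(s)})` for `v ∈ D`. -/
def DHom (s : K) : Type u := (Δ × A.D) ⧸ A.homRel s

instance (s : K) : AddGroup (A.DHom s) := inferInstanceAs (AddGroup ((Δ × A.D) ⧸ A.homRel s))

/-- The element `u^{(s)} ∔ ι(v^{(s)})` of `Δ^{(s)}`. -/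
def dmk (s : K) (u : Δ) (v : A.D) : A.DHom s := QuotientAddGroup.mk' (A.homRel s) (u, v)

variable {A}

theorem dind {p : A.DHom s → Prop} (h : ∀ u v, p (A.dmk s u v)) (x : A.DHom s) : p x := by
  obtain ⟨⟨u, v⟩, rfl⟩ := QuotientAddGroup.mk'_surjective (A.homRel s) x
  exact h u v

theorem rel_iff (u u' : Δ) (v v' : A.D) :
    -(u, v) + (u', v') ∈ A.homRel s ↔ ∃ w : A.D, u' = u + w ∧ v = v' + A.ksmul s w := by
  constructor
  · rintro ⟨w, hw⟩
    have h1 : -u + u' = w := congrArg Prod.fst hw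
    have h2 : -v + v' = -A.ksmul s w := congrArg Prod.snd hw
    refine ⟨w, by rw [← h1]; simp, ?_⟩
    rw [neg_add_eq_iff_eq_add] at h2
    rw [h2]; simp
  · rintro ⟨w, rfl, rfl⟩
    refine ⟨w, ?_⟩
    ext
    · simp
    · simp

theorem dmk_add_D (u : Δ) (v w : A.D) : A.dmk s (u + w) v = A.dmk s u (v + A.ksmul s w) :=
  (QuotientAddGroup.eq.2 ((rel_iff _ _ _ _).2 ⟨w, rfl, rfl⟩)).symm

theorem dmk_add (u u' : Δ) (v v' : A.D) :
    A.dmk s u v + A.dmk s u' v' = A.dmk s (u + u') (v + v') := rfl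

theorem dmk_neg (u : Δ) (v : A.D) : -A.dmk s u v = A.dmk s (-u) (-v) := rfl

theorem dmk_zero : (0 : A.DHom s) = A.dmk s 0 0 := rfl

/-- Maps out of `Δ^{(s)}`. -/
def dlift {X : Type*} (f : Δ → A.D → X)
    (hf : ∀ u v (w : A.D), f (u + w) v = f u (v + A.ksmul s w)) : A.DHom s → X :=
  Quotient.lift (s := QuotientAddGroup.leftRel (A.homRel s)) (fun x => f x.1 x.2) (by
    rintro ⟨u, v⟩ ⟨u', v'⟩ h
    obtain ⟨w, rfl, rfl⟩ := (rel_iff _ _ _ _).1 (QuotientAddGroup.leftRel_apply.1 h)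
    exact (hf _ _ _).symm)

@[simp] theorem dlift_dmk {X : Type*} (f : Δ → A.D → X)
    (hf : ∀ u v (w : A.D), f (u + w) v = f u (v + A.ksmul s w)) (u : Δ) (v : A.D) :
    dlift (s := s) f hf (A.dmk s u v) = f u v := rfl

variable (A)

/-- The action of `R` on `Δ^{(s)}`: `u^{(s)} · a = (u · a)^{(s)}`, `ι(v^{(s)}) · a = ι((v · a)^{(s)})`. -/
def ract (s : K) (x : A.DHom s) (a : R) : A.DHom s :=
  dlift (fun u v => A.dmk s (A.act u a) (A.actD v a)) (fun u v w => by
    rw [A.add_act, A.add_actD, ksmul_actD]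
    exact dmk_add_D _ _ (A.actD w a)) x

@[simp] theorem ract_dmk (u : Δ) (v : A.D) (a : R) :
    A.ract s (A.dmk s u v) a = A.dmk s (A.act u a) (A.actD v a) := rfl

/-- The homotope `(R^{(s)}, Δ^{(s)})` is an odd form ring. -/
def homotope (s : K) : OddFormRing (A.RHom s) (A.DHom s) where
  act x a := A.ract s x (s • a.val)
  phi a := A.dmk s 0 (A.phiD a.val)
  pi := dlift (fun u _ => ⟨A.pi u⟩) (fun u v w => by rw [A.pi_add, A.pi_D, add_zero])
  rho := dlift (fun u v => ⟨s • A.rho u + A.rho v⟩) (fun u v w => by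
    rw [rho_add_D, AddSubgroup.coe_add, rho_add_D, A.rho_ksmul, smul_add, add_assoc,
      add_comm (A.rho v)])
  add_act x y a := by
    induction x using dind with | h u v
    induction y using dind with | h u' v'
    simp only [dmk_add, ract_dmk, A.add_act, A.add_actD]
  act_act x a b := by
    induction x using dind with | h u v
    simp only [ract_dmk, A.act_act, A.actD_actD, RHom.val_mul, smul_mul_assoc, mul_smul_comm]
  pi_add x y := by
    induction x using dind with | h u v
    induction y using dind with | h u' v'
    ext
    simp [dmk_add, A.pi_add]
  pi_act x a := by
    induction x using dind with | h u v
    ext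
    simp [A.pi_act, mul_smul_comm]
  phi_add a b := by
    simp [dmk_add, phiD_add]
  phi_act b a := by
    simp only [ract_dmk, A.zero_act, phiD_act, RHom.val_mul, RHom.val_star, A.star_smul,
      smul_mul_assoc, mul_smul_comm]
  rho_add x y := by
    induction x using dind with | h u v
    induction y using dind with | h u' v'
    ext
    simp only [dmk_add, dlift_dmk, A.rho_add, AddSubgroup.coe_add, A.pi_D, RHom.val_add,
      RHom.val_sub, RHom.val_mul, RHom.val_star, smul_add, smul_sub, mul_zero, sub_zero]
    abel
  rho_act x a := by
    induction x using dind with | h u v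
    ext
    simp only [ract_dmk, dlift_dmk, A.rho_act, RHom.val_mul, RHom.val_star, A.star_smul, actD,
      smul_add, mul_add, add_mul, smul_mul_assoc, mul_smul_comm]
  rho_add_star x := by
    induction x using dind with | h u v
    ext
    have h1 := A.rho_add_star u
    have h2 := A.rho_add_star v
    rw [A.pi_D, mul_zero, add_zero] at h2
    simp only [dlift_dmk, RHom.val_add, RHom.val_mul, RHom.val_star, star_add, A.star_smul,
      RHom.val_zero]
    calc _ = s • (A.rho u + star (A.rho u) + star (A.pi u) * A.pi u)
          + (A.rho v + star (A.rho v)) := by simp only [smul_add]; abel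
      _ = 0 := by rw [h1, h2, smul_zero, add_zero]
  pi_phi a := by
    ext
    simp [A.pi_zero]
  rho_phi a := by
    ext
    simp [A.rho_zero, phiD, A.rho_phi]
  commutator x y := by
    induction x using dind with | h u v
    induction y using dind with | h u' v'
    simp only [sub_eq_add_neg, dmk_neg, dmk_add, dlift_dmk, RHom.val_neg, RHom.val_mul,
      RHom.val_star]
    have h1 := A.commutator u u'
    have h2 : v + v' + -v + -v' = 0 := by
      rw [A.D_comm v v', add_assoc v', add_neg_cancel, add_zero, add_neg_cancel]
    simp only [sub_eq_add_neg] at h1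
    rw [h1, h2, ← smul_neg, phiD_smul]
    have h3 := dmk_add_D (s := s) 0 0 (A.phiD (-(star (A.pi u) * A.pi u')))
    rw [zero_add, zero_add] at h3
    exact h3
  phi_eq_zero a h := by
    have h1 : A.phiD a.val = 0 := Subtype.ext (A.phi_eq_zero _ (congrArg RHom.val h))
    rw [h1]; rfl
  act_add x a b := by
    induction x using dind with | h u v
    simp only [ract_dmk, dlift_dmk, dmk_add, RHom.val_add, smul_add, A.act_add, A.actD_add,
      RHom.val_mul, RHom.val_star, A.star_smul, add_zero]
    have h1 : A.phi (s • star b.val * A.rho u * s • a.val) =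
        (A.phiD (s • star b.val * A.rho u * s • a.val) : Δ) := rfl
    rw [h1, add_assoc, ← A.add_D_comm, ← add_assoc, dmk_add_D, ← phiD_smul]
    congr 1
    have h2 : s • (s • (star b.val * (s • A.rho u + A.rho v)) * a.val) =
        s • (s • star b.val * A.rho u * s • a.val) + s • star b.val * A.rho v * s • a.val := by
      simp only [smul_add, mul_add, add_mul, smul_mul_assoc, mul_smul_comm]
    rw [h2, phiD_add]
    let _ : AddCommGroup A.D := { (inferInstance : AddGroup A.D) with add_comm := A.D_comm }
    abel

end AugOddFormAlgebra

end Homotope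

/-! ### Steinberg groups -/

/-- The signed (non-zero) indices `±i` for `i : ι`. -/
inductive SIdx (ι : Type) : Type
  | pos : ι → SIdx ι
  | neg : ι → SIdx ι

namespace SIdx

variable {ι κ : Type}

instance : Neg (SIdx ι) := ⟨fun i => match i with
  | pos i => neg i
  | neg i => pos i⟩

/-- The absolute value of a signed index. -/
def abs : SIdx ι → ι
  | pos i => i
  | neg i => i

/-- Functoriality of signed indices. -/
def map (f : ι → κ) : SIdx ι → SIdx κ
  | pos i => pos (f i)
  | neg i => neg (f i)

@[simp] theorem neg_pos (i : ι) : -(pos i) = neg i := rfl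
@[simp] theorem neg_neg (i : ι) : -(neg i) = pos i := rfl
@[simp] theorem abs_pos (i : ι) : (pos i).abs = i := rfl
@[simp] theorem abs_neg' (i : ι) : (neg i).abs = i := rfl

instance : InvolutiveNeg (SIdx ι) where
  neg_neg i := by cases i <;> rfl

@[simp] theorem abs_neg (i : SIdx ι) : (-i).abs = i.abs := by cases i <;> rfl

@[simp] theorem abs_map (f : ι → κ) (i : SIdx ι) : (i.map f).abs = f i.abs := by cases i <;> rfl

@[simp] theorem map_neg (f : ι → κ) (i : SIdx ι) : (-i).map f = -(i.map f) := by cases i <;> rfl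

theorem abs_eq_iff (i j : SIdx ι) : i.abs = j.abs ↔ i = j ∨ i = -j := by
  cases i <;> cases j <;> simp

end SIdx

/-- The components `R_{ij}` and `Δ^0_i` (for signed indices `i`, `j`) of an odd form ring, on which
the generators of the Steinberg group live, together with the closure properties which are needed to
write down the Steinberg relations. -/
structure Components {R : Type u} {Δ : Type v} [NonUnitalRing R] [StarRing R] [AddGroup Δ]
    (P : OddFormRing R Δ) (ι : Type) where
  ring : SIdx ι → SIdx ι → AddSubgroup R
  form : SIdx ι → AddSubgroup Δ
  star_mem : ∀ {i j a}, a ∈ ring i j → star a ∈ ring (-j) (-i)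
  mul_mem : ∀ {i j k a b}, a ∈ ring i j → b ∈ ring j k → a * b ∈ ring i k
  phi_mem : ∀ {i a}, a ∈ ring i (-i) → P.phi a ∈ form (-i)
  pi_mem : ∀ {i j u v}, u ∈ form i → v ∈ form j → star (P.pi u) * P.pi v ∈ ring (-i) j
  rho_mem : ∀ {i u}, u ∈ form i → P.rho u ∈ ring (-i) i
  act_mem : ∀ {i j u a}, u ∈ form i → a ∈ ring i j → P.act u a ∈ form j

section Steinberg

variable {R : Type u} {Δ : Type v} [NonUnitalRing R] [StarRing R] [AddGroup Δ]
  {P : OddFormRing R Δ} {ι : Type}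

/-- The generators of the Steinberg group. The condition `i.abs ≠ j.abs` means `i ≠ ±j`. -/
inductive StGen (C : Components P ι) : Type (max u v)
  | ring (i j : SIdx ι) (h : i.abs ≠ j.abs) (a : C.ring i j) : StGen C
  | form (i : SIdx ι) (u : C.form i) : StGen C

namespace StGen

variable (C : Components P ι)

/-- The letter `X_{ij}(a)`. -/
def X {i j : SIdx ι} (h : i.abs ≠ j.abs) {a : R} (ha : a ∈ C.ring i j) : FreeGroup (StGen C) :=
  FreeGroup.of (StGen.ring i j h ⟨a, ha⟩)

/-- The letter `X_i(u)`. -/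
def Y {i : SIdx ι} {u : Δ} (hu : u ∈ C.form i) : FreeGroup (StGen C) :=
  FreeGroup.of (StGen.form i ⟨u, hu⟩)

end StGen

open StGen in
/-- The Steinberg relations: `StRel C x y` means that the equality `x = y` is one of the defining
relations of the Steinberg group. -/
inductive StRel (C : Components P ι) : FreeGroup (StGen C) → FreeGroup (StGen C) → Prop
  /-- `X_{ij}(a) = X_{-j,-i}(-ā)` -/
  | st0 {i j : SIdx ι} (h : i.abs ≠ j.abs) (h' : (-j).abs ≠ (-i).abs)
      {a : R} (ha : a ∈ C.ring i j) :
      StRel C (X C h ha) (X C h' (neg_mem (C.star_mem ha)))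
  /-- `X_{ij}(a) X_{ij}(b) = X_{ij}(a + b)` -/
  | st1 {i j : SIdx ι} (h : i.abs ≠ j.abs) {a b : R} (ha : a ∈ C.ring i j) (hb : b ∈ C.ring i j) :
      StRel C (X C h ha * X C h hb) (X C h (add_mem ha hb))
  /-- `X_i(u) X_i(v) = X_i(u ∔ v)` -/
  | st2 {i : SIdx ι} {u v : Δ} (hu : u ∈ C.form i) (hv : v ∈ C.form i) :
      StRel C (Y C hu * Y C hv) (Y C (add_mem hu hv))
  /-- `[X_{ij}(a), X_{kl}(b)] = 1` for `i ≠ l ≠ -j ≠ -k ≠ i` -/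
  | st3 {i j k l : SIdx ι} (h : i.abs ≠ j.abs) (h' : k.abs ≠ l.abs)
      (h1 : i ≠ l) (h2 : l ≠ -j) (h3 : -j ≠ -k) (h4 : -k ≠ i)
      {a b : R} (ha : a ∈ C.ring i j) (hb : b ∈ C.ring k l) :
      StRel C ⁅X C h ha, X C h' hb⁆ 1
  /-- `[X_{ij}(a), X_{jk}(b)] = X_{ik}(ab)` for `i ≠ ±k` -/
  | st4 {i j k : SIdx ι} (h : i.abs ≠ j.abs) (h' : j.abs ≠ k.abs) (h'' : i.abs ≠ k.abs)
      {a b : R} (ha : a ∈ C.ring i j) (hb : b ∈ C.ring j k) :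
      StRel C ⁅X C h ha, X C h' hb⁆ (X C h'' (C.mul_mem ha hb))
  /-- `[X_{ij}(a), X_{j,-i}(b)] = X_{-i}(φ(ab))` -/
  | st5 {i j : SIdx ι} (h : i.abs ≠ j.abs) (h' : j.abs ≠ (-i).abs)
      {a b : R} (ha : a ∈ C.ring i j) (hb : b ∈ C.ring j (-i)) :
      StRel C ⁅X C h ha, X C h' hb⁆ (Y C (C.phi_mem (C.mul_mem ha hb)))
  /-- `[X_i(u), X_j(v)] = X_{-i,j}(-\bar{π(u)} π(v))` for `i ≠ ±j` -/
  | st6 {i j : SIdx ι} (_ : i.abs ≠ j.abs) (h' : (-i).abs ≠ j.abs)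
      {u v : Δ} (hu : u ∈ C.form i) (hv : v ∈ C.form j) :
      StRel C ⁅Y C hu, Y C hv⁆ (X C h' (neg_mem (C.pi_mem hu hv)))
  /-- `[X_i(u), X_{jk}(a)] = 1` for `j ≠ i ≠ -k` -/
  | st7 {i j k : SIdx ι} (h : j.abs ≠ k.abs) (h1 : j ≠ i) (h2 : i ≠ -k)
      {u : Δ} {a : R} (hu : u ∈ C.form i) (ha : a ∈ C.ring j k) :
      StRel C ⁅Y C hu, X C h ha⁆ 1
  /-- `[X_i(u), X_{ij}(a)] = X_{-i,j}(ρ(u) a) X_j(∸ u · (-a))` -/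
  | st8 {i j : SIdx ι} (h : i.abs ≠ j.abs) (h' : (-i).abs ≠ j.abs)
      {u : Δ} {a : R} (hu : u ∈ C.form i) (ha : a ∈ C.ring i j) :
      StRel C ⁅Y C hu, X C h ha⁆
        (X C h' (C.mul_mem (C.rho_mem hu) ha) * Y C (neg_mem (C.act_mem hu (neg_mem ha))))

/-- The Steinberg group with the generators `X_{ij}(a)`, `X_i(u)` and the relations `StRel`. -/
abbrev StU (C : Components P ι) : Type (max u v) :=
  PresentedGroup {r : FreeGroup (StGen C) | ∃ x y, StRel C x y ∧ x * y⁻¹ = r}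

namespace StU

/-- The generator `X_{ij}(a)` of the Steinberg group. -/
def X (C : Components P ι) (i j : SIdx ι) (h : i.abs ≠ j.abs) (a : R) (ha : a ∈ C.ring i j) :
    StU C :=
  PresentedGroup.of (StGen.ring i j h ⟨a, ha⟩)

/-- The generator `X_i(u)` of the Steinberg group. -/
def Y (C : Components P ι) (i : SIdx ι) (u : Δ) (hu : u ∈ C.form i) : StU C :=
  PresentedGroup.of (StGen.form i ⟨u, hu⟩)

end StU

variable {R' : Type u} {Δ' : Type v} [NonUnitalRing R'] [StarRing R'] [AddGroup Δ']
  {P' : OddFormRing R' Δ'}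

/-- Morphisms of odd form rings preserving the components. -/
structure CompHom (C : Components P ι) (C' : Components P' ι) where
  f : R → R'
  g : Δ → Δ'
  map_add : ∀ a b, f (a + b) = f a + f b
  map_mul : ∀ a b, f (a * b) = f a * f b
  map_star : ∀ a, f (star a) = star (f a)
  map_dadd : ∀ u v, g (u + v) = g u + g v
  map_act : ∀ u a, g (P.act u a) = P'.act (g u) (f a)
  map_phi : ∀ a, g (P.phi a) = P'.phi (f a)
  map_pi : ∀ u, f (P.pi u) = P'.pi (g u)
  map_rho : ∀ u, f (P.rho u) = P'.rho (g u)
  ring_mem : ∀ {i j a}, a ∈ C.ring i j → f a ∈ C'.ring i j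
  form_mem : ∀ {i u}, u ∈ C.form i → g u ∈ C'.form i

namespace CompHom

variable {C : Components P ι} {C' : Components P' ι} (F : CompHom C C')

theorem map_neg (a : R) : F.f (-a) = -F.f a :=
  _root_.map_neg (AddMonoidHom.mk' F.f F.map_add) a

theorem map_dneg (u : Δ) : F.g (-u) = -F.g u :=
  _root_.map_neg (AddMonoidHom.mk' F.g F.map_dadd) u

/-- The induced map on generators. -/
def gen : StGen C → StGen C'
  | .ring i j h a => .ring i j h ⟨F.f a, F.ring_mem a.2⟩
  | .form i u => .form i ⟨F.g u, F.form_mem u.2⟩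

theorem gen_X {i j : SIdx ι} (h : i.abs ≠ j.abs) {a : R} (ha : a ∈ C.ring i j) :
    FreeGroup.map F.gen (StGen.X C h ha) = StGen.X C' h (F.ring_mem ha) :=
  FreeGroup.map.of

theorem gen_Y {i : SIdx ι} {u : Δ} (hu : u ∈ C.form i) :
    FreeGroup.map F.gen (StGen.Y C hu) = StGen.Y C' (F.form_mem hu) :=
  FreeGroup.map.of

theorem X_congr {i j : SIdx ι} (h : i.abs ≠ j.abs) {a b : R} (ha : a ∈ C.ring i j)
    (hb : b ∈ C.ring i j) (e : a = b) : StGen.X C h ha = StGen.X C h hb := by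
  subst e; rfl

theorem Y_congr {i : SIdx ι} {a b : Δ} (ha : a ∈ C.form i)
    (hb : b ∈ C.form i) (e : a = b) : StGen.Y C ha = StGen.Y C hb := by
  subst e; rfl

theorem rel {x y : FreeGroup (StGen C)} (h : StRel C x y) :
    StRel C' (FreeGroup.map F.gen x) (FreeGroup.map F.gen y) := by
  cases h with
  | st0 h h' ha =>
    simp only [gen_X]
    rw [X_congr h' _ (neg_mem (C'.star_mem (F.ring_mem ha))) (by rw [map_neg, map_star])]
    exact .st0 h h' _
  | st1 h ha hb =>
    simp only [_root_.map_mul, gen_X]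
    rw [X_congr h (F.ring_mem (add_mem ha hb)) (add_mem (F.ring_mem ha) (F.ring_mem hb)) (by rw [map_add])]
    exact .st1 h _ _
  | st2 hu hv =>
    simp only [_root_.map_mul, gen_Y]
    rw [Y_congr (F.form_mem (add_mem hu hv)) (add_mem (F.form_mem hu) (F.form_mem hv)) (by rw [map_dadd])]
    exact .st2 _ _
  | st3 h h' h1 h2 h3 h4 ha hb =>
    simp only [map_commutatorElement, gen_X, map_one]
    exact .st3 h h' h1 h2 h3 h4 _ _
  | st4 h h' h'' ha hb =>
    simp only [map_commutatorElement, gen_X]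
    rw [X_congr h'' _ (C'.mul_mem (F.ring_mem ha) (F.ring_mem hb)) (by rw [map_mul])]
    exact .st4 h h' h'' _ _
  | st5 h h' ha hb =>
    simp only [map_commutatorElement, gen_X, gen_Y]
    rw [Y_congr _ (C'.phi_mem (C'.mul_mem (F.ring_mem ha) (F.ring_mem hb)))
      (by rw [map_phi, map_mul])]
    exact .st5 h h' _ _
  | st6 h h' hu hv =>
    simp only [map_commutatorElement, gen_X, gen_Y]
    rw [X_congr h' _ (neg_mem (C'.pi_mem (F.form_mem hu) (F.form_mem hv)))
      (by rw [map_neg, map_mul, map_star, map_pi, map_pi])]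
    exact .st6 h h' _ _
  | st7 h h1 h2 hu ha =>
    simp only [map_commutatorElement, gen_X, gen_Y, map_one]
    exact .st7 h h1 h2 _ _
  | st8 h h' hu ha =>
    simp only [map_commutatorElement, _root_.map_mul, gen_X, gen_Y]
    rw [X_congr h' _ (C'.mul_mem (C'.rho_mem (F.form_mem hu)) (F.ring_mem ha))
        (by rw [map_mul, map_rho]),
      Y_congr _ (neg_mem (C'.act_mem (F.form_mem hu) (neg_mem (F.ring_mem ha))))
        (by rw [map_dneg, map_act, map_neg])]
    exact .st8 h h' _ _

/-- The induced homomorphism of Steinberg groups,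
`X_{ij}(a) ↦ X_{ij}(f(a))` and `X_i(u) ↦ X_i(g(u))`. -/
def stMap : StU C →* StU C' :=
  PresentedGroup.toGroup (f := fun x => PresentedGroup.of (F.gen x)) (by
    rintro _ ⟨x, y, h, rfl⟩
    have hl : FreeGroup.lift (fun x => (PresentedGroup.of (F.gen x) : StU C')) =
        (PresentedGroup.mk _).comp (FreeGroup.map F.gen) := by
      ext; simp [PresentedGroup.of]
    rw [hl]
    exact (PresentedGroup.one_of_mem (rels := {r : FreeGroup (StGen C') |
      ∃ x y, StRel C' x y ∧ x * y⁻¹ = r}) ⟨_, _, F.rel h, by simp⟩))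

@[simp] theorem stMap_X (i j : SIdx ι) (h : i.abs ≠ j.abs) (a : R) (ha : a ∈ C.ring i j) :
    F.stMap (StU.X C i j h a ha) = StU.X C' i j h (F.f a) (F.ring_mem ha) :=
  PresentedGroup.toGroup.of _

@[simp] theorem stMap_Y (i : SIdx ι) (u : Δ) (hu : u ∈ C.form i) :
    F.stMap (StU.Y C i u hu) = StU.Y C' i (F.g u) (F.form_mem hu) :=
  PresentedGroup.toGroup.of _

end CompHom

theorem StU.hom_ext {C : Components P ι} {G : Type*} [Group G] {f g : StU C →* G}
    (h1 : ∀ i j h a ha, f (StU.X C i j h a ha) = g (StU.X C i j h a ha))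
    (h2 : ∀ i u hu, f (StU.Y C i u hu) = g (StU.Y C i u hu)) : f = g := by
  refine PresentedGroup.ext fun x => ?_
  cases x with
  | ring i j h a => exact h1 i j h a a.2
  | form i u => exact h2 i u u.2

theorem StU.X_congr {C : Components P ι} {i j : SIdx ι} (h : i.abs ≠ j.abs) {a b : R}
    (ha : a ∈ C.ring i j) (hb : b ∈ C.ring i j) (e : a = b) :
    StU.X C i j h a ha = StU.X C i j h b hb := by
  subst e; rfl

theorem StU.Y_congr {C : Components P ι} {i : SIdx ι} {a b : Δ} (ha : a ∈ C.form i)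
    (hb : b ∈ C.form i) (e : a = b) : StU.Y C i a ha = StU.Y C i b hb := by
  subst e; rfl

end Steinberg

/-! ### Hyperbolic pairs and orthogonal hyperbolic families -/

/-- Idempotents `e` and `e'` of a non-unital ring are Morita equivalent if `e ∈ R e' R` and
`e' ∈ R e R`. -/
def MoritaEquivalent {R : Type u} [NonUnitalRing R] (e e' : R) : Prop :=
  e ∈ AddSubgroup.closure {z : R | ∃ x y, z = x * e' * y} ∧
    e' ∈ AddSubgroup.closure {z : R | ∃ x y, z = x * e * y}

section Hyperbolic

variable {R : Type u} {Δ : Type v} [NonUnitalRing R] [StarRing R] [AddGroup Δ]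

/-- A hyperbolic pair `(e₋, e, q₋, q)`. -/
structure HypPair (P : OddFormRing R Δ) where
  em : R
  e : R
  qm : Δ
  q : Δ
  em_mul_em : em * em = em
  e_mul_e : e * e = e
  em_mul_e : em * e = 0
  e_mul_em : e * em = 0
  star_e : star e = em
  pi_qm : P.pi qm = em
  pi_q : P.pi q = e
  rho_qm : P.rho qm = 0
  rho_q : P.rho q = 0
  act_qm : P.act qm em = qm
  act_q : P.act q e = q

namespace HypPair

variable {P : OddFormRing R Δ}

theorem star_em (η : HypPair P) : star η.em = η.e := by rw [← η.star_e, star_star]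

/-- The hyperbolic pair `-η`. -/
instance : Neg (HypPair P) := ⟨fun η =>
  { em := η.e, e := η.em, qm := η.q, q := η.qm
    em_mul_em := η.e_mul_e, e_mul_e := η.em_mul_em, em_mul_e := η.e_mul_em, e_mul_em := η.em_mul_e
    star_e := η.star_em
    pi_qm := η.pi_q, pi_q := η.pi_qm, rho_qm := η.rho_q, rho_q := η.rho_qm
    act_qm := η.act_q, act_q := η.act_qm }⟩

@[simp] theorem neg_e (η : HypPair P) : (-η).e = η.em := rfl
@[simp] theorem neg_em (η : HypPair P) : (-η).em = η.e := rfl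

/-- The idempotent `e_{|η|} = e_η + e_{-η}`. -/
def eabs (η : HypPair P) : R := η.e + η.em

/-- Orthogonality of hyperbolic pairs: the idempotents `e_{|η|}`, `e_{|θ|}` are orthogonal. -/
def Orthogonal (η θ : HypPair P) : Prop := η.eabs * θ.eabs = 0 ∧ θ.eabs * η.eabs = 0

@[simp] theorem neg_eabs (η : HypPair P) : (-η).eabs = η.eabs := add_comm _ _

theorem Orthogonal.symm {η θ : HypPair P} (h : Orthogonal η θ) : Orthogonal θ η := ⟨h.2, h.1⟩

theorem e_mul_eabs (η : HypPair P) : η.e * η.eabs = η.e := by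
  simp [eabs, mul_add, η.e_mul_e, η.e_mul_em]

theorem eabs_mul_e (η : HypPair P) : η.eabs * η.e = η.e := by
  simp [eabs, add_mul, η.e_mul_e, η.em_mul_e]

theorem em_mul_eabs (η : HypPair P) : η.em * η.eabs = η.em := by
  simpa using (-η).e_mul_eabs

theorem eabs_mul_em (η : HypPair P) : η.eabs * η.em = η.em := by
  simpa using (-η).eabs_mul_e

theorem eabs_mul_eabs (η : HypPair P) : η.eabs * η.eabs = η.eabs := by
  have h : η.eabs * η.eabs = η.e * η.eabs + η.em * η.eabs := add_mul _ _ _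
  rw [h, e_mul_eabs, em_mul_eabs, eabs]

theorem Orthogonal.e_mul_e {η θ : HypPair P} (h : Orthogonal η θ) : η.e * θ.e = 0 := by
  rw [← η.e_mul_eabs, ← θ.eabs_mul_e, mul_assoc, ← mul_assoc η.eabs, h.1, zero_mul, mul_zero]

theorem Orthogonal.neg_left {η θ : HypPair P} (h : Orthogonal η θ) : Orthogonal (-η) θ := by
  simpa [Orthogonal] using h

theorem Orthogonal.neg_right {η θ : HypPair P} (h : Orthogonal η θ) : Orthogonal η (-θ) := by
  simpa [Orthogonal] using h

theorem act_q_other {η θ : HypPair P} (h : Orthogonal η θ) : P.act η.q θ.e = 0 := by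
  rw [← η.act_q, P.act_act, h.e_mul_e, P.act_zero]

theorem rho_q_add {η θ : HypPair P} (h : Orthogonal η θ) : P.rho (η.q + θ.q) = 0 := by
  have h1 : η.em * θ.e = 0 := h.neg_left.e_mul_e
  rw [P.rho_add, η.rho_q, θ.rho_q, η.pi_q, θ.pi_q, η.star_e, h1]
  simp

theorem act_q_add {η θ : HypPair P} (h : Orthogonal η θ) :
    P.act (η.q + θ.q) (η.e + θ.e) = η.q + θ.q := by
  rw [P.act_add, rho_q_add h, P.add_act, P.add_act, act_q_other h, act_q_other h.symm, η.act_q,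
    θ.act_q]
  simp [P.phi_zero]

theorem add_idem {η θ : HypPair P} (h : Orthogonal η θ) :
    (η.e + θ.e) * (η.e + θ.e) = η.e + θ.e := by
  simp [mul_add, add_mul, η.e_mul_e, θ.e_mul_e, h.e_mul_e, h.symm.e_mul_e]

theorem add_orth {η θ : HypPair P} (h : Orthogonal η θ) :
    (η.em + θ.em) * (η.e + θ.e) = 0 := by
  have h1 : η.em * θ.e = 0 := h.neg_left.e_mul_e
  have h2 : θ.em * η.e = 0 := h.symm.neg_left.e_mul_e
  simp [mul_add, add_mul, η.em_mul_e, θ.em_mul_e, h1, h2]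

/-- The direct sum `η ⊕ θ` of orthogonal hyperbolic pairs. -/
def oplus (η θ : HypPair P) (h : Orthogonal η θ) : HypPair P where
  em := η.em + θ.em
  e := η.e + θ.e
  qm := η.qm + θ.qm
  q := η.q + θ.q
  em_mul_em := add_idem h.neg_left.neg_right
  e_mul_e := add_idem h
  em_mul_e := add_orth h
  e_mul_em := add_orth h.neg_left.neg_right
  star_e := by rw [star_add, η.star_e, θ.star_e]
  pi_qm := by rw [P.pi_add, η.pi_qm, θ.pi_qm]
  pi_q := by rw [P.pi_add, η.pi_q, θ.pi_q]
  rho_qm := rho_q_add h.neg_left.neg_right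
  rho_q := rho_q_add h
  act_qm := act_q_add h.neg_left.neg_right
  act_q := act_q_add h

theorem oplus_eabs (η θ : HypPair P) (h : Orthogonal η θ) :
    (oplus η θ h).eabs = η.eabs + θ.eabs := by
  simp only [oplus, eabs]; abel

end HypPair

theorem morita_aux {e f g : R} (hf : f ∈ AddSubgroup.closure {z : R | ∃ x y, z = x * e * y})
    (he : e * g * e = e) : f ∈ AddSubgroup.closure {z : R | ∃ x y, z = x * g * y} := by
  refine (AddSubgroup.closure_mono ?_) hf
  rintro _ ⟨x, y, rfl⟩
  exact ⟨x * e, e * y, by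
    calc x * e * y = x * (e * g * e) * y := by rw [he]
      _ = x * e * g * (e * y) := by simp only [mul_assoc]⟩

/-- An orthogonal hyperbolic family (indexed by `ι`): pairwise orthogonal and pairwise Morita
equivalent hyperbolic pairs. -/
structure OrthHypFamily (P : OddFormRing R Δ) (ι : Type) where
  pair : ι → HypPair P
  orth : ∀ i j, i ≠ j → (pair i).Orthogonal (pair j)
  morita : ∀ i j, MoritaEquivalent (pair i).eabs (pair j).eabs

namespace OrthHypFamily

variable {P : OddFormRing R Δ} {ι : Type}

/-- The hyperbolic pairs `η_i` for signed indices, `η_{-i} = -η_i`. -/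
def η (H : OrthHypFamily P ι) : SIdx ι → HypPair P
  | .pos i => H.pair i
  | .neg i => -H.pair i

/-- The idempotents `e_i` for signed (non-zero) indices. -/
def e (H : OrthHypFamily P ι) (i : SIdx ι) : R := (H.η i).e

/-- The family is strong if all `e_i` for non-zero indices `i` are pairwise Morita equivalent. -/
def Strong (H : OrthHypFamily P ι) : Prop := ∀ i j, MoritaEquivalent (H.e i) (H.e j)

theorem eabs_η (H : OrthHypFamily P ι) (i : SIdx ι) : (H.η i).eabs = (H.pair i.abs).eabs := by
  cases i with
  | pos i => rfl
  | neg i => exact HypPair.neg_eabs _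

theorem orth_η (H : OrthHypFamily P ι) {i j : SIdx ι} (h : i.abs ≠ j.abs) :
    (H.η i).Orthogonal (H.η j) := by
  have h1 := H.orth _ _ h
  simpa only [HypPair.Orthogonal, eabs_η] using h1

@[simp] theorem e_mul_self (H : OrthHypFamily P ι) (i : SIdx ι) : H.e i * H.e i = H.e i :=
  (H.η i).e_mul_e

@[simp] theorem star_e (H : OrthHypFamily P ι) (i : SIdx ι) : star (H.e i) = H.e (-i) := by
  cases i with
  | pos i => exact (H.pair i).star_e
  | neg i => exact (H.pair i).star_em

theorem e_mul_e (H : OrthHypFamily P ι) {i j : SIdx ι} (h : i ≠ j) : H.e i * H.e j = 0 := by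
  by_cases h1 : i.abs = j.abs
  · rcases (SIdx.abs_eq_iff i j).1 h1 with h2 | rfl
    · exact absurd h2 h
    · cases j with
      | pos j => exact (H.pair j).em_mul_e
      | neg j => exact (H.pair j).e_mul_em
  · exact (H.orth_η h1).e_mul_e

/-- The indices of the family obtained by elimination of the root `e_q - e_p`: the old indices
different from `|p|`, `|q|`, and a new index `∞` (that is `none`). -/
abbrev ElimIdx (p q : SIdx ι) : Type := Option {k : ι // k ≠ p.abs ∧ k ≠ q.abs}

/-- The hyperbolic pairs obtained by elimination of the root `e_q - e_p`:
`η_∞ = η_p ⊕ η_q`, and the other pairs are not changed. -/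
def elimPair (H : OrthHypFamily P ι) (p q : SIdx ι) (h : p.abs ≠ q.abs) :
    ElimIdx p q → HypPair P
  | some k => H.pair k
  | none => (H.η p).oplus (H.η q) (H.orth_η h)

/-- The orthogonal hyperbolic family obtained by elimination of the root `e_q - e_p`. -/
def elim (H : OrthHypFamily P ι) (p q : SIdx ι) (h : p.abs ≠ q.abs) :
    OrthHypFamily P (ElimIdx p q) where
  pair := H.elimPair p q h
  orth := by
    have key : ∀ k : {k : ι // k ≠ p.abs ∧ k ≠ q.abs},
        (H.pair k).Orthogonal ((H.η p).oplus (H.η q) (H.orth_η h)) := by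
      intro k
      have h1 := H.orth _ _ k.2.1
      have h2 := H.orth _ _ k.2.2
      constructor
      · rw [HypPair.oplus_eabs, mul_add, eabs_η, eabs_η, h1.1, h2.1, add_zero]
      · rw [HypPair.oplus_eabs, add_mul, eabs_η, eabs_η, h1.2, h2.2, add_zero]
    rintro (_ | k) (_ | l) hkl
    · exact absurd rfl hkl
    · exact (key l).symm
    · exact key k
    · exact H.orth _ _ (fun h' => hkl (congrArg some (Subtype.ext h')))
  morita := by
    have hpp : (H.pair p.abs).eabs * (H.pair p.abs).eabs = (H.pair p.abs).eabs :=
      HypPair.eabs_mul_eabs _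
    have hpq := H.orth _ _ h
    have key : ∀ k : ι,
        MoritaEquivalent (H.pair k).eabs ((H.η p).oplus (H.η q) (H.orth_η h)).eabs := by
      intro k
      rw [HypPair.oplus_eabs, eabs_η, eabs_η]
      refine ⟨morita_aux (H.morita k p.abs).1 ?_,
        add_mem (H.morita p.abs k).1 (H.morita q.abs k).1⟩
      rw [mul_add, hpp, hpq.1, add_zero, hpp]
    rintro (_ | k) (_ | l)
    · have h1 : ((H.η p).oplus (H.η q) (H.orth_η h)).eabs ∈ AddSubgroup.closure
          {z : R | ∃ x y, z = x * ((H.η p).oplus (H.η q) (H.orth_η h)).eabs * y} := by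
        refine AddSubgroup.subset_closure ⟨((H.η p).oplus (H.η q) (H.orth_η h)).eabs,
          ((H.η p).oplus (H.η q) (H.orth_η h)).eabs, ?_⟩
        rw [HypPair.eabs_mul_eabs, HypPair.eabs_mul_eabs]
      exact ⟨h1, h1⟩
    · exact (key l).symm
    · exact key k
    · exact H.morita _ _

end OrthHypFamily

end Hyperbolic

/-! ### Steinberg pro-groups -/

section Pro

variable {K : Type u} {R : Type u} {Δ : Type u} [CommRing K] [NonUnitalRing R]
  [StarRing R] [Module K R] [IsScalarTower K R R] [SMulCommClass K R R] [AddGroup Δ]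

namespace AugOddFormAlgebra

variable {A : AugOddFormAlgebra K R Δ} {ι : Type}

theorem ract_ract {s : K} (x : A.DHom s) (a b : R) :
    A.ract s (A.ract s x a) b = A.ract s x (a * b) := by
  induction x using dind with | h u v
  simp only [ract_dmk, A.act_act, actD_actD]

theorem add_ract {s : K} (x y : A.DHom s) (a : R) :
    A.ract s (x + y) a = A.ract s x a + A.ract s y a := by
  induction x using dind with | h u v
  induction y using dind with | h u' v'
  simp only [dmk_add, ract_dmk, A.add_act, add_actD]

theorem zero_ract {s : K} (a : R) : A.ract s 0 a = 0 := by
  have h := add_ract (A := A) (s := s) 0 0 a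
  simpa using h

theorem neg_ract {s : K} (x : A.DHom s) (a : R) : A.ract s (-x) a = -A.ract s x a := by
  have h := add_ract (-x) x a
  rw [neg_add_cancel, zero_ract] at h
  exact eq_neg_of_add_eq_zero_left h.symm

theorem pi_ract {s : K} (x : A.DHom s) (a : R) :
    ((A.homotope s).pi (A.ract s x a)).val = ((A.homotope s).pi x).val * a := by
  induction x using dind with | h u v
  exact A.pi_act u a

theorem rho_ract {s : K} (x : A.DHom s) (a : R) :
    ((A.homotope s).rho (A.ract s x a)).val = star a * ((A.homotope s).rho x).val * a := by
  induction x using dind with | h u v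
  change s • A.rho (A.act u a) + A.rho (A.act v a) = star a * (s • A.rho u + A.rho v) * a
  simp only [A.rho_act, mul_add, add_mul, smul_mul_assoc, mul_smul_comm]

/-- The components `R^{(s)}_{ij} = e_i R^{(s)} e_j` and
`Δ^{0,(s)}_i = {u ∈ Δ^{(s)} · e_i | π(u) = e_0 π(u)}`, where `e_0 = 1 - ∑_{k ≠ 0} e_k`.
The condition `π(u) = e_0 π(u)` means that `e_k π(u) = 0` for all `k ≠ 0`. -/
def comps (H : OrthHypFamily A.toOddFormRing ι) (s : K) : Components (A.homotope s) ι where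
  ring i j :=
    { carrier := {a | H.e i * a.val = a.val ∧ a.val * H.e j = a.val}
      zero_mem' := by simp
      add_mem' := by
        rintro a b ⟨h1, h2⟩ ⟨h3, h4⟩
        exact ⟨by simp [mul_add, h1, h3], by simp [add_mul, h2, h4]⟩
      neg_mem' := by
        rintro a ⟨h1, h2⟩
        exact ⟨by simp [h1], by simp [h2]⟩ }
  form i :=
    { carrier := {u | A.ract s u (H.e i) = u ∧ ∀ k, H.e k * ((A.homotope s).pi u).val = 0}
      zero_mem' := ⟨zero_ract _, fun k => by simp [(A.homotope s).pi_zero]⟩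
      add_mem' := by
        rintro u v ⟨h1, h2⟩ ⟨h3, h4⟩
        exact ⟨by rw [add_ract, h1, h3],
          fun k => by rw [(A.homotope s).pi_add, RHom.val_add, mul_add, h2, h4, add_zero]⟩
      neg_mem' := by
        rintro u ⟨h1, h2⟩
        exact ⟨by rw [neg_ract, h1],
          fun k => by rw [(A.homotope s).pi_neg, RHom.val_neg, mul_neg, h2, neg_zero]⟩ }
  star_mem := by
    rintro i j a ⟨h1, h2⟩
    refine ⟨?_, ?_⟩
    · rw [← H.star_e, RHom.val_star, ← star_mul, h2]
    · rw [← H.star_e, RHom.val_star, ← star_mul, h1]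
  mul_mem := by
    rintro i j k a b ⟨h1, h2⟩ ⟨h3, h4⟩
    refine ⟨?_, ?_⟩
    · rw [RHom.val_mul, mul_smul_comm, ← mul_assoc, h1]
    · rw [RHom.val_mul, smul_mul_assoc, mul_assoc, h4]
  phi_mem := by
    rintro i a ⟨h1, h2⟩
    refine ⟨?_, fun k => ?_⟩
    · change A.dmk s (A.act 0 _) (A.actD (A.phiD a.val) _) = A.dmk s 0 (A.phiD a.val)
      rw [A.zero_act, phiD_act, H.star_e, neg_neg, h1, h2]
    · rw [(A.homotope s).pi_phi, RHom.val_zero, mul_zero]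
  pi_mem := by
    rintro i j u v ⟨h1, _⟩ ⟨h2, _⟩
    have h3 := pi_ract u (H.e i)
    have h4 := pi_ract v (H.e j)
    rw [h1] at h3
    rw [h2] at h4
    refine ⟨?_, ?_⟩
    · rw [RHom.val_mul, mul_smul_comm, ← mul_assoc, RHom.val_star, ← H.star_e, ← star_mul, ← h3]
    · rw [RHom.val_mul, smul_mul_assoc, mul_assoc, ← h4]
  rho_mem := by
    rintro i u ⟨h1, _⟩
    have h3 := rho_ract u (H.e i)
    rw [h1, H.star_e] at h3
    refine ⟨?_, ?_⟩
    · rw [h3, ← mul_assoc, ← mul_assoc, H.e_mul_self]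
    · rw [h3, mul_assoc _ _ (H.e i), H.e_mul_self]
  act_mem := by
    rintro i j u a ⟨_, h1⟩ ⟨_, h2⟩
    refine ⟨?_, fun k => ?_⟩
    · change A.ract s (A.ract s u (s • a.val)) (H.e j) = A.ract s u (s • a.val)
      rw [ract_ract, smul_mul_assoc, h2]
    · rw [(A.homotope s).pi_act, RHom.val_mul, mul_smul_comm, ← mul_assoc, h1, zero_mul, smul_zero]

/-- The group `StU^{(s)}(R, Δ) = StU(R^{(s)}, Δ^{(s)})` with respect to the family `H`. -/
abbrev StUs (H : OrthHypFamily A.toOddFormRing ι) (s : K) : Type u := StU (comps H s)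

theorem comps_form_ract (H : OrthHypFamily A.toOddFormRing ι) {s : K} {x : A.DHom s} (i : SIdx ι)
    (h : ∀ k, H.e k * ((A.homotope s).pi x).val = 0) :
    A.ract s x (H.e i) ∈ (comps H s).form i :=
  ⟨by rw [ract_ract, H.e_mul_self], fun k => by rw [pi_ract, ← mul_assoc, h, zero_mul]⟩

/-- The structure map `R^{(s r)} → R^{(s)}`, `a^{(s r)} ↦ (r a)^{(s)}`. -/
def rtrans {s t : K} (r : K) (a : A.RHom t) : A.RHom s := ⟨r • a.val⟩

/-- The structure map `Δ^{(s r)} → Δ^{(s)}`, `u^{(s r)} ↦ (u · r)^{(s)}`,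
`ι(v^{(s r)}) ↦ ι((r v)^{(s)})`. -/
def dtrans {s t : K} (r : K) (h : t = s * r) : A.DHom t → A.DHom s :=
  dlift (fun u v => A.dmk s (A.kact u r) (A.ksmul r v)) (fun u v w => by
    subst h
    rw [A.add_kact, A.kact_D, dmk_add_D, A.ksmul_add, ← A.mul_ksmul, ← A.mul_ksmul]
    congr 3
    ring)

@[simp] theorem dtrans_dmk {s t : K} (r : K) (h : t = s * r) (u : Δ) (v : A.D) :
    dtrans r h (A.dmk t u v) = A.dmk s (A.kact u r) (A.ksmul r v) := rfl

theorem dtrans_ract {s t : K} (r : K) (h : t = s * r) (x : A.DHom t) (a : R) :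
    dtrans r h (A.ract t x a) = A.ract s (dtrans r h x) a := by
  induction x using dind with | h u v
  simp only [ract_dmk, dtrans_dmk, ksmul_actD, A.act_kact, A.kact_act]

theorem ract_smul_dtrans {s t : K} (r : K) (h : t = s * r) (x : A.DHom t) (a : R) :
    dtrans r h (A.ract t x (t • a)) = A.ract s (dtrans r h x) (s • r • a) := by
  rw [dtrans_ract, smul_smul]
  congr 2

/-- The structure maps of the system `(R^{(s)}, Δ^{(s)})` are morphisms of odd form rings preserving
the components. -/
def transHom (H : OrthHypFamily A.toOddFormRing ι) {s t : K} (r : K) (h : t = s * r) :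
    CompHom (comps H t) (comps H s) where
  f := rtrans r
  g := dtrans r h
  map_add a b := by ext; simp [rtrans]
  map_mul a b := by
    ext
    simp only [rtrans, RHom.val_mul, smul_mul_assoc, mul_smul_comm, smul_smul]
    congr 1
    rw [h]; ring
  map_star a := by ext; simp [rtrans, A.star_smul]
  map_dadd x y := by
    induction x using dind with | h u v
    induction y using dind with | h u' v'
    simp only [dmk_add, dtrans_dmk, A.add_kact, A.ksmul_add]
  map_act x a := ract_smul_dtrans r h x a.val
  map_phi a := by
    change A.dmk s (A.kact 0 r) (A.ksmul r (A.phiD a.val)) = A.dmk s 0 (A.phiD (r • a.val))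
    have h0 : A.kact 0 r = 0 := by
      have h1 := A.add_kact 0 0 r
      simpa using h1
    rw [h0, phiD_smul]
  map_pi x := by
    induction x using dind with | h u v
    ext
    exact (A.pi_kact u r).symm
  map_rho x := by
    induction x using dind with | h u v
    ext
    change r • (t • A.rho u + A.rho v) = s • A.rho (A.kact u r) + A.rho (A.ksmul r v)
    rw [A.rho_kact, A.rho_ksmul, smul_add, smul_smul, smul_smul, h]
    congr 2
    ring
  ring_mem := by
    rintro i j a ⟨h1, h2⟩
    exact ⟨by simp only [rtrans, mul_smul_comm, h1], by simp only [rtrans, smul_mul_assoc, h2]⟩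
  form_mem := by
    rintro i x ⟨h1, h2⟩
    refine ⟨by rw [← dtrans_ract, h1], fun k => ?_⟩
    have h3 : ((A.homotope s).pi (dtrans r h x)).val = r • ((A.homotope t).pi x).val := by
      induction x using dind with | h u v
      exact A.pi_kact u r
    rw [h3, mul_smul_comm, h2, smul_zero]

end AugOddFormAlgebra

/-- The index category of the formal projective limits: objects are elements of the multiplicative
subset `S`, morphisms `s ⟶ t` are elements `r ∈ S` such that `t = s r`. -/
structure LocIdx (S : Submonoid K) where
  val : K
  mem : val ∈ S

namespace LocIdx

variable {S : Submonoid K}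

/-- Morphisms of the index category. -/
@[ext] structure Hom (s t : LocIdx S) where
  r : K
  mem : r ∈ S
  eq : t.val = s.val * r

instance : SmallCategory (LocIdx S) where
  Hom := Hom
  id s := ⟨1, S.one_mem, by simp⟩
  comp f g := ⟨f.r * g.r, S.mul_mem f.mem g.mem, by rw [g.eq, f.eq, mul_assoc]⟩
  id_comp f := Hom.ext (one_mul _)
  comp_id f := Hom.ext (mul_one _)
  assoc f g h := Hom.ext (mul_assoc _ _ _)

instance : IsFiltered (LocIdx S) where
  nonempty := ⟨⟨1, S.one_mem⟩⟩
  cocone_objs s t :=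
    ⟨⟨s.val * t.val, S.mul_mem s.mem t.mem⟩, ⟨t.val, t.mem, rfl⟩, ⟨s.val, s.mem, mul_comm _ _⟩, trivial⟩
  cocone_maps {s t} f g := by
    refine ⟨⟨t.val * s.val, S.mul_mem t.mem s.mem⟩, ⟨s.val, s.mem, rfl⟩, Hom.ext ?_⟩
    change f.r * s.val = g.r * s.val
    rw [mul_comm, ← f.eq, mul_comm, ← g.eq]

end LocIdx

/-- The category of pro-groups, i.e. the opposite of the category of ind-objects of `Grpᵒᵖ`. -/
abbrev ProGrp : Type (u + 1) := (Ind GrpCat.{u}ᵒᵖ)ᵒᵖ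

/-- The formal projective limit of a cofiltered system of groups. -/
noncomputable def ProGrp.lim (I : Type u) [SmallCategory I] [IsFiltered I] :
    (Iᵒᵖ ⥤ GrpCat.{u}) ⥤ ProGrp.{u} :=
  ((Functor.leftOpRightOpEquiv I GrpCat.{u}).functor ⋙ Ind.lim I).rightOp

namespace OrthHypFamily

open AugOddFormAlgebra

variable {A : AugOddFormAlgebra K R Δ} {ι : Type}

/-- The projective system of the groups `StU^{(s)}(R, Δ)`, `s ∈ S`, with respect to the orthogonal
hyperbolic family `H`. -/
def stSystem (H : OrthHypFamily A.toOddFormRing ι) (S : Submonoid K) :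
    (LocIdx S)ᵒᵖ ⥤ GrpCat.{u} where
  obj s := GrpCat.of (StUs H s.unop.val)
  map f := GrpCat.ofHom (transHom H f.unop.r f.unop.eq).stMap
  map_id s := by
    refine GrpCat.hom_ext (StU.hom_ext (fun i j h a ha => ?_) (fun i x hx => ?_))
    · refine (CompHom.stMap_X _ i j h a ha).trans (StU.X_congr _ _ _ ?_)
      exact RHom.ext (one_smul K a.val)
    · refine (CompHom.stMap_Y _ i x hx).trans (StU.Y_congr _ _ ?_)
      induction x using dind with | h u v
      change A.dmk _ (A.kact u 1) (A.ksmul 1 v) = A.dmk _ u v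
      rw [A.kact_one, A.one_ksmul]
  map_comp {s t r} f g := by
    refine GrpCat.hom_ext (StU.hom_ext (fun i j h a ha => ?_) (fun i x hx => ?_))
    · refine (CompHom.stMap_X _ i j h a ha).trans (Eq.symm ?_)
      refine ((congrArg _ (CompHom.stMap_X _ i j h a ha)).trans
        (CompHom.stMap_X _ i j h _ _)).trans (StU.X_congr _ _ _ ?_)
      exact RHom.ext (smul_smul _ _ _)
    · refine (CompHom.stMap_Y _ i x hx).trans (Eq.symm ?_)
      refine ((congrArg _ (CompHom.stMap_Y _ i x hx)).trans
        (CompHom.stMap_Y _ i _ _)).trans (StU.Y_congr _ _ ?_)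
      induction x using dind with | h u v
      change A.dmk _ (A.kact (A.kact u f.unop.r) g.unop.r)
        (A.ksmul g.unop.r (A.ksmul f.unop.r v)) =
        A.dmk _ (A.kact u (g.unop.r * f.unop.r)) (A.ksmul (g.unop.r * f.unop.r) v)
      rw [A.kact_kact, A.mul_ksmul, mul_comm]

/-- The Steinberg pro-group `StU^{(∞,S)}(R, Δ)`. -/
noncomputable def stPro (H : OrthHypFamily A.toOddFormRing ι) (S : Submonoid K) : ProGrp.{u} :=
  (ProGrp.lim (LocIdx S)).obj (H.stSystem S)

/-! ### Root elimination -/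

section Elim

variable (H : OrthHypFamily A.toOddFormRing ι) (p q : SIdx ι) (h : p.abs ≠ q.abs)

/-- The signed indices different from `±p`, `±q`. -/
abbrev FinIdx (p q : SIdx ι) : Type := SIdx {k : ι // k ≠ p.abs ∧ k ≠ q.abs}

variable {p q} in
/-- An index different from `±p`, `±q` as an index of the new family. -/
abbrev new (i : FinIdx p q) : SIdx (ElimIdx p q) := i.map some

variable {p q} in
/-- An index different from `±p`, `±q` as an index of the old family. -/
abbrev old (i : FinIdx p q) : SIdx ι := i.map Subtype.val

/-- The new index `∞`, `η_∞ = η_p ⊕ η_q`. -/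
abbrev infty (p q : SIdx ι) : SIdx (ElimIdx p q) := .pos none

variable {p q}

theorem old_ne_left (i : FinIdx p q) : (old i).abs ≠ p.abs := by
  rw [SIdx.abs_map]; exact i.abs.2.1

theorem old_ne_right (i : FinIdx p q) : (old i).abs ≠ q.abs := by
  rw [SIdx.abs_map]; exact i.abs.2.2

theorem elim_e_new (i : FinIdx p q) : (H.elim p q h).e (new i) = H.e (old i) := by
  cases i <;> rfl

theorem elim_e_infty : (H.elim p q h).e (infty p q) = H.e p + H.e q := rfl

theorem elim_e_neg_infty : (H.elim p q h).e (-infty p q) = H.e (-p) + H.e (-q) := by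
  cases p <;> cases q <;> rfl

variable {h} {s : K}

theorem ring_new_new {i j : FinIdx p q} {a : A.RHom s}
    (ha : a ∈ (comps (H.elim p q h) s).ring (new i) (new j)) :
    a ∈ (comps H s).ring (old i) (old j) := by
  obtain ⟨h1, h2⟩ := ha
  rw [elim_e_new] at h1 h2
  exact ⟨h1, h2⟩

theorem ring_new_right {i : FinIdx p q} {j : SIdx (ElimIdx p q)} {a : A.RHom s}
    (ha : a ∈ (comps (H.elim p q h) s).ring (new i) j) (r : SIdx ι) :
    ⟨a.val * H.e r⟩ ∈ (comps H s).ring (old i) r := by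
  obtain ⟨h1, _⟩ := ha
  rw [elim_e_new] at h1
  exact ⟨by rw [← mul_assoc, h1], by rw [mul_assoc, H.e_mul_self]⟩

theorem ring_left_new {i : SIdx (ElimIdx p q)} {j : FinIdx p q} {a : A.RHom s}
    (ha : a ∈ (comps (H.elim p q h) s).ring i (new j)) (r : SIdx ι) :
    ⟨H.e r * a.val⟩ ∈ (comps H s).ring r (old j) := by
  obtain ⟨_, h1⟩ := ha
  rw [elim_e_new] at h1
  exact ⟨by rw [← mul_assoc, H.e_mul_self], by rw [mul_assoc, h1]⟩

theorem ring_e_e (a : A.RHom s) (i j : SIdx ι) :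
    ⟨H.e i * a.val * H.e j⟩ ∈ (comps H s).ring i j :=
  ⟨by rw [mul_assoc, ← mul_assoc, H.e_mul_self], by rw [mul_assoc, H.e_mul_self]⟩

theorem e_pi_of_elim {x : R} (hx : ∀ k, (H.elim p q h).e k * x = 0) (k : SIdx ι) :
    H.e k * x = 0 := by
  have hpos := hx (infty p q)
  have hneg := hx (-infty p q)
  rw [elim_e_infty] at hpos
  rw [elim_e_neg_infty] at hneg
  have hpq : ∀ a b : SIdx ι, a.abs ≠ b.abs → (H.e a + H.e b) * x = 0 →
      H.e a * x = 0 ∧ H.e b * x = 0 := by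
    intro a b hab h0
    have n1 : a ≠ b := fun e => hab (congrArg _ e)
    have h1 : H.e a * ((H.e a + H.e b) * x) = H.e a * x := by
      rw [← mul_assoc, mul_add, H.e_mul_self, H.e_mul_e n1, add_zero]
    have h2 : H.e b * ((H.e a + H.e b) * x) = H.e b * x := by
      rw [← mul_assoc, mul_add, H.e_mul_self, H.e_mul_e n1.symm, zero_add]
    exact ⟨by rw [← h1, h0, mul_zero], by rw [← h2, h0, mul_zero]⟩
  obtain ⟨p1, q1⟩ := hpq p q h hpos
  obtain ⟨p2, q2⟩ := hpq (-p) (-q) (by simpa using h) hneg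
  by_cases hp : k.abs = p.abs
  · rcases (SIdx.abs_eq_iff _ _).1 hp with rfl | rfl
    exacts [p1, p2]
  by_cases hq : k.abs = q.abs
  · rcases (SIdx.abs_eq_iff _ _).1 hq with rfl | rfl
    exacts [q1, q2]
  cases k with
  | pos k => exact hx (.pos (some ⟨k, hp, hq⟩))
  | neg k => exact hx (.neg (some ⟨k, hp, hq⟩))

theorem form_new {i : FinIdx p q} {x : A.DHom s}
    (hx : x ∈ (comps (H.elim p q h) s).form (new i)) : x ∈ (comps H s).form (old i) := by
  obtain ⟨h1, h2⟩ := hx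
  rw [elim_e_new] at h1
  exact ⟨h1, e_pi_of_elim H h2⟩

theorem form_ract {i : SIdx (ElimIdx p q)} {x : A.DHom s}
    (hx : x ∈ (comps (H.elim p q h) s).form i) (r : SIdx ι) :
    A.ract s x (H.e r) ∈ (comps H s).form r :=
  comps_form_ract H r (e_pi_of_elim H hx.2)

variable (h s)

/-- The formulas for the root elimination homomorphism `F_α`, `α = e_q - e_p`, from
`StU^{(s)}(R, Δ; Φ/α)` to `StU^{(s)}(R, Δ; Φ)`. The values on `X_{i,-∞}(a)` and `X_{-∞,i}(a)` are
determined by the relation `X_{ij}(a) = X_{-j,-i}(-ā)`. -/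
structure IsElimHom (f : StUs (H.elim p q h) s →* StUs H s) : Prop where
  /-- `X_{ij}(a) ↦ X_{ij}(a)` -/
  X_new_new : ∀ (i j : FinIdx p q) (hij : (new i).abs ≠ (new j).abs)
    (hij' : (old i).abs ≠ (old j).abs) (a : A.RHom s)
    (ha : a ∈ (comps (H.elim p q h) s).ring (new i) (new j)),
    f (StU.X _ (new i) (new j) hij a ha) = StU.X _ (old i) (old j) hij' a (ring_new_new H ha)
  /-- `X_{i∞}(a) ↦ X_{ip}(a e_p) X_{iq}(a e_q)` -/
  X_new_infty : ∀ (i : FinIdx p q) (hi : (new i).abs ≠ (infty p q).abs) (a : A.RHom s)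
    (ha : a ∈ (comps (H.elim p q h) s).ring (new i) (infty p q)),
    f (StU.X _ (new i) (infty p q) hi a ha) =
      StU.X _ (old i) p (old_ne_left i) ⟨a.val * H.e p⟩ (ring_new_right H ha p) *
        StU.X _ (old i) q (old_ne_right i) ⟨a.val * H.e q⟩ (ring_new_right H ha q)
  /-- `X_{∞j}(a) ↦ X_{pj}(e_p a) X_{qj}(e_q a)` -/
  X_infty_new : ∀ (j : FinIdx p q) (hj : (infty p q).abs ≠ (new j).abs) (a : A.RHom s)
    (ha : a ∈ (comps (H.elim p q h) s).ring (infty p q) (new j)),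
    f (StU.X _ (infty p q) (new j) hj a ha) =
      StU.X _ p (old j) (old_ne_left j).symm ⟨H.e p * a.val⟩ (ring_left_new H ha p) *
        StU.X _ q (old j) (old_ne_right j).symm ⟨H.e q * a.val⟩ (ring_left_new H ha q)
  /-- `X_j(u) ↦ X_j(u)` -/
  Y_new : ∀ (j : FinIdx p q) (u : A.DHom s) (hu : u ∈ (comps (H.elim p q h) s).form (new j)),
    f (StU.Y _ (new j) u hu) = StU.Y _ (old j) u (form_new H hu)
  /-- `X_∞(u) ↦ X_p(u · e_p) X_q(u · e_q) X_{-q,p}(e_{-q} ρ(u) e_p)` -/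
  Y_infty : ∀ (hqp : (-q).abs ≠ p.abs) (u : A.DHom s)
    (hu : u ∈ (comps (H.elim p q h) s).form (infty p q)),
    f (StU.Y _ (infty p q) u hu) =
      StU.Y _ p (A.ract s u (H.e p)) (form_ract H hu p) *
        StU.Y _ q (A.ract s u (H.e q)) (form_ract H hu q) *
        StU.X _ (-q) p hqp ⟨H.e (-q) * ((A.homotope s).rho u).val * H.e p⟩ (ring_e_e H _ _ _)
  /-- `X_{-∞}(u) ↦ X_{-p}(u · e_{-p}) X_{-q}(u · e_{-q}) X_{q,-p}(e_q ρ(u) e_{-p})` -/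
  Y_neg_infty : ∀ (hqp : q.abs ≠ (-p).abs) (u : A.DHom s)
    (hu : u ∈ (comps (H.elim p q h) s).form (-infty p q)),
    f (StU.Y _ (-infty p q) u hu) =
      StU.Y _ (-p) (A.ract s u (H.e (-p))) (form_ract H hu (-p)) *
        StU.Y _ (-q) (A.ract s u (H.e (-q))) (form_ract H hu (-q)) *
        StU.X _ q (-p) hqp ⟨H.e q * ((A.homotope s).rho u).val * H.e (-p)⟩ (ring_e_e H _ _ _)

end Elim

end OrthHypFamily

end Pro

/-! ### The root system -/

/-- The vectors `e_i` for signed indices, `e_{-i} = -e_i`. -/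
def rootVec {n : ℕ} : SIdx (Fin n) → (Fin n → ℝ)
  | .pos i => Pi.single i 1
  | .neg i => -Pi.single i 1

/-- The root system of type `BC_n`: the vectors `±e_i ± e_j` (`i ≠ j`), `±e_k`, `±2e_k`. -/
def rootsBC (n : ℕ) : Set (Fin n → ℝ) :=
  {α | (∃ i j : SIdx (Fin n), i.abs ≠ j.abs ∧ α = rootVec i + rootVec j) ∨
    (∃ k, α = rootVec k) ∨ ∃ k, α = (2 : ℝ) • rootVec k}

/-- Short roots are the roots of length `√2`. -/
def IsShortRoot {n : ℕ} (α : Fin n → ℝ) : Prop := α ∈ rootsBC n ∧ α ⬝ᵥ α = 2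

theorem abs_ne_of_short {n : ℕ} {α : Fin n → ℝ} (hα : IsShortRoot α) {p q : SIdx (Fin n)}
    (h : α = rootVec q - rootVec p) : p.abs ≠ q.abs := by
  intro e
  have h2 := hα.2
  subst h
  have hs : ∀ k : Fin n, (Pi.single k (1 : ℝ) : Fin n → ℝ) ⬝ᵥ Pi.single k 1 = 1 := by simp
  rcases p with p | p <;> rcases q with q | q <;> obtain rfl : p = q := e <;>
    simp [rootVec, sub_eq_add_neg, dotProduct_add] at h2 <;> norm_num at h2

set_option linter.unusedVariables false
set_option linter.unusedSimpArgs false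

/-! ### Scaled odd form rings and Steinberg data -/

/-! The homomorphism `F_α` exists separately for every `s`. In `StU^{(s)}(Φ)` the products `X_{ip}
X_{iq}` and `X_p X_q X_{-q,p}` satisfy the Steinberg relations of the coarse family, where `e_∞ =
e_p + e_q`; this is a direct computation (`Coarsening.coarsen`). Uniqueness holds because the
formulas, together with `X_{ij}(a) = X_{-j,-i}(-ā)`, prescribe the values on all generators
(`IsElimHom.eq`).

The substance is an inverse up to a shift: a homomorphism `StU^{(s^11)}(Φ) → StU^{(s)}(Φ/α)` whose
composites with `F_α` on both sides are the structure maps (`OrthHypFamily.exists_elimInv`). By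
`ProGrp.isIso_lim_map` this suffices for an isomorphism of pro-groups. Inside `StU^{(s)}(Φ/α)`
almost all root subgroups of `Φ` are visible: idempotents cut `X_{ip}` and `X_{iq}` out of `X_{i∞}`,
and `X_{-q,p}` sits in `X_∞` through `φ` (`Refinement.refine`). Only `X_{pq}` and `X_{qp}`, up to
the identification with `X_{-q,-p}` and `X_{-p,-q}`, are missing.

For an index `j` different from `±p`, `±q` the missing element with parameter `a e_j b` has to be
the commutator of `X_{pj}(a)` and `X_{jq}(b)`. Morita equivalence writes `e_p` as a sum of products
through such indices, so these elements are enough; the question is whether they depend only on the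
products. After multiplying the parameters by powers of `s` the commutators lie in one abelian group
and define biadditive maps `F_j`. What is needed is the balancing identity `F_x(a e_j k, b) = F_j(a,
k e_x b)` (`MidMaps.F_balance`). For `x ≠ ±j` it is the Hall–Witt identity. If the rank is at least
4, the case `x = ±j` follows by passing through a third index.

In rank 3 with a strong family only `±j` are available. Conjugation by `X_{p,-q}`, `X_q` and the
long root elements of `X_{±j}` yields weaker relations between `F_j` and `F_{-j}`. They turn the
failure of balancing into a symmetric trilinear map on which the corner ring of `e_{-q}` acts
through a commutative quotient. This map satisfies a trace identity and an exchange identity, and a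
nilpotency argument shows that it is zero (`TriForm.eq_zero`, `BalancingData.obs_eq_zero`).

Balancing gives an additive parametrisation of the missing subgroup (`SDatum.exists_zeta`). Its
commutators with the other root subgroups are computed on products through a conveniently chosen
index and then extended by additivity or by a crossed homomorphism argument. All powers of `s` lost
on the way fit into one shift from `s` to `s^11` (`SDatum.ZetaFam.extend`). To compare different
homotopes in the same ring, every formula is written in `R` itself with an explicit scalar `s`. -/

theorem SIdx.neg_ne_self {ι : Type} (i : SIdx ι) : -i ≠ i := by
  cases i <;> simp [SIdx.neg_pos, SIdx.neg_neg]

@[grind .]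
theorem SIdx.ne_neg_self {ι : Type} (i : SIdx ι) : i ≠ -i := (SIdx.neg_ne_self i).symm

attribute [grind =] SIdx.abs_neg

@[grind =]
theorem SIdx.neg_neg_eq {ι : Type} (i : SIdx ι) : - -i = i := _root_.neg_neg i

@[grind =]
theorem SIdx.neg_eq_neg {ι : Type} (i j : SIdx ι) : -i = -j ↔ i = j := neg_inj

/-- The operations of a homotope of an odd form algebra; the parameter `s` is the
homotopy parameter, and `act` is the action of the original ring. -/
structure OBase (K R D : Type*) [CommRing K] [NonUnitalRing R] [StarRing R] [Module K R]
    [IsScalarTower K R R] [SMulCommClass K R R] [AddGroup D] where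
  s : K
  act : D → R → D
  phi : R → D
  pi : D → R
  rho : D → R
  star_smul : ∀ (k : K) (a : R), star (k • a) = k • star a
  add_act : ∀ u v a, act (u + v) a = act u a + act v a
  act_act : ∀ u a b, act (act u a) b = act u (a * b)
  act_add : ∀ u a b, act u (a + b) = act u a + phi (star b * rho u * a) + act u b
  phi_add : ∀ a b, phi (a + b) = phi a + phi b
  phi_act : ∀ b a, act (phi b) a = phi (star a * b * a)
  phi_star : ∀ a, phi (star a) = -phi a
  pi_add : ∀ u v, pi (u + v) = pi u + pi v
  pi_act : ∀ u a, pi (act u a) = pi u * a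
  pi_phi : ∀ a, pi (phi a) = 0
  rho_add : ∀ u v, rho (u + v) = rho u - s • (star (pi u) * pi v) + rho v
  rho_act : ∀ u a, rho (act u a) = star a * rho u * a
  rho_phi : ∀ a, rho (phi a) = a - star a
  rho_neg : ∀ u, rho (-u) = star (rho u)
  commutator : ∀ u v, u + v - u - v = phi (-(s • (star (pi u) * pi v)))

namespace OBase

variable {K R D : Type*} [CommRing K] [NonUnitalRing R] [StarRing R] [Module K R]
    [IsScalarTower K R R] [SMulCommClass K R R] [AddGroup D] (O : OBase K R D)

theorem phi_zero : O.phi 0 = 0 := by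
  have h := O.phi_add 0 0
  simpa using h

theorem phi_neg (a : R) : O.phi (-a) = -O.phi a := by
  have h := O.phi_add (-a) a
  rw [neg_add_cancel, O.phi_zero] at h
  exact eq_neg_of_add_eq_zero_left h.symm

theorem pi_zero : O.pi 0 = 0 := by
  have h := O.pi_add 0 0
  simpa using h

theorem pi_neg (u : D) : O.pi (-u) = -O.pi u := by
  have h := O.pi_add (-u) u
  rw [neg_add_cancel, O.pi_zero] at h
  exact eq_neg_of_add_eq_zero_left h.symm

theorem zero_act (a : R) : O.act 0 a = 0 := by
  have h := O.add_act 0 0 a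
  simpa using h

theorem neg_act (u : D) (a : R) : O.act (-u) a = -O.act u a := by
  have h := O.add_act (-u) u a
  rw [neg_add_cancel, O.zero_act] at h
  exact eq_neg_of_add_eq_zero_left h.symm

theorem act_zero (u : D) : O.act u 0 = 0 := by
  have h := O.act_add u 0 0
  simpa [O.phi_zero] using h

/-- The commutator of two elements depends only on their values under `π`, and `π` kills the image
of `φ`; hence this image is central. -/
theorem add_phi (u : D) (a : R) : u + O.phi a = O.phi a + u := by
  have h := O.commutator u (O.phi a)
  rw [O.pi_phi, mul_zero, smul_zero, neg_zero, O.phi_zero, sub_eq_zero, sub_eq_iff_eq_add] at h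
  exact h

/-- Expand `u · (a + (-a))`. The element `∸ u · (-a)` of the last Steinberg relation differs from `u
· a` only by a central term. -/
theorem neg_act_neg (u : D) (a : R) :
    -O.act u (-a) = O.act u a + O.phi (-(star a * O.rho u * a)) := by
  have h := O.act_add u a (-a)
  rw [add_neg_cancel, O.act_zero] at h
  rw [star_neg, neg_mul, neg_mul] at h
  exact (eq_neg_of_add_eq_zero_left h.symm).symm

end OBase

/-- A family of idempotents indexed by signed indices. -/
structure EFam {K R D : Type*} [CommRing K] [NonUnitalRing R] [StarRing R] [Module K R]
    [IsScalarTower K R R] [SMulCommClass K R R] [AddGroup D] (O : OBase K R D) (ι : Type) where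
  e : SIdx ι → R
  e_self : ∀ i, e i * e i = e i
  e_ne : ∀ i j, i ≠ j → e i * e j = 0
  star_e : ∀ i, star (e i) = e (-i)
  e_pi : ∀ i u, e i * O.pi u = 0

namespace EFam

variable {K R D : Type*} [CommRing K] [NonUnitalRing R] [StarRing R] [Module K R]
    [IsScalarTower K R R] [SMulCommClass K R R] [AddGroup D] {O : OBase K R D} {ι : Type}
    (E : EFam O ι)

theorem e_self' (i : SIdx ι) (a : R) : E.e i * (E.e i * a) = E.e i * a := by
  rw [← mul_assoc, E.e_self]

theorem e_ne' {i j : SIdx ι} (h : i ≠ j) (a : R) : E.e i * (E.e j * a) = 0 := by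
  rw [← mul_assoc, E.e_ne i j h, zero_mul]

end EFam

/-- Families of elements of a group which satisfy the Steinberg relations between the root
subgroups with indices in `ok`. The elements `x i j a`, `y i u` stand for
`X_{ij}(e_i a e_j)` and `X_i(u · e_i)`. -/
structure SDatum {K R D : Type*} [CommRing K] [NonUnitalRing R] [StarRing R] [Module K R]
    [IsScalarTower K R R] [SMulCommClass K R R] [AddGroup D] {O : OBase K R D} {ι : Type}
    (E : EFam O ι) (ok : SIdx ι → SIdx ι → Prop) (G : Type*) [Group G] where
  x : SIdx ι → SIdx ι → R → G
  y : SIdx ι → D → G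
  x_e : ∀ {i j}, ok i j → ∀ a, x i j (E.e i * a * E.e j) = x i j a
  y_e : ∀ i u, y i (O.act u (E.e i)) = y i u
  x_star : ∀ {i j}, ok i j → ∀ a, x i j a = x (-j) (-i) (-star a)
  x_add : ∀ {i j}, ok i j → ∀ a b, x i j (a + b) = x i j a * x i j b
  y_add : ∀ i u v, y i (u + v) = y i u * y i v
  x_comm : ∀ {i j k l}, ok i j → ok k l → i ≠ l → l ≠ -j → j ≠ k → k ≠ -i →
    ∀ a b, Commute (x i j a) (x k l b)
  x_x : ∀ {i j k}, ok i j → ok j k → ok i k →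
    ∀ a b, ⁅x i j a, x j k b⁆ = x i k (O.s • (a * E.e j * b))
  x_y : ∀ {i j}, ok i j → ok j (-i) →
    ∀ a b, ⁅x i j a, x j (-i) b⁆ = y (-i) (O.phi (O.s • (a * E.e j * b)))
  y_y : ∀ {i j}, i.abs ≠ j.abs → ok (-i) j →
    ∀ u v, ⁅y i u, y j v⁆ = x (-i) j (-(O.s • (star (O.pi u) * O.pi v)))
  y_x_comm : ∀ {i j k}, ok j k → j ≠ i → i ≠ -k → ∀ u a, Commute (y i u) (x j k a)
  y_x : ∀ {i j}, ok i j → ok (-i) j → ∀ u a, ⁅y i u, x i j a⁆ =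
    x (-i) j (O.s • (O.rho u * E.e i * a)) * y j (-(O.act u (-(O.s • (E.e i * a)))))

namespace SDatum

variable {K R D : Type*} [CommRing K] [NonUnitalRing R] [StarRing R] [Module K R]
    [IsScalarTower K R R] [SMulCommClass K R R] [AddGroup D] {O : OBase K R D} {ι : Type}
    {E : EFam O ι} {ok : SIdx ι → SIdx ι → Prop} {G : Type*} [Group G] (X : SDatum E ok G)
  {i j : SIdx ι}

include X

/-- Parameters range over all of `R`, but only the corner `e_i a e_j` counts. This spares membership
proofs in all later formulas. -/
theorem x_congr (h : ok i j) {a b : R} (hab : E.e i * a * E.e j = E.e i * b * E.e j) :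
    X.x i j a = X.x i j b := by
  rw [← X.x_e h a, hab, X.x_e h]

theorem x_left (h : ok i j) (a : R) : X.x i j (E.e i * a) = X.x i j a :=
  X.x_congr h (by rw [← mul_assoc, E.e_self])

theorem x_right (h : ok i j) (a : R) : X.x i j (a * E.e j) = X.x i j a :=
  X.x_congr h (by simp only [mul_assoc, E.e_self])

theorem y_congr {u v : D} (h : O.act u (E.e i) = O.act v (E.e i)) :
    X.y i u = X.y i v := by
  rw [← X.y_e i u, h, X.y_e]

theorem x_zero (h : ok i j) : X.x i j 0 = 1 := by
  have := X.x_add h 0 0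
  simpa using this

theorem x_neg (h : ok i j) (a : R) : X.x i j (-a) = (X.x i j a)⁻¹ := by
  have := X.x_add h (-a) a
  rw [neg_add_cancel, X.x_zero h] at this
  exact eq_inv_of_mul_eq_one_left this.symm

theorem x_eq_one (h : ok i j) {a : R} (ha : E.e i * a * E.e j = 0) : X.x i j a = 1 := by
  rw [← X.x_e h, ha, X.x_zero h]

theorem y_zero (i : SIdx ι) : X.y i 0 = 1 := by
  have := X.y_add i 0 0
  simpa using this

theorem y_neg (i : SIdx ι) (u : D) : X.y i (-u) = (X.y i u)⁻¹ := by
  have := X.y_add i (-u) u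
  rw [neg_add_cancel, X.y_zero] at this
  exact eq_inv_of_mul_eq_one_left this.symm

theorem y_eq_one {u : D} (h : O.act u (E.e i) = 0) : X.y i u = 1 := by
  rw [← X.y_e, h, X.y_zero]

theorem x_comm_self (h : ok i j) (a b : R) : Commute (X.x i j a) (X.x i j b) := by
  rw [Commute, SemiconjBy, ← X.x_add h, ← X.x_add h, add_comm]

theorem y_comm_phi (i : SIdx ι) (u : D) (a : R) : Commute (X.y i u) (X.y i (O.phi a)) := by
  rw [Commute, SemiconjBy, ← X.y_add, ← X.y_add, O.add_phi]

end SDatum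

/-! ### Commutator identities -/

section Comm

variable {G : Type*} [Group G] {a b c d g t : G}

theorem conj_comm_eq (g a b : G) : g * ⁅a, b⁆ * g⁻¹ = ⁅g * a * g⁻¹, g * b * g⁻¹⁆ := by
  simp only [commutatorElement_def]; group

theorem comm_mul_left (a b c : G) : ⁅a * b, c⁆ = a * ⁅b, c⁆ * a⁻¹ * ⁅a, c⁆ := by
  simp only [commutatorElement_def]; group

theorem comm_mul_right (a b c : G) : ⁅a, b * c⁆ = ⁅a, b⁆ * (b * ⁅a, c⁆ * b⁻¹) := by
  simp only [commutatorElement_def]; group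

theorem conj_eq_comm_mul (a b : G) : a * b * a⁻¹ = ⁅a, b⁆ * b := by
  simp only [commutatorElement_def]; group

theorem Commute.conj_eq (h : Commute a b) : a * b * a⁻¹ = b := by
  rw [h.eq]; group

theorem Commute.comm_eq_one (h : Commute a b) : ⁅a, b⁆ = 1 :=
  commutatorElement_eq_one_iff_mul_comm.2 h.eq

theorem comm_mul_left_of_commute (h : Commute a ⁅b, c⁆) : ⁅a * b, c⁆ = ⁅b, c⁆ * ⁅a, c⁆ := by
  rw [comm_mul_left, h.conj_eq]

theorem comm_mul_right_of_commute (h : Commute b ⁅a, c⁆) : ⁅a, b * c⁆ = ⁅a, b⁆ * ⁅a, c⁆ := by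
  rw [comm_mul_right, h.conj_eq]

theorem comm_mul_left_of_commute' (h : Commute b c) : ⁅a * b, c⁆ = ⁅a, c⁆ := by
  rw [comm_mul_left, h.comm_eq_one]; simp

theorem comm_mul_right_of_commute' (h : Commute a c) : ⁅a, b * c⁆ = ⁅a, b⁆ := by
  rw [comm_mul_right, h.comm_eq_one]; simp

theorem comm_inv_comm (a b : G) : ⁅a, b⁆⁻¹ = ⁅b, a⁆ := commutatorElement_inv a b

/-- Conjugation by `g` replaces `a` by `⁅g, a⁆ * a`, and the hypotheses say that the extra factor
has no effect on the commutator with `b`. -/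
theorem commute_comm_of_left (hb : Commute ⁅g, a⁆ b) (hc : Commute ⁅g, a⁆ ⁅a, b⁆)
    (h : Commute g b) : Commute g ⁅a, b⁆ := by
  have e : g * ⁅a, b⁆ * g⁻¹ = ⁅a, b⁆ := by
    rw [conj_comm_eq, h.conj_eq, conj_eq_comm_mul, comm_mul_left, hc.conj_eq, hb.comm_eq_one,
      mul_one]
  exact mul_inv_eq_iff_eq_mul.1 e

theorem commute_comm_of_right (ha : Commute ⁅g, b⁆ a) (hc : Commute ⁅g, b⁆ ⁅a, b⁆)
    (h : Commute g a) : Commute g ⁅a, b⁆ := by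
  have e : g * ⁅a, b⁆ * g⁻¹ = ⁅a, b⁆ := by
    rw [conj_comm_eq, h.conj_eq, conj_eq_comm_mul, comm_mul_right, hc.conj_eq,
      ha.symm.comm_eq_one, one_mul]
  exact mul_inv_eq_iff_eq_mul.1 e

/-- The commutator of `⁅a, b⁆` with an element which commutes with `a`. -/
theorem comm_comm_of_right (h : Commute g a) (hc : Commute ⁅g, b⁆ ⁅a, b⁆) :
    ⁅⁅a, b⁆, g⁆ = ⁅a, ⁅g, b⁆⁆⁻¹ := by
  have e : g * ⁅a, b⁆ * g⁻¹ = ⁅a, ⁅g, b⁆⁆ * ⁅a, b⁆ := by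
    rw [conj_comm_eq, h.conj_eq, conj_eq_comm_mul, comm_mul_right, hc.conj_eq]
  rw [conj_eq_comm_mul] at e
  rw [← comm_inv_comm, mul_right_cancel e]

theorem commute_comm (h : Commute g a) (h' : Commute g b) : Commute g ⁅a, b⁆ := by
  rw [commutatorElement_def]
  exact ((h.mul_right h').mul_right h.inv_right).mul_right h'.inv_right

theorem conj_mul_eq (g a b : G) : g * (a * b) * g⁻¹ = (g * a * g⁻¹) * (g * b * g⁻¹) := by
  group

/-- A form of the Hall–Witt identity. -/
theorem comm_comm_of_commute (h : Commute a b) (h' : Commute ⁅a, c⁆ ⁅c, b⁆) :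
    ⁅a, ⁅c, b⁆⁆ = ⁅c, b⁆ * ⁅⁅a, c⁆, b⁆ * ⁅c, b⁆⁻¹ := by
  have h1 : a * ⁅c, b⁆ * a⁻¹ = ⁅⁅a, c⁆ * c, b⁆ := by
    rw [conj_comm_eq, h.conj_eq, conj_eq_comm_mul]
  have h2 : ⁅a, ⁅c, b⁆⁆ = ⁅⁅a, c⁆ * c, b⁆ * ⁅c, b⁆⁻¹ := by
    rw [← h1, commutatorElement_def a]
  rw [h2, comm_mul_left, h'.conj_eq]

end Comm

/-! ### Balanced trilinear maps -/

/-- A kind of trilinear maps on a pair `(V, W)` with a pairing `κ`. -/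
structure TriForm {A N V W L : Type*} [CommRing A] [AddCommGroup N] [Module A N] [AddCommGroup V]
    [AddCommGroup W] [Fintype L] (κ : W →+ V →+ A) (tv : V → W → V → V) (tw : W → V → W → W)
    (u : L → V) (v : L → W) (T : V →+ W →+ V →+ N) : Prop where
  symm : ∀ m y n, T m y n = T n y m
  left : ∀ m y n y' n', T (tv m y n) y' n' = κ y n • T m y' n'
  mid : ∀ m y n y' n', T m (tw y n y') n' = κ y n • T m y' n'
  quad : ∀ m y n n', κ y n' • T m y n = κ y n • T m y n'
  trace : ∀ n, ∑ l, T (u l) (v l) n = 0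
  sum_left : ∀ x w n, ∑ l, κ (v l) x • T (u l) w n = T x w n
  sum_mid : ∀ x w n, ∑ l, κ w (u l) • T x (v l) n = T x w n
  kappa_left : ∀ w m y n, κ w (tv m y n) = κ w m * κ y n
  kappa_right : ∀ w m y n, κ (tw w m y) n = κ w m * κ y n
  kappa_sum : ∀ w x, ∑ l, κ w (u l) * κ (v l) x = κ w x

namespace TriForm

variable {A N V W L : Type*} [CommRing A] [AddCommGroup N] [Module A N] [AddCommGroup V]
    [AddCommGroup W] [Fintype L] {κ : W →+ V →+ A} {tv : V → W → V → V} {tw : W → V → W → W}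
    {u : L → V} {v : L → W} {T : V →+ W →+ V →+ N}

/-- Linearisation of the exchange identity `quad` in the middle argument. -/
theorem quad_polar (h : TriForm κ tv tw u v T) (m : V) (y y' : W) (n n' : V) :
    κ y n' • T m y' n + κ y' n' • T m y n = κ y n • T m y' n' + κ y' n • T m y n' := by
  have h1 := h.quad m (y + y') n n'
  simp only [map_add, AddMonoidHom.add_apply, add_smul, smul_add] at h1
  linear_combination (norm := module) h1 - h.quad m y n n' - h.quad m y' n n'

/-- The annihilator of an element of a module. -/
def ann (A : Type*) {N : Type*} [CommRing A] [AddCommGroup N] [Module A N] (t : N) : Ideal A :=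
  LinearMap.ker (LinearMap.toSpanSingleton A N t)

theorem mem_ann {t : N} {c : A} : c ∈ ann A t ↔ c • t = 0 := by
  simp [ann]

/-- Modulo the annihilator of `t` every `ε l` squares to zero, so their sum is nilpotent; this sum
is `-c²` there, so `c` is nilpotent too. -/
theorem mem_radical_of_sum {t : N} {ε : L → A} {c : A} (h1 : ∀ l, ε l • ε l • t = 0)
    (h2 : ∑ l, ε l • t = -(c • c • t)) :
    c ∈ (ann A t).radical := by
  set I : Ideal A := ann A t with hI
  have hs : ∑ l, ε l ∈ I.radical := by
    refine Ideal.sum_mem _ fun l _ => ⟨2, ?_⟩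
    simp [hI, mem_ann, pow_two, mul_smul, h1]
  have h3 : c * c + ∑ l, ε l ∈ I := by
    simp [hI, mem_ann, add_smul, Finset.sum_smul, h2, mul_smul]
  have h4 : c * c ∈ I.radical := by
    have := Ideal.sub_mem _ (Ideal.le_radical h3) hs
    simpa using this
  have : c ^ 2 ∈ I.radical := by rwa [pow_two]
  rw [← Ideal.radical_idem I]
  exact ⟨2, this⟩

theorem mem_radical_iff {t : N} {c : A} :
    c ∈ (ann A t).radical ↔
      ∃ k : ℕ, c ^ k • t = 0 := by
  simp [Ideal.mem_radical_iff, mem_ann]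

variable (h : TriForm κ tv tw u v T)
include h

/-- Allows a power of a scalar that kills part of `T` to be absorbed into `T`, so that the second
vanishing lemma applies to the rest. -/
theorem smul (c : A) : TriForm κ tv tw u v
    ((AddMonoidHom.compHom (AddMonoidHom.compHom (DistribSMul.toAddMonoidHom N c))).comp T) := by
  have e : ∀ m y n, ((AddMonoidHom.compHom (AddMonoidHom.compHom
      (DistribSMul.toAddMonoidHom N c))).comp T) m y n = c • T m y n := fun _ _ _ => rfl
  refine ⟨?_, ?_, ?_, ?_, ?_, ?_, ?_, h.kappa_left, h.kappa_right, h.kappa_sum⟩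
  all_goals simp only [e]
  · intro m y n; rw [h.symm]
  · intro m y n y' n'; rw [h.left, smul_comm]
  · intro m y n y' n'; rw [h.mid, smul_comm]
  · intro m y n n'; rw [smul_comm, h.quad, smul_comm]
  · intro n; rw [← Finset.smul_sum, h.trace, smul_zero]
  · intro x w n; simp only [smul_comm _ c]; rw [← Finset.smul_sum, h.sum_left]
  · intro x w n; simp only [smul_comm _ c]; rw [← Finset.smul_sum, h.sum_mid]

/-- One should read `tv m y n` as `m κ(y, n)` and `u`, `v` as dual bases. Where `κ w x` is
invertible, the line of `x` splits off; the trace identity and the exchange identity on the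
complement together force `T x w x` to vanish up to nilpotents, and exchange brings every `T m w n`
back to it. -/
theorem exists_pow_mid_eq_zero (w : W) (x : V) : ∃ k : ℕ, ∀ m n, κ w x ^ k • T m w n = 0 := by
  set c := κ w x with hc
  -- These are `c` times the projections of `u l` and `v l` to the orthogonal complements of `w` and
  -- `x`, written without division.
  set u' : L → V := fun l => tv (u l) w x - tv x w (u l) with hu'
  set v' : L → W := fun l => tw w x (v l) - tw (v l) x w with hv'
  have e1 : ∀ l, κ w (u' l) = 0 := fun l => by
    simp only [hu', map_sub, h.kappa_left]; ring
  have e2 : ∀ l, κ (v' l) x = 0 := fun l => by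
    simp only [hv', map_sub, AddMonoidHom.sub_apply, h.kappa_right]; ring
  have e3 : ∀ l, κ (v' l) (u' l) • T x w x = c • T (u' l) (v' l) x := fun l => by
    have := h.quad_polar x w (v' l) x (u' l)
    rw [e1, e2, zero_smul, zero_smul, zero_add, add_zero, ← hc] at this
    rw [this, h.symm]
  have e4 : ∀ l, κ (v' l) (u' l) • T (u' l) (v' l) x = 0 := fun l => by
    rw [h.quad, e2, zero_smul]
  -- The trace term vanishes. Each of the two cross terms contributes `-c • T x w x`, and the last
  -- term gives it back once.
  have e5 : ∑ l, T (u' l) (v' l) x = -(c • T x w x) := by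
    have : ∀ l, T (u' l) (v' l) x = c • c • T (u l) (v l) x - c • κ (v l) x • T (u l) w x
        - c • κ w (u l) • T x (v l) x + (κ w (u l) * κ (v l) x) • T x w x := fun l => by
      simp only [hu', hv', map_sub, AddMonoidHom.sub_apply, h.left, h.mid, ← hc, mul_smul]
      rw [smul_comm (κ w (u l)) c]
      abel
    rw [Finset.sum_congr rfl fun l _ => this l, Finset.sum_add_distrib, Finset.sum_sub_distrib,
      Finset.sum_sub_distrib, ← Finset.smul_sum, ← Finset.smul_sum, ← Finset.smul_sum,
      ← Finset.smul_sum, ← Finset.sum_smul, h.trace, h.sum_left, h.sum_mid, h.kappa_sum, ← hc]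
    simp
  obtain ⟨k, hk⟩ := mem_radical_iff.1 (mem_radical_of_sum (c := c) (t := T x w x)
    (ε := fun l => κ (v' l) (u' l)) (fun l => by rw [e3, smul_comm, e4, smul_zero])
    (by simp only [e3]; rw [← Finset.smul_sum, e5, smul_neg]))
  -- Two further factors `c` replace `n` and then `m` by `x`, by exchange and symmetry.
  refine ⟨k + 2, fun m n => ?_⟩
  have e6 : c • T m w n = κ w n • T m w x := h.quad m w n x
  have e7 : c • T x w m = κ w m • T x w x := h.quad x w m x
  rw [pow_add, mul_smul, pow_two, mul_smul, e6, smul_comm c, h.symm m, e7, smul_comm (c ^ k),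
    smul_comm (c ^ k), hk]
  simp

/-- With `T` vanishing at the middle argument `w`, only the part of `y` orthogonal to `x` matters.
On this part the linearised exchange identity becomes skew-symmetric, and summing over the dual
bases again produces nilpotent scalars with sum `-c²`. -/
theorem exists_pow_eq_zero_of_mid (w : W) (x : V) (hw : ∀ m n, T m w n = 0) (m : V) (y : W)
    (n : V) : ∃ k : ℕ, κ w x ^ k • T m y n = 0 := by
  set c := κ w x with hc
  set u' : L → V := fun l => tv (u l) w x - tv x w (u l) with hu'
  -- `o y` is `c` times the projection of `y` along `w` to the orthogonal complement of `x`.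
  set o : W → W := fun y => tw w x y - tw y x w with ho
  have e1 : ∀ l, κ w (u' l) = 0 := fun l => by
    simp only [hu', map_sub, h.kappa_left]; ring
  have e2 : ∀ y, κ (o y) x = 0 := fun l => by
    simp only [ho, map_sub, AddMonoidHom.sub_apply, h.kappa_right]; ring
  have e3 : ∀ y, T x (o y) x = c • T x y x := fun y => by
    simp only [ho, map_sub, AddMonoidHom.sub_apply, h.mid, hw, smul_zero, sub_zero, ← hc]
  have e4 : ∀ y n, κ (o y) n • T x (o y) x = 0 := fun y n => by
    rw [h.quad, e2, zero_smul]
  have e5 : ∀ y y' n, κ (o y') n • T x (o y) x = -(κ (o y) n • T x (o y') x) := fun y y' n => by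
    have := h.quad_polar x (o y) (o y') x n
    rw [e2, e2, zero_smul, zero_smul, zero_add] at this
    rw [eq_neg_iff_add_eq_zero, add_comm, this]
  have e6 : ∀ l, κ (o y) (u' l) = c * κ (o y) (u l) := fun l => by
    simp only [hu', map_sub, h.kappa_left, e2]; ring
  obtain ⟨k, hk⟩ := mem_radical_iff.1 (mem_radical_of_sum (c := c) (t := T x (o y) x)
    (ε := fun l => κ (o (v l)) (u' l))
    (fun l => by rw [e5, smul_neg, smul_comm, e4, smul_zero, neg_zero])
    (by
      simp only [e5 y, e6, e3 (v _)]
      rw [Finset.sum_neg_distrib, ← h.sum_mid x (o y) x, Finset.smul_sum, Finset.smul_sum]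
      congr 1
      refine Finset.sum_congr rfl fun l _ => ?_
      simp only [smul_smul]; congr 1; ring))
  have e8 : ∀ m n, c • T m y n = κ w n • T m y x := fun m n => by
    have := h.quad_polar m w y n x
    rwa [hw, hw, smul_zero, smul_zero, add_zero, add_zero] at this
  refine ⟨k + 1 + 2, ?_⟩
  rw [pow_add, mul_smul, pow_two, mul_smul, e8, smul_comm c, h.symm m, e8, pow_succ, mul_smul,
    smul_comm c, smul_comm c, ← e3, smul_comm (c ^ k), smul_comm (c ^ k), hk]
  simp

/-- The scalars `κ (w k) (x k)` generate the unit ideal and each lies in the radical of the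
annihilator of `T m y n`, so the annihilator contains `1`. -/
theorem eq_zero {P : Type*} [Fintype P] (w : P → W) (x : P → V) (h1 : ∑ k, κ (w k) (x k) = 1)
    (m : V) (y : W) (n : V) : T m y n = 0 := by
  set I : Ideal A := ann A (T m y n) with hI
  have h2 : (1 : A) ∈ I.radical := by
    rw [← h1]
    refine Ideal.sum_mem _ fun k _ => mem_radical_iff.2 ?_
    -- After multiplication by the power found for the middle argument `w k`, the trilinear map
    -- satisfies the hypothesis of the second vanishing lemma.
    obtain ⟨a, ha⟩ := h.exists_pow_mid_eq_zero (w k) (x k)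
    obtain ⟨b, hb⟩ := (h.smul (κ (w k) (x k) ^ a)).exists_pow_eq_zero_of_mid (w k) (x k) ha m y n
    refine ⟨b + a, ?_⟩
    rw [pow_add, mul_smul]
    exact hb
  obtain ⟨k, hk⟩ := mem_radical_iff.1 h2
  simpa using hk

end TriForm

/-- The action of a commutative ring on coinduced modules. -/
abbrev coindModule (A M : Type*) [CommRing A] [AddCommGroup M] : Module A (A →+ M) where
  smul a f := f.comp (AddMonoidHom.mulLeft a)
  one_smul f := by ext b; exact congrArg f (one_mul b)
  mul_smul a b f := by
    ext c; exact congrArg f (show a * b * c = b * (a * c) by ring)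
  smul_zero a := rfl
  smul_add a f g := rfl
  add_smul a b f := by
    ext c; exact (congrArg f (add_mul a b c)).trans (map_add f _ _)
  zero_smul f := by ext c; exact (congrArg f (zero_mul c)).trans (map_zero f)

/-- Here the scalars form a noncommutative ring and the target is only an abelian group. The action
on `T` is commutative, so it factors through a commutative quotient; coinducing the target makes `T`
take values in a module over that quotient, and `TriForm.eq_zero` applies. -/
theorem trilinear_eq_zero {C V W M L P : Type*} [Ring C] [AddCommGroup V] [AddCommGroup W]
    [AddCommGroup M] [Fintype L] [Fintype P] (T : V →+ W →+ V →+ M) (r : V →+ C →+ V)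
    (κ : W →+ V →+ C) (tv : V → W → V → V) (tw : W → V → W → W) (u : L → V) (v : L → W)
    (w : P → W) (x : P → V)
    (one : ∀ m y n, T (r m 1) y n = T m y n)
    (mul : ∀ m c c' y n, T (r m (c * c')) y n = T (r (r m c) c') y n)
    (comm : ∀ m c c' y n, T (r m (c * c')) y n = T (r m (c' * c)) y n)
    (symm : ∀ m y n, T m y n = T n y m)
    (right : ∀ m y n c, T m y (r n c) = T (r m c) y n)
    (left : ∀ m y n c y' n', T (r (tv m y n) c) y' n' = T (r m (κ y n * c)) y' n')
    (mid : ∀ m y n y' n', T m (tw y n y') n' = T (r m (κ y n)) y' n')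
    (quad : ∀ m y n n', T m y (r n (κ y n')) = T m y (r n' (κ y n)))
    (trace : ∀ n, ∑ l, T (u l) (v l) n = 0)
    (sum_left : ∀ z w c n, ∑ l, T (r (u l) (κ (v l) z * c)) w n = T (r z c) w n)
    (sum_mid : ∀ z w n, ∑ l, T (r z (κ w (u l))) (v l) n = T z w n)
    (kappa_left : ∀ w m y n, κ w (tv m y n) = κ w m * κ y n)
    (kappa_right : ∀ w m y n, κ (tw w m y) n = κ w m * κ y n)
    (kappa_sum : ∀ w x, ∑ l, κ w (u l) * κ (v l) x = κ w x)
    (kappa_one : ∑ k, κ (w k) (x k) = 1) (m : V) (y : W) (n : V) : T m y n = 0 := by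
  -- The scalars that kill `T`. By `comm` this left ideal is two-sided and contains all additive
  -- commutators.
  let I : Ideal C :=
    { carrier := {c | ∀ m y n, T (r m c) y n = 0}
      zero_mem' := fun m y n => by simp
      add_mem' := fun {c c'} hc hc' m y n => by
        simp only [map_add, AddMonoidHom.add_apply, hc m y n, hc' m y n, add_zero]
      smul_mem' := fun c c' hc' m y n => by rw [smul_eq_mul, mul, hc'] }
  have hI : ∀ c, c ∈ I ↔ ∀ m y n, T (r m c) y n = 0 := fun c => Iff.rfl
  have : I.IsTwoSided := ⟨fun {a} b ha => fun m y n => by rw [comm, mul, ha]⟩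
  let : CommRing (C ⧸ I) :=
    { (inferInstance : Ring (C ⧸ I)) with
      mul_comm := by
        rintro ⟨a⟩ ⟨b⟩
        refine Ideal.Quotient.eq.2 fun m y n => ?_
        rw [map_sub, map_sub, AddMonoidHom.sub_apply, AddMonoidHom.sub_apply, comm, sub_self] }
  let := coindModule (C ⧸ I) M
  let π : C →+* C ⧸ I := Ideal.Quotient.mk I
  have hπ : Function.Surjective π := Ideal.Quotient.mk_surjective
  -- The value at `(m, y, n)` is the function `c ↦ T (m c) y n`; evaluation at `1` recovers `T`.
  let E : V → W → V → (C ⧸ I) →+ M := fun m y n =>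
    QuotientAddGroup.lift I.toAddSubgroup
      (AddMonoidHom.mk' (fun c => T (r m c) y n) fun c c' => by simp) fun c hc => hc m y n
  have hE : ∀ m y n c, E m y n (π c) = T (r m c) y n := fun m y n c => rfl
  have ext : ∀ f g : (C ⧸ I) →+ M, (∀ c, f (π c) = g (π c)) → f = g := fun f g h => by
    ext a; obtain ⟨c, rfl⟩ := hπ a; exact h c
  have sm : ∀ (a : C) (f : (C ⧸ I) →+ M) (c : C), (π a • f) (π c) = f (π (a * c)) :=
    fun a f c => by rw [map_mul]; rfl
  let T' : V →+ W →+ V →+ ((C ⧸ I) →+ M) :=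
    AddMonoidHom.mk' (fun m => AddMonoidHom.mk' (fun y => AddMonoidHom.mk' (fun n => E m y n)
      (fun n n' => ext _ _ fun c => by simp [hE])) (fun y y' => by
        ext1 n; exact ext _ _ fun c => by simp [hE])) (fun m m' => by
        ext1 y; ext1 n; exact ext _ _ fun c => by simp [hE])
  have hT' : ∀ m y n c, T' m y n (π c) = T (r m c) y n := fun m y n c => rfl
  let κ' : W →+ V →+ (C ⧸ I) := (AddMonoidHom.compHom π.toAddMonoidHom).comp κ
  have hκ' : ∀ w v, κ' w v = π (κ w v) := fun _ _ => rfl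
  have key : TriForm κ' tv tw u v T' := by
    refine ⟨?_, ?_, ?_, ?_, ?_, ?_, ?_, ?_, ?_, ?_⟩
    · intro m y n; refine ext _ _ fun c => ?_
      rw [hT', hT', symm, right]
    · intro m y n y' n'; refine ext _ _ fun c => ?_
      rw [hκ', sm, hT', hT', left]
    · intro m y n y' n'; refine ext _ _ fun c => ?_
      rw [hκ', sm, hT', hT', mid, comm, mul]
    · intro m y n n'; refine ext _ _ fun c => ?_
      rw [hκ', hκ', sm, sm, hT', hT', comm, mul, ← right, quad, right, ← mul, comm]
    · intro n; refine ext _ _ fun c => ?_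
      rw [AddMonoidHom.finsetSum_apply]
      simp only [hT', ← right]
      exact trace _
    · intro z w n; refine ext _ _ fun c => ?_
      rw [AddMonoidHom.finsetSum_apply]
      simp only [hκ', sm, hT', sum_left]
    · intro z w n; refine ext _ _ fun c => ?_
      rw [AddMonoidHom.finsetSum_apply]
      simp only [hκ', sm, hT', comm z _ c, mul, sum_mid]
    · intro w m y n; rw [hκ', hκ', hκ', kappa_left, map_mul]
    · intro w m y n; rw [hκ', hκ', hκ', kappa_right, map_mul]
    · intro w x; simp only [hκ', ← map_mul, ← map_sum, kappa_sum]
  have h0 := key.eq_zero w x (by simp only [hκ', ← map_sum, kappa_one, map_one]) m y n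
  have h1 := hT' m y n 1
  rw [h0, one] at h1
  exact h1.symm

/-! ### Balancing of biadditive maps -/

theorem exists_sum_of_mem_closure {R : Type*} [NonUnitalRing R] {e z : R}
    (hz : z ∈ AddSubgroup.closure {z : R | ∃ x y, z = x * e * y}) :
    ∃ (L : ℕ) (u v : Fin L → R), ∑ l, u l * e * v l = z := by
  induction hz using AddSubgroup.closure_induction with
  | mem z hz =>
    obtain ⟨x, y, rfl⟩ := hz
    exact ⟨1, fun _ => x, fun _ => y, by simp⟩
  | zero => exact ⟨0, 0, 0, by simp⟩
  | add a b _ _ ha hb =>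
    obtain ⟨L, u, v, rfl⟩ := ha
    obtain ⟨L', u', v', rfl⟩ := hb
    exact ⟨L + L', Fin.append u u', Fin.append v v', by simp [Fin.sum_univ_add]⟩
  | neg a _ ha =>
    obtain ⟨L, u, v, rfl⟩ := ha
    exact ⟨L, -u, v, by simp⟩

/-- Biadditive maps `F`, `G` on `e_p R e_{±j} × e_{±j} R e_q` which satisfy relations that come
from conjugation in a Steinberg group. Here `e`, `e'`, `f`, `f'` are the idempotents with indices
`j`, `-j`, `-q`, `q`. -/
structure BalancingData {R M : Type*} [NonUnitalRing R] [StarRing R] [AddCommGroup M]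
    (e e' f f' : R) (F G : R →+ R →+ M) : Prop where
  e_self : e * e = e
  f_self : f * f = f
  star_e : star e = e'
  star_f : star f = f'
  left_e : ∀ a b, F (a * e) b = F a b
  right_e : ∀ a b, F a (e * b) = F a b
  right_f : ∀ a b, F a (b * f') = F a b
  swap : ∀ a m y b, F (a * e * m * f * y) b - G (a * e * m * f * star b) (star y) =
    F a (m * f * y * e * b - m * f * star b * e' * star y)
  skew : ∀ a m y d, F (a * e * m * f * y) ((d - star d) * e' * star y) =
    F a (m * f * y * e * (d - star d) * e' * star y)
  change : ∀ a d b, G (a * e * (d - star d)) b = F a ((d - star d) * e' * b)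
  e_mem : e ∈ AddSubgroup.closure {z : R | ∃ x y, z = x * f * y}
  f_mem : f ∈ AddSubgroup.closure {z : R | ∃ x y, z = x * e * y}

namespace BalancingData

section

variable {R M : Type*} [NonUnitalRing R] [AddCommGroup M] {e f : R} {F : R →+ R →+ M}

/-- The obstruction to the balancing of `F`. -/
def obs (e : R) (F : R →+ R →+ M) (a k b : R) : M := F (a * e * k) b - F a (k * e * b)

theorem obs_add_left (a k k' b : R) :
    obs e F a (k + k') b = obs e F a k b + obs e F a k' b := by
  simp only [obs, mul_add, add_mul, map_add, AddMonoidHom.add_apply]; abel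

theorem obs_add_right (a k b b' : R) :
    obs e F a k (b + b') = obs e F a k b + obs e F a k b' := by
  simp only [obs, mul_add, map_add]; abel

theorem obs_sum_left {L : ℕ} (a b : R) (k : Fin L → R) :
    obs e F a (∑ l, k l) b = ∑ l, obs e F a (k l) b :=
  map_sum (AddMonoidHom.mk' (fun k => obs e F a k b) fun k k' => obs_add_left a k k' b) k _

theorem obs_sum_right {L : ℕ} (a k : R) (b : Fin L → R) :
    obs e F a k (∑ l, b l) = ∑ l, obs e F a k (b l) :=
  map_sum (AddMonoidHom.mk' (fun b => obs e F a k b) fun b b' => obs_add_right a k b b') b _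

/-- The trilinear map given by the obstruction. -/
def tri (e f : R) (F : R →+ R →+ M) (a β m y n : R) : M := obs e F a (m * f * y) (n * f * β)

theorem tri_add_left (a β m m' y n : R) :
    tri e f F a β (m + m') y n = tri e f F a β m y n + tri e f F a β m' y n := by
  simp only [tri, add_mul, obs_add_left]

theorem tri_add_mid (a β m y y' n : R) :
    tri e f F a β m (y + y') n = tri e f F a β m y n + tri e f F a β m y' n := by
  simp only [tri, mul_add, obs_add_left]

theorem tri_add_right (a β m y n n' : R) :
    tri e f F a β m y (n + n') = tri e f F a β m y n + tri e f F a β m y n' := by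
  simp only [tri, add_mul, obs_add_right]

end

variable {R M : Type*} [NonUnitalRing R] [StarRing R] [AddCommGroup M]
    {e e' f f' : R} {F G : R →+ R →+ M} (h : BalancingData e e' f f' F G)
include h

theorem ee (a : R) : e * (e * a) = e * a := by rw [← mul_assoc, h.e_self]

theorem ff (a : R) : f * (f * a) = f * a := by rw [← mul_assoc, h.f_self]

theorem obs_right_f (a k b : R) : obs e F a k (b * f') = obs e F a k b := by
  simp only [obs, ← mul_assoc, h.right_f]

theorem obs_right_e (a k b : R) : obs e F a k (e * b) = obs e F a k b := by
  simp only [obs, mul_assoc, h.ee]; simp only [h.right_e]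

theorem obs_left_e (a k b : R) : obs e F a (e * k) b = obs e F a k b := by
  simp only [obs, mul_assoc, h.ee]; simp only [h.right_e]

theorem obs_left_e' (a k b : R) : obs e F a (k * e) b = obs e F a k b := by
  simp only [obs, ← mul_assoc, h.left_e]; simp only [mul_assoc, h.ee]

theorem obs_self (a b : R) : obs e F a e b = 0 := by
  simp only [obs, mul_assoc, h.e_self, h.right_e, h.left_e, sub_self]

/-- On parameters `k` that factor through `f`, the relation `swap` expresses the obstruction by a
single expression in which the last argument occurs under the involution. -/
theorem obs_swap (a m y b : R) : obs e F a (m * f * y) b =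
    G (a * e * (m * f * star b)) (star y) - F a (m * f * star b * e' * star y) := by
  have := h.swap a m y b
  rw [map_sub] at this
  simp only [obs, ← mul_assoc] at this ⊢
  rw [sub_eq_iff_eq_add] at this ⊢
  rw [this]; abel

/-- Apply `swap` twice, once with `k` absorbed into `a` and once with `k` absorbed into `m`. The
left sides coincide, and the difference of the right sides is the claim. -/
theorem obs_star_aux (a k m y b : R) :
    obs e F a k (m * f * (y * e * b)) = obs e F a k (m * f * star (y * e * b)) := by
  have h1 := h.swap (a * e * k) m y b
  have h2 := h.swap a (k * e * m) y b
  rw [map_sub] at h1 h2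
  simp only [obs, star_mul, h.star_e, ← mul_assoc] at h1 h2 ⊢
  rw [h1] at h2
  rw [← sub_eq_zero] at h2 ⊢
  rw [← h2]; abel

/-- By `f ∈ R e R` any `f * β` is a sum of the products treated in `obs_star_aux`. -/
theorem obs_star (a k m β : R) :
    obs e F a k (m * f * β) = obs e F a k (m * f * star β) := by
  obtain ⟨L, w, x, hw⟩ := exists_sum_of_mem_closure h.f_mem
  have h1 : m * f * β = ∑ l, m * f * (w l * e * (x l * β)) := by
    have : f * β = ∑ l, w l * e * (x l * β) := by
      rw [← hw, Finset.sum_mul]; simp only [mul_assoc]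
    rw [← Finset.mul_sum, ← this, mul_assoc, mul_assoc, h.ff]
  have h2 : m * f * star β * f' = ∑ l, m * f * star (w l * e * (x l * β)) := by
    have : star β * f' = ∑ l, star (w l * e * (x l * β)) := by
      rw [← star_sum, ← h.star_f, ← star_mul, ← hw, Finset.sum_mul]; simp only [mul_assoc]
    rw [← Finset.mul_sum, ← this, ← mul_assoc]
  rw [h1, obs_sum_right, ← h.obs_right_f a k (m * f * star β), h2, obs_sum_right]
  exact Finset.sum_congr rfl fun l _ => h.obs_star_aux _ _ _ _ _

/-- Put `d = m f β f' n̄`. Rewriting one side by `obs_star` and both by `obs_swap` turns the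
difference into the relation `change` for `d - d̄`. -/
theorem tri_symm (a β m y n : R) : tri e f F a β m y n = tri e f F a β n y m := by
  have h1 : tri e f F a β m y n = G (a * e * (m * f * β * f' * star n)) (star y) -
      F a (m * f * β * f' * star n * e' * star y) := by
    rw [tri, h.obs_star, h.obs_swap]
    simp only [star_mul, star_star, h.star_f, ← mul_assoc]
  have h2 : tri e f F a β n y m = G (a * e * star (m * f * β * f' * star n)) (star y) -
      F a (star (m * f * β * f' * star n) * e' * star y) := by
    rw [tri, h.obs_swap]
    simp only [star_mul, star_star, ← h.star_f, ← mul_assoc]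
  have h3 := h.change a (m * f * β * f' * star n) (star y)
  rw [h1, h2]
  simp only [mul_sub, sub_mul, map_sub, AddMonoidHom.sub_apply] at h3
  rw [← sub_eq_zero] at h3 ⊢
  rw [← h3]; abel

omit [StarRing R] h in
theorem tri_mid (a β m c y n : R) :
    tri e f F a β m (c * f * y) n = tri e f F a β (m * f * c) y n := by
  simp only [tri, mul_assoc]

theorem tri_right (a β m y n c : R) :
    tri e f F a β m y (n * f * c) = tri e f F a β (m * f * c) y n := by
  rw [h.tri_symm, ← tri_mid, h.tri_symm, tri_mid]

/-- Scalars move freely between the first and the third argument, but moving two of them one after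
another reverses their order. -/
theorem tri_comm (a β m c c' y n : R) :
    tri e f F a β (m * f * (c * f * c')) y n = tri e f F a β (m * f * (c' * f * c)) y n := by
  have h1 := h.tri_right a β (m * f * c) y n c'
  rw [h.tri_symm, h.tri_right, h.tri_symm] at h1
  have h2 := h.tri_right a β m y n (c' * f * c)
  simp only [← mul_assoc] at h1 h2 ⊢
  rw [← h1, h2]

theorem tri_star (a β m y n : R) : tri e f F a (star β) m y n = tri e f F a β m y n := by
  simp only [tri]; rw [h.obs_star _ _ n β]

theorem tri_e_left (a β m y n : R) :
    tri e f F a β (e * m) y n = tri e f F a β m y n := by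
  simp only [tri, mul_assoc, h.obs_left_e]

theorem tri_f_left (a β m y n : R) :
    tri e f F a β (m * f) y n = tri e f F a β m y n := by
  simp only [tri, mul_assoc, h.ff]

theorem tri_e_mid (a β m y n : R) :
    tri e f F a β m (y * e) n = tri e f F a β m y n := by
  simp only [tri, ← mul_assoc, h.obs_left_e']

/-- By `obs_star` the two sides, taken with `β` and with its conjugate, become obstructions at `d e'
ȳ` and `d̄ e' ȳ` for one `d`. Their difference vanishes by `skew`. -/
theorem tri_quad (a β m y n n' : R) :
    tri e f F a β m y (n * f * (y * e * n')) = tri e f F a β m y (n' * f * (y * e * n)) := by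
  have h0 := h.skew a m y (n * f * β * f' * star n')
  have h1 : ∀ n n' β, tri e f F a β m y (n * f * (y * e * n')) =
      obs e F a (m * f * y) (n * f * star β * f' * star n' * e' * star y) := fun n n' β => by
    have := h.obs_star a (m * f * y) n (y * e * n' * f * β)
    simp only [tri, star_mul, h.star_e, h.star_f, ← mul_assoc] at this ⊢
    rw [this]
  rw [← h.tri_star a β m y (n' * f * (y * e * n)), h1, h1, ← sub_eq_zero]
  have h2 : star (n * f * star β * f' * star n') = n' * f * β * f' * star n := by
    simp only [star_mul, star_star, ← h.star_f, mul_assoc]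
  have h0 := h.skew a m y (n * f * star β * f' * star n')
  rw [h2] at h0
  simp only [obs, sub_mul, mul_sub, map_sub, star_star, ← mul_assoc] at h0 ⊢
  rw [← sub_eq_zero] at h0
  rw [← h0]; abel

/-- The scalars are the corner ring `f R f` and the pairing is `κ(y, n) = f y e n f`. Decompositions
of `e` through `f` serve as dual bases, and the trace identity says that the obstruction vanishes at
`e` itself. A decomposition of `f` through `e` makes the pairing unimodular. -/
theorem tri_eq_zero (a β m y n : R) : tri e f F a β m y n = 0 := by
  obtain ⟨L, u, v, huv⟩ := exists_sum_of_mem_closure h.e_mem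
  obtain ⟨P, w, x, hwx⟩ := exists_sum_of_mem_closure h.f_mem
  have hf : IsIdempotentElem f := h.f_self
  have hc : ∀ c : hf.Corner, f * c.1 = c.1 := fun c => ((Subsemigroup.mem_corner_iff hf).1 c.2).1
  have hc' : ∀ c : hf.Corner, c.1 * f = c.1 := fun c => ((Subsemigroup.mem_corner_iff hf).1 c.2).2
  let T : R →+ R →+ R →+ M := AddMonoidHom.mk' (fun m => AddMonoidHom.mk' (fun y =>
    AddMonoidHom.mk' (fun n => tri e f F a β m y n) (fun n n' => tri_add_right _ _ _ _ _ _))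
      (fun y y' => by ext1 n; exact tri_add_mid _ _ _ _ _ _))
      (fun m m' => by ext1 y; ext1 n; exact tri_add_left _ _ _ _ _ _)
  have hT : ∀ m y n, T m y n = tri e f F a β m y n := fun _ _ _ => rfl
  let r : R →+ hf.Corner →+ R := AddMonoidHom.mk' (fun m => AddMonoidHom.mk' (fun c => m * f * c.1)
    (fun c c' => mul_add _ _ _)) (fun m m' => by ext1 c; exact (by
      show (m + m') * f * c.1 = m * f * c.1 + m' * f * c.1
      rw [add_mul, add_mul]))
  have hr : ∀ m c, r m c = m * f * c.1 := fun _ _ => rfl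
  let κ : R →+ R →+ hf.Corner := AddMonoidHom.mk' (fun y => AddMonoidHom.mk'
    (fun n => (⟨f * (y * e * n) * f, y * e * n, rfl⟩ : hf.Corner))
      (fun n n' => Subtype.ext (by
        show f * (y * e * (n + n')) * f = f * (y * e * n) * f + f * (y * e * n') * f
        simp only [mul_add, add_mul])))
      (fun y y' => by
        ext1 n
        refine Subtype.ext ?_
        show f * ((y + y') * e * n) * f = f * (y * e * n) * f + f * (y' * e * n) * f
        simp only [mul_add, add_mul])
  have hκ : ∀ y n, (κ y n).1 = f * (y * e * n) * f := fun _ _ => rfl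
  have hmul : ∀ c c' : hf.Corner, (c * c').1 = c.1 * c'.1 := fun _ _ => rfl
  have hone : (1 : hf.Corner).1 = f := rfl
  have hsum : ∀ {I : Type} [Fintype I] (g : I → hf.Corner), (∑ i, g i).1 = ∑ i, (g i).1 :=
    fun g => map_sum (AddMonoidHom.mk' (fun c : hf.Corner => c.1) fun _ _ => rfl) g _
  have hTs : ∀ (k : Fin L → R) y n, ∑ l, T (k l) y n = T (∑ l, k l) y n := fun k y n => by
    rw [map_sum, AddMonoidHom.finsetSum_apply, AddMonoidHom.finsetSum_apply]
  refine trilinear_eq_zero T r κ (fun m y n => m * f * y * e * n) (fun y n y' => y * e * n * f * y')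
    u v w x ?_ ?_ ?_ ?_ ?_ ?_ ?_ ?_ ?_ ?_ ?_ ?_ ?_ ?_ ?_ m y n
  · intro m y n
    rw [hr, hone, mul_assoc, h.f_self, hT, h.tri_f_left, hT]
  · intro m c c' y n
    have e1 : m * f * (c.1 * c'.1) = m * f * c.1 * f * c'.1 := by
      rw [mul_assoc (m * f * c.1), hc, mul_assoc (m * f)]
    show T (m * f * (c.1 * c'.1)) y n = T (m * f * c.1 * f * c'.1) y n
    rw [e1]
  · intro m c c' y n
    have := h.tri_comm a β m c.1 c'.1 y n
    rw [mul_assoc c.1, mul_assoc c'.1, hc, hc] at this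
    rw [hr, hr, hmul, hmul, hT, hT, this]
  · exact fun m y n => h.tri_symm _ _ _ _ _
  · exact fun m y n c => h.tri_right _ _ _ _ _ _
  · intro m y n c y' n'
    simp only [hr, hκ, hmul, mul_assoc, h.ff]
  · intro m y n y' n'
    rw [hr, hκ, hT, hT, tri_mid]
    simp only [← mul_assoc, h.tri_f_left]
    simp only [mul_assoc, h.ff]
  · intro m y n n'
    have := h.tri_quad a β m y n n'
    rw [h.tri_right, h.tri_right] at this
    rw [hr, hr, hκ, hκ, hT, hT, h.tri_right, h.tri_right]
    simp only [← mul_assoc] at this ⊢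
    rw [h.tri_f_left, h.tri_f_left]
    simp only [mul_assoc, h.ff] at this ⊢
    exact this
  · intro n
    simp only [hT, tri]
    rw [← obs_sum_left, huv, h.obs_self]
  · intro z w c n
    rw [hTs, hT, hT]
    have e1 : ∑ l, r (u l) (κ (v l) z * c) = e * (e * (z * f * c.1)) :=
      calc _ = (∑ l, u l * f * v l) * (e * (z * f * c.1)) := by
            simp only [hr, hκ, hmul, Finset.sum_mul, mul_assoc, h.ff]
        _ = _ := by rw [huv]
    rw [e1, h.tri_e_left, h.tri_e_left, hr]
  · intro z w n
    have e1 : ∀ l, T (r z (κ w (u l))) (v l) n = T z (w * e * (u l * f * v l)) n := fun l => by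
      rw [hr, hκ, hT, hT, ← mul_assoc, h.tri_f_left, ← mul_assoc (w * e), ← mul_assoc (w * e),
        tri_mid]
      simp only [mul_assoc, h.ff]
    rw [Finset.sum_congr rfl fun l _ => e1 l, ← AddMonoidHom.finsetSum_apply, ← map_sum,
      ← Finset.mul_sum, huv, hT, hT, h.tri_e_mid, h.tri_e_mid]
  · intro w m y n
    refine Subtype.ext ?_
    simp only [hκ, hmul, mul_assoc, h.ff]
  · intro w m y n
    refine Subtype.ext ?_
    simp only [hκ, hmul, mul_assoc, h.ff]
  · intro w x
    refine Subtype.ext ?_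
    calc _ = f * (w * e * (∑ l, u l * f * v l) * (e * x) * f) := by
          simp only [hsum, hκ, hmul, Finset.sum_mul, Finset.mul_sum, mul_assoc, h.ff]
      _ = _ := by rw [huv, hκ]; simp only [mul_assoc, h.ee]
  · refine Subtype.ext ?_
    simp only [hsum, hκ, hone, ← Finset.mul_sum, ← Finset.sum_mul, hwx, h.f_self]

/-- Decomposing `e` through `f` on both sides writes every obstruction as a sum of values of the
trilinear map. -/
theorem obs_eq_zero (a k b : R) : obs e F a k b = 0 := by
  obtain ⟨L, u, v, huv⟩ := exists_sum_of_mem_closure h.e_mem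
  have hk : k * e = ∑ l, k * u l * f * v l := by
    rw [← huv, Finset.mul_sum]; simp only [mul_assoc]
  have hb : e * b = ∑ l, u l * f * (v l * b) := by
    rw [← huv, Finset.sum_mul]; simp only [mul_assoc]
  rw [← h.obs_left_e', ← h.obs_right_e, hk, hb, obs_sum_left]
  refine Finset.sum_eq_zero fun l _ => ?_
  rw [obs_sum_right]
  exact Finset.sum_eq_zero fun l' _ => h.tri_eq_zero a (v l' * b) (k * u l) (v l) (u l')

theorem balance (a k b : R) : F (a * e * k) b = F a (k * e * b) :=
  sub_eq_zero.1 (h.obs_eq_zero a k b)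

/-- Once the obstruction vanishes, `obs_swap` becomes an identity between `G` and `F` on products
through `f`, and `e` is a sum of such products. -/
theorem balance_change (a k b : R) : G (a * e * k) b = F a (k * e' * b) := by
  obtain ⟨L, u, v, huv⟩ := exists_sum_of_mem_closure h.e_mem
  have h1 : ∀ m y b, G (a * e * (m * f * y)) b = F a (m * f * y * e' * b) := fun m y b => by
    have := h.obs_swap a m (star b) (star y)
    rw [h.obs_eq_zero, star_star, star_star] at this
    exact (sub_eq_zero.1 this.symm)
  have h2 : e * k = ∑ l, u l * f * (v l * k) := by
    rw [← huv, Finset.sum_mul]; simp only [mul_assoc]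
  have h3 : a * e * k = ∑ l, a * e * (u l * f * (v l * k)) := by
    rw [← Finset.mul_sum, ← h2, mul_assoc, mul_assoc, h.ee]
  have h4 : e * (k * e' * b) = ∑ l, u l * f * (v l * k) * e' * b := by
    rw [← mul_assoc, ← mul_assoc, h2, Finset.sum_mul, Finset.sum_mul]
  rw [h3, map_sum, AddMonoidHom.finsetSum_apply, ← h.right_e, h4, map_sum]
  exact Finset.sum_congr rfl fun l _ => h1 _ _ _

end BalancingData

/-! ### The missing root subgroups -/

/-- The index is different from `±p` and `±q`. -/
@[grind =]
def SIdx.Away {ι : Type} (j p q : SIdx ι) : Prop := j.abs ≠ p.abs ∧ j.abs ≠ q.abs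

/-- All pairs of indices except those of the root subgroups `X_{pq}` and `X_{qp}`. -/
@[grind =]
def PartialOk {ι : Type} (p q i j : SIdx ι) : Prop :=
  i.abs ≠ j.abs ∧ ¬(i = p ∧ j = q) ∧ ¬(i = q ∧ j = p) ∧ ¬(i = -p ∧ j = -q) ∧ ¬(i = -q ∧ j = -p)

namespace SDatum

variable {K R D : Type*} [CommRing K] [NonUnitalRing R] [StarRing R] [Module K R]
    [IsScalarTower K R R] [SMulCommClass K R R] [AddGroup D] {O : OBase K R D} {ι : Type}
    {E : EFam O ι} {ok : SIdx ι → SIdx ι → Prop} {G : Type*} [Group G]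

/-- Restriction to a smaller set of roots. -/
def ofOk (X : SDatum E ok G) {ok' : SIdx ι → SIdx ι → Prop} (h : ∀ {i j}, ok' i j → ok i j) :
    SDatum E ok' G where
  x := X.x
  y := X.y
  x_e hij := X.x_e (h hij)
  y_e := X.y_e
  x_star hij := X.x_star (h hij)
  x_add hij := X.x_add (h hij)
  y_add := X.y_add
  x_comm hij hkl := X.x_comm (h hij) (h hkl)
  x_x h1 h2 h3 := X.x_x (h h1) (h h2) (h h3)
  x_y h1 h2 := X.x_y (h h1) (h h2)
  y_y h1 h2 := X.y_y h1 (h h2)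
  y_x_comm h1 := X.y_x_comm (h h1)
  y_x h1 h2 := X.y_x (h h1) (h h2)

variable {p q j k l x : SIdx ι}

/-- The commutators which replace the elements of the root subgroup `X_{pq}`. -/
def mid (X : SDatum E ok G) (p q j : SIdx ι) (a b : R) : G := ⁅X.x p j a, X.x j q b⁆

variable (hpq : p.abs ≠ q.abs) (X : SDatum E (PartialOk p q) G)
include hpq

/-- The relation `X_{ij}(a) = X_{-j,-i}(-ā)` exchanges the two entries. It halves the work below by
passing from `(p, q)` to `(-q, -p)`. -/
theorem mid_star (hj : j.Away p q) (a b : R) :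
    X.mid p q j a b = (X.mid (-q) (-p) (-j) (-star b) (-star a))⁻¹ := by
  rw [mid, mid, comm_inv_comm, X.x_star (i := p) (by grind), X.x_star (i := j) (by grind)]

/-- `X_{jl}` commutes with `X_{jq}`, and its commutator with `X_{pj}` lies in `X_{pl}`, or in the
`φ`-part of `X_{-p}` if `l = -p`; that commutator commutes with both entries. -/
theorem mid_comm_x_left (hj : j.Away p q) (hl : PartialOk p q j l) (h1 : l ≠ p) (h2 : l ≠ -q)
    (h3 : l ≠ q) (a b c : R) : Commute (X.x j l c) (X.mid p q j a b) := by
  have hB : Commute (X.x j l c) (X.x j q b) := X.x_comm hl (by grind) (by grind) (by grind)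
    (by grind) (by grind) _ _
  have hT : Commute ⁅X.x p j a, X.x j l c⁆ (X.x p j a) ∧
      Commute ⁅X.x p j a, X.x j l c⁆ (X.x j q b) := by
    by_cases h4 : l = -p
    · subst h4
      rw [X.x_y (by grind) (by grind)]
      exact ⟨X.y_x_comm (by grind) (by grind) (by grind) _ _,
        X.y_x_comm (by grind) (by grind) (by grind) _ _⟩
    · have hpl : PartialOk p q p l := by grind [SIdx.abs_eq_iff]
      rw [X.x_x (by grind) hl hpl]
      exact ⟨X.x_comm hpl (by grind) (by grind) (by grind) (by grind) (by grind) _ _,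
        X.x_comm hpl (by grind) (by grind) (by grind) (by grind) (by grind) _ _⟩
  rw [← comm_inv_comm] at hT
  exact commute_comm_of_left (Commute.inv_left_iff.1 hT.2)
    (commute_comm (Commute.inv_left_iff.1 hT.1) (Commute.inv_left_iff.1 hT.2)) hB

theorem mid_comm_x_right (hj : j.Away p q) (hk : PartialOk p q k j) (h1 : k ≠ q) (h2 : k ≠ -p)
    (h3 : k ≠ p) (a b c : R) : Commute (X.x k j c) (X.mid p q j a b) := by
  have hA : Commute (X.x k j c) (X.x p j a) := X.x_comm hk (by grind) (by grind) (by grind)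
    (by grind) (by grind) _ _
  have hT : Commute ⁅X.x k j c, X.x j q b⁆ (X.x p j a) ∧
      Commute ⁅X.x k j c, X.x j q b⁆ (X.x j q b) := by
    by_cases h4 : q = -k
    · subst h4
      rw [X.x_y (by grind) (by grind)]
      exact ⟨X.y_x_comm (by grind) (by grind) (by grind) _ _,
        X.y_x_comm (by grind) (by grind) (by grind) _ _⟩
    · have hpl : PartialOk p q k q := by grind [SIdx.abs_eq_iff]
      rw [X.x_x hk (by grind) hpl]
      exact ⟨X.x_comm hpl (by grind) (by grind) (by grind) (by grind) (by grind) _ _,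
        X.x_comm hpl (by grind) (by grind) (by grind) (by grind) (by grind) _ _⟩
  exact commute_comm_of_right hT.1 (commute_comm hT.1 hT.2) hA

/-- The first four exclusions are the roots that may interact with `e_q - e_p`. The last four are
the entries `X_{pj}` and `X_{jq}` themselves, for which commutation is a separate matter, see
`mid_comm_x_self`. -/
theorem mid_comm_x (hj : j.Away p q) (hkl : PartialOk p q k l) (h1 : l ≠ p) (h2 : l ≠ -q)
    (h3 : k ≠ q) (h4 : k ≠ -p) (h5 : ¬(k = p ∧ l = j)) (h6 : ¬(k = j ∧ l = q))
    (h7 : ¬(k = -j ∧ l = -p)) (h8 : ¬(k = -q ∧ l = -j)) (a b c : R) :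
    Commute (X.x k l c) (X.mid p q j a b) := by
  by_cases hk : k = j
  · subst hk
    exact X.mid_comm_x_left hpq hj hkl h1 h2 (by grind) _ _ _
  by_cases hl : l = j
  · subst hl
    exact X.mid_comm_x_right hpq hj hkl h3 h4 (by grind) _ _ _
  by_cases hl' : l = -j
  · subst hl'
    rw [X.x_star hkl, neg_neg]
    exact X.mid_comm_x_left hpq hj (by grind) (by grind) (by grind) (by grind) _ _ _
  by_cases hk' : k = -j
  · subst hk'
    rw [X.x_star hkl, neg_neg]
    exact X.mid_comm_x_right hpq hj (by grind) (by grind) (by grind) (by grind) _ _ _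
  exact commute_comm
    (X.x_comm hkl (by grind) (by grind) (by grind) (by grind) (by grind) _ _)
    (X.x_comm hkl (by grind) (by grind) (by grind) (by grind) (by grind) _ _)

/-- Only `k = ±j` is not immediate: there `X_k` moves exactly one entry of the commutator, by an
element that commutes with the other entry and with the whole commutator. -/
theorem mid_comm_y (hj : j.Away p q) (h1 : k ≠ p) (h2 : k ≠ -q) (a b : R) (u : D) :
    Commute (X.y k u) (X.mid p q j a b) := by
  have h0 : ∀ {i}, i ≠ p → i ≠ -q → i ≠ j → i ≠ -j → ∀ u, Commute (X.y i u) (X.mid p q j a b) :=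
    fun {i} h1 h2 h3 h4 u => commute_comm
      (X.y_x_comm (by grind) (by grind) (by grind) _ _)
      (X.y_x_comm (by grind) (by grind) (by grind) _ _)
  by_cases h3 : k = j
  · subst h3
    refine commute_comm_of_right ?_ ?_ (X.y_x_comm (by grind) (by grind) (by grind) _ _)
    all_goals rw [X.y_x (by grind) (by grind)]
    · exact Commute.mul_left
        (X.x_comm (by grind) (by grind) (by grind) (by grind) (by grind) (by grind) _ _)
        (X.y_x_comm (by grind) (by grind) (by grind) _ _)
    · exact Commute.mul_left
        (X.mid_comm_x hpq hj (by grind) (by grind) (by grind) (by grind) (by grind) (by grind)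
          (by grind) (by grind) (by grind) _ _ _)
        (h0 (by grind) (by grind) (by grind) (by grind) _)
  by_cases h4 : k = -j
  · subst h4
    refine commute_comm_of_left ?_ ?_ (X.y_x_comm (by grind) (by grind) (by grind) _ _)
    all_goals rw [X.x_star (i := p) (by grind), X.y_x (by grind) (by grind)]
    · exact Commute.mul_left
        (X.x_comm (by grind) (by grind) (by grind) (by grind) (by grind) (by grind) _ _)
        (X.y_x_comm (by grind) (by grind) (by grind) _ _)
    · rw [← X.x_star (i := p) (by grind)]
      exact Commute.mul_left
        (X.mid_comm_x hpq hj (by grind) (by grind) (by grind) (by grind) (by grind) (by grind)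
          (by grind) (by grind) (by grind) _ _ _)
        (h0 (by grind) (by grind) (by grind) (by grind) _)
  exact h0 h1 h2 h3 h4 u

end SDatum

/-! ### Replacing root elements by products through other indices -/

namespace EFam

variable {K R D : Type*} [CommRing K] [NonUnitalRing R] [StarRing R] [Module K R]
    [IsScalarTower K R R] [SMulCommClass K R R] [AddGroup D] {O : OBase K R D} {ι : Type}
    (E : EFam O ι)

/-- The ideal generated by some of the idempotents. -/
def span (P : SIdx ι → Prop) : AddSubgroup R :=
  AddSubgroup.closure {z | ∃ r x y, P r ∧ z = x * E.e r * y}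

variable {E}

theorem span_mono {P Q : SIdx ι → Prop} (h : ∀ r, P r → Q r) : E.span P ≤ E.span Q :=
  AddSubgroup.closure_mono fun _ ⟨r, x, y, hr, hz⟩ => ⟨r, x, y, h r hr, hz⟩

theorem span_induction_left {P : SIdx ι → Prop} {e : R} (h : e ∈ E.span P) {Q : R → Prop}
    (zero : Q 0) (add : ∀ a b, Q a → Q b → Q (a + b)) (neg : ∀ a, Q a → Q (-a))
    (mem : ∀ r, P r → ∀ a c, Q (a * E.e r * c)) (c : R) : Q (e * c) := by
  induction h using AddSubgroup.closure_induction with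
  | mem z hz =>
    obtain ⟨r, x, y, hr, rfl⟩ := hz
    rw [mul_assoc]
    exact mem r hr _ _
  | zero => rwa [zero_mul]
  | add a b _ _ ha hb => rw [add_mul]; exact add _ _ ha hb
  | neg a _ ha => rw [neg_mul]; exact neg _ ha

theorem span_induction_right {P : SIdx ι → Prop} {e : R} (h : e ∈ E.span P) {Q : R → Prop}
    (zero : Q 0) (add : ∀ a b, Q a → Q b → Q (a + b)) (neg : ∀ a, Q a → Q (-a))
    (mem : ∀ r, P r → ∀ a c, Q (a * E.e r * c)) (c : R) : Q (c * e) := by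
  induction h using AddSubgroup.closure_induction with
  | mem z hz =>
    obtain ⟨r, x, y, hr, rfl⟩ := hz
    rw [← mul_assoc, ← mul_assoc]
    exact mem r hr _ _
  | zero => rwa [mul_zero]
  | add a b _ _ ha hb => rw [mul_add]; exact add _ _ ha hb
  | neg a _ ha => rw [mul_neg]; exact neg _ ha

end EFam

/-- The idempotents can be decomposed through other ones. -/
structure Decomposable {K R D : Type*} [CommRing K] [NonUnitalRing R] [StarRing R] [Module K R]
    [IsScalarTower K R R] [SMulCommClass K R R] [AddGroup D] {O : OBase K R D} {ι : Type}
    (E : EFam O ι) (p q : SIdx ι) : Prop where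
  away : ∀ i, i.abs = p.abs ∨ i.abs = q.abs → ∀ j, j.Away p q →
    E.e i ∈ E.span fun r => r.Away p q ∧ r ≠ j
  opp : ∀ i k, i.abs = p.abs ∧ k.abs = q.abs ∨ i.abs = q.abs ∧ k.abs = p.abs → ∀ j, j.Away p q →
    E.e i ∈ E.span fun r => r = k ∨ r.Away p q ∧ r ≠ j ∧ r ≠ -j
  nonempty : ∃ j : SIdx ι, j.Away p q
  -- The two alternatives are the two cases of the theorem: a further index apart from `±j` exists
  -- in rank at least 4, and in rank 3 the family is strong.
  third_or_strong : (∀ j, j.Away p q → E.e j ∈ E.span fun r => r.Away p q ∧ r ≠ j ∧ r ≠ -j) ∨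
    ∀ i j, E.e i ∈ E.span fun r => r = j

namespace SDatum

variable {K R D : Type*} [CommRing K] [NonUnitalRing R] [StarRing R] [Module K R]
    [IsScalarTower K R R] [SMulCommClass K R R] [AddGroup D] {O : OBase K R D} {ι : Type}
    {E : EFam O ι} {G : Type*} [Group G] {p q j k l x z : SIdx ι}

section

variable {ok : SIdx ι → SIdx ι → Prop} (X : SDatum E ok G) {i : SIdx ι}

/-- `X_{ij}(s a e_r c)` is a commutator of elements of `X_{ir}` and `X_{rj}` when these are
available, so a property of `X_{ij}` can be checked through an intermediate index `r` chosen to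
avoid conflicts. This is where factors `s` are lost. -/
theorem x_eq_left {P : SIdx ι → Prop} (h : ok i j) (he : E.e i ∈ E.span P) {Q : G → Prop}
    (one : Q 1) (mul : ∀ a b, Q a → Q b → Q (a * b)) (inv : ∀ a, Q a → Q a⁻¹)
    (mem : ∀ r, P r → ∀ a c, Q (X.x i j (O.s • (a * E.e r * c)))) (c : R) :
    Q (X.x i j (O.s • c)) := by
  rw [← X.x_left h, mul_smul_comm]
  refine EFam.span_induction_left he (Q := fun c => Q (X.x i j (O.s • c))) ?_ ?_ ?_ mem c
  · rwa [smul_zero, X.x_zero h]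
  · intro a b ha hb; rw [smul_add, X.x_add h]; exact mul _ _ ha hb
  · intro a ha; rw [smul_neg, X.x_neg h]; exact inv _ ha

theorem y_phi_left {P : SIdx ι → Prop} (he : E.e (-i) ∈ E.span P) {Q : G → Prop}
    (one : Q 1) (mul : ∀ a b, Q a → Q b → Q (a * b)) (inv : ∀ a, Q a → Q a⁻¹)
    (mem : ∀ r, P r → ∀ a c, Q (X.y i (O.phi (O.s • (a * E.e r * c))))) (c : R) :
    Q (X.y i (O.phi (O.s • c))) := by
  have : X.y i (O.phi (O.s • c)) = X.y i (O.phi (O.s • (E.e (-i) * c))) := by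
    refine X.y_congr ?_
    simp only [O.phi_act, E.star_e, mul_smul_comm, E.e_self']
  rw [this]
  refine EFam.span_induction_left he (Q := fun c => Q (X.y i (O.phi (O.s • c)))) ?_ ?_ ?_ mem c
  · rwa [smul_zero, O.phi_zero, X.y_zero]
  · intro a b ha hb; rw [smul_add, O.phi_add, X.y_add]; exact mul _ _ ha hb
  · intro a ha; rw [smul_neg, O.phi_neg, X.y_neg]; exact inv _ ha

end

variable (hpq : p.abs ≠ q.abs) (hE : Decomposable E p q) (X : SDatum E (PartialOk p q) G)
include hpq

/-- `X_{q,-p}` commutes with `X_{pj}` and moves `X_{jq}` by an element of `X_{j,-p}`, so only the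
commutator of the latter with `X_{pj}` survives. -/
theorem mid_comm_opp (hj : j.Away p q) (a b c : R) :
    ⁅X.mid p q j a b, X.x q (-p) c⁆ =
      X.y (-p) (O.phi (O.s • O.s • (a * E.e j * b * E.e q * c))) := by
  have h0 : ⁅X.x q (-p) c, X.x j q b⁆ = X.x j (-p) (-(O.s • (b * E.e q * c))) := by
    rw [← comm_inv_comm, X.x_x (by grind) (by grind) (by grind), X.x_neg (by grind)]
  rw [mid, comm_comm_of_right, h0, X.x_y (by grind) (by grind), ← X.y_neg, ← O.phi_neg]
  · simp only [mul_neg, neg_neg, smul_neg, mul_smul_comm, mul_assoc]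
  · exact X.x_comm (by grind) (by grind) (by grind) (by grind) (by grind) (by grind) _ _
  · rw [h0]
    exact X.mid_comm_x hpq hj (by grind) (by grind) (by grind) (by grind) (by grind) (by grind)
      (by grind) (by grind) (by grind) _ _ _

theorem mid_comm_opp' (hj : j.Away p q) (a b c : R) :
    ⁅X.mid p q j a b, X.x p (-q) c⁆ =
      X.y (-p) (O.phi (-(O.s • O.s • (a * E.e j * b * E.e q * star c)))) := by
  rw [X.x_star (by grind), neg_neg, X.mid_comm_opp hpq hj]
  simp only [mul_neg, smul_neg]

include hE

/-- Needed for additivity of the commutators. The entry `X_{pj}(s c)` is replaced by commutators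
through `-q` or through another index away from `±j`; the factors of these no longer conflict with
`mid`. -/
theorem mid_comm_x_self (hj : j.Away p q) (a b c : R) :
    Commute (X.x p j (O.s • c)) (X.mid p q j a b) := by
  refine (X.x_eq_left (Q := fun g => Commute g (X.mid p q j a b)) (by grind)
    (hE.opp p (-q) (by grind) j hj)
    (Commute.one_left _) (fun _ _ => Commute.mul_left) (fun _ => Commute.inv_left) ?_ c)
  intro r hr a' c'
  -- `X_{p,-q}` does not commute with `mid`, but the commutator lies in the `φ`-part of `X_{-p}`,
  -- which commutes with both factors used here.
  by_cases hrq : r = -q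
  · subst hrq
    rw [← X.x_x (i := p) (j := -q) (k := j) (by grind) (by grind) (by grind)]
    refine (commute_comm_of_left ?_ ?_ ?_).symm
    rotate_right
    · exact (X.mid_comm_x hpq hj (by grind) (by grind) (by grind) (by grind) (by grind) (by grind)
        (by grind) (by grind) (by grind) _ _ _).symm
    all_goals rw [X.mid_comm_opp' hpq hj]
    · exact X.y_x_comm (by grind) (by grind) (by grind) _ _
    · exact commute_comm (X.y_x_comm (by grind) (by grind) (by grind) _ _)
        (X.y_x_comm (by grind) (by grind) (by grind) _ _)
  · have hr' : r.Away p q ∧ r ≠ j ∧ r ≠ -j := by grind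
    rw [← X.x_x (i := p) (j := r) (k := j) (by grind) (by grind [SIdx.abs_eq_iff]) (by grind)]
    exact (commute_comm
      (X.mid_comm_x hpq hj (by grind) (by grind) (by grind) (by grind) (by grind) (by grind)
        (by grind) (by grind) (by grind) _ _ _).symm
      (X.mid_comm_x hpq hj (by grind [SIdx.abs_eq_iff]) (by grind) (by grind) (by grind) (by grind)
        (by grind) (by grind) (by grind) (by grind) _ _ _).symm).symm

end SDatum

theorem Decomposable.flip {K R D : Type*} [CommRing K] [NonUnitalRing R] [StarRing R] [Module K R]
    [IsScalarTower K R R] [SMulCommClass K R R] [AddGroup D] {O : OBase K R D} {ι : Type}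
    {E : EFam O ι} {p q p' q' : SIdx ι} (hE : Decomposable E p q)
    (h : p'.abs = p.abs ∧ q'.abs = q.abs ∨ p'.abs = q.abs ∧ q'.abs = p.abs) :
    Decomposable E p' q' := by
  have hA : ∀ j : SIdx ι, j.Away p' q' ↔ j.Away p q := fun j => by grind
  refine ⟨?_, ?_, ?_, ?_⟩ <;> simp only [hA]
  · exact fun i hi j hj => hE.away i (by grind) j hj
  · exact fun i k hi j hj => hE.opp i k (by grind) j hj
  · exact hE.nonempty
  · exact hE.third_or_strong

namespace SDatum

variable {K R D : Type*} [CommRing K] [NonUnitalRing R] [StarRing R] [Module K R]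
    [IsScalarTower K R R] [SMulCommClass K R R] [AddGroup D] {O : OBase K R D} {ι : Type}
    {E : EFam O ι} {G : Type*} [Group G] {p q j k l x z : SIdx ι}
    (hpq : p.abs ≠ q.abs) (hE : Decomposable E p q) (X : SDatum E (PartialOk p q) G)
include hpq hE

theorem mid_comm_x_self' (hj : j.Away p q) (a b c : R) :
    Commute (X.x j q (O.s • c)) (X.mid p q j a b) := by
  have h1 := (X.ofOk (ok' := PartialOk (-q) (-p)) (by grind)).mid_comm_x_self (by grind)
    (hE.flip (by grind)) (j := -j) (by grind) (-star b) (-star a) (-star c)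
  rw [X.mid_star hpq hj, X.x_star (by grind), O.star_smul, ← smul_neg]
  exact h1.inv_right

/-- The relation for `X_{-p}` and `X_q` would take its value in the missing subgroup. Instead the
long root element is written as a commutator of elements of `X_{-q,r}` and `X_{rq}`, each of which
commutes with `X_{-p}`. -/
theorem y_comm_y_phi (u : D) (c : R) :
    Commute (X.y (-p) u) (X.y q (O.phi (O.s • c))) := by
  obtain ⟨j, hj⟩ := hE.nonempty
  refine X.y_phi_left (Q := fun g => Commute (X.y (-p) u) g)
    (hE.away (-q) (by grind) j hj)
    (Commute.one_right _) (fun _ _ => Commute.mul_right) (fun _ => Commute.inv_right) ?_ c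
  intro r hr a' c'
  have h1 := X.x_y (i := -q) (j := r) (by grind) (by grind) a' c'
  rw [neg_neg] at h1
  rw [← h1]
  exact commute_comm (X.y_x_comm (by grind) (by grind) (by grind) _ _)
    (X.y_x_comm (by grind) (by grind) (by grind) _ _)

theorem mid_comm_x_smul (hj : j.Away p q) (hx : x.Away p q) (a b c : R) :
    Commute (X.x p x (O.s • c)) (X.mid p q j a b) := by
  by_cases h : x = j
  · subst h; exact X.mid_comm_x_self hpq hE hj _ _ _
  · exact X.mid_comm_x hpq hj (by grind) (by grind) (by grind) (by grind) (by grind) (by grind)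
      (by grind) (by grind) (by grind) _ _ _

theorem mid_comm_x_smul' (hj : j.Away p q) (hx : x.Away p q) (a b c : R) :
    Commute (X.x x q (O.s • c)) (X.mid p q j a b) := by
  by_cases h : x = j
  · subst h; exact X.mid_comm_x_self' hpq hE hj _ _ _
  · exact X.mid_comm_x hpq hj (by grind) (by grind) (by grind) (by grind) (by grind) (by grind)
      (by grind) (by grind) (by grind) _ _ _

/-- One summand carries the factor `s` because only `X_{pj}(s a)` is known to commute with `mid`. -/
theorem mid_add_left (hj : j.Away p q) (a a' b : R) :
    X.mid p q j (O.s • a + a') b = X.mid p q j a' b * X.mid p q j (O.s • a) b := by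
  have h1 := X.mid_comm_x_smul hpq hE hj hj a' b a
  rw [mid, X.x_add (by grind), comm_mul_left_of_commute h1, mid, mid]

theorem mid_add_right (hj : j.Away p q) (a b b' : R) :
    X.mid p q j a (O.s • b + b') = X.mid p q j a (O.s • b) * X.mid p q j a b' := by
  have h1 := X.mid_comm_x_smul' hpq hE hj hj a b' b
  rw [mid, X.x_add (by grind), comm_mul_right_of_commute h1, mid, mid]

theorem mid_comm_mid (hj : j.Away p q) (hx : x.Away p q) (a b a' b' : R) :
    Commute (X.mid p q x (O.s • a) (O.s • b)) (X.mid p q j a' b') :=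
  (commute_comm (X.mid_comm_x_smul hpq hE hj hx a' b' a).symm
    (X.mid_comm_x_smul' hpq hE hj hx a' b' b).symm).symm

end SDatum

namespace SDatum

variable {K R D : Type*} [CommRing K] [NonUnitalRing R] [StarRing R] [Module K R]
    [IsScalarTower K R R] [SMulCommClass K R R] [AddGroup D] {O : OBase K R D} {ι : Type}
    {E : EFam O ι} {G : Type*} [Group G] {p q j k l x z : SIdx ι}
    (hpq : p.abs ≠ q.abs) (hE : Decomposable E p q) (X : SDatum E (PartialOk p q) G)
include hpq

theorem mid_left_e (hj : j.Away p q) (a b : R) : X.mid p q j (a * E.e j) b = X.mid p q j a b := by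
  rw [mid, X.x_right (by grind), mid]

theorem mid_right_e (hj : j.Away p q) (a b : R) : X.mid p q j a (E.e j * b) = X.mid p q j a b := by
  rw [mid, X.x_left (by grind), mid]

/-- The Hall–Witt identity for two different indices. -/
theorem mid_shift (hj : j.Away p q) (hx : x.Away p q) (h : x ≠ j) (h' : x ≠ -j) (a k b : R) :
    X.mid p q x (O.s • (a * E.e j * k)) b = X.mid p q j a (O.s • (k * E.e x * b)) := by
  have hjx : PartialOk p q j x := by grind [SIdx.abs_eq_iff]
  have h1 : ⁅X.x p j a, X.x j x k⁆ = X.x p x (O.s • (a * E.e j * k)) :=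
    X.x_x (by grind) hjx (by grind) _ _
  have h2 : ⁅X.x j x k, X.x x q b⁆ = X.x j q (O.s • (k * E.e x * b)) :=
    X.x_x hjx (by grind) (by grind) _ _
  have h3 := comm_comm_of_commute (a := X.x p j a) (c := X.x j x k) (b := X.x x q b)
    (X.x_comm (by grind) (by grind) (by grind) (by grind) (by grind) (by grind) _ _)
    (by
      rw [h1, h2]
      exact X.x_comm (by grind) (by grind) (by grind) (by grind) (by grind) (by grind) _ _)
  rw [h1, h2] at h3
  rw [mid, mid, h3, Commute.conj_eq]
  exact X.mid_comm_x hpq hx (by grind) (by grind) (by grind) (by grind) (by grind) (by grind)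
      (by grind) (by grind) (by grind) _ _ _

include hE

/-- Hall–Witt with the long root element `X_x(φ(d))` in the middle; by `ρ(φ(d)) = d - d̄` it acts as
an element joining `-x` to `x`. The additional terms in `X_{-p}` and `X_q` are images of `φ` and
drop out. -/
theorem mid_change (hx : x.Away p q) (a b d : R) :
    X.mid p q x (O.s • (a * E.e (-x) * (d - star d))) b =
      X.mid p q (-x) a (O.s • ((d - star d) * E.e x * b)) := by
  have h2 : ⁅X.y x (O.phi d), X.x x q b⁆ = X.x (-x) q (O.s • ((d - star d) * E.e x * b)) *
      X.y q (O.phi (O.s • (-(O.s • (star b * E.e (-x) * d * E.e x * b))))) := by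
    rw [X.y_x (by grind) (by grind), O.rho_phi, O.phi_act, ← O.phi_neg]
    simp only [mul_assoc, smul_mul_assoc, mul_smul_comm, star_mul, O.star_smul, star_neg, E.star_e,
      neg_mul, mul_neg, smul_neg, neg_neg]
  have h1 : ⁅X.x p (-x) a, X.y x (O.phi d)⁆ =
      X.y (-p) (O.phi (O.s • (O.s • (a * E.e (-x) * d * E.e x * star a)))) *
        X.x p x (O.s • (a * E.e (-x) * (d - star d))) := by
    rw [← comm_inv_comm, X.x_star (i := p) (by grind), neg_neg, X.y_x (by grind) (by grind),
      O.rho_phi, O.phi_act, mul_inv_rev, ← X.y_neg, neg_neg, X.x_star (i := -x) (by grind),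
      ← X.x_neg (by grind), neg_neg, neg_neg]
    simp only [mul_assoc, smul_mul_assoc, mul_smul_comm, star_mul, O.star_smul, star_neg, E.star_e,
      neg_mul, mul_neg, smul_neg, neg_neg, star_star, mul_sub, sub_mul, smul_sub, star_sub, neg_sub]
  have hpx : Commute (X.y (-p) (O.phi (O.s • (O.s • (a * E.e (-x) * d * E.e x * star a)))))
      (X.x x q b) := X.y_x_comm (by grind) (by grind) (by grind) _ _
  have hc : Commute (X.x p (-x) a) (X.y q
      (O.phi (O.s • (-(O.s • (star b * E.e (-x) * d * E.e x * b)))))) :=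
    (X.y_x_comm (by grind) (by grind) (by grind) _ _).symm
  have h3 := comm_comm_of_commute (a := X.x p (-x) a) (c := X.y x (O.phi d)) (b := X.x x q b)
    (X.x_comm (by grind) (by grind) (by grind) (by grind) (by grind) (by grind) _ _)
    (by
      rw [h1, h2]
      refine Commute.mul_left (Commute.mul_right ?_ ?_) (Commute.mul_right ?_ ?_)
      · exact X.y_x_comm (by grind) (by grind) (by grind) _ _
      · exact X.y_comm_y_phi hpq hE _ _
      · exact X.x_comm (by grind) (by grind) (by grind) (by grind) (by grind) (by grind) _ _
      · exact (X.y_x_comm (by grind) (by grind) (by grind) _ _).symm)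
  have hy : Commute (X.y (-p) (O.phi (O.s • (O.s • (a * E.e (-x) * d * E.e x * star a)))))
      (X.mid p q x (O.s • (a * E.e (-x) * (d - star d))) b) :=
    X.mid_comm_y hpq hx (by grind) (by grind) _ _ _
  rw [h1, h2, comm_mul_right_of_commute' hc, comm_mul_left] at h3
  change X.mid p q (-x) _ _ = _ * (_ * X.mid p q x _ _ * _ * _) * _ at h3
  rw [hy.conj_eq, hpx.comm_eq_one, mul_one, Commute.conj_eq] at h3
  · exact h3.symm
  · refine Commute.mul_left ?_ ?_
    · exact X.mid_comm_x hpq hx (by grind) (by grind) (by grind) (by grind) (by grind) (by grind)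
        (by grind) (by grind) (by grind) _ _ _
    · exact X.mid_comm_y hpq hx (by grind) (by grind) _ _ _

end SDatum

/-! ### Commutators of `X_{p,-q}` with long root elements of `X_q` -/

namespace SDatum

variable {K R D : Type*} [CommRing K] [NonUnitalRing R] [StarRing R] [Module K R]
    [IsScalarTower K R R] [SMulCommClass K R R] [AddGroup D] {O : OBase K R D} {ι : Type}
    {E : EFam O ι} {G : Type*} [Group G] {p q j k l x z : SIdx ι}
    (hpq : p.abs ≠ q.abs) (hE : Decomposable E p q) (X : SDatum E (PartialOk p q) G)
include hpq hE

/-- Conjugation of a commutator expression for an element of `X_q` by `X_{p,-q}`. -/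
theorem comm_opp_y_phi (hx : x.Away p q) (c y b : R) :
    ⁅X.x p (-q) c, X.y q (O.phi (O.s • (y * E.e x * b)))⁆ =
      (X.mid p q (-x) (O.s • (c * E.e (-q) * -star b)) (-star y))⁻¹ *
      X.y (-p) (O.phi (O.s • O.s • O.s • (c * E.e (-q) * y * E.e x * b * E.e q * star c))) *
      X.mid p q x (O.s • (c * E.e (-q) * y)) b := by
  set U := X.x p x (O.s • (c * E.e (-q) * y)) with hU
  set W := X.x p (-x) (O.s • (c * E.e (-q) * -star b)) with hW
  set V := X.y q (O.phi (O.s • (y * E.e x * b))) with hV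
  have hYB : ⁅X.x (-q) x y, X.x x q b⁆ = V := by
    have := X.x_y (i := -q) (j := x) (by grind) (by grind) y b
    rwa [neg_neg] at this
  have hCY : ⁅X.x p (-q) c, X.x (-q) x y⁆ = U := X.x_x (by grind) (by grind) (by grind) _ _
  have hCB : ⁅X.x p (-q) c, X.x x q b⁆ = W := by
    rw [X.x_star (i := x) (by grind), X.x_x (by grind) (by grind) (by grind)]
  have hYW : ⁅X.x (-q) x y, W⁆ =
      (X.mid p q (-x) (O.s • (c * E.e (-q) * -star b)) (-star y))⁻¹ := by
    rw [mid, comm_inv_comm, X.x_star (i := -x) (by grind), star_neg, neg_neg, neg_neg, star_star]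
  have hUW : ⁅U, W⁆ = X.y (-p) (O.phi (O.s • O.s • O.s •
      (c * E.e (-q) * y * E.e x * b * E.e q * star c))) := by
    rw [hU, hW, X.x_star (i := p) (j := -x) (by grind), neg_neg, X.x_y (by grind) (by grind)]
    simp only [mul_assoc, smul_mul_assoc, mul_smul_comm, star_mul, O.star_smul, star_neg, E.star_e,
      neg_mul, mul_neg, smul_neg, neg_neg, star_star]
  have hWV : Commute W V := (X.y_x_comm (by grind) (by grind) (by grind) _ _).symm
  have hUV : Commute U V := (X.y_x_comm (by grind) (by grind) (by grind) _ _).symm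
  have hUM : ∀ a b, Commute U (X.mid p q (-x) a b) := fun a b =>
    X.mid_comm_x hpq (by grind) (by grind) (by grind) (by grind) (by grind) (by grind)
      (by grind) (by grind) (by grind) (by grind) _ _ _
  have hWM : ∀ a b, Commute W (X.mid p q x a b) := fun a b =>
    X.mid_comm_x hpq hx (by grind) (by grind) (by grind) (by grind) (by grind)
      (by grind) (by grind) (by grind) (by grind) _ _ _
  -- `V` is a commutator of elements of `X_{-q,x}` and `X_{xq}`; conjugation multiplies the entries
  -- by `U` and `W`.
  have e1 : X.x p (-q) c * V * (X.x p (-q) c)⁻¹ = ⁅U * X.x (-q) x y, W * X.x x q b⁆ := by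
    rw [← hYB, conj_comm_eq, conj_eq_comm_mul, hCY, conj_eq_comm_mul, hCB]
  have e2 : ⁅X.x (-q) x y, W * X.x x q b⁆ =
      (X.mid p q (-x) (O.s • (c * E.e (-q) * -star b)) (-star y))⁻¹ * V := by
    rw [comm_mul_right, hYB, hWV.conj_eq, hYW]
  have e3 : ⁅U, W * X.x x q b⁆ = ⁅U, W⁆ * X.mid p q x (O.s • (c * E.e (-q) * y)) b := by
    rw [comm_mul_right, ← mid, (hWM _ _).conj_eq]
  have e4 : V * ⁅U, W⁆ = ⁅U, W⁆ * V := by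
    rw [hUW]; exact (X.y_comm_y_phi hpq hE _ _).symm
  have e5 : V * X.mid p q x (O.s • (c * E.e (-q) * y)) b =
      X.mid p q x (O.s • (c * E.e (-q) * y)) b * V :=
    X.mid_comm_y hpq hx (by grind) (by grind) _ _ _
  rw [comm_mul_left, e2, e3, Commute.conj_eq ((hUM _ _).inv_right.mul_right hUV)] at e1
  rw [commutatorElement_def, e1, ← hUW, mul_inv_eq_iff_eq_mul, mul_assoc, ← mul_assoc V, e4,
    mul_assoc _ V, e5]
  simp only [mul_assoc]

/-- Conjugation of a commutator expression for an element of `X_{p,-q}` by `X_q`. -/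
theorem comm_y_phi_opp (hz : z.Away p q) (a m d : R) :
    ⁅X.y q (O.phi d), X.x p (-q) (O.s • (a * E.e z * m))⁆ =
      X.mid p q z a (-(O.s • (m * E.e (-q) * (d - star d)))) *
      X.y (-p) (O.phi (-(O.s • O.s • O.s • O.s •
        (a * E.e z * m * E.e (-q) * d * E.e q * star m * E.e (-z) * star a)))) := by
  set C := X.x p (-q) (O.s • (a * E.e z * m)) with hC
  set Y := X.y q (O.phi d) with hY
  set P := X.x z q (-(O.s • (m * E.e (-q) * (d - star d)))) with hP
  set Z := X.y (-z) (O.phi (-(O.s • O.s • (m * E.e (-q) * d * E.e q * star m)))) with hZ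
  have hAK : ⁅X.x p z a, X.x z (-q) m⁆ = C := X.x_x (by grind) (by grind) (by grind) _ _
  have hYA : Commute Y (X.x p z a) := X.y_x_comm (by grind) (by grind) (by grind) _ _
  have hYK : ⁅Y, X.x z (-q) m⁆ = P * Z := by
    rw [X.x_star (i := z) (by grind), neg_neg, X.y_x (by grind) (by grind), O.rho_phi, O.phi_act,
      ← O.phi_neg, X.x_star (i := -q) (by grind), neg_neg, neg_neg, hP, hZ]
    simp only [mul_assoc, smul_mul_assoc, mul_smul_comm, star_mul, O.star_smul, star_neg, E.star_e,
      neg_mul, mul_neg, smul_neg, neg_neg, star_star, mul_sub, sub_mul, smul_sub, star_sub, neg_sub]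
  set L := X.x z (-p) (O.s • O.s • O.s •
    (m * E.e (-q) * (d - star d) * E.e q * star m * E.e (-z) * star a)) with hL
  set T := X.y (-p) (O.phi (O.s • O.s • O.s • O.s •
        (a * E.e z * m * E.e (-q) * d * E.e q * star m * E.e (-z) * star a))) with hT
  have hZA : ⁅Z, X.x p z a⁆ = L * T := by
    rw [X.x_star (i := p) (by grind), X.y_x (by grind) (by grind), O.rho_phi, O.phi_act,
      ← O.phi_neg, neg_neg, hL, hT]
    simp only [mul_assoc, smul_mul_assoc, mul_smul_comm, star_mul, O.star_smul, star_neg, E.star_e,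
      neg_mul, mul_neg, smul_neg, neg_neg, star_star, mul_sub, sub_mul, smul_sub, star_sub, neg_sub,
      sub_neg_eq_add, neg_add_eq_sub]
  have hZC : Commute Z C := X.y_x_comm (by grind) (by grind) (by grind) _ _
  have hPC : ⁅P, C⁆ = L := by
    rw [hC, X.x_star (i := p) (by grind), neg_neg, hP, X.x_x (by grind) (by grind) (by grind), hL]
    simp only [mul_assoc, smul_mul_assoc, mul_smul_comm, star_mul, O.star_smul, star_neg, E.star_e,
      neg_mul, mul_neg, smul_neg, neg_neg, star_star, mul_sub, sub_mul, smul_sub, star_sub, neg_sub]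
  have hPL : Commute P L :=
    X.x_comm (by grind) (by grind) (by grind) (by grind) (by grind) (by grind) _ _
  have hPT : Commute P T := (X.y_x_comm (by grind) (by grind) (by grind) _ _).symm
  have hLT : Commute L T := (X.y_x_comm (by grind) (by grind) (by grind) _ _).symm
  -- `C` is a commutator of elements of `X_{pz}` and `X_{z,-q}`; conjugation by `Y` fixes the first
  -- entry and multiplies the second one by `P * Z`.
  have e1 : Y * C * Y⁻¹ = ⁅X.x p z a, P * (Z * X.x z (-q) m)⁆ := by
    rw [← hAK, conj_comm_eq, hYA.conj_eq, conj_eq_comm_mul, hYK, mul_assoc]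
  have e2 : ⁅X.x p z a, Z * X.x z (-q) m⁆ = (L * T)⁻¹ * C := by
    rw [comm_mul_right, hAK, hZC.conj_eq, ← hZA, comm_inv_comm]
  have e3 : P * C * P⁻¹ = L * C := by rw [conj_eq_comm_mul, hPC]
  have e4 : P * ((L * T)⁻¹ * C) * P⁻¹ = T⁻¹ * C := by
    rw [conj_mul_eq, e3, (hPL.mul_right hPT).inv_right.conj_eq, mul_inv_rev, mul_assoc,
      inv_mul_cancel_left]
  have e5 : T⁻¹ = X.y (-p) (O.phi (-(O.s • O.s • O.s • O.s •
        (a * E.e z * m * E.e (-q) * d * E.e q * star m * E.e (-z) * star a)))) := by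
    rw [O.phi_neg, X.y_neg]
  rw [comm_mul_right, e2, e4] at e1
  rw [commutatorElement_def, e1, ← e5, mid, ← mul_assoc, mul_inv_cancel_right]

/-- The element of `X_q` arises from conjugating `X_{-q,x}(y)` by the long root element `B` of
`X_{-x}`. Since `B` commutes with `A`, conjugating `Y` in either order gives the same result, and
the equation can be solved for the unknown commutator. -/
theorem comm_opp_y_phi_skew (hx : x.Away p q) (c y d : R) :
    ⁅X.x p (-q) c, X.y q (O.phi (-(O.s • O.s • (y * E.e x * d * E.e (-x) * star y))))⁆ =
      X.y (-p) (O.phi (-(O.s • O.s • O.s • O.s •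
        (c * E.e (-q) * y * E.e x * d * E.e (-x) * star y * E.e q * star c)))) *
      X.mid p q x (O.s • (c * E.e (-q) * y)) (O.s • -((d - star d) * E.e (-x) * star y)) := by
  set A := X.x p (-q) c with hA
  set B := X.y (-x) (O.phi d) with hB
  set Y := X.x (-q) x y with hY
  set U := X.x p x (O.s • (c * E.e (-q) * y)) with hU
  set Q := X.x x q (O.s • -((d - star d) * E.e (-x) * star y)) with hQ
  set V := X.y q (O.phi (-(O.s • O.s • (y * E.e x * d * E.e (-x) * star y)))) with hV
  set L := X.x x (-p) (-(O.s • O.s • ((d - star d) * E.e (-x) * star y * E.e q * star c))) with hL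
  set T := X.y (-p) (O.phi (-(O.s • O.s • O.s • O.s •
        (c * E.e (-q) * y * E.e x * d * E.e (-x) * star y * E.e q * star c)))) with hT
  have hAB : Commute B A := X.y_x_comm (by grind) (by grind) (by grind) _ _
  have hAY : ⁅A, Y⁆ = U := X.x_x (by grind) (by grind) (by grind) _ _
  have hBY : ⁅B, Y⁆ = Q * V := by
    rw [hY, X.x_star (i := -q) (by grind), neg_neg, X.y_x (by grind) (by grind), O.rho_phi,
      O.phi_act, ← O.phi_neg, hQ, hV]
    simp only [mul_assoc, smul_mul_assoc, mul_smul_comm, star_mul, O.star_smul, star_neg, E.star_e,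
      neg_mul, mul_neg, smul_neg, neg_neg, star_star, mul_sub, sub_mul, smul_sub, star_sub, neg_sub]
  have hBU : ⁅B, U⁆ = L * T := by
    rw [hU, X.x_star (i := p) (by grind), X.y_x (by grind) (by grind), O.rho_phi,
      O.phi_act, ← O.phi_neg, hL, hT, neg_neg]
    simp only [mul_assoc, smul_mul_assoc, mul_smul_comm, star_mul, O.star_smul, star_neg, E.star_e,
      neg_mul, mul_neg, smul_neg, neg_neg, star_star, mul_sub, sub_mul, smul_sub, star_sub, neg_sub]
  have hAQ : ⁅A, Q⁆ = L := by
    rw [hQ, X.x_star (i := x) (by grind), X.x_x (by grind) (by grind) (by grind),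
      X.x_star (i := p) (by grind), hL, neg_neg]
    simp only [mul_assoc, smul_mul_assoc, mul_smul_comm, star_mul, O.star_smul, star_neg, E.star_e,
      neg_mul, mul_neg, smul_neg, neg_neg, star_star, mul_sub, sub_mul, smul_sub, star_sub, neg_sub]
  have hUV : Commute U V := (X.y_x_comm (by grind) (by grind) (by grind) _ _).symm
  have hTQ : Commute T Q := X.y_x_comm (by grind) (by grind) (by grind) _ _
  have hQM : Commute Q ⁅U, Q⁆ := X.mid_comm_x_self' hpq hE hx _ _ _
  have e1 : A * (B * Y * B⁻¹) * A⁻¹ = L * Q * (⁅A, V⁆ * V) * (U * Y) := by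
    rw [conj_eq_comm_mul B, hBY, mul_assoc Q V Y, conj_mul_eq, conj_mul_eq, conj_eq_comm_mul A Q,
      conj_eq_comm_mul A V, conj_eq_comm_mul A Y, hAQ, hAY]
    simp only [mul_assoc]
  have e2 : B * (A * Y * A⁻¹) * B⁻¹ = L * T * U * (Q * V * Y) := by
    rw [conj_eq_comm_mul A, hAY, conj_mul_eq, conj_eq_comm_mul B, conj_eq_comm_mul B, hBU, hBY]
  have e3 : A * (B * Y * B⁻¹) * A⁻¹ = B * (A * Y * A⁻¹) * B⁻¹ := by
    have := hAB.eq
    have h' : A⁻¹ * B⁻¹ = B⁻¹ * A⁻¹ := by rw [← mul_inv_rev, ← mul_inv_rev, this]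
    calc A * (B * Y * B⁻¹) * A⁻¹ = (A * B) * Y * (B⁻¹ * A⁻¹) := by simp only [mul_assoc]
      _ = (B * A) * Y * (A⁻¹ * B⁻¹) := by rw [this, h']
      _ = _ := by simp only [mul_assoc]
  rw [e1, e2] at e3
  have e4 : Q * ⁅A, V⁆ * U = T * U * Q := by
    have h1 : L * (Q * ⁅A, V⁆ * U) * (V * Y) = L * (T * U * Q) * (V * Y) := by
      calc L * (Q * ⁅A, V⁆ * U) * (V * Y) = L * Q * ⁅A, V⁆ * (U * V) * Y := by
            simp only [mul_assoc]
        _ = L * Q * (⁅A, V⁆ * V) * (U * Y) := by rw [hUV.eq]; simp only [mul_assoc]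
        _ = _ := by rw [e3]; simp only [mul_assoc]
    exact mul_left_cancel (mul_right_cancel h1)
  have e5 : ⁅A, V⁆ = Q⁻¹ * (T * U * Q) * U⁻¹ := by rw [← e4]; group
  -- Uses that `Q`, an entry of the commutator, commutes with it; the factor `s` in `Q` is needed
  -- here.
  have e6 : Q⁻¹ * (U * Q * U⁻¹) = ⁅U, Q⁆ := by
    rw [conj_eq_comm_mul, ← hQM.eq, inv_mul_cancel_left]
  calc ⁅A, V⁆ = T * (Q⁻¹ * (U * Q * U⁻¹)) := by
        rw [e5, mul_assoc T, ← mul_assoc Q⁻¹ T, ← hTQ.inv_right.eq]; simp only [mul_assoc]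
    _ = _ := by rw [e6, mid]

end SDatum

/-- The commutators `mid` with scaled arguments as biadditive maps to a commutative subgroup. -/
structure MidMaps {K R D : Type*} [CommRing K] [NonUnitalRing R] [StarRing R] [Module K R]
    [IsScalarTower K R R] [SMulCommClass K R R] [AddGroup D] {O : OBase K R D} {ι : Type}
    {E : EFam O ι} {ok : SIdx ι → SIdx ι → Prop} {G : Type*} [Group G] (X : SDatum E ok G)
    (p q : SIdx ι) (M : Type*) [AddCommGroup M] where
  toG : Multiplicative M →* G
  inj : Function.Injective toG
  g : SIdx ι → R →+ R →+ M
  g_eq : ∀ j, j.Away p q → ∀ a b,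
    toG (Multiplicative.ofAdd (g j a b)) = X.mid p q j (O.s • a) (O.s • b)

namespace SDatum

variable {K R D : Type*} [CommRing K] [NonUnitalRing R] [StarRing R] [Module K R]
    [IsScalarTower K R R] [SMulCommClass K R R] [AddGroup D] {O : OBase K R D} {ι : Type}
    {E : EFam O ι} {G : Type*} [Group G] {p q j k l x z : SIdx ι}
    (hpq : p.abs ≠ q.abs) (hE : Decomposable E p q) (X : SDatum E (PartialOk p q) G)

include hpq hE in
-- By `mid_comm_mid` the commutators with scaled arguments commute for all indices, so they generate
-- an abelian subgroup, and there `mid_add_left` and `mid_add_right` are genuine biadditivity.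
theorem exists_midMaps {G : Type v} [Group G] (X : SDatum E (PartialOk p q) G) : ∃ (M : Type v) (_ : AddCommGroup M), Nonempty (MidMaps X p q M) := by
  classical
  let S : Set G := {g | ∃ j a b, j.Away p q ∧ g = X.mid p q j (O.s • a) (O.s • b)}
  have hS : ∀ x ∈ S, ∀ y ∈ S, x * y = y * x := by
    rintro _ ⟨j, a, b, hj, rfl⟩ _ ⟨x, a', b', hx, rfl⟩
    exact (X.mid_comm_mid hpq hE hx hj _ _ _ _).eq
  let _ : CommGroup (Subgroup.closure S) :=
    { (inferInstance : Group (Subgroup.closure S)) with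
      mul_comm := (Subgroup.isMulCommutative_closure hS).is_comm.comm }
  have mem : ∀ j a b, j.Away p q → X.mid p q j (O.s • a) (O.s • b) ∈ Subgroup.closure S :=
    fun j a b hj => Subgroup.subset_closure ⟨j, a, b, hj, rfl⟩
  let g : SIdx ι → R → R → Additive (Subgroup.closure S) := fun j a b =>
    -- The value `0` at the remaining indices only makes the family total.
    if hj : j.Away p q then Additive.ofMul ⟨_, mem j a b hj⟩ else 0
  have hg : ∀ j (hj : j.Away p q) a b, g j a b = Additive.ofMul ⟨_, mem j a b hj⟩ :=
    fun j hj a b => dif_pos hj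
  have hg' : ∀ j (hj : ¬j.Away p q) a b, g j a b = 0 := fun j hj a b => dif_neg hj
  refine ⟨Additive (Subgroup.closure S), inferInstance, ⟨⟨?_, ?_, fun j => AddMonoidHom.mk'
    (fun a => AddMonoidHom.mk' (g j a) ?_) ?_, ?_⟩⟩⟩
  · exact (Subgroup.closure S).subtype
  · exact (Subgroup.closure S).subtype_injective
  · intro b b'
    by_cases hj : j.Away p q
    · rw [hg j hj, hg j hj, hg j hj]
      refine congrArg Additive.ofMul (Subtype.ext ?_)
      change X.mid p q j (O.s • a) (O.s • (b + b')) = _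
      rw [smul_add, X.mid_add_right hpq hE hj]; rfl
    · simp [hg' j hj]
  · intro a a'
    ext1 b
    by_cases hj : j.Away p q
    · change g j (a + a') b = g j a b + g j a' b
      rw [add_comm, add_comm (g j a b), hg j hj, hg j hj, hg j hj]
      refine congrArg Additive.ofMul (Subtype.ext ?_)
      change X.mid p q j (O.s • (a' + a)) (O.s • b) = _
      rw [add_comm a', smul_add, X.mid_add_left hpq hE hj]; rfl
    · change g j (a + a') b = g j a b + g j a' b
      simp [hg' j hj]
  · intro j hj a b
    change (Subgroup.closure S).subtype (Additive.toMul (g j a b)) = _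
    rw [hg j hj]; rfl

end SDatum

/-! ### Relations between the biadditive maps for different indices -/

namespace MidMaps

variable {K R D : Type*} [CommRing K] [NonUnitalRing R] [StarRing R] [Module K R]
    [IsScalarTower K R R] [SMulCommClass K R R] [AddGroup D] {O : OBase K R D} {ι : Type}
    {E : EFam O ι} {G : Type*} [Group G] {p q j k l x z : SIdx ι}
    {X : SDatum E (PartialOk p q) G} {M : Type*} [AddCommGroup M] (Z : MidMaps X p q M)
    (hpq : p.abs ≠ q.abs) (hE : Decomposable E p q)

theorem eq_of_toG {a b : M}
    (h : Z.toG (Multiplicative.ofAdd a) = Z.toG (Multiplicative.ofAdd b)) : a = b := Z.inj h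

theorem toG_neg (a : M) :
    Z.toG (Multiplicative.ofAdd (-a)) = (Z.toG (Multiplicative.ofAdd a))⁻¹ := by
  rw [ofAdd_neg, map_inv]

theorem toG_add (a b : M) : Z.toG (Multiplicative.ofAdd (a + b)) =
    Z.toG (Multiplicative.ofAdd a) * Z.toG (Multiplicative.ofAdd b) := by
  rw [ofAdd_add, map_mul]

include hpq

theorem g_left_e (hj : j.Away p q) (a b : R) : Z.g j (a * E.e j) b = Z.g j a b := by
  apply Z.eq_of_toG
  rw [Z.g_eq j hj, Z.g_eq j hj, ← smul_mul_assoc, X.mid_left_e hpq hj]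

theorem g_right_e (hj : j.Away p q) (a b : R) : Z.g j a (E.e j * b) = Z.g j a b := by
  apply Z.eq_of_toG
  rw [Z.g_eq j hj, Z.g_eq j hj, ← mul_smul_comm, X.mid_right_e hpq hj]

theorem g_left_p (hj : j.Away p q) (a b : R) : Z.g j (E.e p * a) b = Z.g j a b := by
  apply Z.eq_of_toG
  rw [Z.g_eq j hj, Z.g_eq j hj, SDatum.mid, ← mul_smul_comm, X.x_left (by grind), SDatum.mid]

theorem g_right_q (hj : j.Away p q) (a b : R) : Z.g j a (b * E.e q) = Z.g j a b := by
  apply Z.eq_of_toG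
  rw [Z.g_eq j hj, Z.g_eq j hj, SDatum.mid, ← smul_mul_assoc, X.x_right (by grind), SDatum.mid]

theorem g_shift (hj : j.Away p q) (hx : x.Away p q) (h : x ≠ j) (h' : x ≠ -j) (a k b : R) :
    Z.g x (O.s • (a * E.e j * k)) b = Z.g j a (O.s • (k * E.e x * b)) := by
  apply Z.eq_of_toG
  have h1 := X.mid_shift hpq hj hx h h' (O.s • a) k (O.s • b)
  simp only [smul_mul_assoc, mul_smul_comm] at h1
  rw [Z.g_eq x hx, Z.g_eq j hj, h1]

include hE

theorem g_change (hx : x.Away p q) (a d b : R) :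
    Z.g x (O.s • (a * E.e (-x) * (d - star d))) b =
      Z.g (-x) a (O.s • ((d - star d) * E.e x * b)) := by
  apply Z.eq_of_toG
  have h1 := X.mid_change hpq hE hx (O.s • a) (O.s • b) d
  simp only [smul_mul_assoc, mul_smul_comm] at h1
  rw [Z.g_eq x hx, Z.g_eq (-x) (by grind), h1]

/-- Two evaluations of one commutator between `X_{p,-q}` and `X_q`: in one the element of `X_q` is
expanded through `x`, in the other the element of `X_{p,-q}` is expanded through `z`. The terms in
`X_{-p}` agree and cancel. -/
theorem g_swap (hx : x.Away p q) (hz : z.Away p q) (a m y b : R) :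
    Z.g x (O.s • O.s • O.s • (a * E.e z * m * E.e (-q) * y)) b -
      Z.g (-x) (O.s • O.s • O.s • (a * E.e z * m * E.e (-q) * star b)) (star y) =
    Z.g z a (O.s • O.s • O.s •
      (m * E.e (-q) * (y * E.e x * b - star b * E.e (-x) * star y))) := by
  have h1 := X.comm_opp_y_phi hpq hE hx (O.s • (O.s • a * E.e z * m)) (O.s • y) (O.s • b)
  have h2 := X.comm_y_phi_opp hpq hE hz (O.s • a) m (O.s • (O.s • y * E.e x * O.s • b))
  rw [← comm_inv_comm, h1] at h2
  have hT : ∀ u a b, Commute (X.y (-p) u) (X.mid p q (-x) a b) := fun u a b =>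
    X.mid_comm_y hpq (by grind) (by grind) (by grind) _ _ _
  rw [mul_assoc, mul_inv_rev, inv_inv, mul_inv_rev, mul_assoc, ← X.y_neg, (hT _ _ _).eq,
    ← mul_assoc, ← O.phi_neg] at h2
  have e1 := Z.g_eq x hx (O.s • O.s • O.s • (a * E.e z * m * E.e (-q) * y)) b
  have e2 := Z.g_eq (-x) (by grind) (-(O.s • O.s • O.s • (a * E.e z * m * E.e (-q) * star b)))
    (-star y)
  have e3 := Z.g_eq z hz a (-(O.s • O.s • O.s •
      (m * E.e (-q) * (y * E.e x * b - star b * E.e (-x) * star y))))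
  have h3 : -Z.g x (O.s • O.s • O.s • (a * E.e z * m * E.e (-q) * y)) b +
      Z.g (-x) (-(O.s • O.s • O.s • (a * E.e z * m * E.e (-q) * star b))) (-star y) =
      Z.g z a (-(O.s • O.s • O.s •
        (m * E.e (-q) * (y * E.e x * b - star b * E.e (-x) * star y)))) := by
    apply Z.eq_of_toG
    rw [Z.toG_add, Z.toG_neg, e1, e2, e3]
    simp only [mul_assoc, smul_mul_assoc, mul_smul_comm, star_mul, O.star_smul, star_neg, E.star_e,
      neg_mul, mul_neg, smul_neg, neg_neg, star_star, mul_sub, smul_sub, neg_sub] at h2 ⊢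
    rw [← mul_assoc] at h2
    exact mul_right_cancel h2
  simp only [map_neg, AddMonoidHom.neg_apply, neg_neg] at h3
  rw [← neg_inj, ← h3]
  abel

/-- The same comparison for the elements of `X_q` of the shape treated in `comm_opp_y_phi_skew`. -/
theorem g_skew (hx : x.Away p q) (hz : z.Away p q) (a m y d : R) :
    Z.g x (O.s • O.s • (a * E.e z * m * E.e (-q) * y)) ((d - star d) * E.e (-x) * star y) =
    Z.g z a (O.s • O.s •
      (m * E.e (-q) * y * E.e x * (d - star d) * E.e (-x) * star y)) := by
  have h1 := X.comm_opp_y_phi_skew hpq hE hx (O.s • (O.s • a * E.e z * m)) y d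
  have h2 := X.comm_y_phi_opp hpq hE hz (O.s • a) m
    (-(O.s • O.s • (y * E.e x * d * E.e (-x) * star y)))
  rw [← comm_inv_comm, h1] at h2
  have hT : ∀ u a b, Commute (X.y (-p) u) (X.mid p q x a b) := fun u a b =>
    X.mid_comm_y hpq (by grind) (by grind) (by grind) _ _ _
  rw [(hT _ _ _).eq, ← (hT _ _ _).eq, mul_inv_rev, ← X.y_neg, ← O.phi_neg] at h2
  have e1 := Z.g_eq x hx (O.s • O.s • (a * E.e z * m * E.e (-q) * y))
    (-((d - star d) * E.e (-x) * star y))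
  have e3 := Z.g_eq z hz a (O.s • O.s •
      (m * E.e (-q) * y * E.e x * (d - star d) * E.e (-x) * star y))
  have h3 : -Z.g x (O.s • O.s • (a * E.e z * m * E.e (-q) * y))
        (-((d - star d) * E.e (-x) * star y)) =
      Z.g z a (O.s • O.s •
        (m * E.e (-q) * y * E.e x * (d - star d) * E.e (-x) * star y)) := by
    apply Z.eq_of_toG
    rw [Z.toG_neg, e1, e3]
    simp only [mul_assoc, smul_mul_assoc, mul_smul_comm, star_mul, O.star_smul, star_neg, E.star_e,
      neg_mul, mul_neg, smul_neg, neg_neg, star_star, mul_sub, smul_sub, neg_sub, sub_mul, sub_neg_eq_add,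
      neg_add_eq_sub] at h2 ⊢
    exact mul_right_cancel h2
  rwa [map_neg, neg_neg] at h3

end MidMaps

/-! ### Balancing of the maps after a further scaling -/

namespace MidMaps

variable {K R D : Type*} [CommRing K] [NonUnitalRing R] [StarRing R] [Module K R]
    [IsScalarTower K R R] [SMulCommClass K R R] [AddGroup D] {O : OBase K R D} {ι : Type}
    {E : EFam O ι} {G : Type*} [Group G] {p q j k l x z : SIdx ι}
    {X : SDatum E (PartialOk p q) G} {M : Type*} [AddCommGroup M] (Z : MidMaps X p q M)
    (hpq : p.abs ≠ q.abs) (hE : Decomposable E p q)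

include hpq hE

theorem g_swap_pow (hx : x.Away p q) (hz : z.Away p q) (a m y b : R) :
    Z.g x (O.s ^ 3 • (a * E.e z * m * E.e (-q) * y)) b -
      Z.g (-x) (O.s ^ 3 • (a * E.e z * m * E.e (-q) * star b)) (star y) =
    Z.g z a (O.s ^ 3 •
      (m * E.e (-q) * (y * E.e x * b - star b * E.e (-x) * star y))) := by
  have h := Z.g_swap hpq hE hx hz a m y b
  simp only [smul_smul, ← mul_assoc O.s] at h
  have e : O.s * O.s * O.s = O.s ^ 3 := by ring
  rwa [e] at h

/-- Insert `t ∈ e_x R e_x` and decompose it. If `t` passes through a third index `r`, both sides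
equal the same value of `g r` by `g_shift`. If it passes through `-q`, apply `g_swap_pow` with the
scalar attached either to `b` or to `m`; the other two terms coincide. -/
theorem g_smul (hx : x.Away p q) (c : K) (a b : R) :
    Z.g x (O.s ^ 3 • a) (c • b) = Z.g x (O.s ^ 3 • c • a) b := by
  suffices h : ∀ (t a b : R), Z.g x (O.s ^ 3 • (a * E.e x * (E.e x * t * E.e x))) (c • b) =
      Z.g x (O.s ^ 3 • c • (a * E.e x * (E.e x * t * E.e x))) b by
    have := h (E.e x) a b
    simp only [mul_assoc, E.e_self] at this
    rw [← smul_mul_assoc, ← smul_mul_assoc, ← smul_mul_assoc] at this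
    rwa [Z.g_left_e hpq hx, Z.g_left_e hpq hx] at this
  have add : ∀ u v : R, (∀ a b, Z.g x (O.s ^ 3 • (a * E.e x * (u * E.e x))) (c • b) =
      Z.g x (O.s ^ 3 • c • (a * E.e x * (u * E.e x))) b) →
      (∀ a b, Z.g x (O.s ^ 3 • (a * E.e x * (v * E.e x))) (c • b) =
      Z.g x (O.s ^ 3 • c • (a * E.e x * (v * E.e x))) b) →
      (∀ a b, Z.g x (O.s ^ 3 • (a * E.e x * ((u + v) * E.e x))) (c • b) =
      Z.g x (O.s ^ 3 • c • (a * E.e x * ((u + v) * E.e x))) b) := fun u v hu hv a b => by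
    simp only [add_mul, mul_add, smul_add, map_add, AddMonoidHom.add_apply, hu, hv]
  have neg : ∀ u : R, (∀ a b, Z.g x (O.s ^ 3 • (a * E.e x * (u * E.e x))) (c • b) =
      Z.g x (O.s ^ 3 • c • (a * E.e x * (u * E.e x))) b) →
      (∀ a b, Z.g x (O.s ^ 3 • (a * E.e x * (-u * E.e x))) (c • b) =
      Z.g x (O.s ^ 3 • c • (a * E.e x * (-u * E.e x))) b) := fun u hu a b => by
    simp only [neg_mul, mul_neg, smul_neg, map_neg, AddMonoidHom.neg_apply, hu]
  have zero : ∀ a b, Z.g x (O.s ^ 3 • (a * E.e x * (0 * E.e x))) (c • b) =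
      Z.g x (O.s ^ 3 • c • (a * E.e x * (0 * E.e x))) b := fun a b => by simp
  rcases hE.third_or_strong with h3 | h3
  · refine fun t => EFam.span_induction_left (h3 x hx) zero add neg ?_ t
    rintro r ⟨hr, h1, h2⟩ u k a b
    have e1 := Z.g_shift hpq hr hx (Ne.symm h1) (by grind)
      (O.s ^ 2 • (a * E.e x * u)) (k * E.e x) (c • b)
    have e2 := Z.g_shift hpq hr hx (Ne.symm h1) (by grind)
      (O.s ^ 2 • (a * E.e x * u)) (c • k * E.e x) b
    simp only [smul_mul_assoc, mul_smul_comm, smul_smul, mul_assoc] at e1 e2 ⊢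
    rw [← e2] at e1
    convert e1 using 4 <;> ring
  · refine fun t => EFam.span_induction_left (h3 x (-q)) zero add neg ?_ t
    rintro r rfl m y a b
    have e1 := Z.g_swap_pow hpq hE hx hx a m (y * E.e x) (c • b)
    have e2 := Z.g_swap_pow hpq hE hx hx a (c • m) (y * E.e x) b
    simp only [smul_mul_assoc, mul_smul_comm, mul_assoc, O.star_smul, ← smul_sub] at e1 e2 ⊢
    rw [← e2] at e1
    exact sub_left_injective e1

omit hpq hE in
/-- The biadditive maps after a further scaling. -/
def F (j : SIdx ι) : R →+ R →+ M :=
  AddMonoidHom.mk' (fun a => (Z.g j (O.s ^ 3 • a)).comp (DistribSMul.toAddMonoidHom R (O.s ^ 3)))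
    fun a a' => by ext b; simp

omit hpq hE in
theorem F_apply (j : SIdx ι) (a b : R) : Z.F j a b = Z.g j (O.s ^ 3 • a) (O.s ^ 3 • b) := rfl

/-- All scalars can be collected in the first argument, so the relations for `g` with unequal powers
of `s` become relations for `F` without scalars. -/
theorem F_eq (hx : x.Away p q) (a b : R) : Z.F x a b = Z.g x (O.s ^ 3 • O.s ^ 3 • a) b := by
  rw [Z.F_apply, Z.g_smul hpq hE hx]

/-- The roles of `f` and `f'` are played by `e_{-q}` and `e_q`. Strongness supplies `e_mem` and
`f_mem`, which involve single idempotents and not the sums `e_i + e_{-i}`. -/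
theorem balancingData (hj : j.Away p q) (h : ∀ i j, E.e i ∈ E.span fun r => r = j) :
    BalancingData (E.e j) (E.e (-j)) (E.e (-q)) (E.e q) (Z.F j) (Z.F (-j)) := by
  have hj' : (-j).Away p q := by grind
  have hs : ∀ i j, E.e i ∈ AddSubgroup.closure {z : R | ∃ x y, z = x * E.e j * y} := fun i j => by
    refine AddSubgroup.closure_mono ?_ (h i j)
    rintro _ ⟨r, x, y, rfl, rfl⟩
    exact ⟨x, y, rfl⟩
  refine ⟨E.e_self _, E.e_self _, E.star_e _, ?_, ?_, ?_, ?_, ?_, ?_, ?_, hs _ _, hs _ _⟩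
  · rw [E.star_e, neg_neg]
  · intro a b
    rw [Z.F_apply, ← smul_mul_assoc, Z.g_left_e hpq hj, Z.F_apply]
  · intro a b
    rw [Z.F_apply, ← mul_smul_comm, Z.g_right_e hpq hj, Z.F_apply]
  · intro a b
    rw [Z.F_apply, ← smul_mul_assoc, Z.g_right_q hpq hj, Z.F_apply]
  · intro a m y b
    have e := Z.g_swap_pow hpq hE hj hj (O.s ^ 3 • a) m y b
    rw [Z.F_eq hpq hE hj, Z.F_eq hpq hE hj', Z.F_apply]
    simp only [smul_mul_assoc, mul_smul_comm, mul_assoc, mul_sub] at e ⊢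
    exact e
  · intro a m y d
    have e := Z.g_skew hpq hE hj hj (O.s ^ 3 • a) m y (O.s • d)
    have e2 := Z.g_smul hpq hE hj O.s (O.s ^ 2 • (a * E.e j * m * E.e (-q) * y))
      ((d - star d) * E.e (-j) * star y)
    rw [Z.F_eq hpq hE hj, Z.F_apply]
    simp only [smul_mul_assoc, mul_smul_comm, mul_assoc, O.star_smul, ← smul_sub, smul_smul,
      mul_sub, sub_mul] at e e2 ⊢
    have s1 : O.s * (O.s * O.s ^ 3) = O.s ^ 3 * O.s ^ 2 := by ring
    have s2 : O.s ^ 3 * (O.s * O.s ^ 2) = O.s ^ 3 * O.s ^ 3 := by ring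
    have s3 : O.s * (O.s * O.s) = O.s ^ 3 := by ring
    rw [s1, s3, e2, s2] at e
    exact e
  · intro a d b
    have e := Z.g_change hpq hE hj' (O.s ^ 3 • a) d (O.s ^ 2 • b)
    have e2 := Z.g_smul hpq hE hj' (O.s ^ 2) (O.s • (a * E.e j * (d - star d))) b
    rw [Z.F_eq hpq hE hj', Z.F_apply]
    simp only [smul_mul_assoc, mul_smul_comm, mul_assoc, smul_smul, neg_neg] at e e2 ⊢
    have s1 : O.s * O.s ^ 3 = O.s ^ 3 * O.s := by ring
    have s2 : O.s ^ 3 * (O.s ^ 2 * O.s) = O.s ^ 3 * O.s ^ 3 := by ring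
    have s3 : O.s * O.s ^ 2 = O.s ^ 3 := by ring
    rw [s1, s3, e2, s2] at e
    exact e

theorem F_shift (hj : j.Away p q) (hx : x.Away p q) (h : x ≠ j) (h' : x ≠ -j) (a k b : R) :
    Z.F x (a * E.e j * k) b = Z.F j a (k * E.e x * b) := by
  have e := Z.g_shift hpq hj hx h h' (O.s ^ 3 • a) k (O.s ^ 2 • b)
  have e2 := Z.g_smul hpq hE hx (O.s ^ 2) (O.s • (a * E.e j * k)) b
  rw [Z.F_eq hpq hE hx, Z.F_apply]
  simp only [smul_mul_assoc, mul_smul_comm, smul_smul] at e e2 ⊢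
  have s1 : O.s * O.s ^ 3 = O.s ^ 3 * O.s := by ring
  have s2 : O.s ^ 3 * (O.s ^ 2 * O.s) = O.s ^ 3 * O.s ^ 3 := by ring
  have s3 : O.s * O.s ^ 2 = O.s ^ 3 := by ring
  rw [s1, s3, e2, s2] at e
  exact e

theorem F_right_e (hj : j.Away p q) (a b : R) : Z.F j a (E.e j * b) = Z.F j a b := by
  rw [Z.F_apply, ← mul_smul_comm, Z.g_right_e hpq hj, Z.F_apply]

/-- The biadditive maps are balanced. -/
theorem F_balance (hj : j.Away p q) (hx : x.Away p q) (a k b : R) :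
    Z.F x (a * E.e j * k) b = Z.F j a (k * E.e x * b) := by
  by_cases hjx : x ≠ j ∧ x ≠ -j
  · exact Z.F_shift hpq hE hj hx hjx.1 hjx.2 a k b
  rcases hE.third_or_strong with h3 | h3
  -- For `x = ±j` decompose `e_j` through a third index `r` and shift twice, from `x` to `r` and
  -- from `r` to `j`.
  · have key : ∀ k a b, Z.F x (a * E.e j * (E.e j * k)) b = Z.F j a ((E.e j * k) * E.e x * b) := by
      refine EFam.span_induction_left (h3 j hj) (Q := fun k => ∀ a b,
        Z.F x (a * E.e j * k) b = Z.F j a (k * E.e x * b)) ?_ ?_ ?_ ?_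
      · simp
      · intro u v hu hv a b
        simp only [mul_add, add_mul, map_add, AddMonoidHom.add_apply, hu, hv]
      · intro u hu a b
        simp only [mul_neg, neg_mul, map_neg, AddMonoidHom.neg_apply, hu]
      · rintro r ⟨hr, h1, h2⟩ u k a b
        have e1 := Z.F_shift hpq hE hr hx (by grind) (by grind) (a * E.e j * u) k b
        have e2 := Z.F_shift hpq hE hj hr h1 h2 a u (k * E.e x * b)
        simp only [mul_assoc] at e1 e2 ⊢
        rw [e1, e2]
    have e := key k a b
    rw [mul_assoc, E.e_self', mul_assoc (E.e j), mul_assoc (E.e j), Z.F_right_e hpq hE hj] at e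
    rw [mul_assoc, e]
  · have h := Z.balancingData hpq hE hj h3
    by_cases h1 : x = j
    · subst h1; exact h.balance a k b
    · obtain rfl : x = -j := by grind
      exact h.balance_change a k b

end MidMaps

theorem Decomposable.induction {K R D : Type*} [CommRing K] [NonUnitalRing R] [StarRing R]
    [Module K R] [IsScalarTower K R R] [SMulCommClass K R R] [AddGroup D] {O : OBase K R D}
    {ι : Type} {E : EFam O ι} {p q : SIdx ι} (hE : Decomposable E p q) {i : SIdx ι}
    (hi : i.abs = p.abs ∨ i.abs = q.abs) {j : SIdx ι} (hj : j.Away p q) {Q : R → Prop}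
    (e : ∀ a, Q (E.e i * a) → Q a) (zero : Q 0) (add : ∀ a b, Q a → Q b → Q (a + b))
    (neg : ∀ a, Q a → Q (-a)) (mem : ∀ r, r.Away p q → r ≠ j → ∀ a c, Q (a * E.e r * c))
    (c : R) : Q c :=
  e _ (EFam.span_induction_left (hE.away i hi j hj) zero add neg
    (fun r hr => mem r hr.1 hr.2) c)

/-- A substitute for the missing root subgroup `X_{pq}`. -/
structure Zeta {K R D : Type*} [CommRing K] [NonUnitalRing R] [StarRing R] [Module K R]
    [IsScalarTower K R R] [SMulCommClass K R R] [AddGroup D] {O : OBase K R D} {ι : Type}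
    {E : EFam O ι} {ok : SIdx ι → SIdx ι → Prop} {G : Type*} [Group G] (X : SDatum E ok G)
    (p q : SIdx ι) where
  z : R → G
  z_e : ∀ a, z (E.e p * a * E.e q) = z a
  z_add : ∀ a b, z (a + b) = z a * z b
  z_mid : ∀ j, j.Away p q → ∀ a b, z (a * E.e j * b) = X.mid p q j (O.s ^ 4 • a) (O.s ^ 4 • b)

section

variable {K R D : Type*} [CommRing K] [NonUnitalRing R] [StarRing R] [Module K R]
    [IsScalarTower K R R] [SMulCommClass K R R] [AddGroup D] {O : OBase K R D} {ι : Type}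
    {E : EFam O ι} {G : Type*} [Group G] {p q j k l x : SIdx ι}

/-- If `e_p = ∑ u e_r v`, then the value at `c` is forced to be `∑ F_r(u, v c)`. Balancing shows
that this sum takes the required value on every product `a e_x b`, whatever `x` is. -/
theorem SDatum.exists_zeta (X : SDatum E (PartialOk p q) G) (hpq : p.abs ≠ q.abs)
    (hE : Decomposable E p q) : Nonempty (Zeta X p q) := by
  obtain ⟨M, _, ⟨Z⟩⟩ := SDatum.exists_midMaps hpq hE X
  obtain ⟨j0, hj0⟩ := hE.nonempty
  -- The statement for general `t` can be proved by induction on its decomposition; it is applied to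
  -- `t = e_p`.
  have key : ∀ t ∈ E.span (fun r => r.Away p q ∧ r ≠ j0), ∃ θ : R →+ M, ∀ x, x.Away p q → ∀ a b,
      θ (a * E.e x * b) = Z.F x (t * a) b := by
    intro t ht
    induction ht using AddSubgroup.closure_induction with
    | mem t ht =>
      obtain ⟨r, u, v, hr, rfl⟩ := ht
      refine ⟨(Z.F r u).comp (AddMonoidHom.mulLeft v), fun x hx a b => ?_⟩
      rw [mul_assoc (u * E.e r) v a, Z.F_balance hpq hE hr.1 hx]
      simp only [AddMonoidHom.comp_apply, AddMonoidHom.coe_mulLeft, mul_assoc]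
    | zero => exact ⟨0, fun x hx a b => by simp⟩
    | add s t _ _ hs ht =>
      obtain ⟨θ, h⟩ := hs
      obtain ⟨θ', h'⟩ := ht
      exact ⟨θ + θ', fun x hx a b => by simp [h x hx, h' x hx, add_mul]⟩
    | neg s _ hs =>
      obtain ⟨θ, h⟩ := hs
      exact ⟨-θ, fun x hx a b => by simp [h x hx]⟩
  obtain ⟨θ, hθ⟩ := key _ (hE.away p (by grind) j0 hj0)
  refine ⟨⟨fun c => Z.toG (Multiplicative.ofAdd (θ (E.e p * c * E.e q))), ?_, ?_, ?_⟩⟩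
  · intro a
    simp only [mul_assoc, E.e_self, E.e_self']
  · intro a b
    rw [mul_add, add_mul, map_add, Z.toG_add]
  · intro j hj a b
    have e1 : E.e p * (a * E.e j * b) * E.e q = (E.e p * a) * E.e j * (b * E.e q) := by
      simp only [mul_assoc]
    rw [e1, hθ j hj, Z.F_apply, ← mul_smul_comm, ← mul_smul_comm, Z.g_left_p hpq hj,
      Z.g_left_p hpq hj, ← smul_mul_assoc, Z.g_right_q hpq hj, Z.g_eq j hj, smul_smul, smul_smul]
    -- One factor comes from `g_eq` and three from `F_apply`; this is the origin of the exponent in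
    -- `z_mid`.
    have : O.s * O.s ^ 3 = O.s ^ 4 := by ring
    rw [this]

end

/-! ### Commutators of the new root subgroup with the old ones -/

namespace Zeta

variable {K R D : Type*} [CommRing K] [NonUnitalRing R] [StarRing R] [Module K R]
    [IsScalarTower K R R] [SMulCommClass K R R] [AddGroup D] {O : OBase K R D} {ι : Type}
    {E : EFam O ι} {G : Type*} [Group G] {p q j k l x : SIdx ι}
    {X : SDatum E (PartialOk p q) G} (Z : Zeta X p q)

theorem z_zero : Z.z 0 = 1 := by
  have := Z.z_add 0 0
  simpa using this

theorem z_neg (a : R) : Z.z (-a) = (Z.z a)⁻¹ := by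
  have := Z.z_add (-a) a
  rw [neg_add_cancel, Z.z_zero] at this
  exact eq_inv_of_mul_eq_one_left this.symm

theorem z_left (a : R) : Z.z (E.e p * a) = Z.z a := by
  rw [← Z.z_e, E.e_self', Z.z_e]

theorem z_comm (a b : R) : Commute (Z.z a) (Z.z b) := by
  rw [Commute, SemiconjBy, ← Z.z_add, ← Z.z_add, add_comm]

variable (hpq : p.abs ≠ q.abs) (hE : Decomposable E p q)
include hpq hE

/-- The same root subgroup with the other indices. -/
def dual : Zeta (X.ofOk (ok' := PartialOk (-q) (-p)) (by grind)) (-q) (-p) where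
  z c := Z.z (-star c)
  z_e a := by
    rw [← Z.z_e (-star a)]
    simp only [star_mul, E.star_e, neg_neg, mul_neg, neg_mul, mul_assoc]
  z_add a b := by rw [star_add, neg_add, Z.z_add]
  z_mid j hj a b := by
    have hj' : (-j).Away p q := by grind
    have e1 : -star (a * E.e j * b) = -((-star b) * E.e (-j) * (-star a)) := by
      simp only [star_mul, E.star_e, neg_neg, mul_neg, neg_mul, mul_assoc]
    have e2 := (X.ofOk (ok' := PartialOk (-q) (-p)) (by grind)).mid_star (by grind) hj
      (O.s ^ 4 • a) (O.s ^ 4 • b)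
    rw [e2, e1, Z.z_neg, Z.z_mid _ hj', neg_neg, neg_neg, smul_neg, smul_neg, O.star_smul,
      O.star_smul]
    rfl

theorem comm_y (h1 : k ≠ p) (h2 : k ≠ -q) (u : D) (c : R) : Commute (X.y k u) (Z.z c) := by
  obtain ⟨j, hj⟩ := hE.nonempty
  refine hE.induction (i := p) (by grind) hj (Q := fun c => Commute (X.y k u) (Z.z c)) ?_ ?_ ?_ ?_ ?_ c
  · intro a h; rwa [← Z.z_left]
  · rw [Z.z_zero]; exact Commute.one_right _
  · intro a b ha hb; rw [Z.z_add]; exact ha.mul_right hb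
  · intro a ha; rw [Z.z_neg]; exact ha.inv_right
  · intro r hr _ a c
    rw [Z.z_mid r hr]
    exact X.mid_comm_y hpq hr h1 h2 _ _ _

theorem comm_x (hkl : PartialOk p q k l) (h1 : l ≠ p) (h2 : l ≠ -q)
    (h3 : k ≠ q) (h4 : k ≠ -p) (b c : R) : Commute (X.x k l b) (Z.z c) := by
  -- If the root element is itself an entry of the commutators through some index, that index is
  -- taken as `j` and avoided in the decomposition.
  have key : ∀ j, j.Away p q → (∀ r, r.Away p q → r ≠ j → ¬(k = p ∧ l = r) ∧ ¬(k = r ∧ l = q) ∧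
      ¬(k = -r ∧ l = -p) ∧ ¬(k = -q ∧ l = -r)) → Commute (X.x k l b) (Z.z c) := by
    intro j hj h
    refine hE.induction (i := p) (by grind) hj (Q := fun c => Commute (X.x k l b) (Z.z c)) ?_ ?_ ?_ ?_ ?_ c
    · intro a h; rwa [← Z.z_left]
    · rw [Z.z_zero]; exact Commute.one_right _
    · intro a b ha hb; rw [Z.z_add]; exact ha.mul_right hb
    · intro a ha; rw [Z.z_neg]; exact ha.inv_right
    · intro r hr hrj a c
      obtain ⟨h5, h6, h7, h8⟩ := h r hr hrj
      rw [Z.z_mid r hr]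
      exact X.mid_comm_x hpq hr hkl h1 h2 h3 h4 h5 h6 h7 h8 _ _ _
  obtain ⟨j, hj⟩ := hE.nonempty
  by_cases c1 : k = p ∧ l.Away p q
  · exact key l c1.2 (by grind)
  by_cases c2 : k = -q ∧ l.Away p q
  · exact key (-l) (by grind) (by grind)
  by_cases c3 : l = q ∧ k.Away p q
  · exact key k c3.2 (by grind)
  by_cases c4 : l = -p ∧ k.Away p q
  · exact key (-k) (by grind) (by grind)
  exact key j hj (by grind)

/-- The exponent collects `s^4` from each argument in `z_mid` and one `s` from each of the two
successive commutators. -/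
theorem comm_opp (c d : R) : ⁅Z.z c, X.x q (-p) d⁆ =
    X.y (-p) (O.phi (O.s ^ 10 • (c * E.e q * d))) := by
  obtain ⟨j, hj⟩ := hE.nonempty
  have hy : ∀ u c, Commute (Z.z c) (X.y (-p) u) := fun u c =>
    (Z.comm_y hpq hE (by grind) (by grind) _ _).symm
  refine hE.induction (i := p) (by grind) hj (Q := fun c => ⁅Z.z c, X.x q (-p) d⁆ =
    X.y (-p) (O.phi (O.s ^ 10 • (c * E.e q * d)))) ?_ ?_ ?_ ?_ ?_ c
  · intro a h
    rw [Z.z_left] at h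
    rw [h]
    refine X.y_congr ?_
    simp only [O.phi_act, E.star_e, neg_neg, smul_mul_assoc, mul_smul_comm, mul_assoc, E.e_self']
  · rw [Z.z_zero, commutatorElement_one_left, zero_mul, zero_mul, smul_zero, O.phi_zero, X.y_zero]
  · intro a b ha hb
    rw [Z.z_add, comm_mul_left, ha, hb, (hy _ _).conj_eq, add_mul, add_mul, smul_add, add_comm,
      O.phi_add, X.y_add]
  · intro a ha
    have h1 := comm_mul_left (Z.z (-a)) (Z.z a) (X.x q (-p) d)
    rw [ha, (hy _ _).conj_eq, ← Z.z_add, neg_add_cancel, Z.z_zero, commutatorElement_one_left] at h1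
    rw [neg_mul, neg_mul, smul_neg, O.phi_neg, X.y_neg]
    exact eq_inv_of_mul_eq_one_right h1.symm
  · intro r hr _ a b
    rw [Z.z_mid r hr, X.mid_comm_opp hpq hr]
    simp only [smul_mul_assoc, mul_smul_comm, smul_smul]
    congr 3; ring

end Zeta

namespace SDatum

variable {K R D : Type*} [CommRing K] [NonUnitalRing R] [StarRing R] [Module K R]
    [IsScalarTower K R R] [SMulCommClass K R R] [AddGroup D] {O : OBase K R D} {ι : Type}
    {E : EFam O ι} {G : Type*} [Group G] {p q j k l x z : SIdx ι}
    (hpq : p.abs ≠ q.abs) (hE : Decomposable E p q) (X : SDatum E (PartialOk p q) G)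
include hpq

/-- For `j ≠ ±k` the element of `X_{qk}` moves only the entry `X_{jq}`, by an element of `X_{jk}`.
-/
theorem mid_comm_next (hj : j.Away p q) (hk : k.Away p q) (h : j ≠ k) (h' : j ≠ -k) (a b c : R) :
    ⁅X.mid p q j a b, X.x q k c⁆ = X.x p k (O.s • O.s • (a * E.e j * b * E.e q * c)) := by
  have hjk : PartialOk p q j k := by grind [SIdx.abs_eq_iff]
  have h0 : ⁅X.x q k c, X.x j q b⁆ = X.x j k (-(O.s • (b * E.e q * c))) := by
    rw [← comm_inv_comm, X.x_x (by grind) (by grind) hjk, X.x_neg hjk]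
  rw [mid, comm_comm_of_right, h0, X.x_x (by grind) hjk (by grind), ← X.x_neg (by grind)]
  · simp only [mul_neg, neg_neg, smul_neg, mul_smul_comm, mul_assoc]
  · exact X.x_comm (by grind) (by grind) (by grind) (by grind) (by grind) (by grind) _ _
  · rw [h0]
    exact X.mid_comm_x hpq hj hjk (by grind) (by grind) (by grind) (by grind) (by grind)
      (by grind) (by grind) (by grind) _ _ _

/-- Here `C` moves both entries: `A` by `T` in `X_{q,-p}` and `B` by `Y` in `X_{-j}`. Their
contributions `V` in `X_{-p}` cancel, and what remains in `X_{j,-p}` is the expected value in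
`X_{p,-j}`. -/
theorem mid_comm_next_neg (hj : j.Away p q) (a b c : R) :
    ⁅X.mid p q j a b, X.x q (-j) c⁆ =
      X.x p (-j) (O.s • O.s • (a * E.e j * b * E.e q * c)) := by
  set A := X.x p j a with hA
  set B := X.x j q b with hB
  set C := X.x q (-j) c with hC
  set f := X.mid p q j a b with hf
  have hfd : f = ⁅A, B⁆ := rfl
  set T := X.x q (-p) (-(O.s • (c * E.e (-j) * star a))) with hT
  set Y := X.y (-j) (O.phi (-(O.s • (b * E.e q * c)))) with hY
  set L := X.x j (-p) (O.s • O.s • ((b * E.e q * c - star c * E.e (-q) * star b) * E.e (-j) *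
    star a)) with hL
  set V := X.y (-p) (O.phi (O.s • O.s • O.s • (a * E.e j * b * E.e q * c * E.e (-j) * star a)))
    with hV
  set N := X.x j (-p) (O.s • O.s • (b * E.e q * c * E.e (-j) * star a)) with hN
  have hCA : ⁅C, A⁆ = T := by
    rw [hA, X.x_star (i := p) (by grind), X.x_x (by grind) (by grind) (by grind), mul_neg, smul_neg]
  have hCB : ⁅C, B⁆ = Y := by
    rw [← comm_inv_comm, X.x_y (by grind) (by grind), ← X.y_neg, ← O.phi_neg]
  have hYA : ⁅Y, A⁆ = L * V := by
    rw [hA, X.x_star (i := p) (by grind), hY, X.y_x (by grind) (by grind), O.rho_phi, O.phi_act,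
      ← O.phi_neg, neg_neg, hL, hV]
    simp only [mul_assoc, smul_mul_assoc, mul_smul_comm, star_mul, O.star_smul, star_neg, E.star_e,
      neg_mul, mul_neg, smul_neg, neg_neg, star_star, mul_sub, sub_mul, smul_sub, star_sub, neg_sub,
      sub_neg_eq_add, neg_add_eq_sub, E.e_self']
  have hTB : ⁅T, B⁆ = N := by
    rw [← comm_inv_comm, X.x_x (by grind) (by grind) (by grind), ← X.x_neg (by grind), hN]
    simp only [mul_assoc, mul_smul_comm, mul_neg, smul_neg, neg_neg]
  have hfT : ⁅f, T⁆ = V⁻¹ := by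
    rw [hf, hT, X.mid_comm_opp hpq hj, hV, ← X.y_neg, ← O.phi_neg]
    simp only [mul_assoc, mul_smul_comm, mul_neg, smul_neg, neg_neg]
  have hYT : Commute Y T := X.y_x_comm (by grind) (by grind) (by grind) _ _
  have hYf : Commute Y f := X.mid_comm_y hpq hj (by grind) (by grind) _ _ _
  have hYN : Commute Y N := X.y_x_comm (by grind) (by grind) (by grind) _ _
  have hTL : Commute T L :=
    X.x_comm (by grind) (by grind) (by grind) (by grind) (by grind) (by grind) _ _
  have hTV : Commute T V := (X.y_x_comm (by grind) (by grind) (by grind) _ _).symm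
  have hfL : ∀ d, Commute f (X.x j (-p) d) := fun d =>
    (X.mid_comm_x hpq hj (by grind) (by grind) (by grind) (by grind) (by grind) (by grind)
      (by grind) (by grind) (by grind) _ _ _).symm
  have hTf : T * f * T⁻¹ = V * f := by
    rw [conj_eq_comm_mul, ← comm_inv_comm, hfT, inv_inv]
  have e1 : C * f * C⁻¹ = ⁅T * A, Y * B⁆ := by
    rw [hfd, conj_comm_eq, conj_eq_comm_mul, conj_eq_comm_mul, hCA, hCB]
  have e2 : ⁅A, Y * B⁆ = (L * V)⁻¹ * f := by
    rw [comm_mul_right, ← hfd, hYf.conj_eq, ← comm_inv_comm, hYA]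
  have e3 : ⁅T, Y * B⁆ = N := by
    rw [comm_mul_right, hYT.symm.comm_eq_one, hTB, hYN.conj_eq, one_mul]
  have e4 : C * f * C⁻¹ = f * (L⁻¹ * N) := by
    rw [e1, comm_mul_left, e2, e3, conj_mul_eq, (hTL.mul_right hTV).inv_right.conj_eq, hTf,
      mul_inv_rev]
    have : Commute V L := X.y_x_comm (by grind) (by grind) (by grind) _ _
    rw [this.inv_inv.eq]
    calc L⁻¹ * V⁻¹ * (V * f) * N = L⁻¹ * f * N := by simp only [mul_assoc, inv_mul_cancel_left]
      _ = _ := by rw [← (hfL _).inv_right.eq, mul_assoc]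
  have e5 : ⁅f, C⁆ = f * (L⁻¹ * N)⁻¹ * f⁻¹ := by
    rw [commutatorElement_def, mul_assoc, mul_assoc, mul_assoc, ← mul_inv_rev f, ← e4]; group
  rw [e5, Commute.conj_eq ((hfL _).inv_right.mul_right (hfL _)).inv_right,
    ← X.x_neg (by grind), ← X.x_add (by grind), ← X.x_neg (by grind), X.x_star (by grind), neg_neg]
  simp only [mul_assoc, smul_mul_assoc, mul_smul_comm, star_mul, O.star_smul, star_neg, E.star_e,
      neg_mul, mul_neg, smul_neg, neg_neg, star_star, mul_sub, sub_mul, smul_sub, star_sub, neg_sub,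
      star_add, sub_add_cancel]

end SDatum

namespace Zeta

variable {K R D : Type*} [CommRing K] [NonUnitalRing R] [StarRing R] [Module K R]
    [IsScalarTower K R R] [SMulCommClass K R R] [AddGroup D] {O : OBase K R D} {ι : Type}
    {E : EFam O ι} {G : Type*} [Group G] {p q j k l x : SIdx ι}
    {X : SDatum E (PartialOk p q) G} (Z : Zeta X p q)
    (hpq : p.abs ≠ q.abs) (hE : Decomposable E p q)
include hpq hE

/-- The index `k` can be avoided in the decomposition of `c`, but `-k` cannot in general, which is
why `mid_comm_next_neg` is needed. -/
theorem comm_next (hk : k.Away p q) (c d : R) : ⁅Z.z c, X.x q k d⁆ =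
    X.x p k (O.s ^ 10 • (c * E.e q * d)) := by
  have hpk : PartialOk p q p k := by grind
  have hx : ∀ d c, Commute (Z.z c) (X.x p k d) := fun d c =>
    (Z.comm_x hpq hE hpk (by grind) (by grind) (by grind) (by grind) _ _).symm
  refine hE.induction (i := p) (by grind) hk (Q := fun c => ⁅Z.z c, X.x q k d⁆ =
    X.x p k (O.s ^ 10 • (c * E.e q * d))) ?_ ?_ ?_ ?_ ?_ c
  · intro a h
    rw [Z.z_left] at h
    rw [h, mul_assoc, mul_assoc, ← mul_smul_comm, X.x_left hpk, mul_assoc]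
  · rw [Z.z_zero, commutatorElement_one_left, zero_mul, zero_mul, smul_zero, X.x_zero hpk]
  · intro a b ha hb
    rw [Z.z_add, comm_mul_left, ha, hb, (hx _ _).conj_eq, add_mul, add_mul, smul_add, add_comm,
      X.x_add hpk]
  · intro a ha
    have h1 := comm_mul_left (Z.z (-a)) (Z.z a) (X.x q k d)
    rw [ha, (hx _ _).conj_eq, ← Z.z_add, neg_add_cancel, Z.z_zero, commutatorElement_one_left] at h1
    rw [neg_mul, neg_mul, smul_neg, X.x_neg hpk]
    exact eq_inv_of_mul_eq_one_right h1.symm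
  · intro r hr hrk a b
    have e : O.s * (O.s * (O.s ^ 4 * O.s ^ 4)) = O.s ^ 10 := by ring
    rw [Z.z_mid r hr]
    by_cases h : r = -k
    · have hrk : k = -r := by grind
      subst hrk
      rw [X.mid_comm_next_neg hpq hr]
      simp only [smul_mul_assoc, mul_smul_comm, smul_smul, e]
    · rw [X.mid_comm_next hpq hr hk hrk h]
      simp only [smul_mul_assoc, mul_smul_comm, smul_smul, e]

end Zeta

/-- Two crossed homomorphisms agree on an additive subgroup. -/
theorem eq_of_crossed {R G : Type*} [AddGroup R] [Group G] {z f g : R → G}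
    (hf : ∀ a b, f (a + b) = f a * (z a * f b * (z a)⁻¹))
    (hg : ∀ a b, g (a + b) = g a * (z a * g b * (z a)⁻¹)) :
    f 0 = g 0 ∧ (∀ a b, f a = g a → f b = g b → f (a + b) = g (a + b)) ∧
      ∀ a, f a = g a → f (-a) = g (-a) := by
  have h0 : f 0 = g 0 := by
    have h1 := hf 0 0
    have h2 := hg 0 0
    rw [add_zero, left_eq_mul, mul_inv_eq_one, mul_eq_left] at h1 h2
    rw [h1, h2]
  refine ⟨h0, fun a b ha hb => by rw [hf, hg, ha, hb], fun a ha => ?_⟩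
  have h1 := hf (-a) a
  have h2 := hg (-a) a
  rw [neg_add_cancel] at h1 h2
  rw [← h0, h1, ha] at h2
  exact mul_right_cancel h2

namespace Zeta

variable {K R D : Type*} [CommRing K] [NonUnitalRing R] [StarRing R] [Module K R]
    [IsScalarTower K R R] [SMulCommClass K R R] [AddGroup D] {O : OBase K R D} {ι : Type}
    {E : EFam O ι} {G : Type*} [Group G] {p q j k l x : SIdx ι}
    {X : SDatum E (PartialOk p q) G} (Z : Zeta X p q)
    (hpq : p.abs ≠ q.abs) (hE : Decomposable E p q)
include hpq hE

/-- This and the next formula are `comm_opp` and `comm_next` for the dual parametrisation with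
indices `-q`, `-p`. -/
theorem opp_comm (c d : R) : ⁅Z.z c, X.x (-p) q d⁆ =
    X.y q (O.phi (-(O.s ^ 10 • (star c * E.e (-p) * d)))) := by
  have h := (Z.dual hpq).comm_opp (by grind) (hE.flip (by grind)) (-star c) d
  rw [neg_neg] at h
  change ⁅Z.z (-star (-star c)), X.x (-p) q d⁆ = X.y q _ at h
  rw [star_neg, neg_neg, star_star] at h
  rw [h, neg_mul, neg_mul, smul_neg]

theorem prev_comm (hk : k.Away p q) (c d : R) : ⁅Z.z c, X.x k p d⁆ =
    X.x k q (-(O.s ^ 10 • (d * E.e p * c))) := by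
  have h := (Z.dual hpq).comm_next (by grind) (hE.flip (by grind)) (k := -k) (by grind) (-star c) (-star d)
  change ⁅Z.z (-star (-star c)), X.x (-p) (-k) (-star d)⁆ = X.x (-q) (-k) _ at h
  rw [star_neg, neg_neg, star_star, ← X.x_star (by grind)] at h
  rw [h, X.x_star (i := k) (by grind)]
  simp only [star_mul, E.star_e, O.star_smul, star_neg, neg_neg, mul_neg, neg_mul, mul_assoc]

/-- `X_p(u)` fixes the entry in `X_{rq}` and multiplies the one in `X_{pr}` by `W * X_r(v)`.
Expanding the commutator again yields the two expected factors; the term `N` in `X_{-r,q}` appears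
twice and cancels. -/
theorem y_comm_mid {r : SIdx ι} (hr : r.Away p q) (u : D) (a b : R) :
    ⁅X.y p u, Z.z (a * E.e r * b)⁆ =
    X.x (-p) q (O.s ^ 10 • (O.rho u * E.e p * (a * E.e r * b))) *
      X.y q (-(O.act u (-(O.s ^ 10 • (E.e p * (a * E.e r * b)))))) := by
  have hpo : PartialOk p q (-p) q := by grind
  have hpr : PartialOk p q p r := by grind
  have hpr' : PartialOk p q (-p) r := by grind
  have hrq0 : PartialOk p q r q := by grind
  have hrq1 : PartialOk p q (-r) q := by grind
  have hzy : ∀ u c, Commute (Z.z c) (X.y q u) := fun u c =>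
    (Z.comm_y hpq hE (by grind) (by grind) _ _).symm
  have hxy : ∀ u c, Commute (X.x (-p) q c) (X.y q u) := fun u c =>
    (X.y_x_comm hpo (by grind) (by grind) _ _).symm
  have hVf : ∀ v c, Commute (X.y r v) (Z.z c) := fun v c =>
    Z.comm_y hpq hE (by grind) (by grind) _ _
  have hWN : ∀ c d, Commute (X.x (-p) r c) (X.x (-r) q d) := fun c d =>
    X.x_comm hpr' hrq1 (by grind) (by grind) (by grind) (by grind) _ _
  have hWY : ∀ c d, Commute (X.x (-p) r c) (X.y q d) := fun c d =>
    (X.y_x_comm hpr' (by grind) (by grind) _ _).symm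
  have hyB : ∀ c, Commute (X.y p u) (X.x r q c) := fun c =>
    X.y_x_comm hrq0 (by grind) (by grind) _ _
  have hrq : ∀ c d, Commute (X.x (-r) q c) (Z.z d) := fun c d =>
    Z.comm_x hpq hE (by grind) (by grind) (by grind) (by grind) (by grind) _ _
  set f := Z.z (a * E.e r * b) with hf
  have hfd : f = ⁅X.x p r (O.s ^ 4 • a), X.x r q (O.s ^ 4 • b)⁆ := Z.z_mid r hr a b
  set t := O.s ^ 10 • (E.e p * (a * E.e r * b)) with ht
  set W := X.x (-p) r (O.s • (O.rho u * E.e p * (O.s ^ 4 • a))) with hW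
  set v := -(O.act u (-(O.s • (E.e p * (O.s ^ 4 • a))))) with hv
  set N := X.x (-r) q (O.s • (O.rho v * E.e r * (O.s ^ 4 • b))) with hN
  set U := X.x (-p) q (O.s ^ 10 • (O.rho u * E.e p * (a * E.e r * b))) with hU
  have hyA : ⁅X.y p u, X.x p r (O.s ^ 4 • a)⁆ = W * X.y r v := X.y_x hpr hpr' _ _
  have hVB : ⁅X.y r v, X.x r q (O.s ^ 4 • b)⁆ = N * X.y q (O.act u t) := by
    rw [X.y_x hrq0 hrq1]
    refine congrArg (N * ·) (congrArg (X.y q) ?_)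
    rw [hv, O.neg_act, neg_neg, O.act_act, ht]
    simp only [neg_mul, mul_neg, neg_neg, smul_mul_assoc, mul_smul_comm, smul_smul, mul_assoc,
      smul_neg]
    congr 2; ring
  have hWB : ⁅W, X.x r q (O.s ^ 4 • b)⁆ = U := by
    rw [X.x_x hpr' hrq0 hpo, hU]
    simp only [smul_mul_assoc, mul_smul_comm, smul_smul, mul_assoc]
    congr 2; ring
  have hWf : W * f * W⁻¹ = f * N⁻¹ := by
    have h1 : ⁅f, W⁆ = N := by
      rw [hW, X.x_star hpr', neg_neg, Z.prev_comm hpq hE (by grind), hN, hv, O.rho_neg,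
        O.rho_act]
      simp only [star_mul, E.star_e, O.star_smul, star_neg, neg_neg, mul_neg, neg_mul, mul_assoc,
          smul_mul_assoc, mul_smul_comm, smul_smul, E.e_self', smul_neg, star_star]
      congr 2; ring
    rw [conj_eq_comm_mul, ← comm_inv_comm, h1, (hrq _ _).inv_left.eq]
  have hfU : ⁅f, U⁆ = X.y q (O.phi (-(star t * O.rho u * t))) := by
    rw [hU, Z.opp_comm hpq hE, ht]
    simp only [star_mul, E.star_e, O.star_smul, star_neg, neg_neg, mul_neg, neg_mul, mul_assoc,
          smul_mul_assoc, mul_smul_comm, smul_smul, E.e_self', smul_neg]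
  have hWN' : Commute W N := hWN _ _
  have hWY' : Commute W (X.y q (O.act u t)) := hWY _ _
  have hVf' : Commute (X.y r v) f := hVf _ _
  have hzy' : ∀ u, Commute f (X.y q u) := fun u => hzy _ _
  have hxy' : ∀ u, Commute U (X.y q u) := fun u => hxy _ _
  clear_value f N U
  have e1 : X.y p u * f * (X.y p u)⁻¹ = f * X.y q (O.act u t) * U := by
    rw [hfd, conj_comm_eq, (hyB _).conj_eq, conj_eq_comm_mul, hyA, mul_assoc, comm_mul_left W, hWB,
      comm_mul_left, ← hfd, hVf'.conj_eq, hVB, conj_mul_eq, hWf, (hWN'.mul_right hWY').conj_eq]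
    simp only [mul_assoc, inv_mul_cancel_left]
  calc ⁅X.y p u, f⁆ = X.y q (O.act u t) * (f * U * f⁻¹) := by
        rw [commutatorElement_def, e1, (hzy' _).eq]; simp only [mul_assoc]
    _ = _ := by
        rw [O.neg_act_neg, X.y_add, ← hfU, conj_eq_comm_mul, hfU, ← mul_assoc,
          ((hxy' _).mul_right (hxy' _)).eq]

/-- As functions of `c` both sides are crossed homomorphisms for the same conjugation, so by
`eq_of_crossed` it suffices to compare them on products through an index away from `±p` and `±q`. -/
theorem y_comm (u : D) (c : R) : ⁅X.y p u, Z.z c⁆ =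
    X.x (-p) q (O.s ^ 10 • (O.rho u * E.e p * c)) *
      X.y q (-(O.act u (-(O.s ^ 10 • (E.e p * c))))) := by
  obtain ⟨j, hj⟩ := hE.nonempty
  have hpo : PartialOk p q (-p) q := by grind
  have hzy : ∀ u c, Commute (Z.z c) (X.y q u) := fun u c =>
    (Z.comm_y hpq hE (by grind) (by grind) _ _).symm
  have hxy : ∀ u c, Commute (X.x (-p) q c) (X.y q u) := fun u c =>
    (X.y_x_comm hpo (by grind) (by grind) _ _).symm
  obtain ⟨h0, hadd, hneg⟩ := eq_of_crossed (z := Z.z) (f := fun c => ⁅X.y p u, Z.z c⁆)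
    (g := fun c => X.x (-p) q (O.s ^ 10 • (O.rho u * E.e p * c)) *
      X.y q (-(O.act u (-(O.s ^ 10 • (E.e p * c))))))
    (fun a b => by rw [Z.z_add, comm_mul_right]) (fun a b => by
      rw [conj_mul_eq, conj_eq_comm_mul _ (X.x _ _ _), Z.opp_comm hpq hE, (hzy _ _).conj_eq,
        mul_add, smul_add, mul_add, smul_add, add_comm (O.s ^ 10 • (E.e p * a)), neg_add, O.act_add,
        neg_add_rev, neg_add_rev, X.x_add hpo, X.y_add, X.y_add, ← O.phi_neg]
      have e : O.s ^ 10 • (star a * E.e (-p) * O.s ^ 10 • (O.rho u * E.e p * b)) =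
          star (-(O.s ^ 10 • (E.e p * a))) * O.rho u * -(O.s ^ 10 • (E.e p * b)) := by
        simp only [star_mul, E.star_e, O.star_smul, star_neg, neg_neg, mul_neg, neg_mul, mul_assoc,
          smul_mul_assoc, mul_smul_comm, smul_neg]
      rw [e]
      simp only [mul_assoc]
      congr 1
      rw [← mul_assoc, ← mul_assoc (X.y q _) (X.y q _), ← mul_assoc (X.y q _ * X.y q _) (X.x _ _ _),
        (((hxy _ _).mul_right (hxy _ _))).eq.symm]
      simp only [mul_assoc])
  refine hE.induction (i := p) (by grind) hj (Q := fun c => ⁅X.y p u, Z.z c⁆ =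
    X.x (-p) q (O.s ^ 10 • (O.rho u * E.e p * c)) *
      X.y q (-(O.act u (-(O.s ^ 10 • (E.e p * c)))))) ?_ h0 hadd hneg ?_ c
  · intro a h
    rwa [Z.z_left, mul_assoc, E.e_self', ← mul_assoc] at h
  exact fun r hr _ a b => Z.y_comm_mid hpq hE hr u a b

/-- Now the missing subgroup occurs as a value: `X_{-p}(u)` moves `X_{-p,r}` into `X_{pr}`, whose
commutator with `X_{rq}` is a `mid`. -/
theorem y_comm_x_mid {r : SIdx ι} (hr : r.Away p q) (u : D) (a b : R) :
    ⁅X.y (-p) u, X.x (-p) q (O.s ^ 8 • (a * E.e r * b))⁆ =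
      Z.z (O.rho u * E.e (-p) * (a * E.e r * b)) *
        X.y q (-(O.act u (-(O.s ^ 9 • (E.e (-p) * (a * E.e r * b)))))) := by
  have hpo : PartialOk p q (-p) q := by grind
  have hpr : PartialOk p q p r := by grind
  have hpr' : PartialOk p q (-p) r := by grind
  have hrp : PartialOk p q (-r) (-p) := by grind
  have hrq0 : PartialOk p q r q := by grind
  have hrq1 : PartialOk p q (-r) q := by grind
  have hzy : ∀ u c, Commute (Z.z c) (X.y q u) := fun u c =>
    (Z.comm_y hpq hE (by grind) (by grind) _ _).symm
  have hxy : ∀ u c, Commute (X.x (-p) q c) (X.y q u) := fun u c =>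
    (X.y_x_comm hpo (by grind) (by grind) _ _).symm
  have hVx : ∀ v c, Commute (X.y r v) (X.x (-p) q c) := fun v c =>
    X.y_x_comm hpo (by grind) (by grind) _ _
  have hWN : ∀ c d, Commute (X.x p r c) (X.x (-r) q d) := fun c d =>
    X.x_comm hpr hrq1 (by grind) (by grind) (by grind) (by grind) _ _
  have hNx : ∀ c d, Commute (X.x (-r) q c) (X.x (-p) q d) := fun c d =>
    X.x_comm hrq1 hpo (by grind) (by grind) (by grind) (by grind) _ _
  have hWY : ∀ c d, Commute (X.x p r c) (X.y q d) := fun c d =>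
    (X.y_x_comm hpr (by grind) (by grind) _ _).symm
  have hyB : ∀ c, Commute (X.y (-p) u) (X.x r q c) := fun c =>
    X.y_x_comm hrq0 (by grind) (by grind) _ _
  have hyP := X.y_x hpr' (by rwa [neg_neg]) u (O.s ^ 3 • a)
  rw [neg_neg] at hyP
  set ξ := X.x (-p) q (O.s ^ 8 • (a * E.e r * b)) with hξ
  -- The split `8 = 1 + 3 + 4` is chosen so that the element `W` of `X_{pr}`, which gains one more
  -- `s`, and the element of `X_{rq}` both carry the `s^4` demanded by `z_mid`.
  have hξd : ξ = ⁅X.x (-p) r (O.s ^ 3 • a), X.x r q (O.s ^ 4 • b)⁆ := by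
    rw [X.x_x hpr' hrq0 hpo, hξ]
    simp only [smul_mul_assoc, mul_smul_comm, smul_smul, mul_assoc]
    congr 2; ring
  set t := O.s ^ 9 • (E.e (-p) * (a * E.e r * b)) with ht
  set W := X.x p r (O.s • (O.rho u * E.e (-p) * (O.s ^ 3 • a))) with hW
  set v := -(O.act u (-(O.s • (E.e (-p) * (O.s ^ 3 • a))))) with hv
  set N := X.x (-r) q (O.s • (O.rho v * E.e r * (O.s ^ 4 • b))) with hN
  set f := Z.z (O.rho u * E.e (-p) * (a * E.e r * b)) with hf
  have hVB : ⁅X.y r v, X.x r q (O.s ^ 4 • b)⁆ = N * X.y q (O.act u t) := by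
    rw [X.y_x hrq0 hrq1]
    refine congrArg (N * ·) (congrArg (X.y q) ?_)
    rw [hv, O.neg_act, neg_neg, O.act_act, ht]
    simp only [neg_mul, mul_neg, neg_neg, smul_mul_assoc, mul_smul_comm, smul_smul, mul_assoc,
      smul_neg]
    congr 2; ring
  have hWB : ⁅W, X.x r q (O.s ^ 4 • b)⁆ = f := by
    have h1 := Z.z_mid r hr (O.rho u * E.e (-p) * a) b
    simp only [mul_assoc] at h1
    rw [hf, mul_assoc, mul_assoc, h1, SDatum.mid, hW]
    simp only [smul_mul_assoc, mul_smul_comm, smul_smul, mul_assoc]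
    rw [← pow_succ']
  have hWξ : W * ξ * W⁻¹ = N⁻¹ * ξ := by
    rw [conj_eq_comm_mul, hW, X.x_star hpr, hξ, X.x_x hrp hpo hrq1, hN, hv, ← X.x_neg hrq1,
      O.rho_neg, O.rho_act]
    simp only [star_mul, E.star_e, O.star_smul, star_neg, neg_neg, mul_neg, neg_mul, mul_assoc,
          smul_mul_assoc, mul_smul_comm, smul_smul, E.e_self', smul_neg, star_star]
    congr 4; ring
  have hξf : ⁅ξ, f⁆ = X.y q (O.phi (-(star t * O.rho u * t))) := by
    rw [← comm_inv_comm, hξ, Z.opp_comm hpq hE, ht, O.phi_neg, O.phi_neg, X.y_neg, inv_inv,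
      ← O.phi_star]
    simp only [star_mul, E.star_e, O.star_smul, star_neg, neg_neg, mul_neg, neg_mul, mul_assoc,
          smul_mul_assoc, mul_smul_comm, smul_smul, E.e_self', smul_neg, star_star]
    congr 3; ring
  have hWN' : Commute W N := hWN _ _
  have hNx' : Commute N ξ := hNx _ _
  have hWY' : Commute W (X.y q (O.act u t)) := hWY _ _
  have hVx' : Commute (X.y r v) ξ := hVx _ _
  have hzy' : ∀ u, Commute f (X.y q u) := fun u => hzy _ _
  have hxy' : ∀ u, Commute ξ (X.y q u) := fun u => hxy _ _
  clear_value f N ξ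
  have e1 : X.y (-p) u * ξ * (X.y (-p) u)⁻¹ = ξ * X.y q (O.act u t) * f := by
    rw [hξd, conj_comm_eq, (hyB _).conj_eq, conj_eq_comm_mul, hyP, mul_assoc, comm_mul_left W, hWB,
      comm_mul_left, ← hξd, hVx'.conj_eq, hVB, conj_mul_eq, hWξ, (hWN'.mul_right hWY').conj_eq,
      hNx'.inv_left.eq]
    simp only [mul_assoc, inv_mul_cancel_left]
  calc ⁅X.y (-p) u, ξ⁆ = X.y q (O.act u t) * (ξ * f * ξ⁻¹) := by
        rw [commutatorElement_def, e1, (hxy' _).eq]; simp only [mul_assoc]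
    _ = _ := by
        rw [O.neg_act_neg, X.y_add, ← hξf, conj_eq_comm_mul, hξf, ← mul_assoc,
          ((hzy' _).mul_right (hzy' _)).eq]

/-- The crossed homomorphism argument of `y_comm`, now with conjugation by `X_{-p,q}`. -/
theorem y_comm_x (u : D) (c : R) : ⁅X.y (-p) u, X.x (-p) q (O.s ^ 8 • c)⁆ =
    Z.z (O.rho u * E.e (-p) * c) * X.y q (-(O.act u (-(O.s ^ 9 • (E.e (-p) * c))))) := by
  obtain ⟨j, hj⟩ := hE.nonempty
  have hpo : PartialOk p q (-p) q := by grind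
  have hzy : ∀ u c, Commute (Z.z c) (X.y q u) := fun u c =>
    (Z.comm_y hpq hE (by grind) (by grind) _ _).symm
  have hxy : ∀ u c, Commute (X.x (-p) q c) (X.y q u) := fun u c =>
    (X.y_x_comm hpo (by grind) (by grind) _ _).symm
  obtain ⟨h0, hadd, hneg⟩ := eq_of_crossed (z := fun c => X.x (-p) q (O.s ^ 8 • c))
    (f := fun c => ⁅X.y (-p) u, X.x (-p) q (O.s ^ 8 • c)⁆)
    (g := fun c => Z.z (O.rho u * E.e (-p) * c) *
      X.y q (-(O.act u (-(O.s ^ 9 • (E.e (-p) * c))))))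
    (fun a b => by rw [smul_add, X.x_add hpo, comm_mul_right]) (fun a b => by
      rw [conj_mul_eq, conj_eq_comm_mul _ (Z.z _), ← comm_inv_comm, Z.opp_comm hpq hE,
        (hxy _ _).conj_eq,
        mul_add, mul_add, smul_add, add_comm (O.s ^ 9 • (E.e (-p) * a)), neg_add, O.act_add,
        neg_add_rev, neg_add_rev, Z.z_add, X.y_add, X.y_add, ← O.phi_neg, ← X.y_neg, ← O.phi_neg,
        neg_neg]
      have e : star (-(star (-(O.s ^ 9 • (E.e (-p) * a))) * O.rho u * -(O.s ^ 9 • (E.e (-p) * b)))) =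
          -(O.s ^ 10 • (star (O.rho u * E.e (-p) * b) * E.e (-p) * O.s ^ 8 • a)) := by
        simp only [star_mul, E.star_e, O.star_smul, star_neg, neg_neg, mul_neg, neg_mul, mul_assoc,
          smul_mul_assoc, mul_smul_comm, smul_neg, smul_smul, star_star, E.e_self']
        congr 2; ring
      rw [← neg_neg (O.s ^ 10 • _), ← e, O.phi_neg (star _), O.phi_star, neg_neg]
      simp only [mul_assoc]
      congr 1
      rw [← mul_assoc, ← mul_assoc (X.y q _) (X.y q _), ← mul_assoc (X.y q _ * X.y q _) (Z.z _),
        (((hzy _ _).mul_right (hzy _ _))).eq.symm]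
      simp only [mul_assoc])
  refine hE.induction (i := -p) (by grind) hj (Q := fun c =>
    ⁅X.y (-p) u, X.x (-p) q (O.s ^ 8 • c)⁆ = Z.z (O.rho u * E.e (-p) * c) *
      X.y q (-(O.act u (-(O.s ^ 9 • (E.e (-p) * c)))))) ?_ h0 hadd hneg ?_ c
  · intro a h
    rwa [← mul_smul_comm, X.x_left hpo, mul_assoc, E.e_self', ← mul_assoc] at h
  exact fun r hr _ a b => Z.y_comm_x_mid hpq hE hr u a b

end Zeta

namespace SDatum

variable {K R D : Type*} [CommRing K] [NonUnitalRing R] [StarRing R] [Module K R]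
    [IsScalarTower K R R] [SMulCommClass K R R] [AddGroup D] {O : OBase K R D} {ι : Type}
    {E : EFam O ι} {G : Type*} [Group G] {p q j k l x : SIdx ι}
    (X : SDatum E (PartialOk p q) G) (hpq : p.abs ≠ q.abs)
include hpq

/-- Conjugate the relation for the commutator of `X_j(u)` and `X_{j,-p}(a)` by `X_q(v)`: it moves
`X_j(u)` by an element of `X_{-q,j}`, and this element produces the commutator on the right. -/
theorem y_y_mid (hj : j.Away p q) (u v : D) (a : R) :
    ⁅X.y q v, X.y (-p) (-(O.act u (-(O.s • (E.e j * a)))))⁆ =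
      X.mid (-q) (-p) j (-(O.s • (star (O.pi v) * O.pi u))) a := by
  have h1 : PartialOk p q j (-p) := by grind
  have h2 : PartialOk p q (-j) (-p) := by grind
  have h3 : PartialOk p q (-q) j := by grind
  have hqj : q.abs ≠ j.abs := by grind
  have hyN : ∀ c, Commute (X.y q v) (X.x (-j) (-p) c) := fun c =>
    X.y_x_comm h2 (by grind) (by grind) _ _
  have hyB : ∀ c, Commute (X.y q v) (X.x j (-p) c) := fun c =>
    X.y_x_comm h1 (by grind) (by grind) _ _
  have hTN : ∀ c d, Commute (X.x (-q) j c) (X.x (-j) (-p) d) := fun c d =>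
    X.x_comm h3 h2 (by grind) (by grind) (by grind) (by grind) _ _
  have hTw : ∀ c u, Commute (X.x (-q) j c) (X.y (-p) u) := fun c u =>
    (X.y_x_comm h3 (by grind) (by grind) _ _).symm
  have hwf : ∀ u c d, Commute (X.y (-p) u) (X.mid (-q) (-p) j c d) := fun u c d =>
    (X.ofOk (ok' := PartialOk (-q) (-p)) (by grind)).mid_comm_y (by grind) (by grind) (by grind)
      (by grind) _ _ _
  have hKB := X.y_x h1 h2 u a
  have hyK := X.y_y hqj h3 v u
  set w := -(O.act u (-(O.s • (E.e j * a)))) with hw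
  set N := X.x (-j) (-p) (O.s • (O.rho u * E.e j * a)) with hN
  set T := X.x (-q) j (-(O.s • (star (O.pi v) * O.pi u))) with hT
  have e1 : X.y q v * (N * X.y (-p) w) * (X.y q v)⁻¹ = N * X.y (-p) w * ⁅T, X.x j (-p) a⁆ := by
    rw [← hKB, conj_comm_eq, (hyB _).conj_eq, conj_eq_comm_mul, hyK, comm_mul_left, hKB,
      ((hTN _ _).mul_right (hTw _ _)).conj_eq]
  rw [conj_mul_eq, (hyN _).conj_eq, mul_assoc N, mul_right_inj, conj_eq_comm_mul] at e1
  have hf : ⁅T, X.x j (-p) a⁆ = X.mid (-q) (-p) j (-(O.s • (star (O.pi v) * O.pi u))) a := rfl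
  rw [hf, (hwf _ _ _).eq] at e1
  exact mul_right_cancel e1

end SDatum

namespace Zeta

variable {K R D : Type*} [CommRing K] [NonUnitalRing R] [StarRing R] [Module K R]
    [IsScalarTower K R R] [SMulCommClass K R R] [AddGroup D] {O : OBase K R D} {ι : Type}
    {E : EFam O ι} {G : Type*} [Group G] {p q j k l x : SIdx ι}
    {X : SDatum E (PartialOk p q) G} (Z : Zeta X p q)
    (hpq : p.abs ≠ q.abs) (hE : Decomposable E p q)
include hpq hE

/-- The exponents `3` and `5` become `4` and `4` in the dual `z_mid`: the commutator of `X_q` and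
`X_r` contributes one `s` to the first, and the action in `y_y_mid` uses up one `s` of the second.
-/
theorem y_comm_y (u v : D) (c : R) :
    ⁅X.y q (O.act v (O.s ^ 3 • E.e q)), X.y (-p) (O.act u (O.s ^ 5 • c))⁆ =
      Z.z (star (star (O.pi v) * O.pi u * c)) := by
  obtain ⟨j, hj⟩ := hE.nonempty
  have hyz : ∀ u c, Commute (X.y (-p) u) (Z.z c) := fun u c =>
    Z.comm_y hpq hE (by grind) (by grind) _ _
  have hyφ : ∀ u c, Commute (X.y q u) (X.y (-p) (O.phi (O.s • c))) := fun u c => by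
    have := (X.ofOk (ok' := PartialOk (-q) (-p)) (by grind)).y_comm_y_phi (by grind)
      (hE.flip (by grind)) u c
    rwa [neg_neg] at this
  set y := X.y q (O.act v (O.s ^ 3 • E.e q)) with hy
  -- Additivity in the argument of the action fails only by a `φ`-term, which commutes with `y`
  -- because it is a multiple of `s`.
  have key : ∀ u a b d, ⁅y, X.y (-p) (O.act u (O.s ^ 5 • b))⁆ = Z.z d →
      ⁅y, X.y (-p) (O.act u (O.s ^ 5 • (a + b)))⁆ =
        ⁅y, X.y (-p) (O.act u (O.s ^ 5 • a))⁆ * Z.z d := by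
    intro u a b d h
    have e : star (O.s ^ 5 • b) * O.rho u * O.s ^ 5 • a =
        O.s • (O.s ^ 9 • (star b * O.rho u * a)) := by
      simp only [O.star_smul, smul_mul_assoc, mul_smul_comm, smul_smul]
      congr 1; ring
    have h2 : Commute y (X.y (-p) (O.phi (O.s • (O.s ^ 9 • (star b * O.rho u * a))))) := hyφ _ _
    rw [smul_add, O.act_add, e, O.add_phi, X.y_add, X.y_add, mul_assoc, comm_mul_right,
      h2.comm_eq_one, one_mul, comm_mul_right, h, (hyz _ _).conj_eq, conj_mul_eq,
      (hyz _ _).conj_eq, Commute.conj_eq (commute_comm h2.symm ?_)]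
    exact (X.y_comm_phi _ _ _).symm
  have hc : ∀ u, ⁅y, X.y (-p) (O.act u (O.s ^ 5 • (c * E.e (-p))))⁆ =
      Z.z (star (star (O.pi v) * O.pi u * (c * E.e (-p)))) := by
    refine EFam.span_induction_right (hE.away (-p) (by grind) j hj) (Q := fun c => ∀ u,
      ⁅y, X.y (-p) (O.act u (O.s ^ 5 • c))⁆ = Z.z (star (star (O.pi v) * O.pi u * c)))
      ?_ ?_ ?_ ?_ c
    · intro u
      rw [smul_zero, O.act_zero, X.y_zero, commutatorElement_one_right, mul_zero, star_zero,
        Z.z_zero]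
    · intro a b ha hb u
      rw [key _ _ _ _ (hb u), ha, ← Z.z_add, mul_add, star_add]
    · intro a ha u
      have h := key u (-a) a _ (ha u)
      rw [neg_add_cancel, smul_zero, O.act_zero, X.y_zero, commutatorElement_one_right] at h
      rw [mul_neg, star_neg, Z.z_neg]
      exact eq_inv_of_mul_eq_one_left h.symm
    · intro r hr a b u
      have h := X.y_y_mid hpq hr.1 (O.act u a) (O.act v (O.s ^ 3 • E.e q)) (O.s ^ 4 • b)
      have h1 : O.s ^ 5 • (a * E.e r * b) = a * (O.s ^ 5 • (E.e r * b)) := by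
        simp only [mul_smul_comm, mul_assoc]
      have h2 := O.neg_act_neg (O.act u a) (O.s ^ 5 • (E.e r * b))
      have h3 : O.s • (E.e r * O.s ^ 4 • b) = O.s ^ 5 • (E.e r * b) := by
        simp only [mul_smul_comm, smul_smul]
        congr 1; ring
      have h4 : -(star (O.s ^ 5 • (E.e r * b)) * O.rho (O.act u a) * O.s ^ 5 • (E.e r * b)) =
          O.s • (-(O.s ^ 9 • (star (E.e r * b) * O.rho (O.act u a) * (E.e r * b)))) := by
        simp only [O.star_smul, smul_mul_assoc, mul_smul_comm, smul_smul, smul_neg]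
        congr 2; ring
      rw [h3, h2, h4, X.y_add, comm_mul_right_of_commute' (hyφ _ _)] at h
      have h5 := (Z.dual hpq).z_mid r (by grind) (-(star (O.pi v) * O.pi u * a)) b
      change Z.z (-star (-(star (O.pi v) * O.pi u * a) * E.e r * b)) =
        X.mid (-q) (-p) r (O.s ^ 4 • -(star (O.pi v) * O.pi u * a)) (O.s ^ 4 • b) at h5
      rw [neg_mul, neg_mul, star_neg, neg_neg] at h5
      have h6 : -(O.s • (star (O.pi (O.act v (O.s ^ 3 • E.e q))) * O.pi (O.act u a))) =
          E.e (-q) * (O.s ^ 4 • -(star (O.pi v) * O.pi u * a)) := by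
        rw [O.pi_act, O.pi_act]
        simp only [star_mul, E.star_e, O.star_smul, mul_neg, neg_mul, mul_assoc,
          smul_mul_assoc, mul_smul_comm, smul_neg, smul_smul]
        congr 2; ring
      rw [h1, ← O.act_act, h, h6, SDatum.mid, X.x_left (by grind), ← SDatum.mid, ← h5]
      simp only [mul_assoc]
  have h1 : star (star (O.pi v) * O.pi u * (c * E.e (-p))) =
      E.e p * star (star (O.pi v) * O.pi u * c) := by
    simp only [star_mul, E.star_e, neg_neg, mul_assoc]
  rw [← Z.z_left, ← h1, ← hc]
  congr 1
  refine X.y_congr ?_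
  simp only [O.act_act, smul_mul_assoc, mul_assoc, E.e_self]

end Zeta

/-! ### Extension to all roots -/

/-- The pairs of indices of the root subgroups `X_{pq}` and `X_{qp}`. -/
@[grind =]
def SIdx.Bad {ι : Type} (p q i j : SIdx ι) : Prop :=
  (i = p ∧ j = q) ∨ (i = q ∧ j = p) ∨ (i = -p ∧ j = -q) ∨ (i = -q ∧ j = -p)

/-- A morphism from the homotope with the parameter `s ^ 11` to the homotope with the
parameter `s`. -/
structure OBase.Shift {K R D D' : Type*} [CommRing K] [NonUnitalRing R] [StarRing R] [Module K R]
    [IsScalarTower K R R] [SMulCommClass K R R] [AddGroup D] [AddGroup D'] (O' : OBase K R D')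
    (O : OBase K R D) where
  tr : D' → D
  s_eq : O'.s = O.s ^ 11
  tr_add : ∀ u v, tr (u + v) = tr u + tr v
  tr_act : ∀ u a, tr (O'.act u a) = O.act (tr u) a
  tr_phi : ∀ a, tr (O'.phi a) = O.phi (O.s ^ 10 • a)
  pi_tr : ∀ u, O.pi (tr u) = O.s ^ 10 • O'.pi u
  rho_tr : ∀ u, O.rho (tr u) = O.s ^ 10 • O'.rho u
  -- A factor `s^k` of the total shift can be moved into the ring argument. It counts twice on the
  -- augmentation, which leaves `s^l` there, while `π(w)` keeps the exponent `k + l`.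
  exists_scale : ∀ k l, 2 * k + l = 10 → ∀ u, ∃ w, O.pi w = O.s ^ (k + l) • O'.pi u ∧
    ∀ a, O.act (tr u) a = O.act w (O.s ^ k • a)

namespace SDatum

variable {K R D D' : Type*} [CommRing K] [NonUnitalRing R] [StarRing R] [Module K R]
    [IsScalarTower K R R] [SMulCommClass K R R] [AddGroup D] [AddGroup D'] {O : OBase K R D}
    {O' : OBase K R D'} {ι : Type}
    {E : EFam O ι} {E' : EFam O' ι} {G : Type*} [Group G] {p q : SIdx ι}
    (X : SDatum E (PartialOk p q) G)

/-- Substitutes for all missing root subgroups. -/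
structure ZetaFam where
  z : SIdx ι → SIdx ι → R → G
  zeta : ∀ {i j} (h : SIdx.Bad p q i j), ∃ Z : Zeta (X.ofOk (ok' := PartialOk i j) (by grind)) i j,
    Z.z = z i j
  z_star : ∀ {i j} (h : SIdx.Bad p q i j) c, z i j c = z (-j) (-i) (-star c)

variable (hpq : p.abs ≠ q.abs) (hE : Decomposable E p q)
include hpq hE

open Classical in
-- The parametrisations of `X_{pq}` and `X_{qp}` are chosen independently; those for the negated
-- pairs are defined as their duals, so that `z_star` holds by construction.
theorem exists_zetaFam : Nonempty (ZetaFam X) := by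
  obtain ⟨Z1⟩ := X.exists_zeta hpq hE
  obtain ⟨Z2⟩ := (X.ofOk (ok' := PartialOk q p) (by grind)).exists_zeta hpq.symm
    (hE.flip (by grind))
  have n1 : p ≠ q := by grind
  have n2 : p ≠ -q := by grind
  have n3 : q ≠ -p := by grind
  let z : SIdx ι → SIdx ι → R → G := fun i j =>
    if i = p ∧ j = q then Z1.z else if i = q ∧ j = p then Z2.z else
    if i = -q ∧ j = -p then (Z1.dual hpq).z else (Z2.dual hpq.symm).z
  have z1 : z p q = Z1.z := if_pos ⟨rfl, rfl⟩
  have z2 : z q p = Z2.z := (if_neg (by grind)).trans (if_pos ⟨rfl, rfl⟩)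
  have z3 : z (-q) (-p) = (Z1.dual hpq).z :=
    (if_neg (by grind)).trans <| (if_neg (by grind)).trans (if_pos ⟨rfl, rfl⟩)
  have z4 : z (-p) (-q) = (Z2.dual hpq.symm).z :=
    (if_neg (by grind)).trans <| (if_neg (by grind)).trans (if_neg (by grind))
  refine ⟨z, ?_, ?_⟩
  · rintro i j (⟨rfl, rfl⟩ | ⟨rfl, rfl⟩ | ⟨rfl, rfl⟩ | ⟨rfl, rfl⟩)
    · exact ⟨Z1, z1.symm⟩
    · exact ⟨Z2, z2.symm⟩
    · exact ⟨Z2.dual hpq.symm, z4.symm⟩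
    · exact ⟨Z1.dual hpq, z3.symm⟩
  · rintro i j (⟨rfl, rfl⟩ | ⟨rfl, rfl⟩ | ⟨rfl, rfl⟩ | ⟨rfl, rfl⟩) c
    · rw [z1, z3]
      change _ = Z1.z (-star (-star c))
      rw [star_neg, neg_neg, star_star]
    · rw [z2, z4]
      change _ = Z2.z (-star (-star c))
      rw [star_neg, neg_neg, star_star]
    · rw [neg_neg, neg_neg, z2, z4]
      rfl
    · rw [neg_neg, neg_neg, z1, z3]
      rfl

end SDatum

namespace SDatum.ZetaFam

variable {K R D D' : Type*} [CommRing K] [NonUnitalRing R] [StarRing R] [Module K R]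
    [IsScalarTower K R R] [SMulCommClass K R R] [AddGroup D] [AddGroup D'] {O : OBase K R D}
    {O' : OBase K R D'} {ι : Type}
    {E : EFam O ι} {E' : EFam O' ι} {G : Type*} [Group G] {p q i j k l : SIdx ι}
    {X : SDatum E (PartialOk p q) G} (Z : ZetaFam X)

open Classical in
/-- The root elements for all roots. -/
noncomputable def root (i j : SIdx ι) (a : R) : G :=
  -- The exponents `1` and `10` match all commutator formulas with the new parameter `s^11`: two
  -- good roots give `1 + 10 + 10 = 10 + 11`, and a bad and a good one give `10 + 1 + 10`.
  if SIdx.Bad p q i j then Z.z i j (O.s • a) else X.x i j (O.s ^ 10 • a)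

theorem root_bad (h : SIdx.Bad p q i j) (a : R) : Z.root i j a = Z.z i j (O.s • a) := if_pos h

theorem root_good (h : ¬SIdx.Bad p q i j) (a : R) : Z.root i j a = X.x i j (O.s ^ 10 • a) :=
  if_neg h

variable (hpq : p.abs ≠ q.abs) (hE : Decomposable E p q)
include hpq hE

theorem bad_abs (h : SIdx.Bad p q i j) : i.abs ≠ j.abs := by grind

theorem bad_decomposable (h : SIdx.Bad p q i j) : Decomposable E i j := hE.flip (by grind)

theorem root_comm (hij : i.abs ≠ j.abs) (hkl : k.abs ≠ l.abs) (h1 : i ≠ l) (h2 : l ≠ -j)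
    (h3 : j ≠ k) (h4 : k ≠ -i) (a b : R) : Commute (Z.root i j a) (Z.root k l b) := by
  by_cases b1 : SIdx.Bad p q i j <;> by_cases b2 : SIdx.Bad p q k l
  · rw [Z.root_bad b1, Z.root_bad b2]
    have : (k = i ∧ l = j) ∨ (k = -j ∧ l = -i) := by grind
    obtain ⟨W, hW⟩ := Z.zeta b1
    rcases this with ⟨rfl, rfl⟩ | ⟨rfl, rfl⟩
    · rw [← hW]; exact W.z_comm _ _
    · rw [Z.z_star b2, neg_neg, neg_neg, ← hW]; exact W.z_comm _ _
  · rw [Z.root_bad b1, Z.root_good b2]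
    obtain ⟨W, hW⟩ := Z.zeta b1
    rw [← hW]
    exact (W.comm_x (bad_abs hpq hE b1) (bad_decomposable hpq hE b1) (by grind) (by grind)
      (by grind) (by grind) (by grind) _ _).symm
  · rw [Z.root_good b1, Z.root_bad b2]
    obtain ⟨W, hW⟩ := Z.zeta b2
    rw [← hW]
    exact (W.comm_x (bad_abs hpq hE b2) (bad_decomposable hpq hE b2) (by grind) (by grind)
      (by grind) (by grind) (by grind) _ _)
  · rw [Z.root_good b1, Z.root_good b2]
    exact X.x_comm (by grind) (by grind) h1 h2 h3 h4 _ _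

theorem root_root (hij : i.abs ≠ j.abs) (hjk : j.abs ≠ k.abs) (hik : i.abs ≠ k.abs) (a b : R) :
    ⁅Z.root i j a, Z.root j k b⁆ = Z.root i k (O.s ^ 11 • (a * E.e j * b)) := by
  by_cases b1 : SIdx.Bad p q i j
  · obtain ⟨W, hW⟩ := Z.zeta b1
    rw [Z.root_bad b1, Z.root_good (by grind), Z.root_good (by grind), ← hW]
    refine (W.comm_next (bad_abs hpq hE b1) (bad_decomposable hpq hE b1) (by grind) _ _).trans ?_
    simp only [smul_mul_assoc, mul_smul_comm, smul_smul]
    exact congrArg (X.x i k) (by congr 1; ring)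
  by_cases b2 : SIdx.Bad p q j k
  · obtain ⟨W, hW⟩ := Z.zeta b2
    rw [Z.root_bad b2, Z.root_good (by grind), Z.root_good (by grind), ← hW, ← comm_inv_comm,
      inv_eq_iff_eq_inv, ← X.x_neg (by grind)]
    refine (W.prev_comm (bad_abs hpq hE b2) (bad_decomposable hpq hE b2) (by grind) _ _).trans ?_
    simp only [smul_mul_assoc, mul_smul_comm, smul_smul]
    exact congrArg (X.x i k) (by congr 2; ring)
  rw [Z.root_good b1, Z.root_good b2]
  -- With a missing root as the value, the relation is `z_mid` for arguments scaled by `s^6`: `4 + 6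
  -- = 10` on the left and `6 + 6 = 1 + 11` on the right.
  by_cases b3 : SIdx.Bad p q i k
  · obtain ⟨W, hW⟩ := Z.zeta b3
    have h := W.z_mid j (by grind) (O.s ^ 6 • a) (O.s ^ 6 • b)
    simp only [smul_smul, ← pow_add] at h
    rw [Z.root_bad b3, ← hW]
    refine h.symm.trans ?_
    simp only [smul_mul_assoc, mul_smul_comm, smul_smul]
    congr 2; ring
  · rw [Z.root_good b3, X.x_x (by grind) (by grind) (by grind)]
    simp only [smul_mul_assoc, mul_smul_comm, smul_smul]
    congr 2; ring

theorem root_opp (hij : i.abs ≠ j.abs) (a b : R) :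
    ⁅Z.root i j a, Z.root j (-i) b⁆ =
      X.y (-i) (O.phi (O.s ^ 10 • (O.s ^ 11 • (a * E.e j * b)))) := by
  by_cases b1 : SIdx.Bad p q i j
  · obtain ⟨W, hW⟩ := Z.zeta b1
    rw [Z.root_bad b1, Z.root_good (by grind), ← hW]
    refine (W.comm_opp (bad_abs hpq hE b1) (bad_decomposable hpq hE b1) _ _).trans ?_
    simp only [smul_mul_assoc, mul_smul_comm, smul_smul]
    exact congrArg (fun x => X.y _ (O.phi x)) (by congr 1; ring)
  by_cases b2 : SIdx.Bad p q j (-i)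
  · obtain ⟨W, hW⟩ := Z.zeta b2
    have h := W.opp_comm (bad_abs hpq hE b2) (bad_decomposable hpq hE b2) (O.s • b)
      (-star (O.s ^ 10 • a))
    change ⁅W.z _, X.x (-j) (-i) _⁆ = X.y (-i) _ at h
    rw [← X.x_star (by grind)] at h
    rw [Z.root_bad b2, Z.root_good (by grind), ← hW, ← comm_inv_comm, h, ← X.y_neg, ← O.phi_star]
    simp only [star_mul, E.star_e, O.star_smul, star_neg, neg_neg, mul_neg, neg_mul, mul_assoc,
          smul_mul_assoc, mul_smul_comm, smul_neg, smul_smul, star_star]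
    congr 3; ring
  · rw [Z.root_good b1, Z.root_good b2, X.x_y (by grind) (by grind)]
    simp only [smul_mul_assoc, mul_smul_comm, smul_smul]
    congr 3; ring

variable (T : O'.Shift O)
include T

theorem y_y_root (hij : i.abs ≠ j.abs) (u v : D') : ⁅X.y i (T.tr u), X.y j (T.tr v)⁆ =
    Z.root (-i) j (-(O.s ^ 11 • (star (O'.pi u) * O'.pi v))) := by
  by_cases b : SIdx.Bad p q (-i) j
  · have b' : SIdx.Bad p q (-j) i := by grind
    obtain ⟨W, hW⟩ := Z.zeta b'
    -- The splittings provide the explicit factors `s^3` and `s^5` that `y_comm_y` requires; the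
    -- values of `π` then carry `s^7` and `s^5`, together `s^12 = s * s^11`.
    obtain ⟨u', h1, h2⟩ := T.exists_scale 3 4 rfl u
    obtain ⟨v', h3, h4⟩ := T.exists_scale 5 0 rfl v
    have h := W.y_comm_y (bad_abs hpq hE b') (bad_decomposable hpq hE b') v' u' (E.e j)
    rw [neg_neg] at h
    have e1 : X.y i (T.tr u) = X.y i (O.act u' (O.s ^ 3 • E.e i)) := by
      rw [← h2, X.y_e]
    have e2 : X.y j (T.tr v) = X.y j (O.act v' (O.s ^ 5 • E.e j)) := by
      rw [← h4, X.y_e]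
    have e3 : star (star (O.pi u') * O.pi v' * E.e j) =
        E.e (-j) * star (star (O.pi u') * O.pi v') := by
      simp only [star_mul, E.star_e]
    rw [e1, e2]
    refine h.trans ?_
    rw [e3, W.z_left, Z.root_bad b, Z.z_star b, neg_neg, ← hW, h1, h3]
    simp only [star_mul, E.star_e, O.star_smul, star_neg, neg_neg, mul_neg, neg_mul, mul_assoc,
          smul_mul_assoc, mul_smul_comm, smul_neg, smul_smul, star_star]
    congr 2; ring
  · rw [Z.root_good b, X.y_y hij (by grind), T.pi_tr, T.pi_tr]
    simp only [O.star_smul, smul_mul_assoc, mul_smul_comm, smul_neg, smul_smul]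
    congr 3; ring

theorem y_root (hij : i.abs ≠ j.abs) (u : D') (a : R) : ⁅X.y i (T.tr u), Z.root i j a⁆ =
    Z.root (-i) j (O.s ^ 11 • (O'.rho u * E.e i * a)) *
      X.y j (-(O.act (T.tr u) (-(O.s ^ 11 • (E.e i * a))))) := by
  by_cases b1 : SIdx.Bad p q i j
  · obtain ⟨W, hW⟩ := Z.zeta b1
    rw [Z.root_bad b1, Z.root_good (by grind), ← hW]
    refine (W.y_comm (bad_abs hpq hE b1) (bad_decomposable hpq hE b1) _ _).trans ?_
    rw [T.rho_tr]
    simp only [smul_mul_assoc, mul_smul_comm, smul_smul]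
    refine congrArg₂ (· * ·) (congrArg (X.x (-i) j) ?_) (congrArg (X.y j) ?_)
    · congr 1; ring
    · congr 4; ring
  by_cases b2 : SIdx.Bad p q (-i) j
  · obtain ⟨W, hW⟩ := Z.zeta b2
    have h := W.y_comm_x (bad_abs hpq hE b2) (bad_decomposable hpq hE b2) (T.tr u) (O.s ^ 2 • a)
    rw [neg_neg] at h
    rw [Z.root_good b1, Z.root_bad b2, ← hW]
    rw [smul_smul, ← pow_add] at h
    refine h.trans ?_
    rw [T.rho_tr]
    simp only [smul_mul_assoc, mul_smul_comm, smul_smul]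
    refine congrArg₂ (· * ·) (congrArg W.z ?_) (congrArg (X.y j) ?_)
    · congr 1; ring
    · congr 4; ring
  · rw [Z.root_good b1, Z.root_good b2, X.y_x (by grind) (by grind), T.rho_tr]
    simp only [smul_mul_assoc, mul_smul_comm, smul_smul]
    refine congrArg₂ (· * ·) (congrArg (X.x (-i) j) ?_) (congrArg (X.y j) ?_)
    · congr 1; ring
    · congr 4; ring

/-- The Steinberg datum for all roots over a deeper homotope. -/
noncomputable def extend (he : ∀ i, E'.e i = E.e i) : SDatum E' (fun i j => i.abs ≠ j.abs) G where
  x := Z.root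
  y i u := X.y i (T.tr u)
  x_e {i j} hij a := by
    by_cases b : SIdx.Bad p q i j
    · obtain ⟨W, hW⟩ := Z.zeta b
      rw [Z.root_bad b, Z.root_bad b, ← hW, ← W.z_e (O.s • a), he, he]
      simp only [smul_mul_assoc, mul_smul_comm]
    · rw [Z.root_good b, Z.root_good b, ← X.x_e (by grind) (_ • a), he, he]
      simp only [smul_mul_assoc, mul_smul_comm]
  y_e i u := by rw [T.tr_act, he, X.y_e]
  x_star {i j} hij a := by
    by_cases b : SIdx.Bad p q i j
    · rw [Z.root_bad b, Z.root_bad (by grind), Z.z_star b, smul_neg, O.star_smul]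
    · rw [Z.root_good b, Z.root_good (by grind), X.x_star (by grind), smul_neg, O.star_smul]
  x_add {i j} hij a b := by
    by_cases h : SIdx.Bad p q i j
    · obtain ⟨W, hW⟩ := Z.zeta h
      rw [Z.root_bad h, Z.root_bad h, Z.root_bad h, ← hW, ← W.z_add, smul_add]
    · rw [Z.root_good h, Z.root_good h, Z.root_good h, ← X.x_add (by grind), smul_add]
  y_add i u v := by rw [T.tr_add, X.y_add]
  x_comm hij hkl h1 h2 h3 h4 a b := Z.root_comm hpq hE hij hkl h1 h2 h3 h4 a b
  x_x hij hjk hik a b := by rw [Z.root_root hpq hE hij hjk hik, T.s_eq, he]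
  x_y {i j} hij hjk a b := by rw [Z.root_opp hpq hE hij, T.tr_phi, T.s_eq, he]
  y_y hij _ u v := by rw [Z.y_y_root hpq hE T hij, T.s_eq]
  y_x_comm {i j k} hjk h1 h2 u a := by
    by_cases b : SIdx.Bad p q j k
    · obtain ⟨W, hW⟩ := Z.zeta b
      rw [Z.root_bad b, ← hW]
      exact W.comm_y (bad_abs hpq hE b) (bad_decomposable hpq hE b) h1.symm h2 _ _
    · rw [Z.root_good b]
      exact X.y_x_comm (by grind) h1 h2 _ _
  y_x {i j} hij _ u a := by
    have h : ∀ v, T.tr (-v) = -T.tr v := fun v =>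
      (AddMonoidHom.mk' T.tr T.tr_add).map_neg v
    rw [Z.y_root hpq hE T hij, T.s_eq, he, h, T.tr_act]

end SDatum.ZetaFam

/-! ### Refinement of a family of idempotents -/

namespace SDatum

variable {K R D : Type*} [CommRing K] [NonUnitalRing R] [StarRing R] [Module K R]
    [IsScalarTower K R R] [SMulCommClass K R R] [AddGroup D] {O : OBase K R D} {κ : Type}
    {E : EFam O κ} {G : Type*} [Group G] {i j k l : SIdx κ}
    (X : SDatum E (fun i j => i.abs ≠ j.abs) G)
include X

/-- Root subgroups that commute in the fine system may have adjacent roots in the coarse one; they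
still commute because the product of their parameters passes through orthogonal idempotents. -/
theorem x_commute_of_mul_eq_zero (hij : i.abs ≠ j.abs) (hjk : j.abs ≠ k.abs) (hik : i ≠ k) {a b : R}
    (h : a * E.e j * b = 0) : Commute (X.x i j a) (X.x j k b) := by
  rw [← commutatorElement_eq_one_iff_commute]
  by_cases h' : k = -i
  · subst h'
    rw [X.x_y hij hjk, h, smul_zero, O.phi_zero, X.y_zero]
  · have hik' : i.abs ≠ k.abs := by grind [SIdx.abs_eq_iff]
    rw [X.x_x hij hjk hik', h, smul_zero, X.x_zero hik']

theorem y_commute_of_mul_eq_zero (hij : i.abs ≠ j.abs) {u : D} {a : R} (h : O.rho u * E.e i * a = 0)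
    (h' : O.act u (-(O.s • (E.e i * a))) = 0) : Commute (X.y i u) (X.x i j a) := by
  have h1 : (-i).abs ≠ j.abs := by grind
  rw [← commutatorElement_eq_one_iff_commute, X.y_x hij h1, h, h', smul_zero, X.x_zero h1, neg_zero,
    X.y_zero, one_mul]

end SDatum

/-- A family of idempotents such that the idempotents of another one are sums of at most two of
its members. -/
structure Refinement {K R D : Type*} [CommRing K] [NonUnitalRing R] [StarRing R] [Module K R]
    [IsScalarTower K R R] [SMulCommClass K R R] [AddGroup D] {O : OBase K R D} {ι κ : Type}
    (E : EFam O ι) (E' : EFam O κ) (p q : SIdx ι) where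
  bar : SIdx ι → SIdx κ
  bar_neg : ∀ i, bar (-i) = -bar i
  eq_or_bad : ∀ {i j}, bar i = bar j → i = j ∨ SIdx.Bad p q i j
  e_mul : ∀ i, E'.e (bar i) * E.e i = E.e i

namespace Refinement

variable {K R D : Type*} [CommRing K] [NonUnitalRing R] [StarRing R] [Module K R]
    [IsScalarTower K R R] [SMulCommClass K R R] [AddGroup D] {O : OBase K R D} {ι κ : Type}
    {E : EFam O ι} {E' : EFam O κ} {p q : SIdx ι} (B : Refinement E E' p q)

include B in
theorem mul_e (i : SIdx ι) : E.e i * E'.e (B.bar i) = E.e i := by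
  have h := congrArg star (B.e_mul (-i))
  rwa [star_mul, E.star_e, E'.star_e, B.bar_neg, neg_neg, neg_neg] at h

theorem bar_abs {i j : SIdx ι} (h : B.bar i ≠ B.bar j) (h' : B.bar i ≠ -B.bar j) :
    (B.bar i).abs ≠ (B.bar j).abs := by
  grind [SIdx.abs_eq_iff]

variable (hpq : p.abs ≠ q.abs) {G : Type*} [Group G] (X : SDatum E' (fun i j => i.abs ≠ j.abs) G)

open Classical in
/-- The root elements of the refined family. -/
noncomputable def root (i j : SIdx ι) (a : R) : G :=
  -- A short root of the fine family such as that of `X_{-q,p}` collapses to a long root of the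
  -- coarse family, and its elements are found through `φ`.
  if B.bar i = -B.bar j then X.y (B.bar j) (O.phi (E.e i * a * E.e j))
  else X.x (B.bar i) (B.bar j) (E.e i * a * E.e j)

theorem root_opp {i j : SIdx ι} (h : B.bar i = -B.bar j) (a : R) :
    B.root X i j a = X.y (B.bar j) (O.phi (E.e i * a * E.e j)) := if_pos h

theorem root_ne {i j : SIdx ι} (h : B.bar i ≠ -B.bar j) (a : R) :
    B.root X i j a = X.x (B.bar i) (B.bar j) (E.e i * a * E.e j) := if_neg h

include hpq

theorem bar_ne {i j : SIdx ι} (h : PartialOk p q i j) : B.bar i ≠ B.bar j := by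
  intro e
  have := B.eq_or_bad e
  grind

theorem root_star {i j : SIdx ι} (h : PartialOk p q i j) (a : R) :
    B.root X i j a = B.root X (-j) (-i) (-star a) := by
  have e : E.e (-j) * -star a * E.e (-i) = -star (E.e i * a * E.e j) := by
    simp only [star_mul, E.star_e, mul_neg, neg_mul, mul_assoc]
  have hb := B.bar_neg
  by_cases h1 : B.bar i = -B.bar j
  · rw [B.root_opp X h1, B.root_opp X (by grind), e, O.phi_neg, O.phi_star, _root_.neg_neg, hb, h1,
      _root_.neg_neg]
  · rw [B.root_ne X h1, B.root_ne X (by grind), e, X.x_star (B.bar_abs (B.bar_ne hpq h) h1), hb, hb]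

variable {i j k l : SIdx ι}

omit hpq in
-- Different indices with equal images occur only among `±p` and `±q`, whose images coincide up to
-- sign.
theorem eq_or_eq_neg (h1 : i ≠ k) (h2 : j ≠ l) (e1 : B.bar i = B.bar k) (e2 : B.bar j = B.bar l) :
    B.bar i = B.bar j ∨ B.bar i = -B.bar j := by
  have hb := B.bar_neg
  rcases (B.eq_or_bad e1).resolve_left h1 with ⟨rfl, rfl⟩ | ⟨rfl, rfl⟩ | ⟨rfl, rfl⟩ | ⟨rfl, rfl⟩ <;>
  rcases (B.eq_or_bad e2).resolve_left h2 with ⟨rfl, rfl⟩ | ⟨rfl, rfl⟩ | ⟨rfl, rfl⟩ | ⟨rfl, rfl⟩ <;>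
  simp_all

/-- `ρ(φ(c)) = c - c̄` for `c = e_i a e_j`, and both summands are killed by `e_k` on the right since
`k` is neither `j` nor `-i`. -/
theorem phi_commute {a b : R} (h1 : j ≠ k) (h2 : k ≠ -i) (hij : B.bar i = -B.bar j)
    (hkl : (B.bar k).abs ≠ (B.bar l).abs) (hjk : B.bar j = B.bar k) :
    Commute (X.y (B.bar j) (O.phi (E.e i * a * E.e j)))
      (X.x (B.bar k) (B.bar l) (E.e k * b * E.e l)) := by
  have h3 : -i ≠ k := h2.symm
  rw [hjk]
  refine X.y_commute_of_mul_eq_zero hkl ?_ ?_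
  · have := B.e_mul k
    rw [O.rho_phi, mul_assoc, ← mul_assoc (E'.e _), ← mul_assoc (E'.e _), this]
    simp only [sub_mul, mul_assoc, star_mul, E.star_e, E.e_ne' h1, E.e_ne' h3, mul_zero, sub_zero]
  · have := B.e_mul k
    rw [O.phi_act, ← mul_assoc (E'.e _), ← mul_assoc (E'.e _), this]
    simp only [mul_assoc, mul_neg, mul_smul_comm, E.e_ne' h1, mul_zero, smul_zero, neg_zero,
      O.phi_zero]

/-- Cases according to which of the two roots collapse to long roots and which coarse indices become
adjacent. Each adjacent case is reduced, if necessary by the involution, to a vanishing product of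
idempotents. -/
theorem root_commute (hij : PartialOk p q i j) (hkl : PartialOk p q k l) (h1 : i ≠ l) (h2 : l ≠ -j)
    (h3 : j ≠ k) (h4 : k ≠ -i) (a b : R) : Commute (B.root X i j a) (B.root X k l b) := by
  have hb := B.bar_neg
  have key : ∀ {i j k l : SIdx ι}, PartialOk p q i j → PartialOk p q k l → i ≠ l → l ≠ -j → j ≠ k →
      k ≠ -i → B.bar i = -B.bar j → B.bar k ≠ -B.bar l → ∀ a b,
      Commute (B.root X i j a) (B.root X k l b) := by
    intro i j k l hij hkl h1 h2 h3 h4 b1 b2 a b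
    have hkl' := B.bar_abs (B.bar_ne hpq hkl) b2
    by_cases c1 : B.bar j = B.bar k
    · rw [B.root_opp X b1, B.root_ne X b2]
      exact B.phi_commute hpq X h3 h4 b1 hkl' c1
    by_cases c2 : B.bar j = -B.bar l
    · rw [B.root_star hpq X hkl, B.root_opp X b1, B.root_ne X (by grind)]
      exact B.phi_commute hpq X (by grind) (by grind) b1 (by grind) (by grind)
    rw [B.root_opp X b1, B.root_ne X b2]
    exact X.y_x_comm hkl' (Ne.symm c1) c2 _ _
  by_cases b1 : B.bar i = -B.bar j <;> by_cases b2 : B.bar k = -B.bar l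
  · rw [B.root_opp X b1, B.root_opp X b2]
    have e1 := B.eq_or_bad (b1.trans (hb j).symm)
    have e2 := B.eq_or_bad (b2.trans (hb l).symm)
    have : B.bar l = B.bar j := by
      have h5 : l = j ∨ k = i ∨ l = -i ∨ k = -j := by clear b1 b2; grind
      rcases h5 with rfl | rfl | rfl | rfl <;> grind
    rw [this]
    exact X.y_comm_phi _ _ _
  · exact key hij hkl h1 h2 h3 h4 b1 b2 a b
  · exact (key hkl hij (by grind) (by grind) (by grind) (by grind) b2 b1 b a).symm
  have hij' := B.bar_abs (B.bar_ne hpq hij) b1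
  have hkl' := B.bar_abs (B.bar_ne hpq hkl) b2
  have key2 : ∀ {i j k l : SIdx ι}, (B.bar i).abs ≠ (B.bar j).abs → (B.bar k).abs ≠ (B.bar l).abs →
      j ≠ k → B.bar i ≠ B.bar l → B.bar j = B.bar k → ∀ a b,
      Commute (X.x (B.bar i) (B.bar j) (E.e i * a * E.e j))
        (X.x (B.bar k) (B.bar l) (E.e k * b * E.e l)) := by
    intro i j k l hij hkl h1 h2 h3 a b
    have := B.mul_e j
    rw [← h3] at hkl ⊢
    refine X.x_commute_of_mul_eq_zero hij hkl h2 ?_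
    rw [mul_assoc _ (E.e j), this]
    simp only [mul_assoc, E.e_ne' h1, mul_zero]
  have n1 := B.bar_ne hpq hij
  have n2 := B.bar_ne hpq hkl
  by_cases c1 : B.bar j = B.bar k
  · rw [B.root_ne X b1, B.root_ne X b2]
    refine key2 hij' hkl' h3 (fun e => ?_) c1 _ _
    have := B.eq_or_eq_neg h1 h3 e c1
    grind
  by_cases c2 : B.bar i = B.bar l
  · rw [B.root_ne X b1, B.root_ne X b2]
    exact (key2 hkl' hij' h1.symm (by grind) c2.symm _ _).symm
  by_cases c3 : B.bar l = -B.bar j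
  · rw [B.root_star hpq X hkl, B.root_ne X b1, B.root_ne X (by grind)]
    refine key2 hij' (by grind) (by grind) (fun e => ?_) (by grind) _ _
    have := B.eq_or_eq_neg (i := i) (j := j) (k := -k) (l := -l) (by grind) (by grind) e (by grind)
    grind
  by_cases c4 : B.bar k = -B.bar i
  · rw [B.root_star hpq X hkl, B.root_ne X b1, B.root_ne X (by grind)]
    exact (key2 (by grind) hij' (by grind) (by grind) (by grind) _ _).symm
  · rw [B.root_ne X b1, B.root_ne X b2]
    exact X.x_comm hij' hkl' c2 c3 c1 c4 _ _

/-- In the relation for `X_i(u)` and `X_{ij}(a)` with `u = φ(c)`, only one half of `ρ(φ(c)) = c -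
c̄` survives multiplication by `e_j`, and the ultrashort factor disappears. -/
theorem phi_root (hij : B.bar i = -B.bar j) (hij0 : i ≠ -j) (hjk : (B.bar j).abs ≠ (B.bar k).abs)
    (a b : R) : ⁅X.y (B.bar j) (O.phi (E.e i * a * E.e j)),
      X.x (B.bar j) (B.bar k) (E.e j * b * E.e k)⁆ =
      X.x (B.bar i) (B.bar k) (O.s • (E.e i * a * E.e j * b * E.e k)) := by
  have h1 : -i ≠ j := by grind
  have h2 : -j ≠ i := by grind
  have h3 : (-B.bar j).abs ≠ (B.bar k).abs := by grind
  have h4 := B.e_mul j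
  rw [X.y_x hjk h3, O.rho_phi, O.phi_act, mul_assoc _ (E'.e _), ← mul_assoc (E'.e _),
    ← mul_assoc (E'.e _), h4, hij]
  simp only [sub_mul, mul_assoc, star_mul, E.star_e, E.e_self', E.e_ne' h1, E.e_ne' h2, mul_zero,
    sub_zero, star_neg, O.star_smul, mul_neg, neg_mul, smul_mul_assoc, mul_smul_comm, smul_zero,
    O.phi_zero, neg_zero, X.y_zero, mul_one, zero_mul]

theorem root_root (hij : PartialOk p q i j) (hjk : PartialOk p q j k) (hik : PartialOk p q i k)
    (a b : R) : ⁅B.root X i j a, B.root X j k b⁆ = B.root X i k (O.s • (a * E.e j * b)) := by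
  have hb := B.bar_neg
  have n1 := B.bar_ne hpq hij
  have n2 := B.bar_ne hpq hjk
  have n3 := B.bar_ne hpq hik
  have key : ∀ {i j k : SIdx ι}, B.bar i = -B.bar j → B.bar i ≠ B.bar k → B.bar j ≠ B.bar k →
      i ≠ -j → ∀ a b, ⁅B.root X i j a, B.root X j k b⁆ = B.root X i k (O.s • (a * E.e j * b)) := by
    intro i j k b1 n3 n2 n0 a b
    rw [B.root_opp X b1, B.root_ne X (by grind), B.root_ne X (by grind),
      B.phi_root hpq X b1 n0 (B.bar_abs n2 (by grind))]
    simp only [mul_smul_comm, smul_mul_assoc, mul_assoc]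
  by_cases b1 : B.bar i = -B.bar j
  · exact key b1 n3 n2 (by grind) a b
  by_cases b2 : B.bar j = -B.bar k
  · have h := key (i := -k) (j := -j) (k := -i) (by grind) (by grind) (by grind) (by grind)
      (-star b) (-star a)
    rw [← B.root_star hpq X hij, ← B.root_star hpq X hjk] at h
    rw [← comm_inv_comm, h, B.root_star hpq X hik, B.root_ne X (by grind), B.root_ne X (by grind),
      ← X.x_neg (B.bar_abs (by grind) (by grind))]
    simp only [star_mul, E.star_e, O.star_smul, mul_neg, neg_mul, smul_neg, neg_neg, mul_assoc]
  have hij' := B.bar_abs n1 b1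
  have hjk' := B.bar_abs n2 b2
  have e : E.e i * a * E.e j * E'.e (B.bar j) * (E.e j * b * E.e k) =
      E.e i * (a * E.e j * b) * E.e k := by
    have := B.mul_e j
    rw [mul_assoc _ (E.e j), this]
    simp only [mul_assoc, E.e_self']
  rw [B.root_ne X b1, B.root_ne X b2]
  by_cases b3 : B.bar i = -B.bar k
  · have h5 : B.bar k = -B.bar i := by grind
    rw [B.root_opp X b3, h5, X.x_y hij' (by grind), e]
    simp only [mul_smul_comm, smul_mul_assoc]
  · rw [B.root_ne X b3, X.x_x hij' hjk' (B.bar_abs n3 b3), e]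
    simp only [mul_smul_comm, smul_mul_assoc]

/-- The Steinberg datum of the refined family. -/
noncomputable def refine : SDatum E (PartialOk p q) G where
  x := B.root X
  y i u := X.y (B.bar i) (O.act u (E.e i))
  x_e {i j} _ a := by
    simp only [root, mul_assoc, E.e_self', E.e_self]
  y_e i u := by rw [O.act_act, E.e_self]
  x_star h a := B.root_star hpq X h a
  x_add {i j} h a b := by
    by_cases b1 : B.bar i = -B.bar j
    · simp only [B.root_opp X b1, mul_add, add_mul, O.phi_add, X.y_add]
    · simp only [B.root_ne X b1, mul_add, add_mul, X.x_add (B.bar_abs (B.bar_ne hpq h) b1)]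
  y_add i u v := by rw [O.add_act, X.y_add]
  x_comm hij hkl h1 h2 h3 h4 a b := B.root_commute hpq X hij hkl h1 h2 h3 h4 a b
  x_x hij hjk hik a b := B.root_root hpq X hij hjk hik a b
  x_y {i j} hij hjk a b := by
    have hb := B.bar_neg
    have n1 := B.bar_ne hpq hij
    have n2 := B.bar_ne hpq hjk
    have e : E.e i * a * E.e j * E'.e (B.bar j) * (E.e j * b * E.e (-i)) =
        E.e i * (a * E.e j * b) * E.e (-i) := by
      have := B.mul_e j
      rw [mul_assoc _ (E.e j), this]
      simp only [mul_assoc, E.e_self']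
    rw [B.root_ne X (by grind), B.root_ne X (by grind), hb,
      X.x_y (B.bar_abs n1 (by grind)) (by grind [SIdx.abs_eq_iff]), e, O.phi_act, E.star_e, neg_neg]
    simp only [mul_smul_comm, smul_mul_assoc]
  y_y {i j} hij h u v := by
    have hb := B.bar_neg
    have n1 := B.bar_ne hpq h
    by_cases b1 : B.bar i = B.bar j
    · rw [B.root_opp X (by grind), ← b1]
      rw [commutatorElement_def, ← X.y_neg, ← X.y_neg, ← X.y_add, ← X.y_add, ← X.y_add,
        ← sub_eq_add_neg, ← sub_eq_add_neg, O.commutator, O.pi_act, O.pi_act]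
      simp only [star_mul, E.star_e, mul_neg, neg_mul, mul_assoc, mul_smul_comm, smul_mul_assoc]
    · rw [B.root_ne X (by grind), hb, X.y_y (B.bar_abs b1 (by grind)) (by grind [SIdx.abs_eq_iff]),
        O.pi_act, O.pi_act]
      simp only [star_mul, E.star_e, mul_neg, neg_mul, mul_assoc, mul_smul_comm, smul_mul_assoc]
  y_x_comm {i j k} hjk h1 h2 u a := by
    have hb := B.bar_neg
    have n1 := B.bar_ne hpq hjk
    have key : ∀ {j k}, PartialOk p q j k → j ≠ i → B.bar j ≠ -B.bar k → B.bar j = B.bar i → ∀ a,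
        Commute (X.y (B.bar i) (O.act u (E.e i))) (B.root X j k a) := by
      intro j k hjk h1 b1 b2 a
      have h4 := B.e_mul j
      rw [B.root_ne X b1, ← b2]
      refine X.y_commute_of_mul_eq_zero (B.bar_abs (B.bar_ne hpq hjk) b1) ?_ ?_
      · rw [O.rho_act, mul_assoc, ← mul_assoc (E'.e _), ← mul_assoc (E'.e _), h4]
        simp only [mul_assoc, E.e_ne' h1.symm, mul_zero]
      · rw [O.act_act, ← mul_assoc (E'.e _), ← mul_assoc (E'.e _), h4]
        simp only [mul_neg, mul_smul_comm, mul_assoc, E.e_ne' h1.symm, smul_zero, neg_zero,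
          O.act_zero]
    by_cases b1 : B.bar j = -B.bar k
    · rw [B.root_opp X b1]
      have e1 := B.eq_or_bad (b1.trans (hb k).symm)
      by_cases b2 : B.bar i = B.bar k
      · rw [b2]; exact X.y_comm_phi _ _ _
      by_cases b3 : B.bar i = -B.bar k
      · have e2 := B.eq_or_bad (b3.trans (hb k).symm)
        clear b1 b2 b3 key
        grind
      have b4 := B.bar_abs b2 b3
      rw [← commutatorElement_eq_one_iff_commute, X.y_y b4 (by grind), O.pi_phi, mul_zero, smul_zero,
        neg_zero, X.x_zero (by grind)]
    by_cases b2 : B.bar j = B.bar i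
    · exact key hjk h1 b1 b2 a
    by_cases b3 : B.bar i = -B.bar k
    · rw [B.root_star hpq X hjk]
      exact key (by grind) (by grind) (by grind) (by grind) _
    · rw [B.root_ne X b1]
      exact X.y_x_comm (B.bar_abs n1 b1) b2 b3 _ _
  y_x {i j} hij h u a := by
    have hb := B.bar_neg
    have n1 := B.bar_ne hpq hij
    have n2 := B.bar_ne hpq h
    have n3 := B.bar_abs n1 (by grind)
    have h4 := B.e_mul i
    rw [B.root_ne X (by grind), B.root_ne X (by grind), X.y_x n3 (by grind), hb, O.rho_act,
      mul_assoc _ (E'.e _), ← mul_assoc (E'.e _), ← mul_assoc (E'.e _), h4, O.neg_act, O.act_act,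
      O.act_act]
    simp only [E.star_e, mul_neg, neg_mul, mul_smul_comm, smul_mul_assoc, mul_assoc, E.e_self',
      E.e_self]

end Refinement

/-! ### Steinberg groups and Steinberg data -/

section StU

variable {R Δ : Type*} [NonUnitalRing R] [StarRing R] [AddGroup Δ] {P : OddFormRing R Δ} {ι : Type}
  {C : Components P ι}

theorem StU.eq_of_rel {x y : FreeGroup (StGen C)} (h : StRel C x y) :
    (PresentedGroup.mk {r : FreeGroup (StGen C) | ∃ x y, StRel C x y ∧ x * y⁻¹ = r}) x =
      PresentedGroup.mk _ y := by
  rw [← mul_inv_eq_one, ← map_inv, ← map_mul]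
  exact PresentedGroup.one_of_mem (rels := {r : FreeGroup (StGen C) |
    ∃ x y, StRel C x y ∧ x * y⁻¹ = r}) ⟨x, y, h, rfl⟩

/-- The universal property of the Steinberg group. -/
def StU.lift {G : Type*} [Group G] (f : StGen C → G)
    (hf : ∀ x y, StRel C x y → FreeGroup.lift f x = FreeGroup.lift f y) : StU C →* G :=
  PresentedGroup.toGroup (f := f) (by
    rintro _ ⟨x, y, h, rfl⟩
    rw [map_mul, map_inv, hf x y h, mul_inv_cancel])

end StU

namespace OrthHypFamily

open AugOddFormAlgebra

variable {K R Δ : Type u} [CommRing K] [NonUnitalRing R] [StarRing R] [Module K R]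
    [IsScalarTower K R R] [SMulCommClass K R R] [AddGroup Δ]
    {A : AugOddFormAlgebra K R Δ} {ι κ : Type}

/-- The elements `u` of the homotope such that `e_k π(u) = 0` for all `k ≠ 0`. -/
def zeroPart (H : OrthHypFamily A.toOddFormRing ι) (s : K) : AddSubgroup (A.DHom s) where
  carrier := {u | ∀ k, H.e k * ((A.homotope s).pi u).val = 0}
  zero_mem' := fun k => by simp [(A.homotope s).pi_zero]
  add_mem' h1 h2 k := by rw [(A.homotope s).pi_add, RHom.val_add, mul_add, h1, h2, add_zero]
  neg_mem' h1 k := by rw [(A.homotope s).pi_neg, RHom.val_neg, mul_neg, h1, neg_zero]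

/-- The analogue of `act_add` for the action of the original ring `R`, which does not contain the
factor `s` of the action of `R^{(s)}`. -/
theorem ract_add {s : K} (x : A.DHom s) (a b : R) : A.ract s x (a + b) =
    A.ract s x a + (A.homotope s).phi ⟨star b * ((A.homotope s).rho x).val * a⟩ + A.ract s x b := by
  induction x using dind with | h u v
  change A.dmk s (A.act u (a + b)) (A.actD v (a + b)) = A.dmk s (A.act u a) (A.actD v a) +
    A.dmk s 0 (A.phiD (star b * (s • A.rho u + A.rho v) * a)) + A.dmk s (A.act u b) (A.actD v b)
  have h1 : A.phi (star b * A.rho u * a) = (A.phiD (star b * A.rho u * a) : Δ) := rfl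
  rw [dmk_add, dmk_add, A.act_add, A.actD_add, h1, add_assoc, ← A.add_D_comm, ← add_assoc, dmk_add_D,
    ← phiD_smul, add_zero, mul_add, add_mul, A.phiD_add, mul_smul_comm, smul_mul_assoc]
  congr 1
  let _ : AddCommGroup A.D := { (inferInstance : AddGroup A.D) with add_comm := A.D_comm }
  abel

theorem rho_neg {s : K} (x : A.DHom s) :
    (A.homotope s).rho (-x) = star ((A.homotope s).rho x) := by
  have h1 := (A.homotope s).rho_add x (-x)
  have h2 := (A.homotope s).rho_add_star x
  rw [add_neg_cancel, (A.homotope s).rho_zero, (A.homotope s).pi_neg, mul_neg, sub_neg_eq_add] at h1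
  rw [← h2, add_right_comm] at h1
  exact (add_left_cancel (add_right_cancel ((add_right_comm _ _ _).trans
    (h1.trans (add_right_comm _ _ _))))).symm

/-- The operations of the homotope, restricted to `zeroPart`. -/
def base (H : OrthHypFamily A.toOddFormRing ι) (s : K) : OBase K R (H.zeroPart s) where
  s := s
  act u a := ⟨A.ract s u a, fun k => by rw [pi_ract, ← mul_assoc, u.2, zero_mul]⟩
  phi a := ⟨(A.homotope s).phi ⟨a⟩, fun k => by rw [(A.homotope s).pi_phi, RHom.val_zero, mul_zero]⟩
  pi u := ((A.homotope s).pi u).val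
  rho u := ((A.homotope s).rho u).val
  star_smul := A.star_smul
  add_act u v a := Subtype.ext (add_ract _ _ _)
  act_act u a b := Subtype.ext (ract_ract _ _ _)
  act_add u a b := Subtype.ext (ract_add _ _ _)
  phi_add a b := Subtype.ext ((A.homotope s).phi_add ⟨a⟩ ⟨b⟩)
  phi_act b a := Subtype.ext (by
    change A.dmk s (A.act 0 a) (A.actD (A.phiD b) a) = A.dmk s 0 (A.phiD (star a * b * a))
    rw [A.zero_act, phiD_act])
  phi_star a := Subtype.ext (by
    refine eq_neg_of_add_eq_zero_left (((A.homotope s).phi_add _ _).symm.trans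
      ((A.homotope s).phi_eq_zero _ ?_))
    exact RHom.ext (by simp [add_comm]))
  pi_add u v := congrArg RHom.val ((A.homotope s).pi_add u v)
  pi_act u a := pi_ract _ _
  pi_phi a := congrArg RHom.val ((A.homotope s).pi_phi ⟨a⟩)
  rho_add u v := congrArg RHom.val ((A.homotope s).rho_add u v)
  rho_act u a := rho_ract _ _
  rho_phi a := congrArg RHom.val ((A.homotope s).rho_phi ⟨a⟩)
  rho_neg u := congrArg RHom.val (rho_neg u.1)
  commutator u v := Subtype.ext ((A.homotope s).commutator u v)

/-- The morphism between homotopes. -/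
def shift (H : OrthHypFamily A.toOddFormRing ι) (s : K) :
    (H.base (s ^ 11)).Shift (H.base s) where
  tr u := ⟨dtrans (s ^ 10) (pow_succ' s 10) u, fun k => by
    have h := u.2 k
    have h1 := congrArg RHom.val ((transHom H (s ^ 10) (pow_succ' s 10)).map_pi u.1)
    change s ^ 10 • ((A.homotope (s ^ 11)).pi u.1).val = _ at h1
    exact (congrArg (H.e k * ·) h1.symm).trans (by simp only [mul_smul_comm, h, smul_zero])⟩
  s_eq := rfl
  tr_add u v := Subtype.ext ((transHom H (s ^ 10) (pow_succ' s 10)).map_dadd u.1 v.1)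
  tr_act u a := Subtype.ext (dtrans_ract (s ^ 10) (pow_succ' s 10) _ _)
  tr_phi a := Subtype.ext ((transHom H (s ^ 10) (pow_succ' s 10)).map_phi ⟨a⟩)
  pi_tr u := (congrArg RHom.val ((transHom H (s ^ 10) (pow_succ' s 10)).map_pi u.1)).symm
  rho_tr u := (congrArg RHom.val ((transHom H (s ^ 10) (pow_succ' s 10)).map_rho u.1)).symm
  exists_scale k l hkl u := by
    obtain ⟨x, hx⟩ := u
    revert hx
    induction x using dind with | h u v
    intro hx
    have hp : ((A.homotope s).pi (A.dmk s (A.kact u (s ^ (k + l))) (A.ksmul (s ^ l) v))).val =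
        s ^ (k + l) • ((A.homotope (s ^ 11)).pi (A.dmk (s ^ 11) u v)).val := A.pi_kact u _
    -- On `Δ` the remaining `s^k` adds to `k + l`; on the augmentation it acts as `s^(2k)` and adds
    -- to `l`. Both totals are `2k + l = 10`.
    refine ⟨⟨A.dmk s (A.kact u (s ^ (k + l))) (A.ksmul (s ^ l) v), fun j => ?_⟩, hp, fun a =>
      Subtype.ext ?_⟩
    · rw [hp, mul_smul_comm, hx, smul_zero]
    · change A.dmk s (A.act (A.kact u (s ^ 10)) a) (A.actD (A.ksmul (s ^ 10) v) a) =
        A.dmk s (A.act (A.kact u (s ^ (k + l))) (s ^ k • a)) (A.actD (A.ksmul (s ^ l) v) (s ^ k • a))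
      rw [A.kact_act, A.kact_act, D_actD_smul, ksmul_actD, ksmul_actD, ← A.mul_ksmul, smul_smul,
        ← pow_add, ← pow_add, ← pow_add, show k + l + k = 10 by omega, show k + k + l = 10 by omega]

variable (H : OrthHypFamily A.toOddFormRing ι) (H' : OrthHypFamily A.toOddFormRing κ)

/-- The idempotents of a family with the same `e_0`. -/
def efam (hz : ∀ x : R, (∀ k, H.e k * x = 0) ↔ ∀ k, H'.e k * x = 0) (s : K) :
    EFam (H.base s) κ where
  e := H'.e
  e_self := H'.e_mul_self
  e_ne i j h := H'.e_mul_e h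
  star_e := H'.star_e
  e_pi i u := (hz _).1 u.2 i

variable (hz : ∀ x : R, (∀ k, H.e k * x = 0) ↔ ∀ k, H'.e k * x = 0) {s : K}

include hz in
theorem mem_zeroPart {i : SIdx κ} {u : A.DHom s} (hu : u ∈ (comps H' s).form i) : u ∈ H.zeroPart s :=
  (hz _).2 hu.2

open Classical in
/-- The generators of the Steinberg group satisfy the Steinberg relations. -/
noncomputable def stDatum (s : K) :
    SDatum (H.efam H' hz s) (fun i j => i.abs ≠ j.abs) (StUs H' s) where
  -- For `i = ±j` there is no generator; the value `1` is never used by a relation.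
  x i j a := if h : i.abs ≠ j.abs then StU.X (comps H' s) i j h ⟨H'.e i * a * H'.e j⟩
    (ring_e_e H' ⟨a⟩ i j) else 1
  y i u := StU.Y (comps H' s) i (A.ract s u (H'.e i)) (comps_form_ract H' i ((hz _).1 u.2))
  x_e {i j} h a := by
    rw [dif_pos h, dif_pos h]
    refine StU.X_congr _ _ _ (RHom.ext ?_)
    change H'.e i * (H'.e i * a * H'.e j) * H'.e j = H'.e i * a * H'.e j
    rw [mul_assoc (H'.e i) a, ← mul_assoc (H'.e i) (H'.e i), H'.e_mul_self, mul_assoc, mul_assoc,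
      H'.e_mul_self]
  y_e i u := by
    refine StU.Y_congr _ _ ?_
    change A.ract s (A.ract s u (H'.e i)) (H'.e i) = _
    rw [ract_ract, H'.e_mul_self]
  x_star {i j} h a := by
    have h' : (-j).abs ≠ (-i).abs := by simpa using h.symm
    rw [dif_pos h, dif_pos h']
    refine (StU.eq_of_rel (.st0 h h' (ring_e_e H' ⟨a⟩ i j))).trans
      (StU.X_congr _ (neg_mem ((comps H' s).star_mem (ring_e_e H' ⟨a⟩ i j))) _ (RHom.ext ?_))
    change -star (H'.e i * a * H'.e j) = H'.e (-j) * -star a * H'.e (-i)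
    simp only [star_mul, H'.star_e, mul_neg, neg_mul, mul_assoc]
  x_add {i j} h a b := by
    rw [dif_pos h, dif_pos h, dif_pos h]
    refine ((StU.eq_of_rel (.st1 h (ring_e_e H' ⟨a⟩ i j) (ring_e_e H' ⟨b⟩ i j))).trans
      (StU.X_congr _ (add_mem (ring_e_e H' ⟨a⟩ i j) (ring_e_e H' ⟨b⟩ i j)) _ (RHom.ext ?_))).symm
    change H'.e i * a * H'.e j + H'.e i * b * H'.e j = H'.e i * (a + b) * H'.e j
    rw [mul_add, add_mul]
  y_add i u v := by
    have hu := comps_form_ract H' i ((hz _).1 u.2)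
    have hv := comps_form_ract H' i ((hz _).1 v.2)
    exact ((StU.eq_of_rel (.st2 hu hv)).trans
      (StU.Y_congr (add_mem hu hv) _ (add_ract _ _ _).symm)).symm
  x_comm {i j k l} h h' h1 h2 h3 h4 a b := by
    rw [dif_pos h, dif_pos h', ← commutatorElement_eq_one_iff_commute]
    exact StU.eq_of_rel (.st3 h h' h1 h2 (by simpa using h3) (by simpa [neg_eq_iff_eq_neg] using h4) (ring_e_e H' ⟨a⟩ i j)
      (ring_e_e H' ⟨b⟩ k l))
  x_x {i j k} h h' h'' a b := by
    rw [dif_pos h, dif_pos h', dif_pos h'']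
    have ha := ring_e_e H' (s := s) ⟨a⟩ i j
    have hb := ring_e_e H' (s := s) ⟨b⟩ j k
    refine (StU.eq_of_rel (.st4 h h' h'' ha hb)).trans
      (StU.X_congr _ ((comps H' s).mul_mem ha hb) _ (RHom.ext ?_))
    change s • (H'.e i * a * H'.e j * (H'.e j * b * H'.e k)) =
      H'.e i * (s • (a * H'.e j * b)) * H'.e k
    rw [mul_assoc (H'.e j) b, ← mul_assoc _ (H'.e j), mul_assoc _ (H'.e j) (H'.e j), H'.e_mul_self]
    simp only [mul_smul_comm, smul_mul_assoc, mul_assoc]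
  x_y {i j} h h' a b := by
    rw [dif_pos h, dif_pos h']
    have ha := ring_e_e H' (s := s) ⟨a⟩ i j
    have hb := ring_e_e H' (s := s) ⟨b⟩ j (-i)
    refine (StU.eq_of_rel (.st5 h h' ha hb)).trans
      (StU.Y_congr ((comps H' s).phi_mem ((comps H' s).mul_mem ha hb)) _ ?_)
    refine Eq.trans ?_ (congrArg Subtype.val ((H.base s).phi_act _ _)).symm
    refine congrArg (A.homotope s).phi (RHom.ext ?_)
    change s • (H'.e i * a * H'.e j * (H'.e j * b * H'.e (-i))) =
      star (H'.e (-i)) * (s • (a * H'.e j * b)) * H'.e (-i)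
    rw [mul_assoc (H'.e j) b, ← mul_assoc _ (H'.e j), mul_assoc _ (H'.e j) (H'.e j), H'.e_mul_self,
      H'.star_e, neg_neg]
    simp only [mul_smul_comm, smul_mul_assoc, mul_assoc]
  y_y {i j} h h' u v := by
    rw [dif_pos h']
    have hu := comps_form_ract H' i ((hz _).1 u.2)
    have hv := comps_form_ract H' j ((hz _).1 v.2)
    refine (StU.eq_of_rel (.st6 h h' hu hv)).trans
      (StU.X_congr _ (neg_mem ((comps H' s).pi_mem hu hv)) _ (RHom.ext ?_))
    change -(s • (star ((A.homotope s).pi (A.ract s u (H'.e i))).val *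
      ((A.homotope s).pi (A.ract s v (H'.e j))).val)) = H'.e (-i) *
      -(s • (star ((A.homotope s).pi u.1).val * ((A.homotope s).pi v.1).val)) * H'.e j
    rw [pi_ract, pi_ract]
    simp only [star_mul, H'.star_e, mul_neg, neg_mul, mul_smul_comm, smul_mul_assoc, mul_assoc]
  y_x_comm {i j k} h h1 h2 u a := by
    rw [dif_pos h, ← commutatorElement_eq_one_iff_commute]
    exact StU.eq_of_rel (.st7 h h1 h2 (comps_form_ract H' i ((hz _).1 u.2))
      (ring_e_e H' ⟨a⟩ j k))
  y_x {i j} h h' u a := by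
    rw [dif_pos h, dif_pos h']
    have hu := comps_form_ract H' i ((hz _).1 u.2)
    have ha := ring_e_e H' (s := s) ⟨a⟩ i j
    refine (StU.eq_of_rel (.st8 h h' hu ha)).trans (congrArg₂ (· * ·)
      (StU.X_congr _ ((comps H' s).mul_mem ((comps H' s).rho_mem hu) ha) _ (RHom.ext ?_))
      (StU.Y_congr (neg_mem ((comps H' s).act_mem hu (neg_mem ha))) _ ?_))
    · change s • (((A.homotope s).rho (A.ract s u (H'.e i))).val * (H'.e i * a * H'.e j)) =
        H'.e (-i) * (s • (((A.homotope s).rho u.1).val * H'.e i * a)) * H'.e j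
      rw [rho_ract, H'.star_e, mul_assoc (H'.e i) a, ← mul_assoc _ (H'.e i),
        mul_assoc _ (H'.e i) (H'.e i), H'.e_mul_self]
      simp only [mul_smul_comm, smul_mul_assoc, mul_assoc]
    · change -(A.ract s (A.ract s u (H'.e i)) (s • -(H'.e i * a * H'.e j))) =
        A.ract s (-(A.ract s u (-(s • (H'.e i * a))))) (H'.e j)
      rw [ract_ract, neg_ract, ract_ract, mul_smul_comm, mul_neg, mul_assoc (H'.e i) a,
        ← mul_assoc (H'.e i), H'.e_mul_self]
      simp only [mul_smul_comm, smul_mul_assoc, mul_assoc, neg_mul, smul_neg]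

end OrthHypFamily

namespace OrthHypFamily

open AugOddFormAlgebra

variable {K R Δ : Type u} [CommRing K] [NonUnitalRing R] [StarRing R] [Module K R]
    [IsScalarTower K R R] [SMulCommClass K R R] [AddGroup Δ]
    {A : AugOddFormAlgebra K R Δ} {ι κ : Type}
    {H : OrthHypFamily A.toOddFormRing ι} {H' : OrthHypFamily A.toOddFormRing κ}
    {hz : ∀ x : R, (∀ k, H.e k * x = 0) ↔ ∀ k, H'.e k * x = 0} {s : K} {G : Type*} [Group G]
    (X : SDatum (H.efam H' hz s) (fun i j => i.abs ≠ j.abs) G)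

/-- The image of a generator. -/
def evalGen : StGen (comps H' s) → G
  | .ring i j _ a => X.x i j a.1.val
  | .form i u => X.y i ⟨u.1, mem_zeroPart H H' hz u.2⟩

theorem evalGen_X {i j : SIdx κ} (h : i.abs ≠ j.abs) {a : A.RHom s} (ha : a ∈ (comps H' s).ring i j) :
    FreeGroup.lift (evalGen X) (StGen.X (comps H' s) h ha) = X.x i j a.val := FreeGroup.lift_apply_of

theorem evalGen_Y {i : SIdx κ} {u : A.DHom s} (hu : u ∈ (comps H' s).form i) :
    FreeGroup.lift (evalGen X) (StGen.Y (comps H' s) hu) = X.y i ⟨u, mem_zeroPart H H' hz hu⟩ :=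
  FreeGroup.lift_apply_of

/-- The homomorphism from the Steinberg group given by a Steinberg datum. -/
def ofDatum : StUs H' s →* G :=
  StU.lift (evalGen X) (by
    intro x y h
    cases h with
    | st0 h h' ha => rw [evalGen_X, evalGen_X]; exact X.x_star h _
    | st1 h ha hb => rw [map_mul, evalGen_X, evalGen_X, evalGen_X]; exact (X.x_add h _ _).symm
    | st2 hu hv => rw [map_mul, evalGen_Y, evalGen_Y, evalGen_Y]; exact (X.y_add _ _ _).symm
    | st3 h h' h1 h2 h3 h4 ha hb =>
      rw [map_commutatorElement, map_one, evalGen_X, evalGen_X, commutatorElement_eq_one_iff_commute]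
      exact X.x_comm h h' h1 h2 (by simpa using h3) (by simpa [neg_eq_iff_eq_neg] using h4) _ _
    | @st4 i j k h h' h'' a b ha hb =>
      rw [map_commutatorElement, evalGen_X, evalGen_X, evalGen_X, X.x_x h h' h'']
      refine congrArg (X.x i k) ?_
      change s • (a.val * H'.e j * b.val) = s • (a.val * b.val)
      rw [ha.2]
    | @st5 i j h h' a b ha hb =>
      rw [map_commutatorElement, evalGen_X, evalGen_X, evalGen_Y, X.x_y h h']
      refine congrArg (X.y (-i)) (Subtype.ext (congrArg (A.homotope s).phi (RHom.ext ?_)))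
      change s • (a.val * H'.e j * b.val) = s • (a.val * b.val)
      rw [ha.2]
    | st6 h h' hu hv =>
      rw [map_commutatorElement, evalGen_Y, evalGen_Y, evalGen_X, X.y_y h h']
      rfl
    | st7 h h1 h2 hu ha =>
      rw [map_commutatorElement, map_one, evalGen_X, evalGen_Y, commutatorElement_eq_one_iff_commute]
      exact X.y_x_comm h h1 h2 _ _
    | @st8 i j h h' u a hu ha =>
      rw [map_commutatorElement, map_mul, evalGen_Y, evalGen_X, evalGen_X, evalGen_Y, X.y_x h h']
      refine congrArg₂ (· * ·) (congrArg (X.x (-i) j) ?_) (congrArg (X.y j) (Subtype.ext ?_))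
      · change s • (((A.homotope s).rho u).val * H'.e i * a.val) =
          s • (((A.homotope s).rho u).val * a.val)
        rw [mul_assoc, ha.1]
      · change -A.ract s u (-(s • (H'.e i * a.val))) = -A.ract s u (s • -a.val)
        rw [ha.1, smul_neg])

theorem ofDatum_X (i j : SIdx κ) (h : i.abs ≠ j.abs) (a : A.RHom s)
    (ha : a ∈ (comps H' s).ring i j) : ofDatum X (StU.X _ i j h a ha) = X.x i j a.val :=
  evalGen_X X h ha

theorem ofDatum_Y (i : SIdx κ) (u : A.DHom s) (hu : u ∈ (comps H' s).form i) :
    ofDatum X (StU.Y _ i u hu) = X.y i ⟨u, mem_zeroPart H H' hz hu⟩ :=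
  evalGen_Y X hu

end OrthHypFamily

/-! ### Sums of two idempotents -/

theorem OBase.rho_add_star {K R D : Type*} [CommRing K] [NonUnitalRing R] [StarRing R] [Module K R]
    [IsScalarTower K R R] [SMulCommClass K R R] [AddGroup D] (O : OBase K R D) (u : D) :
    O.rho u = -star (O.rho u) - O.s • (star (O.pi u) * O.pi u) := by
  have h0 : O.rho 0 = 0 := by
    have h := O.rho_phi 0
    rwa [O.phi_zero, star_zero, sub_zero] at h
  have h := O.rho_add u (-u)
  rw [add_neg_cancel, h0, O.rho_neg, O.pi_neg, mul_neg, smul_neg, sub_neg_eq_add] at h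
  rw [sub_eq_add_neg, ← neg_add, eq_neg_iff_add_eq_zero, add_comm (star _), ← add_assoc]
  exact h.symm

namespace SDatum

variable {K R D : Type*} [CommRing K] [NonUnitalRing R] [StarRing R] [Module K R]
    [IsScalarTower K R R] [SMulCommClass K R R] [AddGroup D] {O : OBase K R D} {ι : Type}
    {E : EFam O ι} {G : Type*} [Group G] {i j k p q : SIdx ι}
    (X : SDatum E (fun i j => i.abs ≠ j.abs) G)
include X

/-- Moving `X_q(u)` past `X_p(v)` creates exactly the element of `X_{-q,p}` that corrects the
failure of `ρ` to be additive. -/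
theorem two_y_add (hpq : p.abs ≠ q.abs) (u v : D) :
    X.y p (u + v) * X.y q (u + v) * X.x (-q) p (O.rho (u + v)) =
      X.y p u * X.y q u * X.x (-q) p (O.rho u) * (X.y p v * X.y q v * X.x (-q) p (O.rho v)) := by
  have h : (-q).abs ≠ p.abs := by grind
  have c1 : ∀ a v, Commute (X.x (-q) p a) (X.y p v) := fun a v =>
    (X.y_x_comm h (by grind) (by grind) _ _).symm
  have c2 : ∀ a v, Commute (X.x (-q) p a) (X.y q v) := fun a v =>
    (X.y_x_comm h (by grind) (by grind) _ _).symm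
  have c3 := X.y_y hpq.symm h u v
  rw [O.rho_add, sub_eq_add_neg, X.x_add h, X.x_add h, X.y_add, X.y_add, ← c3]
  have e : X.y q u * X.y p v = ⁅X.y q u, X.y p v⁆ * X.y p v * X.y q u := by
    rw [commutatorElement_def]; group
  have c4 : Commute ⁅X.y q u, X.y p v⁆ (X.y p v) := by rw [c3]; exact c1 _ _
  have c5 : ∀ w, Commute ⁅X.y q u, X.y p v⁆ (X.y q w) := fun w => by rw [c3]; exact c2 _ _
  have c6 : Commute ⁅X.y q u, X.y p v⁆ (X.x (-q) p (O.rho u)) := by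
    rw [c3]; exact X.x_comm_self h _ _
  have c7 := c1 (O.rho u) v
  have c8 := c2 (O.rho u) v
  generalize ⁅X.y q u, X.y p v⁆ = c at *
  generalize X.x (-q) p (O.rho u) = r at *
  calc _ = X.y p u * (X.y p v * X.y q u * (X.y q v * (r * c))) * X.x (-q) p (O.rho v) := by
        simp only [mul_assoc]
    _ = X.y p u * (X.y p v * X.y q u * c * X.y q v) * r * X.x (-q) p (O.rho v) := by
        rw [← c6.eq, ← mul_assoc (X.y q v), ← (c5 v).eq]; simp only [mul_assoc]
    _ = X.y p u * (c * X.y p v * X.y q u * X.y q v) * r * X.x (-q) p (O.rho v) := by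
        rw [mul_assoc (X.y p v), ← (c5 u).eq, ← mul_assoc (X.y p v), ← c4.eq]
    _ = X.y p u * X.y q u * (X.y p v * X.y q v * r) * X.x (-q) p (O.rho v) := by
        rw [← e]; simp only [mul_assoc]
    _ = _ := by
        rw [← (c7.mul_right c8).eq]; simp only [mul_assoc]

theorem two_x_x_left (hpq : p.abs ≠ q.abs) (hp : p.abs ≠ j.abs) (hq : q.abs ≠ j.abs)
    (hpk : p.abs ≠ k.abs) (hqk : q.abs ≠ k.abs) (hjk : j.abs ≠ k.abs) (a b : R) :
    ⁅X.x p j a * X.x q j a, X.x j k b⁆ =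
      X.x p k (O.s • (a * E.e j * b)) * X.x q k (O.s • (a * E.e j * b)) := by
  have c : ∀ c d, Commute (X.x p j c) (X.x q k d) := fun c d =>
    X.x_comm hp hqk (by grind) (by grind) (by grind) (by grind) _ _
  have c' : ∀ c d, Commute (X.x p k c) (X.x q k d) := fun c d =>
    X.x_comm hpk hqk (by grind) (by grind) (by grind) (by grind) _ _
  rw [comm_mul_left, X.x_x hq hjk hqk, X.x_x hp hjk hpk, (c _ _).conj_eq, (c' _ _).eq]

theorem two_x_x_mid (hpq : p.abs ≠ q.abs) (hp : p.abs ≠ i.abs) (hq : q.abs ≠ i.abs)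
    (hpk : p.abs ≠ k.abs) (hqk : q.abs ≠ k.abs) (hik : i.abs ≠ k.abs) (a b : R) :
    ⁅X.x i p a * X.x i q a, X.x p k b * X.x q k b⁆ = X.x i k (O.s • (a * (E.e p + E.e q) * b)) := by
  have c1 : ∀ c d, Commute (X.x i p c) (X.x q k d) := fun c d =>
    X.x_comm hp.symm hqk (by grind) (by grind) (by grind) (by grind) _ _
  have c2 : ∀ c d, Commute (X.x i q c) (X.x p k d) := fun c d =>
    X.x_comm hq.symm hpk (by grind) (by grind) (by grind) (by grind) _ _
  have c3 : ∀ c d, Commute (X.x i p c) (X.x i k d) := fun c d =>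
    X.x_comm hp.symm hik (by grind) (by grind) (by grind) (by grind) _ _
  have c4 : ∀ c d, Commute (X.x p k c) (X.x i k d) := fun c d =>
    X.x_comm hpk hik (by grind) (by grind) (by grind) (by grind) _ _
  rw [comm_mul_left, comm_mul_right, comm_mul_right, (c2 _ _).comm_eq_one, (c1 _ _).comm_eq_one,
    X.x_x hp.symm hpk hik, X.x_x hq.symm hqk hik, mul_one, mul_inv_cancel, mul_one, one_mul,
    (c4 _ _).conj_eq, (c3 _ _).conj_eq, mul_add, add_mul, smul_add, add_comm, X.x_add hik]

theorem two_x_x_right (hpq : p.abs ≠ q.abs) (hp : p.abs ≠ i.abs) (hq : q.abs ≠ i.abs)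
    (hpj : p.abs ≠ j.abs) (hqj : q.abs ≠ j.abs) (hij : i.abs ≠ j.abs) (a b : R) :
    ⁅X.x i j a, X.x j p b * X.x j q b⁆ =
      X.x i p (O.s • (a * E.e j * b)) * X.x i q (O.s • (a * E.e j * b)) := by
  have c : ∀ c d, Commute (X.x j p c) (X.x i q d) := fun c d =>
    X.x_comm hpj.symm hq.symm (by grind) (by grind) (by grind) (by grind) _ _
  rw [comm_mul_right, X.x_x hij hqj.symm hq.symm, X.x_x hij hpj.symm hp.symm, (c _ _).conj_eq]

theorem two_x_y_mid (hpq : p.abs ≠ q.abs) (hp : p.abs ≠ i.abs) (hq : q.abs ≠ i.abs) (a b : R) :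
    ⁅X.x i p a * X.x i q a, X.x p (-i) b * X.x q (-i) b⁆ =
      X.y (-i) (O.phi (O.s • (a * (E.e p + E.e q) * b))) := by
  have hp' : p.abs ≠ (-i).abs := by grind
  have hq' : q.abs ≠ (-i).abs := by grind
  have c1 : ∀ c d, Commute (X.x i p c) (X.x q (-i) d) := fun c d =>
    X.x_comm hp.symm hq' (by grind) (by grind) (by grind) (by grind) _ _
  have c2 : ∀ c d, Commute (X.x i q c) (X.x p (-i) d) := fun c d =>
    X.x_comm hq.symm hp' (by grind) (by grind) (by grind) (by grind) _ _
  have c3 : ∀ c d, Commute (X.x i p c) (X.y (-i) d) := fun c d =>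
    (X.y_x_comm hp.symm (by grind) (by grind) _ _).symm
  have c4 : ∀ c d, Commute (X.x p (-i) c) (X.y (-i) d) := fun c d =>
    (X.y_x_comm hp' (by grind) (by grind) _ _).symm
  rw [comm_mul_left, comm_mul_right, comm_mul_right, (c2 _ _).comm_eq_one, (c1 _ _).comm_eq_one,
    X.x_y hp.symm hp', X.x_y hq.symm hq', mul_one, mul_inv_cancel, mul_one, one_mul,
    (c4 _ _).conj_eq, (c3 _ _).conj_eq, mul_add, add_mul, smul_add, add_comm, O.phi_add, X.y_add]

/-- With `c` the product, the mixed commutators give `c` in `X_{q,-p}` and `c` in `X_{p,-q}`, that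
is `-c̄` in `X_{q,-p}`; together this is `ρ(φ(c))`. -/
theorem two_x_y_out (hpq : p.abs ≠ q.abs) (hp : p.abs ≠ j.abs) (hq : q.abs ≠ j.abs) (a b : R) :
    ⁅X.x p j a * X.x q j a, X.x j (-p) b * X.x j (-q) b⁆ =
      X.y (-p) (O.phi (O.s • (a * E.e j * b))) * X.y (-q) (O.phi (O.s • (a * E.e j * b))) *
        X.x q (-p) (O.rho (O.phi (O.s • (a * E.e j * b)))) := by
  have hp' : j.abs ≠ (-p).abs := by grind
  have hq' : j.abs ≠ (-q).abs := by grind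
  have hpq' : p.abs ≠ (-q).abs := by grind
  have hqp : q.abs ≠ (-p).abs := by grind
  have c1 : ∀ c d, Commute (X.x p j c) (X.x q (-p) d) := fun c d =>
    X.x_comm hp hqp (by grind) (by grind) (by grind) (by grind) _ _
  have c2 : ∀ c d, Commute (X.x p j c) (X.y (-q) d) := fun c d =>
    (X.y_x_comm hp (by grind) (by grind) _ _).symm
  have c3 : ∀ c d, Commute (X.x j (-p) c) (X.y (-q) d) := fun c d =>
    (X.y_x_comm hp' (by grind) (by grind) _ _).symm
  have c4 : ∀ c d, Commute (X.x j (-p) c) (X.x p (-q) d) := fun c d =>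
    X.x_comm hp' hpq' (by grind) (by grind) (by grind) (by grind) _ _
  have c5 : ∀ c d, Commute (X.x q (-p) c) (X.y (-p) d) := fun c d =>
    (X.y_x_comm hqp (by grind) (by grind) _ _).symm
  have c6 : ∀ c d, Commute (X.x q (-p) c) (X.y (-q) d) := fun c d =>
    (X.y_x_comm hqp (by grind) (by grind) _ _).symm
  have c7 : ∀ c d, Commute (X.y (-p) (O.phi c)) (X.y (-q) d) := fun c d => by
    rw [← commutatorElement_eq_one_iff_commute, X.y_y (by grind) (by grind), O.pi_phi, star_zero,
      zero_mul, smul_zero, neg_zero, X.x_zero (by grind)]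
  rw [comm_mul_left, comm_mul_right, comm_mul_right, X.x_x hq hp' hqp, X.x_y hq hq',
    X.x_y hp hp', X.x_x hp hq' hpq', (c3 _ _).conj_eq, (c4 _ _).conj_eq,
    (((c1 _ _).mul_right (c2 _ _))).conj_eq, X.x_star hpq', neg_neg, O.rho_phi, sub_eq_add_neg,
    X.x_add hqp]
  set c := O.s • (a * E.e j * b)
  rw [((c6 c (O.phi c))).eq, mul_assoc, ← mul_assoc (X.x q (-p) c), (c5 _ _).eq, mul_assoc,
    ← mul_assoc (X.y (-q) _), ← (c7 _ _).eq]

theorem two_y_y (hpq : p.abs ≠ q.abs) (hp : p.abs ≠ j.abs) (hq : q.abs ≠ j.abs) (u v : D) :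
    ⁅X.y p u * X.y q u * X.x (-q) p (O.rho u), X.y j v⁆ =
      X.x (-p) j (-(O.s • (star (O.pi u) * O.pi v))) *
        X.x (-q) j (-(O.s • (star (O.pi u) * O.pi v))) := by
  have hp' : (-p).abs ≠ j.abs := by grind
  have hq' : (-q).abs ≠ j.abs := by grind
  have c1 : ∀ c, Commute (X.x (-q) p c) (X.y j v) := fun c =>
    (X.y_x_comm (by grind) (by grind) (by grind) _ _).symm
  have c2 : ∀ c, Commute (X.y p u) (X.x (-q) j c) := fun c =>
    X.y_x_comm hq' (by grind) (by grind) _ _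
  have c3 : ∀ c d, Commute (X.x (-p) j c) (X.x (-q) j d) := fun c d =>
    X.x_comm hp' hq' (by grind) (by grind) (by grind) (by grind) _ _
  rw [comm_mul_left_of_commute' (c1 _), comm_mul_left, X.y_y hp hp', X.y_y hq hq', (c2 _).conj_eq,
    (c3 _ _).eq]

/-- The third factor arises from moving `X_{ip}` past `X_{-i,q}`, which contributes `ρ(v)` in
`X_{-q,p}`. -/
theorem two_y_x_right (hpq : p.abs ≠ q.abs) (hp : p.abs ≠ i.abs) (hq : q.abs ≠ i.abs) (u : D)
    (a : R) : ⁅X.y i u, X.x i p a * X.x i q a⁆ =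
      X.x (-i) p (O.s • (O.rho u * E.e i * a)) * X.x (-i) q (O.s • (O.rho u * E.e i * a)) *
        (X.y p (-(O.act u (-(O.s • (E.e i * a))))) * X.y q (-(O.act u (-(O.s • (E.e i * a))))) *
          X.x (-q) p (O.rho (-(O.act u (-(O.s • (E.e i * a))))))) := by
  have h1 : i.abs ≠ p.abs := hp.symm
  have h2 : i.abs ≠ q.abs := hq.symm
  have h3 : (-i).abs ≠ p.abs := by grind
  have h4 : (-i).abs ≠ q.abs := by grind
  have h5 : (-p).abs ≠ q.abs := by grind
  have h6 : (-q).abs ≠ p.abs := by grind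
  have h7 : (-p).abs ≠ (-i).abs := by grind
  have c1 : ∀ c d, Commute (X.x i p c) (X.y q d) := fun c d =>
    (X.y_x_comm h1 (by grind) (by grind) _ _).symm
  have c2 : ∀ c d, Commute (X.x (-q) p c) (X.x (-i) q d) := fun c d => by
    rw [X.x_star h6, neg_neg]
    exact X.x_comm h5 h4 (by grind) (by grind) (by grind) (by grind) _ _
  have c3 : ∀ c d, Commute (X.x (-i) q c) (X.y p d) := fun c d =>
    (X.y_x_comm h4 (by grind) (by grind) _ _).symm
  have c4 : ∀ c d, Commute (X.x (-q) p c) (X.y q d) := fun c d =>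
    (X.y_x_comm h6 (by grind) (by grind) _ _).symm
  set v := -(O.act u (-(O.s • (E.e i * a)))) with hv
  set c := O.s • (O.rho u * E.e i * a) with hc
  have e : ⁅X.x i p a, X.x (-i) q c⁆ = X.x (-q) p (O.rho v) := by
    rw [X.x_star h1, X.x_x h7 h4 h5, X.x_star h5, neg_neg, hv, O.rho_neg, O.rho_act, hc]
    simp only [star_mul, E.star_e, O.star_smul, star_neg, neg_neg, mul_neg, neg_mul, mul_assoc,
      smul_mul_assoc, mul_smul_comm, smul_neg, star_star, E.e_self']
  have y1 : ⁅X.y i u, X.x i p a⁆ = X.x (-i) p c * X.y p v := X.y_x h1 h3 u a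
  have y2 : ⁅X.y i u, X.x i q a⁆ = X.x (-i) q c * X.y q v := X.y_x h2 h4 u a
  rw [comm_mul_right, y1, y2, conj_mul_eq, (c1 _ _).conj_eq, conj_eq_comm_mul, e]
  calc _ = X.x (-i) p c * (X.y p v * (X.x (-q) p (O.rho v) * X.x (-i) q c)) * X.y q v := by
        simp only [mul_assoc]
    _ = X.x (-i) p c * (X.y p v * X.x (-i) q c) * (X.x (-q) p (O.rho v) * X.y q v) := by
        rw [(c2 _ _).eq]; simp only [mul_assoc]
    _ = _ := by rw [← (c3 _ _).eq, (c4 _ _).eq]; simp only [mul_assoc]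

/-- The three factors of `X_∞(u)` act successively on `X_{pj}` and `X_{qj}`; the cross terms
recombine to the formula for `e_p + e_q`. -/
theorem two_y_x_left (hpq : p.abs ≠ q.abs) (hp : p.abs ≠ j.abs) (hq : q.abs ≠ j.abs) (u : D)
    (a : R) : ⁅X.y p u * X.y q u * X.x (-q) p (O.rho u), X.x p j a * X.x q j a⁆ =
      X.x (-p) j (O.s • (O.rho u * (E.e p + E.e q) * a)) *
        X.x (-q) j (O.s • (O.rho u * (E.e p + E.e q) * a)) *
        X.y j (-(O.act u (-(O.s • ((E.e p + E.e q) * a))))) := by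
  have h1 : (-p).abs ≠ j.abs := by grind
  have h2 : (-q).abs ≠ j.abs := by grind
  have h3 : (-q).abs ≠ p.abs := by grind
  have h4 : (-p).abs ≠ q.abs := by grind
  have h5 : (-j).abs ≠ (-(-p)).abs := by grind
  have c1 : ∀ c, Commute (X.y q u) (X.x (-q) j c) := fun c =>
    X.y_x_comm h2 (by grind) (by grind) _ _
  have c2 : ∀ c, Commute (X.y q u) (X.x p j c) := fun c => X.y_x_comm hp (by grind) (by grind) _ _
  have c3 : ∀ c, Commute (X.y p u) (X.x (-q) j c) := fun c =>
    X.y_x_comm h2 (by grind) (by grind) _ _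
  have c4 : ∀ c, Commute (X.y q u) (X.x (-p) j c) := fun c =>
    X.y_x_comm h1 (by grind) (by grind) _ _
  have c5 : ∀ c, Commute (X.y p u) (X.x (-p) j c) := fun c =>
    X.y_x_comm h1 (by grind) (by grind) _ _
  have c6 : ∀ c, Commute (X.y p u) (X.x q j c) := fun c => X.y_x_comm hq (by grind) (by grind) _ _
  have c7 : ∀ c d, Commute (X.x p j c) (X.x (-q) j d) := fun c d =>
    X.x_comm hp h2 (by grind) (by grind) (by grind) (by grind) _ _
  have c8 : ∀ c w, Commute (X.x p j c) (X.y j w) := fun c w =>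
    (X.y_x_comm hp (by grind) (by grind) _ _).symm
  have c9 : ∀ c w, Commute (X.x (-p) j c) (X.y j w) := fun c w =>
    (X.y_x_comm h1 (by grind) (by grind) _ _).symm
  have c10 : ∀ c w, Commute (X.x (-q) j c) (X.y j w) := fun c w =>
    (X.y_x_comm h2 (by grind) (by grind) _ _).symm
  have c11 : ∀ c d, Commute (X.x (-p) j c) (X.x (-q) j d) := fun c d =>
    X.x_comm h1 h2 (by grind) (by grind) (by grind) (by grind) _ _
  set A := X.x p j a with hA
  set B := X.x q j a with hB
  set wp := -(O.act u (-(O.s • (E.e p * a)))) with hwp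
  set wq := -(O.act u (-(O.s • (E.e q * a)))) with hwq
  set g := X.y p u * X.y q u * X.x (-q) p (O.rho u) with hg
  set rp := O.s • (O.rho u * E.e p * a) with hrp
  set rq := O.s • (O.rho u * E.e q * a) with hrq
  have yA : ⁅X.y p u, A⁆ = X.x (-p) j rp * X.y j wp := X.y_x hp h1 u a
  have yB : ⁅X.y q u, B⁆ = X.x (-q) j rq * X.y j wq := X.y_x hq h2 u a
  have xA : ⁅X.x (-q) p (O.rho u), A⁆ = X.x (-q) j rp := X.x_x h3 hp h2 _ _
  have eA : g * A * g⁻¹ = X.x (-q) j rp * (X.x (-p) j rp * X.y j wp) * A := by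
    calc g * A * g⁻¹ = X.y p u * (X.y q u * (X.x (-q) p (O.rho u) * A * (X.x (-q) p (O.rho u))⁻¹) *
          (X.y q u)⁻¹) * (X.y p u)⁻¹ := by
          rw [hg]; simp only [mul_inv_rev, mul_assoc]
      _ = _ := by
        rw [conj_eq_comm_mul (X.x (-q) p (O.rho u)) A, xA, ((c1 _).mul_right (c2 a)).conj_eq,
          conj_mul_eq, (c3 _).conj_eq, conj_eq_comm_mul, yA, hA]
        simp only [mul_assoc]
  have eB : g * B * g⁻¹ = X.x (-p) j rq * X.x (-q) j rq * X.y j wq * B := by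
    have yw : ⁅X.y p u, X.y j wq⁆ = X.x (-p) j (-(O.s • (star (O.pi u) * O.pi wq))) :=
      X.y_y hp h1 _ _
    have e1 : ⁅X.x (-q) p (O.rho u), B⁆ =
        X.x (-p) j (-(O.s • (star (O.rho u) * E.e q * a))) := by
      rw [hB, X.x_star h3, neg_neg, X.x_x h4 hq h1, neg_mul, neg_mul, smul_neg]
    -- `X_{-q,p}(ρ(u))` contributes `-ρ(u)̄`, and the commutator of `X_p(u)` with `X_j(wq)`
    -- contributes the `π`-term; `rho_add_star` turns their sum into `ρ(u)`.
    have e2 : rq = -(O.s • (star (O.rho u) * E.e q * a)) +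
        -(O.s • (star (O.pi u) * O.pi wq)) := by
      rw [hrq, hwq, O.pi_neg, O.pi_act]
      nth_rw 1 [O.rho_add_star]
      simp only [add_mul, neg_mul, mul_neg, neg_neg, smul_add, smul_neg, mul_smul_comm,
        smul_mul_assoc, mul_assoc, sub_eq_add_neg]
    calc g * B * g⁻¹ = X.y p u * (X.y q u * (X.x (-q) p (O.rho u) * B * (X.x (-q) p (O.rho u))⁻¹) *
          (X.y q u)⁻¹) * (X.y p u)⁻¹ := by
          rw [hg]; simp only [mul_inv_rev, mul_assoc]
      _ = X.y p u * (X.x (-p) j (-(O.s • (star (O.rho u) * E.e q * a))) *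
          (X.x (-q) j rq * X.y j wq * B)) * (X.y p u)⁻¹ := by
        rw [conj_eq_comm_mul (X.x (-q) p (O.rho u)) B, e1, conj_mul_eq (X.y q u), (c4 _).conj_eq,
          conj_eq_comm_mul _ B, yB]
      _ = X.x (-p) j (-(O.s • (star (O.rho u) * E.e q * a))) * (X.x (-q) j rq *
          (X.x (-p) j (-(O.s • (star (O.pi u) * O.pi wq))) * X.y j wq) * B) := by
        rw [conj_mul_eq, (c5 _).conj_eq, conj_mul_eq, (c6 a).conj_eq, conj_mul_eq, (c3 _).conj_eq,
          conj_eq_comm_mul _ (X.y j wq), yw]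
      _ = X.x (-p) j (-(O.s • (star (O.rho u) * E.e q * a))) *
          X.x (-p) j (-(O.s • (star (O.pi u) * O.pi wq))) * X.x (-q) j rq * X.y j wq * B := by
        rw [← mul_assoc (X.x (-q) j rq), ← (c11 _ _).eq]; simp only [mul_assoc]
      _ = _ := by rw [← X.x_add h1, ← e2]
  have eC : A * X.x (-p) j rq * A⁻¹ = X.y j (O.phi (-(star (-(O.s • (E.e p * a))) * O.rho u *
      (-(O.s • (E.e q * a)))))) * X.x (-p) j rq := by
    have e3 : X.x (-p) j rq = X.x (-j) p (-star rq) := by rw [X.x_star h1, neg_neg]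
    have h6 : (-j).abs ≠ p.abs := by grind
    have h7 := X.x_y h6 (by grind) (-star rq) a
    rw [neg_neg] at h7
    rw [conj_eq_comm_mul, hA, e3, ← comm_inv_comm, h7, ← X.y_neg, ← O.phi_star, hrq]
    simp only [star_mul, E.star_e, O.star_smul, star_neg, neg_neg, mul_neg, neg_mul, mul_assoc,
      smul_mul_assoc, mul_smul_comm, smul_neg, star_star]
  -- The middle `φ`-term is produced in the group by moving `A` past `X_{-p,j}`, see `eC`.
  have e4 : -(O.act u (-(O.s • ((E.e p + E.e q) * a)))) = wp + O.phi (-(star (-(O.s • (E.e p * a))) *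
      O.rho u * (-(O.s • (E.e q * a))))) + wq := by
    rw [add_mul, smul_add, add_comm, neg_add, O.act_add, neg_add_rev, neg_add_rev, ← O.phi_neg,
      add_assoc]
  have e5 : O.s • (O.rho u * (E.e p + E.e q) * a) = rp + rq := by
    rw [mul_add, add_mul, smul_add]
  rw [commutatorElement_def, conj_mul_eq, eA, eB, e4, e5, X.y_add, X.y_add, X.x_add h1, X.x_add h2]
  set φ := X.y j (O.phi (-(star (-(O.s • (E.e p * a))) * O.rho u * (-(O.s • (E.e q * a)))))) with hφ
  have d1 : A * X.x (-p) j rq = φ * X.x (-p) j rq * A := by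
    rw [← eC, inv_mul_cancel_right]
  have d2 : Commute A (X.x (-q) j rq) := c7 _ _
  have d3 : Commute A (X.y j wq) := c8 _ _
  have d4 : Commute (X.x (-p) j rq) (X.y j wp * φ) := (c9 _ _).mul_right (c9 _ _)
  have d5 : Commute (X.x (-q) j rq) (X.y j wp * φ) := (c10 _ _).mul_right (c10 _ _)
  have d6 := c11 rp rp
  have d7 := c11 rq rp
  have d8 := c11 rp rq
  have d9 := (X.x_comm_self h1 rp rq)
  generalize X.x (-p) j rq = r1 at *
  generalize X.x (-q) j rq = r2 at *
  generalize X.x (-p) j rp = r3 at *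
  generalize X.x (-q) j rp = r4 at *
  generalize X.y j wp = t1 at *
  generalize X.y j wq = t2 at *
  clear_value A B φ
  calc r4 * (r3 * t1) * A * (r1 * r2 * t2 * B) * (A * B)⁻¹
      = r4 * r3 * t1 * (A * r1) * (r2 * t2 * B) * (A * B)⁻¹ := by simp only [mul_assoc]
    _ = r4 * r3 * ((t1 * φ) * r1) * (A * (r2 * t2)) * B * (A * B)⁻¹ := by
        rw [d1]; simp only [mul_assoc]
    _ = r4 * r3 * r1 * ((t1 * φ) * r2) * t2 * (A * B) * (A * B)⁻¹ := by
        rw [(d2.mul_right d3).eq, ← d4.eq]; simp only [mul_assoc]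
    _ = r3 * r1 * (r4 * r2) * (t1 * φ * t2) := by
        rw [mul_inv_cancel_right, ← d5.eq, ← d6.eq, mul_assoc r3 r4, ← d7.eq]; simp only [mul_assoc]

end SDatum

/-! ### Coarsening of a family of idempotents -/

/-- A family of idempotents such that up to sign one of its members is the sum of two members of
another family, and the others are members of the other family. -/
structure Coarsening {K R D : Type*} [CommRing K] [NonUnitalRing R] [StarRing R] [Module K R]
    [IsScalarTower K R R] [SMulCommClass K R R] [AddGroup D] {O : OBase K R D} {ι κ : Type}
    (E : EFam O ι) (E' : EFam O κ) where
  P : SIdx κ → SIdx ι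
  Q : SIdx κ → SIdx ι
  dbl : SIdx κ → Prop
  P_neg : ∀ i, P (-i) = -P i
  Q_neg : ∀ i, Q (-i) = -Q i
  dbl_neg : ∀ i, dbl (-i) ↔ dbl i
  P_P : ∀ {i j}, i.abs ≠ j.abs → (P i).abs ≠ (P j).abs
  P_Q : ∀ {i j}, i.abs ≠ j.abs → (P i).abs ≠ (Q j).abs
  P_Q_self : ∀ {i}, dbl i → (P i).abs ≠ (Q i).abs
  dbl_abs : ∀ {i j}, dbl i → dbl j → i.abs = j.abs
  e_dbl : ∀ {i}, dbl i → E'.e i = E.e (P i) + E.e (Q i)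
  e_single : ∀ {i}, ¬dbl i → E'.e i = E.e (P i)

namespace Coarsening

variable {K R D : Type*} [CommRing K] [NonUnitalRing R] [StarRing R] [Module K R]
    [IsScalarTower K R R] [SMulCommClass K R R] [AddGroup D] {O : OBase K R D} {ι κ : Type}
    {E : EFam O ι} {E' : EFam O κ} (C : Coarsening E E')

attribute [grind =] P_neg Q_neg dbl_neg
attribute [grind →] P_Q_self

theorem e_P_mul (i : SIdx κ) : E.e (C.P i) * E'.e i = E.e (C.P i) := by
  by_cases h : C.dbl i
  · have h' : C.P i ≠ C.Q i := fun e => C.P_Q_self h (congrArg SIdx.abs e)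
    rw [C.e_dbl h, mul_add, E.e_self, E.e_ne _ _ h', add_zero]
  · rw [C.e_single h, E.e_self]

theorem e_Q_mul {i : SIdx κ} (h : C.dbl i) : E.e (C.Q i) * E'.e i = E.e (C.Q i) := by
  have h' : C.Q i ≠ C.P i := fun e => C.P_Q_self h (congrArg SIdx.abs e).symm
  rw [C.e_dbl h, mul_add, E.e_self, E.e_ne _ _ h', zero_add]

theorem mul_e_P (i : SIdx κ) : E'.e i * E.e (C.P i) = E.e (C.P i) := by
  have h := congrArg star (C.e_P_mul (-i))
  rwa [star_mul, E.star_e, E'.star_e, C.P_neg, neg_neg, neg_neg] at h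

theorem mul_e_Q {i : SIdx κ} (h : C.dbl i) : E'.e i * E.e (C.Q i) = E.e (C.Q i) := by
  have h := congrArg star (C.e_Q_mul ((C.dbl_neg i).2 h))
  rwa [star_mul, E.star_e, E'.star_e, C.Q_neg, neg_neg, neg_neg] at h

variable {G : Type*} [Group G] (X : SDatum E (fun i j => i.abs ≠ j.abs) G)

open Classical in
/-- The short root elements of the coarsened family. -/
noncomputable def x (i j : SIdx κ) (a : R) : G :=
  if C.dbl i then X.x (C.P i) (C.P j) a * X.x (C.Q i) (C.P j) a
  else if C.dbl j then X.x (C.P i) (C.P j) a * X.x (C.P i) (C.Q j) a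
  else X.x (C.P i) (C.P j) a

open Classical in
/-- The ultrashort and long root elements of the coarsened family. -/
noncomputable def y (i : SIdx κ) (u : D) : G :=
  if C.dbl i then X.y (C.P i) u * X.y (C.Q i) u * X.x (-C.Q i) (C.P i) (O.rho u)
  else X.y (C.P i) u

variable {i j k l : SIdx κ}

theorem x_left (h : C.dbl i) (a : R) :
    C.x X i j a = X.x (C.P i) (C.P j) a * X.x (C.Q i) (C.P j) a := if_pos h

theorem x_right (h : ¬C.dbl i) (h' : C.dbl j) (a : R) :
    C.x X i j a = X.x (C.P i) (C.P j) a * X.x (C.P i) (C.Q j) a := by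
  rw [x, if_neg h, if_pos h']

theorem x_none (h : ¬C.dbl i) (h' : ¬C.dbl j) (a : R) : C.x X i j a = X.x (C.P i) (C.P j) a := by
  rw [x, if_neg h, if_neg h']

theorem y_dbl (h : C.dbl i) (u : D) :
    C.y X i u = X.y (C.P i) u * X.y (C.Q i) u * X.x (-C.Q i) (C.P i) (O.rho u) := if_pos h

theorem y_single (h : ¬C.dbl i) (u : D) : C.y X i u = X.y (C.P i) u := if_neg h

/-- The indices of the summands of an idempotent. -/
def Leg (i : SIdx κ) (r : SIdx ι) : Prop := r = C.P i ∨ C.dbl i ∧ r = C.Q i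

theorem leg_neg {r : SIdx ι} (h : C.Leg i r) : C.Leg (-i) (-r) := by
  unfold Leg at *
  grind

theorem leg_abs {r t : SIdx ι} (hr : C.Leg i r) (ht : C.Leg j t) (h : i.abs ≠ j.abs) :
    r.abs ≠ t.abs := by
  have := C.dbl_abs (i := i) (j := j)
  have h1 := C.P_P h
  have h2 := C.P_Q h
  have h3 := C.P_Q h.symm
  unfold Leg at *
  grind

theorem leg_ne {r t : SIdx ι} (hr : C.Leg i r) (ht : C.Leg j t) (h : i ≠ j) : r ≠ t := by
  by_cases h' : i.abs = j.abs
  · obtain rfl := ((SIdx.abs_eq_iff i j).1 h').resolve_left h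
    unfold Leg at *
    grind
  · exact fun e => C.leg_abs hr ht h' (congrArg SIdx.abs e)

/-- Commutation for the coarse root elements reduces to their factors, indexed by the legs; the
inequalities between coarse indices pass to legs by `leg_ne`. -/
theorem x_commute (h : i.abs ≠ j.abs) {g : G} (a : R)
    (hg : ∀ r t, r.abs ≠ t.abs → C.Leg i r → C.Leg j t → Commute (X.x r t a) g) :
    Commute (C.x X i j a) g := by
  have h' : ∀ r t, C.Leg i r → C.Leg j t → Commute (X.x r t a) g := fun r t hr ht =>
    hg r t (C.leg_abs hr ht h) hr ht
  unfold x
  split_ifs with h1 h2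
  · exact (h' _ _ (.inl rfl) (.inl rfl)).mul_left (h' _ _ (.inr ⟨h1, rfl⟩) (.inl rfl))
  · exact (h' _ _ (.inl rfl) (.inl rfl)).mul_left (h' _ _ (.inl rfl) (.inr ⟨h2, rfl⟩))
  · exact h' _ _ (.inl rfl) (.inl rfl)

theorem y_commute {g : G} (u : D) (hg : ∀ r, C.Leg i r → Commute (X.y r u) g)
    (hg' : ∀ r t, r.abs ≠ t.abs → C.Leg i r → C.Leg i t → Commute (X.x (-r) t (O.rho u)) g) :
    Commute (C.y X i u) g := by
  unfold y
  split_ifs with h1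
  · exact ((hg _ (.inl rfl)).mul_left (hg _ (.inr ⟨h1, rfl⟩))).mul_left
      (hg' _ _ (C.P_Q_self h1).symm (.inr ⟨h1, rfl⟩) (.inl rfl))
  · exact hg _ (.inl rfl)

theorem not_dbl (h : C.dbl i) (hij : i.abs ≠ j.abs) : ¬C.dbl j := fun h' => hij (C.dbl_abs h h')

theorem x_e (hij : i.abs ≠ j.abs) (a : R) : C.x X i j (E'.e i * a * E'.e j) = C.x X i j a := by
  have h1 := C.P_P hij
  have h2 := C.P_Q hij
  have h3 := (C.P_Q hij.symm).symm
  have e : ∀ r t : SIdx ι, E.e r * E'.e i = E.e r → E'.e j * E.e t = E.e t →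
      E.e r * (E'.e i * a * E'.e j) * E.e t = E.e r * a * E.e t := fun r t hr ht => by
    rw [mul_assoc (E'.e i), ← mul_assoc (E.e r), hr, ← mul_assoc, mul_assoc _ _ (E.e t), ht]
  by_cases hi : C.dbl i
  · rw [C.x_left X hi, C.x_left X hi, X.x_congr h1 (e _ _ (C.e_P_mul i) (C.mul_e_P j)),
      X.x_congr h3 (e _ _ (C.e_Q_mul hi) (C.mul_e_P j))]
  · by_cases hj : C.dbl j
    · rw [C.x_right X hi hj, C.x_right X hi hj, X.x_congr h1 (e _ _ (C.e_P_mul i) (C.mul_e_P j)),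
        X.x_congr h2 (e _ _ (C.e_P_mul i) (C.mul_e_Q hj))]
    · rw [C.x_none X hi hj, C.x_none X hi hj, X.x_congr h1 (e _ _ (C.e_P_mul i) (C.mul_e_P j))]

theorem y_e (i : SIdx κ) (u : D) : C.y X i (O.act u (E'.e i)) = C.y X i u := by
  have e : ∀ r, E'.e i * E.e r = E.e r → X.y r (O.act u (E'.e i)) = X.y r u := fun r hr =>
    X.y_congr (by rw [O.act_act, hr])
  by_cases h : C.dbl i
  · have h1 : (-C.Q i).abs ≠ (C.P i).abs := by grind
    rw [C.y_dbl X h, C.y_dbl X h, e _ (C.mul_e_P i), e _ (C.mul_e_Q h), O.rho_act, E'.star_e]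
    refine congrArg _ (X.x_congr h1 ?_)
    have := C.e_Q_mul ((C.dbl_neg i).2 h)
    rw [C.Q_neg] at this
    rw [mul_assoc (E'.e (-i)), ← mul_assoc (E.e _), this, ← mul_assoc, mul_assoc _ _ (E.e (C.P i)),
      C.mul_e_P]
  · rw [C.y_single X h, C.y_single X h, e _ (C.mul_e_P i)]

theorem x_star (hij : i.abs ≠ j.abs) (a : R) : C.x X i j a = C.x X (-j) (-i) (-star a) := by
  have h1 := C.P_P hij
  have h2 := C.P_Q hij
  have h3 := (C.P_Q hij.symm).symm
  by_cases hi : C.dbl i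
  · have hj := C.not_dbl hi hij
    rw [C.x_left X hi, C.x_right X (by rwa [C.dbl_neg]) (by rwa [C.dbl_neg]), C.P_neg, C.P_neg,
      C.Q_neg, ← X.x_star h1, ← X.x_star h3]
  · by_cases hj : C.dbl j
    · rw [C.x_right X hi hj, C.x_left X (by rwa [C.dbl_neg]), C.P_neg, C.P_neg,
        C.Q_neg, ← X.x_star h1, ← X.x_star h2]
    · rw [C.x_none X hi hj, C.x_none X (by rwa [C.dbl_neg]) (by rwa [C.dbl_neg]), C.P_neg, C.P_neg,
        ← X.x_star h1]

theorem x_add (hij : i.abs ≠ j.abs) (a b : R) : C.x X i j (a + b) = C.x X i j a * C.x X i j b := by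
  have h1 := C.P_P hij
  have h2 := C.P_Q hij
  have h3 := (C.P_Q hij.symm).symm
  have hi := C.P_Q_self (i := i)
  have hj := C.P_Q_self (i := j)
  unfold x
  split_ifs with hi' hj'
  · have c : Commute (X.x (C.Q i) (C.P j) a) (X.x (C.P i) (C.P j) b) :=
      X.x_comm h3 h1 (by grind) (by grind) (by grind) (by grind) _ _
    rw [X.x_add h1, X.x_add h3, mul_assoc, mul_assoc, ← mul_assoc (X.x (C.Q i) _ _), c.eq,
      mul_assoc]
  · have c : Commute (X.x (C.P i) (C.Q j) a) (X.x (C.P i) (C.P j) b) :=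
      X.x_comm h2 h1 (by grind) (by grind) (by grind) (by grind) _ _
    rw [X.x_add h1, X.x_add h2, mul_assoc, mul_assoc, ← mul_assoc (X.x _ (C.Q j) _), c.eq,
      mul_assoc]
  · exact X.x_add h1 a b

theorem x_x (hij : i.abs ≠ j.abs) (hjk : j.abs ≠ k.abs) (hik : i.abs ≠ k.abs) (a b : R) :
    ⁅C.x X i j a, C.x X j k b⁆ = C.x X i k (O.s • (a * E'.e j * b)) := by
  by_cases hi : C.dbl i
  · have hj := C.not_dbl hi hij
    have hk := C.not_dbl hi hik
    rw [C.x_left X hi, C.x_left X hi, C.x_none X hj hk, C.e_single hj]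
    exact X.two_x_x_left (C.P_Q_self hi) (C.P_P hij) (C.P_Q hij.symm).symm (C.P_P hik)
      (C.P_Q hik.symm).symm (C.P_P hjk) a b
  by_cases hj : C.dbl j
  · have hk := C.not_dbl hj hjk
    rw [C.x_right X hi hj, C.x_left X hj, C.x_none X hi hk, C.e_dbl hj]
    exact X.two_x_x_mid (C.P_Q_self hj) (C.P_P hij.symm) (C.P_Q hij).symm (C.P_P hjk)
      (C.P_Q hjk.symm).symm (C.P_P hik) a b
  by_cases hk : C.dbl k
  · rw [C.x_none X hi hj, C.x_right X hj hk, C.x_right X hi hk, C.e_single hj]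
    exact X.two_x_x_right (C.P_Q_self hk) (C.P_P hik.symm) (C.P_Q hik).symm (C.P_P hjk.symm)
      (C.P_Q hjk).symm (C.P_P hij) a b
  · rw [C.x_none X hi hj, C.x_none X hj hk, C.x_none X hi hk, C.e_single hj]
    exact X.x_x (C.P_P hij) (C.P_P hjk) (C.P_P hik) a b

theorem x_y (hij : i.abs ≠ j.abs) (a b : R) :
    ⁅C.x X i j a, C.x X j (-i) b⁆ = C.y X (-i) (O.phi (O.s • (a * E'.e j * b))) := by
  by_cases hi : C.dbl i
  · have hj := C.not_dbl hi hij
    have hi' := (C.dbl_neg i).2 hi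
    rw [C.x_left X hi, C.x_right X hj hi', C.y_dbl X hi', C.e_single hj, C.P_neg, C.Q_neg, neg_neg]
    exact X.two_x_y_out (C.P_Q_self hi) (C.P_P hij) (C.P_Q hij.symm).symm a b
  have hi' : ¬C.dbl (-i) := by rwa [C.dbl_neg]
  by_cases hj : C.dbl j
  · rw [C.x_right X hi hj, C.x_left X hj, C.y_single X hi', C.e_dbl hj, C.P_neg]
    exact X.two_x_y_mid (C.P_Q_self hj) (C.P_P hij.symm) (C.P_Q hij).symm a b
  · rw [C.x_none X hi hj, C.x_none X hj hi', C.y_single X hi', C.e_single hj, C.P_neg]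
    have h := C.P_P hij
    exact X.x_y h (by grind) a b

theorem y_y (hij : i.abs ≠ j.abs) (u v : D) :
    ⁅C.y X i u, C.y X j v⁆ = C.x X (-i) j (-(O.s • (star (O.pi u) * O.pi v))) := by
  by_cases hi : C.dbl i
  · have hj := C.not_dbl hi hij
    rw [C.y_dbl X hi, C.y_single X hj, C.x_left X ((C.dbl_neg i).2 hi), C.P_neg, C.Q_neg]
    exact X.two_y_y (C.P_Q_self hi) (C.P_P hij) (C.P_Q hij.symm).symm u v
  have hi' : ¬C.dbl (-i) := by rwa [C.dbl_neg]
  by_cases hj : C.dbl j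
  · have h1 : (-C.P j).abs ≠ (C.P i).abs := by rw [SIdx.abs_neg]; exact C.P_P hij.symm
    have h2 : (-C.Q j).abs ≠ (C.P i).abs := by rw [SIdx.abs_neg]; exact (C.P_Q hij).symm
    have h3 := C.P_Q_self hj
    have h4 : (-C.P i).abs ≠ (C.P j).abs := by grind
    have h5 : (-C.P i).abs ≠ (C.Q j).abs := by grind
    have c : Commute (X.x (-C.P i) (C.P j) (-(O.s • (star (O.pi u) * O.pi v))))
        (X.x (-C.P i) (C.Q j) (-(O.s • (star (O.pi u) * O.pi v)))) :=
      X.x_comm h4 h5 (by grind) (by grind) (by grind) (by grind) _ _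
    rw [C.y_dbl X hj, C.y_single X hi, C.x_right X hi' hj, C.P_neg, c.eq, ← comm_inv_comm,
      X.two_y_y h3 (C.P_P hij.symm) (C.P_Q hij).symm, mul_inv_rev, ← X.x_neg h1, ← X.x_neg h2,
      X.x_star h1, X.x_star h2]
    simp only [star_neg, neg_neg, O.star_smul, star_mul, star_star]
  · rw [C.y_single X hi, C.y_single X hj, C.x_none X hi' hj, C.P_neg]
    have h := C.P_P hij
    exact X.y_y h (by grind) u v

theorem y_x (hij : i.abs ≠ j.abs) (u : D) (a : R) : ⁅C.y X i u, C.x X i j a⁆ =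
    C.x X (-i) j (O.s • (O.rho u * E'.e i * a)) *
      C.y X j (-(O.act u (-(O.s • (E'.e i * a))))) := by
  by_cases hi : C.dbl i
  · have hj := C.not_dbl hi hij
    rw [C.y_dbl X hi, C.y_single X hj, C.x_left X hi, C.x_left X ((C.dbl_neg i).2 hi), C.P_neg,
      C.Q_neg, C.e_dbl hi]
    exact X.two_y_x_left (C.P_Q_self hi) (C.P_P hij) (C.P_Q hij.symm).symm u a
  have hi' : ¬C.dbl (-i) := by rwa [C.dbl_neg]
  by_cases hj : C.dbl j
  · rw [C.y_dbl X hj, C.y_single X hi, C.x_right X hi hj, C.x_right X hi' hj, C.P_neg,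
      C.e_single hi]
    exact X.two_y_x_right (C.P_Q_self hj) (C.P_P hij.symm) (C.P_Q hij).symm u a
  · rw [C.y_single X hi, C.y_single X hj, C.x_none X hi hj, C.x_none X hi' hj, C.P_neg,
      C.e_single hi]
    have h := C.P_P hij
    exact X.y_x h (by grind) u a

/-- The Steinberg datum over the coarsened family. -/
noncomputable def coarsen : SDatum E' (fun i j => i.abs ≠ j.abs) G where
  x := C.x X
  y := C.y X
  x_e h a := C.x_e X h a
  y_e := C.y_e X
  x_star h a := C.x_star X h a
  x_add h a b := C.x_add X h a b
  y_add i u v := by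
    by_cases h : C.dbl i
    · simp only [C.y_dbl X h]
      exact X.two_y_add (C.P_Q_self h) u v
    · simp only [C.y_single X h]
      exact X.y_add _ u v
  x_comm h h' h1 h2 h3 h4 a b :=
    C.x_commute X h a fun r t hrt hr ht => (C.x_commute X h' b fun r' t' hrt' hr' ht' =>
      (X.x_comm hrt hrt' (C.leg_ne hr ht' h1) (C.leg_ne ht' (C.leg_neg ht) h2)
        (C.leg_ne ht hr' h3) (C.leg_ne hr' (C.leg_neg hr) h4) a b).symm).symm
  x_x h h' h'' a b := C.x_x X h h' h'' a b
  x_y h h' a b := C.x_y X h a b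
  y_y h h' u v := C.y_y X h u v
  y_x_comm {i j k} h h1 h2 u a := by
    refine C.y_commute X u (fun r hr => ?_) (fun r t hrt hr ht => ?_)
    · exact (C.x_commute X h a fun r' t' hrt' hr' ht' => (X.y_x_comm hrt' (C.leg_ne hr' hr h1)
        (C.leg_ne hr (C.leg_neg ht') h2) u a).symm).symm
    · refine (C.x_commute X h a fun r' t' hrt' hr' ht' => ?_).symm
      have e1 := C.leg_ne hr (C.leg_neg ht') h2
      have e2 := C.leg_ne ht (C.leg_neg ht') h2
      have e3 := C.leg_ne hr' hr h1
      have e4 := C.leg_ne hr' ht h1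
      exact X.x_comm hrt' (by simpa using hrt) (by grind) (by grind) (by grind) (by grind) _ _
  y_x h h' u a := C.y_x X h u a

end Coarsening

/-! ### Coarsening and refinement are mutually inverse up to a shift -/

/-- Where the true root subgroup exists, the commutators in `z_mid` can be evaluated there, and they
give `s * s^4 * s^4`. -/
theorem SDatum.ZetaFam.map_z {K R D : Type*} [CommRing K] [NonUnitalRing R] [StarRing R]
    [Module K R] [IsScalarTower K R R] [SMulCommClass K R R] [AddGroup D] {O : OBase K R D}
    {ι : Type} {E : EFam O ι} {G G' : Type*} [Group G] [Group G'] {p q i j : SIdx ι}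
    (X : SDatum E (fun i j => i.abs ≠ j.abs) G) {W : SDatum E (PartialOk p q) G'} (Z : W.ZetaFam)
    (hpq : p.abs ≠ q.abs) (hE : Decomposable E p q) {f : G' →* G}
    (hf : ∀ i j, PartialOk p q i j → ∀ a, f (W.x i j a) = X.x i j a) (h : SIdx.Bad p q i j) (c : R) :
    f (Z.z i j c) = X.x i j (O.s ^ 9 • c) := by
  obtain ⟨Y, hY⟩ := Z.zeta h
  have hij : i.abs ≠ j.abs := by grind
  obtain ⟨t, ht⟩ := hE.nonempty
  rw [← hY]
  refine Decomposable.induction (SDatum.ZetaFam.bad_decomposable hpq hE h) (i := i) (.inl rfl)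
    (j := t) (show t.Away i j by grind) (Q := fun c => f (Y.z c) = X.x i j (O.s ^ 9 • c)) ?_ ?_ ?_ ?_ ?_ c
  · intro a ha
    rwa [Y.z_left, ← mul_smul_comm, X.x_left hij] at ha
  · rw [Y.z_zero, map_one, smul_zero, X.x_zero hij]
  · intro a b ha hb
    rw [Y.z_add, map_mul, ha, hb, smul_add, X.x_add hij]
  · intro a ha
    rw [Y.z_neg, map_inv, ha, smul_neg, X.x_neg hij]
  · intro r hr _ a c
    have h1 : PartialOk p q i r := by grind
    have h2 : PartialOk p q r j := by grind
    rw [Y.z_mid r hr, SDatum.mid, map_commutatorElement]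
    change ⁅f (W.x _ _ _), f (W.x _ _ _)⁆ = _
    rw [hf _ _ h1, hf _ _ h2, X.x_x h1.1 h2.1 hij]
    simp only [smul_mul_assoc, mul_smul_comm, smul_smul]
    congr 2
    ring

namespace Coarsening

variable {K R D D' : Type*} [CommRing K] [NonUnitalRing R] [StarRing R] [Module K R]
    [IsScalarTower K R R] [SMulCommClass K R R] [AddGroup D] [AddGroup D'] {O : OBase K R D}
    {O' : OBase K R D'} {ι κ : Type} {E : EFam O ι} {F : EFam O κ} {p q : SIdx ι}

/-- A coarsening and a refinement of families of idempotents are compatible. -/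
structure Compatible (C : Coarsening E F) (B : Refinement E F p q) : Prop where
  bar_P : ∀ i, B.bar (C.P i) = i
  bar_Q : ∀ i, C.dbl i → B.bar (C.Q i) = i
  leg_bar : ∀ i, C.Leg (B.bar i) i
  bar_eq : B.bar p = B.bar q

namespace Compatible

variable {C : Coarsening E F} {B : Refinement E F p q} (H : C.Compatible B) (hpq : p.abs ≠ q.abs)
  {G G' : Type*} [Group G] [Group G'] {i j : SIdx ι}

section

variable (X : SDatum E (fun i j => i.abs ≠ j.abs) G)
    (X' : SDatum F (fun i j => i.abs ≠ j.abs) G') {f : G' →* G}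
    (hx : ∀ i j, i.abs ≠ j.abs → ∀ a, f (X'.x i j a) = C.x X i j a)
    (hy : ∀ i u, f (X'.y i u) = C.y X i u)
include H X hx hy

include hpq in
-- Decomposing a fine root element into the coarse group and mapping it back splits it over the
-- legs; the idempotents `e_i`, `e_j` in the parameter kill all factors but the original one.
theorem map_root (h : PartialOk p q i j) (a : R) : f (B.root X' i j a) = X.x i j a := by
  have hi := H.leg_bar i
  have hj := H.leg_bar j
  have hij : i.abs ≠ j.abs := h.1
  by_cases b : B.bar i = -B.bar j
  · rw [B.root_opp X' b, hy]
    -- Opposite images of indices with different absolute values occur only over the merged index.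
    have hd : C.dbl (B.bar j) := by
      by_contra hd
      have hd' : ¬C.dbl (B.bar i) := by rwa [b, C.dbl_neg]
      have e1 := hi.resolve_right (fun h => hd' h.1)
      have e2 := hj.resolve_right (fun h => hd h.1)
      rw [b, C.P_neg, ← e2] at e1
      exact hij (by rw [e1, SIdx.abs_neg])
    have hn := C.P_Q_self hd
    generalize B.bar j = k at *
    have hQP : (-C.Q k).abs ≠ (C.P k).abs := by grind
    have hij' : (j = C.P k ∧ i = -C.Q k) ∨ (j = C.Q k ∧ i = -C.P k) := by
      unfold Leg at hi hj
      grind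
    have hP : X.y (C.P k) (O.phi (E.e i * a * E.e j)) = 1 := by
      refine X.y_eq_one ?_
      rw [O.phi_act, E.star_e]
      rcases hij' with ⟨rfl, rfl⟩ | ⟨rfl, rfl⟩
      · simp only [mul_assoc]
        rw [E.e_ne' (i := -C.P k) (j := -C.Q k) (by grind), O.phi_zero]
      · simp only [mul_assoc]
        rw [E.e_ne (C.Q k) (C.P k) (by grind), mul_zero, mul_zero, mul_zero, O.phi_zero]
    have hQ : X.y (C.Q k) (O.phi (E.e i * a * E.e j)) = 1 := by
      refine X.y_eq_one ?_
      rw [O.phi_act, E.star_e]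
      rcases hij' with ⟨rfl, rfl⟩ | ⟨rfl, rfl⟩
      · simp only [mul_assoc]
        rw [E.e_ne (C.P k) (C.Q k) (by grind), mul_zero, mul_zero, mul_zero, O.phi_zero]
      · simp only [mul_assoc]
        rw [E.e_ne' (i := -C.Q k) (j := -C.P k) (by grind), O.phi_zero]
    rw [C.y_dbl X hd, hP, hQ, one_mul, one_mul, O.rho_phi]
    rcases hij' with ⟨rfl, rfl⟩ | ⟨rfl, rfl⟩
    · refine X.x_congr hQP ?_
      simp only [mul_sub, sub_mul, star_mul, E.star_e, mul_assoc, E.e_self', E.e_self]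
      rw [E.e_ne' (i := -C.Q k) (j := -C.P k) (by grind), sub_zero]
    · rw [X.x_star hij, neg_neg]
      refine X.x_congr hQP ?_
      simp only [mul_sub, sub_mul, star_mul, E.star_e, mul_assoc, E.e_self', E.e_self, neg_neg,
        mul_neg, neg_mul]
      rw [E.e_ne' (i := -C.Q k) (j := -C.P k) (by grind), zero_sub]
  · have hb := B.bar_abs (B.bar_ne hpq h) b
    rw [B.root_ne X' b, hx _ _ hb]
    have h1 := C.P_P hb
    have h2 := C.P_Q hb
    have h3 := (C.P_Q hb.symm).symm
    have hs : X.x i j (E.e i * a * E.e j) = X.x i j a := X.x_e hij a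
    have hl : ∀ r : SIdx ι, r ≠ i → r.abs ≠ j.abs → X.x r j (E.e i * a * E.e j) = 1 :=
      fun r hr hrj => X.x_eq_one hrj (by rw [mul_assoc (E.e i), E.e_ne' hr, zero_mul])
    have hr : ∀ r : SIdx ι, r ≠ j → i.abs ≠ r.abs → X.x i r (E.e i * a * E.e j) = 1 :=
      fun r hr hri => X.x_eq_one hri (by
        rw [mul_assoc, mul_assoc, E.e_ne j r hr.symm, mul_zero, mul_zero])
    by_cases hi' : C.dbl (B.bar i)
    · have hj' := hj.resolve_right fun h' => C.not_dbl hi' hb h'.1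
      have hn := C.P_Q_self hi'
      rw [C.x_left X hi', ← hj']
      rw [← hj'] at h1 h3
      rcases hi with hi | ⟨_, hi⟩
      · rw [← hi, hs, hl _ (by grind) h3, mul_one]
      · rw [← hi, hs, hl _ (by grind) h1, one_mul]
    · have hi := hi.resolve_right fun h' => hi' h'.1
      by_cases hj' : C.dbl (B.bar j)
      · have hn := C.P_Q_self hj'
        rw [C.x_right X hi' hj', ← hi]
        rw [← hi] at h1 h2
        rcases hj with hj | ⟨_, hj⟩
        · rw [← hj, hs, hr _ (by grind) h2, mul_one]
        · rw [← hj, hs, hr _ (by grind) h1, one_mul]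
      · rw [C.x_none X hi' hj', ← hi, ← hj.resolve_right fun h' => hj' h'.1, hs]

theorem map_y (u : D) : f (X'.y (B.bar i) (O.act u (E.e i))) = X.y i u := by
  have hi := H.leg_bar i
  rw [hy]
  by_cases hd : C.dbl (B.bar i)
  · have hn := C.P_Q_self hd
    have hQP : (-C.Q (B.bar i)).abs ≠ (C.P (B.bar i)).abs := by grind
    have hne : ∀ r : SIdx ι, r ≠ i → X.y r (O.act u (E.e i)) = 1 := fun r hr =>
      X.y_eq_one (by rw [O.act_act, E.e_ne _ _ hr.symm, O.act_zero])
    rw [C.y_dbl X hd, O.rho_act, E.star_e]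
    generalize B.bar i = k at *
    rcases hi with rfl | ⟨_, rfl⟩
    · rw [hne (C.Q k) (by grind), X.y_e, mul_one, X.x_eq_one hQP, mul_one]
      rw [mul_assoc (E.e _) (O.rho u), E.e_ne' (by grind), zero_mul]
    · rw [hne (C.P k) (by grind), X.y_e, one_mul, X.x_eq_one hQP, mul_one]
      simp only [mul_assoc]
      rw [E.e_ne (C.Q k) (C.P k) (by grind), mul_zero, mul_zero, mul_zero]
  · rw [C.y_single X hd, ← hi.resolve_right fun h => hd h.1, X.y_e]

variable (Z : (B.refine hpq X').ZetaFam) (hE : Decomposable E p q)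
include hE

/-- For a missing root the exponent is `9 + 1`, the sum of those in `map_z` and in `root_bad`; for
the others it is `10` by definition. -/
theorem map_extend_x (hij : i.abs ≠ j.abs) (a : R) : f (Z.root i j a) = X.x i j (O.s ^ 10 • a) := by
  have hf : ∀ i j, PartialOk p q i j → ∀ a, f ((B.refine hpq X').x i j a) = X.x i j a :=
    fun i j h a => H.map_root hpq X X' hx hy h a
  by_cases b : SIdx.Bad p q i j
  · rw [Z.root_bad b, Z.map_z X hpq hE hf b, smul_smul, ← pow_succ]
  · rw [Z.root_good b, hf _ _ (by grind)]

end

variable {E' : EFam O' ι} {F' : EFam O' κ} {C' : Coarsening E' F'}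
    (hP : ∀ i, C'.P i = C.P i) (hQ : ∀ i, C'.Q i = C.Q i) (hd : ∀ i, C'.dbl i ↔ C.dbl i)
    (X' : SDatum F (fun i j => i.abs ≠ j.abs) G') (Z : (B.refine hpq X').ZetaFam)
    (hE : Decomposable E p q) (T : O'.Shift O) (he : ∀ i, E'.e i = E.e i)
    {i j : SIdx κ}
include H

theorem not_bad {r t : SIdx ι} (h : B.bar r ≠ B.bar t) : ¬SIdx.Bad p q r t := by
  intro b
  have h1 := H.bar_eq
  have h2 := B.bar_neg p
  have h3 := B.bar_neg q
  grind

theorem extend_x {r t : SIdx ι} (hr : B.bar r = i) (ht : B.bar t = j) (hij : i.abs ≠ j.abs)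
    (a : R) : (Z.extend hpq hE T he).x r t a = X'.x i j (E.e r * (O.s ^ 10 • a) * E.e t) := by
  have h1 : ¬SIdx.Bad p q r t := H.not_bad (by grind)
  have h2 : B.bar r ≠ -B.bar t := by grind
  refine (Z.root_good h1 a).trans ((B.root_ne X' h2 _).trans ?_)
  rw [hr, ht]

include hP hQ hd

/-- For coarse indices with different absolute values no missing root is involved, so the factors
are pieces of one coarse root element cut out by `e_P` and `e_Q`, and they add up to it. -/
theorem coarsen_extend_x (hij : i.abs ≠ j.abs) (a : R) :
    C'.x (Z.extend hpq hE T he) i j a = X'.x i j (O.s ^ 10 • a) := by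
  have hPi := H.bar_P i
  have hPj := H.bar_P j
  rw [← hP] at hPi hPj
  by_cases hi : C.dbl i
  · have hQi := H.bar_Q i hi
    rw [← hQ] at hQi
    rw [C'.x_left _ ((hd i).2 hi), H.extend_x hpq X' Z hE T he hPi hPj hij,
      H.extend_x hpq X' Z hE T he hQi hPj hij, ← X'.x_add hij, ← add_mul, ← add_mul, hP, hQ, hP,
      ← C.e_dbl hi, ← C.e_single (C.not_dbl hi hij), X'.x_e hij]
  · by_cases hj : C.dbl j
    · have hQj := H.bar_Q j hj
      rw [← hQ] at hQj
      rw [C'.x_right _ (by rwa [hd]) ((hd j).2 hj), H.extend_x hpq X' Z hE T he hPi hPj hij,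
        H.extend_x hpq X' Z hE T he hPi hQj hij, ← X'.x_add hij, ← mul_add, hP, hQ, hP,
        ← C.e_dbl hj, ← C.e_single hi, X'.x_e hij]
    · rw [C'.x_none _ (by rwa [hd]) (by rwa [hd]), H.extend_x hpq X' Z hE T he hPi hPj hij, hP, hP,
        ← C.e_single hi, ← C.e_single hj, X'.x_e hij]

/-- The three factors become `u · e_P`, `u · e_Q` and a `φ`-term of one coarse root subgroup. Their
product is `u · (e_P + e_Q)` by `act_add`, which explains the third factor in the formula for
`X_∞(u)`. -/
theorem coarsen_extend_y (u : D') :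
    C'.y (Z.extend hpq hE T he) i u = X'.y i (T.tr u) := by
  have hPi := H.bar_P i
  rw [← hP] at hPi
  have hy : ∀ r, B.bar r = i →
      (Z.extend hpq hE T he).y r u = X'.y i (O.act (T.tr u) (E.e r)) := fun r hr => by
    change X'.y (B.bar r) _ = _
    rw [hr]
  by_cases hi : C.dbl i
  · have hQi := H.bar_Q i hi
    rw [← hQ] at hQi
    have hb : B.bar (-C'.Q i) = -i := by rw [B.bar_neg, hQi]
    have hne : B.bar (-C'.Q i) = -B.bar (C'.P i) := by rw [hb, hPi]
    have h1 : ¬SIdx.Bad p q (-C'.Q i) (C'.P i) := H.not_bad (by grind)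
    have hx : (Z.extend hpq hE T he).x (-C'.Q i) (C'.P i) (O'.rho u) =
        X'.y i (O.phi (star (E.e (C.Q i)) * O.rho (T.tr u) * E.e (C.P i))) := by
      refine (Z.root_good h1 _).trans ((B.root_opp X' hne _).trans ?_)
      rw [hPi, T.rho_tr, hP, hQ, E.star_e]
    rw [C'.y_dbl _ ((hd i).2 hi), hy _ hPi, hy _ hQi, hx, mul_assoc, ← X'.y_add, ← X'.y_add, hP, hQ,
      O.add_phi, ← add_assoc, ← O.act_add, ← C.e_dbl hi, X'.y_e]
  · rw [C'.y_single _ (by rwa [hd]), hy _ hPi, hP, ← C.e_single hi, X'.y_e]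

end Compatible

end Coarsening

/-! ### Decompositions from Morita equivalences -/

theorem exists_fin_ne {n : ℕ} (hn : 4 ≤ n) (a b c : Fin n) : ∃ t : Fin n, t ≠ a ∧ t ≠ b ∧ t ≠ c := by
  have h : ({a, b, c} : Finset (Fin n)).card < Fintype.card (Fin n) := by
    rw [Fintype.card_fin]
    exact Finset.card_le_three.trans_lt hn
  obtain ⟨t, ht⟩ : ∃ t, t ∉ ({a, b, c} : Finset (Fin n)) := by
    by_contra! ht
    exact h.ne ((Finset.card_eq_iff_eq_univ _).2 (Finset.eq_univ_iff_forall.2 ht))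
  simp only [Finset.mem_insert, Finset.mem_singleton, not_or] at ht
  exact ⟨t, ht⟩

theorem exists_fin_ne_two {n : ℕ} (hn : 3 ≤ n) (a b : Fin n) : ∃ t : Fin n, t ≠ a ∧ t ≠ b := by
  have h : ({a, b} : Finset (Fin n)).card < Fintype.card (Fin n) := by
    rw [Fintype.card_fin]
    exact Finset.card_le_two.trans_lt hn
  obtain ⟨t, ht⟩ : ∃ t, t ∉ ({a, b} : Finset (Fin n)) := by
    by_contra! ht
    exact h.ne ((Finset.card_eq_iff_eq_univ _).2 (Finset.eq_univ_iff_forall.2 ht))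
  simp only [Finset.mem_insert, Finset.mem_singleton, not_or] at ht
  exact ⟨t, ht⟩

namespace OrthHypFamily

open AugOddFormAlgebra

section Decomp

variable {K R Δ D : Type u} [CommRing K] [NonUnitalRing R] [StarRing R] [Module K R]
    [IsScalarTower K R R] [SMulCommClass K R R] [AddGroup Δ] [AddGroup D]
    {P : OddFormRing R Δ} {ι : Type} (H : OrthHypFamily P ι)
    {O : OBase K R D} {E : EFam O ι} (hE : ∀ i, E.e i = H.e i)
include hE

/-- Without strongness only the idempotents `e_t + e_{-t}` are Morita equivalent, so the
decomposition uses `t` and `-t` together. -/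
theorem e_mem_span_abs (i : SIdx ι) (t : ι) : E.e i ∈ E.span fun r => r.abs = t := by
  have h := (H.morita i.abs t).1
  rw [← H.eabs_η i] at h
  have key : ∀ z ∈ AddSubgroup.closure {z : R | ∃ x y, z = x * (H.pair t).eabs * y},
      H.e i * z ∈ E.span fun r => r.abs = t := by
    intro z hz
    induction hz using AddSubgroup.closure_induction with
    | mem z hz =>
      obtain ⟨x, y, rfl⟩ := hz
      have e : (H.pair t).eabs = E.e (.pos t) + E.e (.neg t) := by
        rw [hE, hE]; rfl
      rw [e, mul_add, add_mul, mul_add]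
      exact add_mem (AddSubgroup.subset_closure ⟨.pos t, H.e i * x, y, rfl, by simp only [mul_assoc]⟩)
        (AddSubgroup.subset_closure ⟨.neg t, H.e i * x, y, rfl, by simp only [mul_assoc]⟩)
    | zero => rw [mul_zero]; exact zero_mem _
    | add a b _ _ ha hb => rw [mul_add]; exact add_mem ha hb
    | neg a _ ha => rw [mul_neg]; exact neg_mem ha
  have h1 := key _ h
  have e : H.e i * (H.η i).eabs = H.e i := by
    have h2 : H.e i * H.e (-i) = 0 := H.e_mul_e (SIdx.ne_neg_self i)
    have h3 : (H.η i).eabs = H.e i + H.e (-i) := by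
      cases i with
      | pos i => rfl
      | neg i => rfl
    rw [h3, mul_add, H.e_mul_self, h2, add_zero]
  rwa [e, ← hE] at h1

theorem e_mem_span_of_strong (h : H.Strong) (i j : SIdx ι) : E.e i ∈ E.span fun r => r = j := by
  have h1 := (h i j).1
  rw [← hE, ← hE] at h1
  refine AddSubgroup.closure_mono ?_ h1
  rintro z ⟨x, y, rfl⟩
  exact ⟨j, x, y, rfl, rfl⟩

end Decomp

theorem decomposable {K R Δ D : Type u} [CommRing K] [NonUnitalRing R] [StarRing R] [Module K R]
    [IsScalarTower K R R] [SMulCommClass K R R] [AddGroup Δ] [AddGroup D]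
    {P : OddFormRing R Δ} {n : ℕ} (H : OrthHypFamily P (Fin n)) {O : OBase K R D}
    {E : EFam O (Fin n)} (hE : ∀ i, E.e i = H.e i) (hn : 4 ≤ n ∨ (3 ≤ n ∧ H.Strong))
    (p q : SIdx (Fin n)) : Decomposable E p q := by
  have h3 : 3 ≤ n := by omega
  have hne : ∃ j : SIdx (Fin n), j.Away p q := by
    obtain ⟨t, h1, h2⟩ := exists_fin_ne_two h3 p.abs q.abs
    exact ⟨.pos t, h1, h2⟩
  rcases hn with hn | ⟨_, hs⟩
  -- In rank at least 4 some `t` differs from the absolute values of `p`, `q` and `j`, and it serves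
  -- all conditions at once.
  · have key : ∀ i j, j.Away p q → E.e i ∈ E.span fun r => r.Away p q ∧ r ≠ j ∧ r ≠ -j := by
      intro i j hj
      obtain ⟨t, h1, h2, h3⟩ := exists_fin_ne hn p.abs q.abs j.abs
      exact EFam.span_mono (fun r hr => by grind) (H.e_mem_span_abs hE i t)
    exact ⟨fun i _ j hj => EFam.span_mono (fun r hr => ⟨hr.1, hr.2.1⟩) (key i j hj),
      fun i k _ j hj => EFam.span_mono (fun r hr => .inr hr) (key i j hj), hne,
      .inl fun j hj => key j j hj⟩
  -- For a strong family single indices suffice: `-j` when `j` has to be avoided, and `k` itself for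
  -- `opp`.
  · have key := H.e_mem_span_of_strong hE hs
    exact ⟨fun i _ j hj => EFam.span_mono (fun r hr => by grind) (key i (-j)),
      fun i k _ j hj => EFam.span_mono (fun r hr => .inl hr) (key i k), hne, .inr key⟩

end OrthHypFamily

namespace OrthHypFamily

open AugOddFormAlgebra

/-! ### The elimination homomorphism and its inverse -/

section Elim

variable {K R Δ : Type u} [CommRing K] [NonUnitalRing R] [StarRing R] [Module K R]
    [IsScalarTower K R R] [SMulCommClass K R R] [AddGroup Δ]
    {A : AugOddFormAlgebra K R Δ} {ι : Type} (H : OrthHypFamily A.toOddFormRing ι)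
    {p q : SIdx ι} (hpq : p.abs ≠ q.abs)

open Classical in
/-- The index of the coarse family corresponding to an index. -/
noncomputable def elimBar (p q : SIdx ι) (i : SIdx ι) : SIdx (ElimIdx p q) :=
  if h : i.abs ≠ p.abs ∧ i.abs ≠ q.abs then
    match i with
    | .pos k => .pos (some ⟨k, h⟩)
    | .neg k => .neg (some ⟨k, h⟩)
  else if i = p ∨ i = q then infty p q else -infty p q

/-- The first index in the decomposition of an index of the coarse family. -/
def elimLeft (p q : SIdx ι) : SIdx (ElimIdx p q) → SIdx ι
  | .pos none => p
  | .neg none => -p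
  | .pos (some k) => .pos k.1
  | .neg (some k) => .neg k.1

/-- The second index in the decomposition of an index of the coarse family. -/
def elimRight (p q : SIdx ι) : SIdx (ElimIdx p q) → SIdx ι
  | .pos none => q
  | .neg none => -q
  | .pos (some k) => .pos k.1
  | .neg (some k) => .neg k.1

theorem elimLeft_new (i : FinIdx p q) : elimLeft p q (new i) = old i := by cases i <;> rfl

theorem elimBar_old (i : FinIdx p q) : elimBar p q (old i) = new i := by
  have h : (old i).abs ≠ p.abs ∧ (old i).abs ≠ q.abs := ⟨old_ne_left i, old_ne_right i⟩
  rw [elimBar, dif_pos h]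
  cases i <;> rfl

theorem elimBar_of_abs {i : SIdx ι} (h : i.abs = p.abs ∨ i.abs = q.abs) (h' : i = p ∨ i = q) :
    elimBar p q i = infty p q := by
  rw [elimBar, dif_neg (by grind), if_pos h']

theorem elimBar_of_abs_neg {i : SIdx ι} (h : i.abs = p.abs ∨ i.abs = q.abs)
    (h' : ¬(i = p ∨ i = q)) : elimBar p q i = -infty p q := by
  rw [elimBar, dif_neg (by grind), if_neg h']

/-- Every index either is old or one of `±p`, `±q`. -/
theorem exists_old_or (p q i : SIdx ι) : (∃ j : FinIdx p q, i = old j) ∨ i = p ∨ i = q ∨ i = -p ∨ i = -q := by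
  by_cases h : i.abs ≠ p.abs ∧ i.abs ≠ q.abs
  · left
    cases i with
    | pos k => exact ⟨.pos ⟨k, h⟩, rfl⟩
    | neg k => exact ⟨.neg ⟨k, h⟩, rfl⟩
  · right
    grind [SIdx.abs_eq_iff]

theorem exists_new_or (i : SIdx (ElimIdx p q)) :
    (∃ j : FinIdx p q, i = new j) ∨ i = infty p q ∨ i = -infty p q := by
  match i with
  | .pos none => exact .inr (.inl rfl)
  | .neg none => exact .inr (.inr rfl)
  | .pos (some k) => exact .inl ⟨.pos k, rfl⟩
  | .neg (some k) => exact .inl ⟨.neg k, rfl⟩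

theorem elimBar_left : elimBar p q p = infty p q := elimBar_of_abs (.inl rfl) (.inl rfl)

theorem elimBar_right : elimBar p q q = infty p q := elimBar_of_abs (.inr rfl) (.inr rfl)

include hpq in
theorem elimBar_neg_left : elimBar p q (-p) = -infty p q :=
  elimBar_of_abs_neg (.inl (SIdx.abs_neg p)) (by grind)

include hpq in
theorem elimBar_neg_right : elimBar p q (-q) = -infty p q :=
  elimBar_of_abs_neg (.inr (SIdx.abs_neg q)) (by grind)

theorem e_zero_refl (x : R) : (∀ k, H.e k * x = 0) ↔ ∀ k, H.e k * x = 0 := Iff.rfl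

/-- Both families have the same zero component, so one `OBase` carries the Steinberg data of both.
-/
theorem e_zero_elim (x : R) : (∀ k, H.e k * x = 0) ↔ ∀ k, (H.elim p q hpq).e k * x = 0 := by
  refine ⟨fun h k => ?_, fun h k => e_pi_of_elim H h k⟩
  obtain ⟨j, rfl⟩ | rfl | rfl := exists_new_or k
  · rw [elim_e_new]; exact h _
  · rw [elim_e_infty, add_mul, h, h, add_zero]
  · rw [elim_e_neg_infty, add_mul, h, h, add_zero]

theorem elim_e_elimBar_mul (i : SIdx ι) :
    (H.elim p q hpq).e (elimBar p q i) * H.e i = H.e i := by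
  obtain ⟨j, rfl⟩ | rfl | rfl | rfl | rfl := exists_old_or p q i
  · rw [elimBar_old, elim_e_new, H.e_mul_self]
  · rw [elimBar_left, elim_e_infty, add_mul, H.e_mul_self, H.e_mul_e (by grind), add_zero]
  · rw [elimBar_right, elim_e_infty, add_mul, H.e_mul_self, H.e_mul_e (by grind), zero_add]
  · rw [elimBar_neg_left hpq, elim_e_neg_infty, add_mul, H.e_mul_self, H.e_mul_e (by grind),
      add_zero]
  · rw [elimBar_neg_right hpq, elim_e_neg_infty, add_mul, H.e_mul_self, H.e_mul_e (by grind),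
      zero_add]

include hpq in
theorem elimBar_neg (i : SIdx ι) : elimBar p q (-i) = -elimBar p q i := by
  obtain ⟨j, rfl⟩ | rfl | rfl | rfl | rfl := exists_old_or p q i
  · rw [elimBar_old, ← SIdx.map_neg, elimBar_old, new, new, SIdx.map_neg]
  · rw [elimBar_left, elimBar_neg_left hpq]
  · rw [elimBar_right, elimBar_neg_right hpq]
  · rw [_root_.neg_neg, elimBar_left, elimBar_neg_left hpq, _root_.neg_neg]
  · rw [_root_.neg_neg, elimBar_right, elimBar_neg_right hpq, _root_.neg_neg]

include hpq in
theorem elimBar_leg (i : SIdx ι) : i = elimLeft p q (elimBar p q i) ∨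
    (elimBar p q i).abs = none ∧ i = elimRight p q (elimBar p q i) := by
  obtain ⟨j, rfl⟩ | rfl | rfl | rfl | rfl := exists_old_or p q i
  · rw [elimBar_old, elimLeft_new]; exact .inl rfl
  · rw [elimBar_left]; exact .inl rfl
  · rw [elimBar_right]; exact .inr ⟨rfl, rfl⟩
  · rw [elimBar_neg_left hpq]; exact .inl rfl
  · rw [elimBar_neg_right hpq]; exact .inr ⟨rfl, rfl⟩

/-- The old family of idempotents as a refinement of the new one. -/
noncomputable def elimRefinement (s : K) :
    Refinement (H.efam H H.e_zero_refl s) (H.efam (H.elim p q hpq) (H.e_zero_elim hpq) s) p q where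
  bar := elimBar p q
  bar_neg := elimBar_neg hpq
  eq_or_bad {i j} h := by
    have hi := elimBar_leg hpq i
    have hj := elimBar_leg hpq j
    rw [← h] at hj
    obtain ⟨k, hk⟩ | hk | hk := exists_new_or (elimBar p q i) <;> rw [hk] at hi hj
    · have hd : (new k).abs ≠ none := by simp
      exact .inl ((hi.resolve_right fun h => hd h.1).trans (hj.resolve_right fun h => hd h.1).symm)
    · change i = p ∨ _ ∧ i = q at hi
      change j = p ∨ _ ∧ j = q at hj
      grind
    · change i = -p ∨ _ ∧ i = -q at hi
      change j = -p ∨ _ ∧ j = -q at hj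
      grind
  e_mul := H.elim_e_elimBar_mul hpq

/-- The new family of idempotents as a coarsening of the old one. -/
def elimCoarsening (s : K) :
    Coarsening (H.efam H H.e_zero_refl s) (H.efam (H.elim p q hpq) (H.e_zero_elim hpq) s) where
  P := elimLeft p q
  Q := elimRight p q
  dbl i := i.abs = none
  P_neg i := match i with
    | .pos none => rfl
    | .neg none => (neg_neg p).symm
    | .pos (some k) => rfl
    | .neg (some k) => rfl
  Q_neg i := match i with
    | .pos none => rfl
    | .neg none => (neg_neg q).symm
    | .pos (some k) => rfl
    | .neg (some k) => rfl
  dbl_neg i := by rw [SIdx.abs_neg]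
  P_P {i j} h := by
    obtain ⟨i, rfl⟩ | rfl | rfl := exists_new_or i <;>
      obtain ⟨j, rfl⟩ | rfl | rfl := exists_new_or j
    · rw [elimLeft_new, elimLeft_new, SIdx.abs_map, SIdx.abs_map]
      simpa [Subtype.ext_iff] using h
    · rw [elimLeft_new]; exact old_ne_left i
    · rw [elimLeft_new]; exact (SIdx.abs_neg p).symm ▸ old_ne_left i
    · rw [elimLeft_new]; exact (old_ne_left j).symm
    · exact absurd rfl h
    · exact absurd rfl h
    · rw [elimLeft_new]; exact (SIdx.abs_neg p).symm ▸ (old_ne_left j).symm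
    · exact absurd rfl h
    · exact absurd rfl h
  P_Q {i j} h := by
    have hR : ∀ j : FinIdx p q, elimRight p q (new j) = old j := fun j => by cases j <;> rfl
    obtain ⟨i, rfl⟩ | rfl | rfl := exists_new_or i <;>
      obtain ⟨j, rfl⟩ | rfl | rfl := exists_new_or j
    · rw [elimLeft_new, hR, SIdx.abs_map, SIdx.abs_map]
      simpa [Subtype.ext_iff] using h
    · rw [elimLeft_new]; exact old_ne_right i
    · rw [elimLeft_new]; exact (SIdx.abs_neg q).symm ▸ old_ne_right i
    · rw [hR]; exact (old_ne_left j).symm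
    · exact absurd rfl h
    · exact absurd rfl h
    · rw [hR]; exact (SIdx.abs_neg p).symm ▸ (old_ne_left j).symm
    · exact absurd rfl h
    · exact absurd rfl h
  P_Q_self {i} h := by
    obtain ⟨i, rfl⟩ | rfl | rfl := exists_new_or i
    · simp at h
    · exact hpq
    · change (-p).abs ≠ (-q).abs
      rwa [SIdx.abs_neg, SIdx.abs_neg]
  dbl_abs h h' := h.trans h'.symm
  e_dbl {i} h := by
    obtain ⟨i, rfl⟩ | rfl | rfl := exists_new_or i
    · simp at h
    · exact H.elim_e_infty hpq
    · exact H.elim_e_neg_infty hpq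
  e_single {i} h := by
    obtain ⟨i, rfl⟩ | rfl | rfl := exists_new_or i
    · rw [elimLeft_new]; exact H.elim_e_new hpq i
    · exact absurd rfl h
    · exact absurd rfl h

theorem elimCompatible (s : K) : (H.elimCoarsening hpq s).Compatible (H.elimRefinement hpq s) where
  bar_P i := by
    change elimBar p q (elimLeft p q i) = i
    obtain ⟨i, rfl⟩ | rfl | rfl := exists_new_or i
    · rw [elimLeft_new, elimBar_old]
    · exact elimBar_left
    · exact elimBar_neg_left hpq
  bar_Q i h := by
    change elimBar p q (elimRight p q i) = i
    obtain ⟨i, rfl⟩ | rfl | rfl := exists_new_or i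
    · simp [elimCoarsening] at h
    · exact elimBar_right
    · exact elimBar_neg_right hpq
  leg_bar := elimBar_leg hpq
  bar_eq := elimBar_left.trans elimBar_right.symm

end Elim

end OrthHypFamily

/-! ### Functoriality of coarsening -/

namespace Coarsening

variable {K R D D' : Type*} [CommRing K] [NonUnitalRing R] [StarRing R] [Module K R]
    [IsScalarTower K R R] [SMulCommClass K R R] [AddGroup D] [AddGroup D'] {O : OBase K R D}
    {O' : OBase K R D'} {ι κ : Type} {E : EFam O ι} {F : EFam O κ} {E' : EFam O' ι} {F' : EFam O' κ}
    (C : Coarsening E F) (C' : Coarsening E' F') {G G' : Type*} [Group G] [Group G']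
    (X : SDatum E (fun i j => i.abs ≠ j.abs) G) (X' : SDatum E' (fun i j => i.abs ≠ j.abs) G')
    (hP : ∀ i, C'.P i = C.P i) (hQ : ∀ i, C'.Q i = C.Q i) (hd : ∀ i, C'.dbl i ↔ C.dbl i)
    {f : G →* G'} {φ : R → R} {ψ : D → D'}
    (hx : ∀ i j, i.abs ≠ j.abs → ∀ a, f (X.x i j a) = X'.x i j (φ a))
include hP hQ hd hx

theorem map_x {i j : SIdx κ} (hij : i.abs ≠ j.abs) (a : R) :
    f (C.x X i j a) = C'.x X' i j (φ a) := by
  have h1 := C.P_P hij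
  have h2 := C.P_Q hij
  have h3 := (C.P_Q hij.symm).symm
  by_cases hi : C.dbl i
  · rw [C.x_left X hi, C'.x_left X' ((hd i).2 hi), map_mul, hx _ _ h1, hx _ _ h3, hP, hQ, hP]
  · by_cases hj : C.dbl j
    · rw [C.x_right X hi hj, C'.x_right X' (by rwa [hd]) ((hd j).2 hj), map_mul, hx _ _ h1,
        hx _ _ h2, hP, hQ, hP]
    · rw [C.x_none X hi hj, C'.x_none X' (by rwa [hd]) (by rwa [hd]), hx _ _ h1, hP, hP]

theorem map_y (hy : ∀ i u, f (X.y i u) = X'.y i (ψ u)) (hρ : ∀ u, φ (O.rho u) = O'.rho (ψ u))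
    (i : SIdx κ) (u : D) : f (C.y X i u) = C'.y X' i (ψ u) := by
  by_cases hi : C.dbl i
  · have h := C.P_Q_self hi
    rw [C.y_dbl X hi, C'.y_dbl X' ((hd i).2 hi), map_mul, map_mul, hy, hy, hx _ _ (by grind), hP,
      hQ, hρ]
  · rw [C.y_single X hi, C'.y_single X' (by rwa [hd]), hy, hP]

end Coarsening

namespace OrthHypFamily

open AugOddFormAlgebra

section Generators

variable {K R Δ : Type u} [CommRing K] [NonUnitalRing R] [StarRing R] [Module K R]
    [IsScalarTower K R R] [SMulCommClass K R R] [AddGroup Δ]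
    {A : AugOddFormAlgebra K R Δ} {ι κ : Type}
    (H : OrthHypFamily A.toOddFormRing ι) (H' : OrthHypFamily A.toOddFormRing κ)
    (hz : ∀ x : R, (∀ k, H.e k * x = 0) ↔ ∀ k, H'.e k * x = 0) {s t : K}

theorem stDatum_x {i j : SIdx κ} (h : i.abs ≠ j.abs) (a : R) :
    (stDatum H H' hz s).x i j a = StU.X (comps H' s) i j h ⟨H'.e i * a * H'.e j⟩
      (ring_e_e H' ⟨a⟩ i j) := dif_pos h

theorem stDatum_y (i : SIdx κ) (u : H.zeroPart s) :
    (stDatum H H' hz s).y i u =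
      StU.Y (comps H' s) i (A.ract s u (H'.e i)) (comps_form_ract H' i ((hz _).1 u.2)) := rfl

theorem stDatum_x_of_mem {i j : SIdx κ} (h : i.abs ≠ j.abs) {a : A.RHom s}
    (ha : a ∈ (comps H' s).ring i j) : (stDatum H H' hz s).x i j a.val = StU.X _ i j h a ha := by
  rw [stDatum_x H H' hz h]
  refine StU.X_congr h _ _ (RHom.ext ?_)
  change H'.e i * a.val * H'.e j = a.val
  rw [ha.1, ha.2]

theorem stDatum_y_of_mem {i : SIdx κ} {u : H.zeroPart s} (hu : u.1 ∈ (comps H' s).form i) :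
    (stDatum H H' hz s).y i u = StU.Y _ i u.1 hu :=
  StU.Y_congr _ _ hu.1

variable {H H' hz} in
theorem ofDatum_stDatum_x {G : Type*} [Group G]
    (X : SDatum (H.efam H' hz s) (fun i j => i.abs ≠ j.abs) G) {i j : SIdx κ} (h : i.abs ≠ j.abs)
    (a : R) : ofDatum X ((stDatum H H' hz s).x i j a) = X.x i j a := by
  rw [stDatum_x H H' hz h, ofDatum_X]
  exact X.x_e h a

variable {H H' hz} in
theorem ofDatum_stDatum_y {G : Type*} [Group G]
    (X : SDatum (H.efam H' hz s) (fun i j => i.abs ≠ j.abs) G) (i : SIdx κ) (u : H.zeroPart s) :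
    ofDatum X ((stDatum H H' hz s).y i u) = X.y i u := by
  rw [stDatum_y, ofDatum_Y]
  exact X.y_e i u

/-- The structure map on the zero components. -/
def zeroTrans (r : K) (h : t = s * r) (u : H.zeroPart t) : H.zeroPart s :=
  ⟨dtrans r h u, fun k => by
    have h1 := congrArg RHom.val ((transHom H r h).map_pi u.1)
    change r • ((A.homotope t).pi u.1).val = _ at h1
    exact (congrArg (H.e k * ·) h1.symm).trans (by simp only [mul_smul_comm, u.2 k, smul_zero])⟩

theorem stMap_stDatum_x (r : K) (h : t = s * r) {i j : SIdx κ} (hij : i.abs ≠ j.abs) (a : R) :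
    (transHom H' r h).stMap ((stDatum H H' hz t).x i j a) = (stDatum H H' hz s).x i j (r • a) := by
  rw [stDatum_x H H' hz hij, stDatum_x H H' hz hij, CompHom.stMap_X]
  refine StU.X_congr hij _ _ (RHom.ext ?_)
  change r • (H'.e i * a * H'.e j) = H'.e i * (r • a) * H'.e j
  rw [mul_smul_comm, smul_mul_assoc]

theorem stMap_stDatum_y (r : K) (h : t = s * r) (i : SIdx κ) (u : H.zeroPart t) :
    (transHom H' r h).stMap ((stDatum H H' hz t).y i u) =
      (stDatum H H' hz s).y i (H.zeroTrans r h u) := by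
  rw [stDatum_y, stDatum_y, CompHom.stMap_Y]
  exact StU.Y_congr _ _ (dtrans_ract r h _ _)

end Generators

section Elim

variable {K R Δ : Type u} [CommRing K] [NonUnitalRing R] [StarRing R] [Module K R]
    [IsScalarTower K R R] [SMulCommClass K R R] [AddGroup Δ]
    {A : AugOddFormAlgebra K R Δ} {ι : Type} (H : OrthHypFamily A.toOddFormRing ι)
    {p q : SIdx ι} (hpq : p.abs ≠ q.abs)

/-- The root elimination homomorphism. -/
noncomputable def elimMap (s : K) : StUs (H.elim p q hpq) s →* StUs H s :=
  ofDatum ((H.elimCoarsening hpq s).coarsen (stDatum H H H.e_zero_refl s))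

theorem elimMap_X {s : K} (i j : SIdx (ElimIdx p q)) (h : i.abs ≠ j.abs) (a : A.RHom s)
    (ha : a ∈ (comps (H.elim p q hpq) s).ring i j) : H.elimMap hpq s (StU.X _ i j h a ha) =
      (H.elimCoarsening hpq s).x (stDatum H H H.e_zero_refl s) i j a.val :=
  ofDatum_X _ i j h a ha

theorem elimMap_Y {s : K} (i : SIdx (ElimIdx p q)) (u : A.DHom s)
    (hu : u ∈ (comps (H.elim p q hpq) s).form i) : H.elimMap hpq s (StU.Y _ i u hu) =
      (H.elimCoarsening hpq s).y (stDatum H H H.e_zero_refl s) i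
        ⟨u, mem_zeroPart H _ (H.e_zero_elim hpq) hu⟩ :=
  ofDatum_Y _ i u hu

theorem stMap_elimMap {s t : K} (r : K) (h : t = s * r) (x : StUs (H.elim p q hpq) t) :
    (transHom H r h).stMap (H.elimMap hpq t x) =
      H.elimMap hpq s ((transHom (H.elim p q hpq) r h).stMap x) := by
  have hx := fun i j => @stMap_stDatum_x _ _ _ _ _ _ _ _ _ _ _ _ _ H H H.e_zero_refl _ _ r h i j
  suffices e : (transHom H r h).stMap.comp (H.elimMap hpq t) =
      (H.elimMap hpq s).comp (transHom (H.elim p q hpq) r h).stMap from DFunLike.congr_fun e x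
  refine StU.hom_ext (fun i j hij a ha => ?_) (fun i u hu => ?_)
  · rw [MonoidHom.comp_apply, MonoidHom.comp_apply, elimMap_X, CompHom.stMap_X, elimMap_X]
    exact Coarsening.map_x (H.elimCoarsening hpq t) (H.elimCoarsening hpq s) _ _ (fun _ => rfl) (fun _ => rfl)
      (fun _ => Iff.rfl) hx hij a.val
  · rw [MonoidHom.comp_apply, MonoidHom.comp_apply, elimMap_Y, CompHom.stMap_Y, elimMap_Y]
    exact Coarsening.map_y (H.elimCoarsening hpq t) (H.elimCoarsening hpq s) _ _ (fun _ => rfl) (fun _ => rfl)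
      (fun _ => Iff.rfl) hx (H.stMap_stDatum_y H H.e_zero_refl r h)
      (fun u => congrArg RHom.val ((transHom H r h).map_rho u.1)) i _

theorem isElimHom_elimMap (s : K) : H.IsElimHom hpq s (H.elimMap hpq s) := by
  have hd : ∀ i : FinIdx p q, ¬(H.elimCoarsening hpq s).dbl (new i) := fun i => by
    change (new i).abs ≠ none
    simp
  have hi : (H.elimCoarsening hpq s).dbl (infty p q) := rfl
  have hP : ∀ i : FinIdx p q, (H.elimCoarsening hpq s).P (new i) = old i := elimLeft_new
  constructor
  · intro i j hij hij' a ha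
    rw [elimMap_X, Coarsening.x_none _ _ (hd i) (hd j), hP, hP]
    exact stDatum_x_of_mem H H _ hij' (ring_new_new H ha)
  · intro i hi' a ha
    rw [elimMap_X, Coarsening.x_right _ _ (hd i) hi, hP]
    refine congrArg₂ (· * ·) ?_ ?_
    · rw [← stDatum_x_of_mem H H H.e_zero_refl (old_ne_left i)]
      exact (SDatum.x_right _ (old_ne_left i) _).symm
    · rw [← stDatum_x_of_mem H H H.e_zero_refl (old_ne_right i)]
      exact (SDatum.x_right _ (old_ne_right i) _).symm
  · intro j hj a ha
    rw [elimMap_X, Coarsening.x_left _ _ hi, hP]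
    refine congrArg₂ (· * ·) ?_ ?_
    · rw [← stDatum_x_of_mem H H H.e_zero_refl (old_ne_left j).symm]
      exact (SDatum.x_left _ (old_ne_left j).symm _).symm
    · rw [← stDatum_x_of_mem H H H.e_zero_refl (old_ne_right j).symm]
      exact (SDatum.x_left _ (old_ne_right j).symm _).symm
  · intro j u hu
    rw [elimMap_Y, Coarsening.y_single _ _ (hd j), hP]
    exact stDatum_y_of_mem H H _ (u := ⟨u, _⟩) (form_new H hu)
  · intro hqp u hu
    rw [elimMap_Y, Coarsening.y_dbl _ _ hi]
    exact congrArg _ (stDatum_x H H H.e_zero_refl hqp _)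
  · intro hqp u hu
    have hi' : (H.elimCoarsening hpq s).dbl (-infty p q) := rfl
    rw [elimMap_Y, Coarsening.y_dbl _ _ hi']
    have e : -(H.elimCoarsening hpq s).Q (-infty p q) = q := neg_neg q
    rw [e]
    exact congrArg _ (stDatum_x H H H.e_zero_refl hqp _)

variable {H hpq} in
theorem IsElimHom.eq {s : K} {f f' : StUs (H.elim p q hpq) s →* StUs H s}
    (hf : H.IsElimHom hpq s f) (hf' : H.IsElimHom hpq s f') : f = f' := by
  have hqp : (-q).abs ≠ p.abs := by grind
  have hqp' : q.abs ≠ (-p).abs := by grind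
  -- The negated indices are passed as variables with equations, so that they can be rewritten to
  -- `infty p q` and `new _` without transporting the generator.
  have hstar : ∀ (i j : SIdx (ElimIdx p q)), (∀ k l, k = -j → l = -i → ∀ h a ha,
      f (StU.X _ k l h a ha) = f' (StU.X _ k l h a ha)) →
      ∀ h a ha, f (StU.X _ i j h a ha) = f' (StU.X _ i j h a ha) := by
    intro i j hk h a ha
    have h' : (-j).abs ≠ (-i).abs := by grind
    have e : StU.X _ i j h a ha =
        StU.X _ (-j) (-i) h' (-star a) (neg_mem ((comps (H.elim p q hpq) s).star_mem ha)) :=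
      StU.eq_of_rel (.st0 h h' ha)
    exact (congrArg f e).trans ((hk _ _ rfl rfl _ _ _).trans (congrArg f' e).symm)
  have h1 : ∀ (i : FinIdx p q) h a ha, f (StU.X _ (new i) (infty p q) h a ha) =
      f' (StU.X _ (new i) (infty p q) h a ha) := fun i h a ha => by
    rw [hf.X_new_infty, hf'.X_new_infty]
  have h2 : ∀ (i : FinIdx p q) h a ha, f (StU.X _ (infty p q) (new i) h a ha) =
      f' (StU.X _ (infty p q) (new i) h a ha) := fun i h a ha => by
    rw [hf.X_infty_new, hf'.X_infty_new]
  refine StU.hom_ext (fun i j => ?_) (fun i u hu => ?_)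
  · obtain ⟨i, rfl⟩ | rfl | rfl := exists_new_or i <;>
      obtain ⟨j, rfl⟩ | rfl | rfl := exists_new_or j
    · intro h a ha
      have h' : (old i).abs ≠ (old j).abs := by
        simpa [Subtype.ext_iff] using h
      rw [hf.X_new_new _ _ _ h', hf'.X_new_new _ _ _ h']
    · exact h1 i
    · refine hstar _ _ fun k l hk hl => ?_
      obtain rfl : k = infty p q := hk
      obtain rfl : l = new (-i) := hl.trans (SIdx.map_neg _ _).symm
      exact h2 _
    · exact h2 j
    · exact fun h => absurd rfl h
    · exact fun h => absurd rfl h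
    · refine hstar _ _ fun k l hk hl => ?_
      obtain rfl : l = infty p q := hl
      obtain rfl : k = new (-j) := hk.trans (SIdx.map_neg _ _).symm
      exact h1 _
    · exact fun h => absurd rfl h
    · exact fun h => absurd rfl h
  · obtain ⟨i, rfl⟩ | rfl | rfl := exists_new_or i
    · rw [hf.Y_new, hf'.Y_new]
    · rw [hf.Y_infty hqp, hf'.Y_infty hqp]
    · rw [hf.Y_neg_infty hqp', hf'.Y_neg_infty hqp']

/-- The elimination homomorphism has an inverse up to passing to a deeper homotope. -/
theorem exists_elimInv (s : K) (hE : Decomposable (H.efam H H.e_zero_refl s) p q) :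
    ∃ g : StUs H (s ^ 11) →* StUs (H.elim p q hpq) s,
      (H.elimMap hpq s).comp g = (transHom H (s ^ 10) (pow_succ' s 10)).stMap ∧
      g.comp (H.elimMap hpq (s ^ 11)) =
        (transHom (H.elim p q hpq) (s ^ 10) (pow_succ' s 10)).stMap := by
  let X' := stDatum H (H.elim p q hpq) (H.e_zero_elim hpq) s
  let X := stDatum H H H.e_zero_refl s
  have hC := H.elimCompatible hpq s
  obtain ⟨Z⟩ := SDatum.exists_zetaFam ((H.elimRefinement hpq s).refine hpq X') hpq hE
  -- All root subgroups of the fine family inside the coarse Steinberg group, for the parameter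
  -- `s^11`; this datum defines the inverse.
  let W : SDatum (H.efam H H.e_zero_refl (s ^ 11)) _ _ :=
    Z.extend hpq hE (H.shift s) (fun _ => rfl)
  have hx : ∀ i j, i.abs ≠ j.abs → ∀ a, H.elimMap hpq s (X'.x i j a) =
      (H.elimCoarsening hpq s).x X i j a := fun i j h a => ofDatum_stDatum_x _ h a
  have hy : ∀ i u, H.elimMap hpq s (X'.y i u) = (H.elimCoarsening hpq s).y X i u :=
    fun i u => ofDatum_stDatum_y _ i u
  have hP : ∀ i, (H.elimCoarsening hpq (s ^ 11)).P i = (H.elimCoarsening hpq s).P i := fun _ => rfl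
  have hQ : ∀ i, (H.elimCoarsening hpq (s ^ 11)).Q i = (H.elimCoarsening hpq s).Q i := fun _ => rfl
  have hd : ∀ i, (H.elimCoarsening hpq (s ^ 11)).dbl i ↔ (H.elimCoarsening hpq s).dbl i :=
    fun _ => Iff.rfl
  have hWx : ∀ i j, i.abs ≠ j.abs → ∀ a,
      (H.elimCoarsening hpq (s ^ 11)).x W i j a = X'.x i j (s ^ 10 • a) := fun i j h a =>
    hC.coarsen_extend_x hpq hP hQ hd X' Z hE (H.shift s) (fun _ => rfl) h a
  have hWy : ∀ i u, (H.elimCoarsening hpq (s ^ 11)).y W i u = X'.y i ((H.shift s).tr u) :=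
    fun i u => hC.coarsen_extend_y hpq hP hQ hd X' Z hE (H.shift s) (fun _ => rfl) u
  refine ⟨ofDatum W, StU.hom_ext (fun i j h a ha => ?_) (fun i u hu => ?_),
    StU.hom_ext (fun i j h a ha => ?_) (fun i u hu => ?_)⟩
  · rw [MonoidHom.comp_apply, ofDatum_X, CompHom.stMap_X]
    refine (hC.map_extend_x hpq X X' hx hy Z hE h a.val).trans ?_
    exact stDatum_x_of_mem H H _ h ((transHom H (s ^ 10) (pow_succ' s 10)).ring_mem ha)
  · rw [MonoidHom.comp_apply, ofDatum_Y, CompHom.stMap_Y]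
    refine (hC.map_y X X' hx hy _).trans ?_
    exact stDatum_y_of_mem H H _ (u := ⟨_, _⟩)
      ((transHom H (s ^ 10) (pow_succ' s 10)).form_mem hu)
  · rw [MonoidHom.comp_apply, elimMap_X, CompHom.stMap_X]
    refine (Coarsening.map_x (H.elimCoarsening hpq (s ^ 11))
      (H.elimCoarsening hpq (s ^ 11)) _ W (fun _ => rfl) (fun _ => rfl)
      (fun _ => Iff.rfl) (φ := id) (fun i j h a => ofDatum_stDatum_x W h a) h a.val).trans ?_
    refine (hWx i j h a.val).trans ?_
    exact stDatum_x_of_mem H _ _ h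
      ((transHom (H.elim p q hpq) (s ^ 10) (pow_succ' s 10)).ring_mem ha)
  · rw [MonoidHom.comp_apply, elimMap_Y, CompHom.stMap_Y]
    refine (Coarsening.map_y (H.elimCoarsening hpq (s ^ 11))
      (H.elimCoarsening hpq (s ^ 11)) _ W (fun _ => rfl) (fun _ => rfl)
      (fun _ => Iff.rfl) (φ := id) (ψ := id) (fun i j h a => ofDatum_stDatum_x W h a)
      (fun i u => ofDatum_stDatum_y W i u) (fun _ => rfl) i _).trans ?_
    refine (hWy i _).trans ?_
    exact stDatum_y_of_mem H _ _ (u := ⟨_, _⟩)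
      ((transHom (H.elim p q hpq) (s ^ 10) (pow_succ' s 10)).form_mem hu)

end Elim

end OrthHypFamily

/-! ### Isomorphisms of pro-groups -/

open Limits in
/-- A natural transformation between filtered systems which has inverses up to structure maps
induces an isomorphism of the colimits. -/
theorem isIso_colimMap_of_exists {I : Type*} [Category I] [IsFiltered I] {C : Type*} [Category C]
    {F G : I ⥤ C} [HasColimit F] [HasColimit G] (α : F ⟶ G)
    (h : ∀ i, ∃ (j : I) (f : i ⟶ j) (g : G.obj i ⟶ F.obj j),
      α.app i ≫ g = F.map f ∧ g ≫ α.app j = G.map f) : IsIso (colimMap α) := by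
  choose j f g h1 h2 using h
  have key : ∀ {i i' : I} (u : i ⟶ i'),
      -- The chosen `g` need not be natural. Any two choices agree after a common refinement and one
      -- further structure map, which is invisible in the colimit.
      G.map u ≫ g i' ≫ colimit.ι F (j i') = g i ≫ colimit.ι F (j i) := by
    intro i i' u
    obtain ⟨k, a, b, hab⟩ := IsFiltered.span (f i) (u ≫ f i')
    have e : (g i ≫ F.map a) ≫ F.map (f k) = (G.map u ≫ g i' ≫ F.map b) ≫ F.map (f k) := by
      simp only [← h1, Category.assoc, α.naturality_assoc, reassoc_of% h2, ← G.map_comp_assoc]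
      rw [hab, Category.assoc]
    have e' := congrArg (· ≫ colimit.ι F (j k)) e
    simpa using e'.symm
  refine ⟨colimit.desc G ⟨_, ⟨fun i => g i ≫ colimit.ι F (j i), fun i i' u => ?_⟩⟩,
    colimit.hom_ext fun i => ?_, colimit.hom_ext fun i => ?_⟩
  · simpa using key u
  · simp [reassoc_of% h1]
  · simp [reassoc_of% h2]

/-- A formal projective limit of groups is, in the opposite category, a filtered colimit of
representables, so the criterion for colimits applies after reversing arrows. -/
theorem ProGrp.isIso_lim_map {I : Type u} [SmallCategory I] [IsFiltered I] {X Y : Iᵒᵖ ⥤ GrpCat.{u}}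
    (α : X ⟶ Y) (h : ∀ i : I, ∃ (j : I) (f : i ⟶ j) (g : Y.obj (.op j) ⟶ X.obj (.op i)),
      α.app (.op j) ≫ g = X.map f.op ∧ g ≫ α.app (.op i) = Y.map f.op) :
    IsIso ((ProGrp.lim I).map α) := by
  let β := ((Functor.whiskeringRight _ _ _).obj Ind.yoneda).map
    ((Functor.leftOpRightOpEquiv I GrpCat.{u}).functor.map α.op)
  have h1 : IsIso (Limits.colimMap β) := by
    refine isIso_colimMap_of_exists _ fun i => ?_
    obtain ⟨j, f, g, h1, h2⟩ := h i
    refine ⟨j, f, Ind.yoneda.map g.op, ?_, ?_⟩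
    · refine (Ind.yoneda.map_comp _ _).symm.trans (congrArg Ind.yoneda.map ?_)
      exact congrArg Quiver.Hom.op h2
    · refine (Ind.yoneda.map_comp _ _).symm.trans (congrArg Ind.yoneda.map ?_)
      exact congrArg Quiver.Hom.op h1
  exact inferInstanceAs (IsIso (Limits.colimMap β).op)

namespace OrthHypFamily

open AugOddFormAlgebra

variable {K R Δ : Type u} [CommRing K] [NonUnitalRing R] [StarRing R] [Module K R]
    [IsScalarTower K R R] [SMulCommClass K R R] [AddGroup Δ]
    {A : AugOddFormAlgebra K R Δ} {ι : Type} (H : OrthHypFamily A.toOddFormRing ι)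
    {p q : SIdx ι} (hpq : p.abs ≠ q.abs) (S : Submonoid K)

/-- The morphism of projective systems given by the root elimination homomorphisms. -/
noncomputable def elimSystem : (H.elim p q hpq).stSystem S ⟶ H.stSystem S where
  app s := GrpCat.ofHom (H.elimMap hpq s.unop.val)
  naturality s t f := GrpCat.hom_ext (MonoidHom.ext fun x =>
    (H.stMap_elimMap hpq f.unop.r f.unop.eq x).symm)

theorem isIso_lim_elimSystem
    (hE : ∀ s, Decomposable (H.efam H H.e_zero_refl s) p q) :
    IsIso ((ProGrp.lim (LocIdx S)).map (H.elimSystem hpq S)) := by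
  refine ProGrp.isIso_lim_map _ fun s => ?_
  obtain ⟨g, h1, h2⟩ := H.exists_elimInv hpq s.val (hE s.val)
  -- The inverse at level `s` is defined on level `s^11`, reached from `s` by the arrow `s^10`; both
  -- powers lie in `S`.
  refine ⟨⟨s.val ^ 11, S.pow_mem s.mem 11⟩, ⟨s.val ^ 10, S.pow_mem s.mem 10, pow_succ' _ _⟩,
    GrpCat.ofHom g, GrpCat.hom_ext h2, GrpCat.hom_ext h1⟩

end OrthHypFamily

theorem mainTheorem4 {K R Δ : Type u} [CommRing K] [NonUnitalRing R] [StarRing R] [Module K R]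
    [IsScalarTower K R R] [SMulCommClass K R R] [AddGroup Δ]
    (A : AugOddFormAlgebra K R Δ) (S : Submonoid K) (n : ℕ)
    (H : OrthHypFamily A.toOddFormRing (Fin n))
    (hn : 4 ≤ n ∨ (3 ≤ n ∧ H.Strong))
    (α : Fin n → ℝ) (hα : IsShortRoot α)
    (p q : SIdx (Fin n)) (hpq : α = rootVec q - rootVec p) :
    ∃ F : (H.elim p q (abs_ne_of_short hα hpq)).stSystem S ⟶ H.stSystem S,
      (∀ s : LocIdx S, H.IsElimHom (abs_ne_of_short hα hpq) s.val (F.app (Opposite.op s)).hom) ∧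
      (∀ F' : (H.elim p q (abs_ne_of_short hα hpq)).stSystem S ⟶ H.stSystem S,
        (∀ s : LocIdx S,
          H.IsElimHom (abs_ne_of_short hα hpq) s.val (F'.app (Opposite.op s)).hom) → F' = F) ∧
      IsIso ((ProGrp.lim (LocIdx S)).map F :
        (H.elim p q (abs_ne_of_short hα hpq)).stPro S ⟶ H.stPro S) := by
  have h := abs_ne_of_short hα hpq
  refine ⟨H.elimSystem h S, fun s => H.isElimHom_elimMap h s.val, fun F' hF' => ?_,
    H.isIso_lim_elimSystem h S fun s => H.decomposable (fun _ => rfl) hn p q⟩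
  refine NatTrans.ext (funext fun s => GrpCat.hom_ext ?_)
  exact (hF' s.unop).eq (H.isElimHom_elimMap h s.unop.val)
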